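/- Let $0\le\alpha<\beta$ be real constants, and for $n\ge 1$ put $$\lambda_n=\frac{(n+\beta+\alpha-1)(n+\beta-\alpha-1)}{2(n+\beta-\frac12)} .$$ Let $\phi_n$ be the polynomials given by $\phi_0(x)=1$, $\phi_1(x)=\sqrt{2/\lambda_1}\,x$ and $$x\,\phi_n(x)=\sqrt{\tfrac{\lambda_{n+1}}{2}}\;\phi_{n+1}(x)+\sqrt{\tfrac{\lambda_n}{2}}\;\phi_{n-1}(x),\qquad n\ge 1 .$$ Let $\gamma_n=\sqrt{2^n/(\lambda_1\cdots\lambda_n)}$ be the leading coefficient of $\phi_n$, let $N=n+\beta-1$, and let $$E_n(z)=(4e)^{-N/2}\,\gamma_n\,N^{n/2}\,\exp\Big\{Nz^2+\frac{(\alpha^2-\frac14)\log(Nz^2)}{4Nz^2}\Big\}.$$ (a) As $n\to\infty$, $$\phi_n(N^{1/2}z)=\frac{E_n(z)}{z^{\beta-\frac32}(z^2-1)^{1/4}}\,\exp\Big\{N\big(\log(z+\sqrt{z^2-1})-z\sqrt{z^2-1}\big)\Big\}\,\big(1+O(N^{-1})\big),$$ uniformly for $z$ in any compact subset of $\mathbb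 C\setminus[-1,1]$. Here $\log z$ and $z^{\beta-\frac32}$ are principal, and $(z^2-1)^{p}=(z-1)^p(z+1)^p$ with principal powers, for $p=\frac12,\frac14$. (b) Let $\theta(z)=z\sqrt{1-z^2}-\cos^{-1}z$ with principal branches. For every $0<\delta<\frac12$ there is a complex neighbourhood $\{z:\operatorname{dist}(z,[\delta,1-\delta])\le\eta\}$, $\eta>0$ independent of $n$, such that, as $n\to\infty$, $$\frac{\phi_n(N^{1/2}z)}{E_n(z)}=\frac{2}{z^{\beta-\frac32}(1-z^2)^{1/4}}\cos\Big\{N\theta(z)+\frac\pi4\Big\}+O\big(N^{-1}e^{N|\operatorname{Im}\theta(z)|}\big)$$ uniformly for $z$ in this neighbourhood. That is, the error is $O(N^{-1})$ relative to the larger of the two exponentials that make up the cosine. (c) In particular, for every $0<\delta<\frac12$ and every $A\ge 0$, $$\frac{\phi_n(N^{1/2}z)}{E_n(z)}=\frac{2}{z^{\beta-\frac32}(1-z^2)^{1/4}}\cos\Big\{N\theta(z)+\frac\pi4\Big\}+O(N^{-1})$$ as $n\to\infty$, uniformly for complex $z$ with $\operatorname{dist}(z,[\delta,1-\delta])\le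 A/N$; for $A=0$ this is the interval $[\delta,1-\delta]$ itself. -/

import Mathlib

noncomputable section

namespace CoherentPoly

/-- The recurrence coefficient `λ_n(α, β)` (used for `n ≥ 1`). -/
def lam (α β : ℝ) (n : ℕ) : ℝ :=
  ((n : ℝ) + β + α - 1) * ((n : ℝ) + β - α - 1) / (2 * ((n : ℝ) + β - 1 / 2))

/-- The polynomials `φ_n(x) = φ_n(x; α, β)`, given by `φ_0 = 1`, `φ_1(x) = √(2/λ_1) x` and
`x φ_n(x) = √(λ_{n+1}/2) φ_{n+1}(x) + √(λ_n/2) φ_{n-1}(x)` for `n ≥ 1`. -/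
def phi (α β : ℝ) : ℕ → ℂ → ℂ
  | 0, _ => 1
  | 1, x => (√(2 / lam α β 1) : ℝ) * x
  | n + 2, x =>
      (x * phi α β (n + 1) x - (√(lam α β (n + 1) / 2) : ℝ) * phi α β n x)
        / (√(lam α β (n + 2) / 2) : ℝ)

/-- The leading coefficient `γ_n = √(2^n / (λ_1 ⋯ λ_n))` of `φ_n`. -/
def gam (α β : ℝ) (n : ℕ) : ℝ :=
  √(2 ^ n / ∏ k ∈ Finset.Icc 1 n, lam α β k)

/-- The large parameter `N = n + β - 1`. -/
def bigN (β : ℝ) (n : ℕ) : ℝ := (n : ℝ) + β - 1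

/-- The common factor
`(4e)^{-N/2} γ_n N^{n/2} exp(N z² + (α² - 1/4) log(N z²) / (4 N z²))`. -/
def prefactor (α β : ℝ) (n : ℕ) (z : ℂ) : ℂ :=
  (((4 * Real.exp 1) ^ (-(bigN β n) / 2) * gam α β n * bigN β n ^ ((n : ℝ) / 2) : ℝ) : ℂ) *
    Complex.exp ((bigN β n : ℂ) * z ^ 2 +
      ((α : ℂ) ^ 2 - 1 / 4) * Complex.log ((bigN β n : ℂ) * z ^ 2) / (4 * (bigN β n : ℂ) * z ^ 2))

/-- The power `(z² - 1)^p` of `z² - 1` with the branch on `ℂ ∖ (-∞, 1]` that behaves like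
`z^{2p}` at infinity.  For `p = 1/2` it is analytic on `ℂ ∖ [-1, 1]`. -/
def sqSubOnePow (p z : ℂ) : ℂ := (z - 1) ^ p * (z + 1) ^ p

/-- The leading term outside `[-1, 1]`. -/
def outerTerm (α β : ℝ) (n : ℕ) (z : ℂ) : ℂ :=
  prefactor α β n z / (z ^ ((β : ℂ) - 3 / 2) * sqSubOnePow (1 / 4) z) *
    Complex.exp ((bigN β n : ℂ) *
      (Complex.log (z + sqSubOnePow (1 / 2) z) - z * sqSubOnePow (1 / 2) z))

/-- The principal branch of the complex inverse cosine, analytic off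
`(-∞, -1] ∪ [1, ∞)` and equal to the usual `cos⁻¹` on `[-1, 1]`. -/
def carccos (z : ℂ) : ℂ :=
  -Complex.I * Complex.log (z + Complex.I * (1 - z ^ 2) ^ (1 / 2 : ℂ))

/-- The phase function `z √(1 - z²) - cos⁻¹ z`. -/
def theta (z : ℂ) : ℂ := z * (1 - z ^ 2) ^ (1 / 2 : ℂ) - carccos z

/-- The leading oscillatory term
`2 z^{-(β - 3/2)} (1 - z²)^{-1/4} cos(N (z √(1 - z²) - cos⁻¹ z) + π/4)`. -/
def innerTerm (β : ℝ) (n : ℕ) (z : ℂ) : ℂ :=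
  2 / (z ^ ((β : ℂ) - 3 / 2) * (1 - z ^ 2) ^ (1 / 4 : ℂ)) *
    Complex.cos ((bigN β n : ℂ) * theta z + (Real.pi : ℂ) / 4)

/-- The closed neighbourhood of the interval `[δ, 1 - δ]` in `ℂ` of radius `η`. -/
def intervalNhd (δ η : ℝ) : Set ℂ :=
  {z : ℂ | ∃ x ∈ Set.Icc δ (1 - δ), ‖z - (x : ℂ)‖ ≤ η}

end CoherentPoly

end

open CoherentPoly

/-!
The monic multiples of `φ_n` satisfy `p_{k+1} = x p_k - (λ_k / 2) p_{k-1}`, where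
`λ_k / 2 = ν / 4 - d / (ν + 1)` with `ν = k + β - 3 / 2` and `d = (α² - 1 / 4) / 4`. All asymptotics
are read off from this recurrence, in the scaled variable `z = x / √N` and with
`y = x⁻² = 1 / (N z²)`.

*Off the cut.* As long as the roots `(1 ± √(1 - M y)) / 2` of the recurrence at the level
`M = k + β - 1` stay apart for all `k ≤ n`, the function `exp (wkbLog y M)` satisfies the recurrence
with `d = 0` up to a relative residual `O(y²)` (`WkbRegular.step`). The quotient of `p_k / x ^ k` by it
varies slowly: its increments contract at each step by the quotient of the two roots, and are driven
by `d y / k`, so that at `n` it equals `1 + d y log n + O(y)` (`slowly_varying_asymptotics`,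
`dominant_asymptotics`). Since `y = O(1 / N)` and `log n - log (N z²) = O(1)`, this is
`exp (d y log (N z²)) (1 + O(1 / N))`, with the logarithmic factor of `prefactor`. For `z` in a
compact set off `[-1, 1]` the roots do stay apart, and this gives the first part
(`phi_outer_asymptotics`).

*On the interval.* For `z` near `x₀` in `(0, 1)` the roots meet at the index `k ≈ z² n`, and the
solutions have to be continued past that index. The contour integrals
`∫ ζ ^ ν exp (2 N (ζ - z)²) F(ζ) dζ` satisfy the recurrence exactly if
`F'' + 4 N (ζ - z) F' = (4 d / ζ²) F` (`contourIntegral_recurrence`), and this equation has a solution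
with `F = 1 + O(1 / N)` away from the origin along contours on which `Re (ζ - z)²` decreases
(`exists_isAmplitude`). For `ν ≈ κ N` the phase is `κ log ζ + 2 (ζ - z)²`. A contour is chosen
that passes through the small saddle point belonging to a small `κ = κ₀` and through one of the two
conjugate saddle points `(z ± i √(1 - z²)) / 2` belonging to `κ = 1`, and along which each phase is
largest at its own saddle point (`exists_contour`). Laplace's method (`contourIntegral_laplace`) then
evaluates the same solution both at the index `n` and at the index `κ₀ n`.

At the index `κ₀ n` the polynomials are in the region of the first part, since `z` is off the cut
relative to the smaller large parameter `κ₀ N` (`normPhi_matchIndex`). So the Casoratian of the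
polynomials and a contour integral is known there. It is carried up to `n` by the product of the
recurrence coefficients (`casoratian_eq_prod`), which a form of Stirling's formula evaluates
(`exists_prod_lam_bound`). Dividing by the Casoratian of the two contour integrals gives the
coefficients that express `p_n` by them (`connection_relEquiv`). All dependence on `κ₀` cancels
(`match_product_eq`), and the two resulting terms are the two exponentials of the cosine, each with
relative error `O(1 / N)` (`connection_eq`, `oscillatory_local`). Compactness of `[δ, 1 - δ]` gives
uniformity (`oscillatory_uniform`).

Finally `θ` is real on `(0, 1)` and Lipschitz near `[δ, 1 - δ]`, so `N |Im θ(z)|` is bounded within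
`A / N` of that interval, and the second part gives the third.
-/

/-! ### The logarithm of the exponential WKB approximation -/

/-- The root `√(1 - τ)`, the scaled discriminant of the recurrence. -/
noncomputable def wkbRoot (τ : ℂ) : ℂ := (1 - τ) ^ (1 / 2 : ℂ)

/-- The scaled dominant characteristic root `(1 + √(1 - τ)) / 2`. -/
noncomputable def wkbRatio (τ : ℂ) : ℂ := (1 + wkbRoot τ) / 2

/-- The logarithm of the dominant WKB solution at the (real) index `M`, where `y = x⁻²`. -/
noncomputable def wkbLog (y : ℂ) (M : ℝ) : ℂ :=
  M * (Complex.log (wkbRatio (M * y)) + 1 / (2 * wkbRatio (M * y)) - 1 / 2)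
    - Complex.log (wkbRoot (M * y)) / 2

theorem wkbRoot_sq (τ : ℂ) : wkbRoot τ ^ 2 = 1 - τ := by
  rw [wkbRoot, ← Complex.cpow_nat_mul]; norm_num

theorem mem_slitPlane_of_wkbRoot {τ : ℂ} (h : 0 < (wkbRoot τ).re) : 1 - τ ∈ Complex.slitPlane := by
  rw [← wkbRoot_sq, Complex.mem_slitPlane_iff]
  by_cases hb : (wkbRoot τ).im = 0
  · left; rw [pow_two, Complex.mul_re, hb]; nlinarith
  · right; rw [pow_two, Complex.mul_im]
    intro h0
    have : (wkbRoot τ).re * (wkbRoot τ).im = 0 := by linarith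
    rcases mul_eq_zero.1 this with h1 | h1
    · exact h.ne' h1
    · exact hb h1

theorem wkbRoot_ne_zero {τ : ℂ} (h : 0 < (wkbRoot τ).re) : wkbRoot τ ≠ 0 := by
  intro h0; rw [h0] at h; simp at h

theorem wkbRatio_re {τ : ℂ} (h : 0 < (wkbRoot τ).re) : 1 / 2 < (wkbRatio τ).re := by
  have : (wkbRatio τ).re = (1 + (wkbRoot τ).re) / 2 := by simp [wkbRatio]
  rw [this]; linarith

theorem wkbRatio_ne_zero {τ : ℂ} (h : 0 < (wkbRoot τ).re) : wkbRatio τ ≠ 0 := by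
  intro h0; have := wkbRatio_re h; rw [h0] at this; simp at this; linarith

theorem half_le_norm_wkbRatio {τ : ℂ} (h : 0 < (wkbRoot τ).re) : 1 / 2 ≤ ‖wkbRatio τ‖ :=
  (wkbRatio_re h).le.trans (Complex.re_le_norm _)

theorem wkbRatio_mem_slitPlane {τ : ℂ} (h : 0 < (wkbRoot τ).re) :
    wkbRatio τ ∈ Complex.slitPlane :=
  Complex.mem_slitPlane_iff.2 (Or.inl (by linarith [wkbRatio_re h]))

theorem hasDerivAt_wkbRoot {y : ℂ} {M : ℝ} (h : 0 < (wkbRoot (M * y)).re) :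
    HasDerivAt (fun M : ℝ => wkbRoot (M * y)) (-y / (2 * wkbRoot (M * y))) M := by
  have h1 : HasDerivAt (fun M : ℝ => 1 - (M : ℂ) * y) (-y) M := by
    have := ((hasDerivAt_id (M : ℂ)).comp_ofReal.mul_const y).const_sub 1
    simpa using this
  have h2 := HasDerivAt.comp M (((hasDerivAt_id (1 - (M : ℂ) * y)).cpow_const (c := (1 / 2 : ℂ))
    (mem_slitPlane_of_wkbRoot h))) h1
  refine h2.congr_deriv ?_
  simp only [id, mul_one]
  have hs := mem_slitPlane_of_wkbRoot h
  have h0 := Complex.slitPlane_ne_zero hs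
  rw [Complex.cpow_sub _ _ h0, Complex.cpow_one]
  change (1 / 2 : ℂ) * (wkbRoot (M * y) / (1 - M * y)) * (-y) = _
  rw [← wkbRoot_sq]
  have := wkbRoot_ne_zero h
  field_simp

theorem hasDerivAt_wkbRatio {y : ℂ} {M : ℝ} (h : 0 < (wkbRoot (M * y)).re) :
    HasDerivAt (fun M : ℝ => wkbRatio (M * y)) (-y / (4 * wkbRoot (M * y))) M := by
  refine (((hasDerivAt_wkbRoot h).const_add 1).div_const 2).congr_deriv ?_
  have := wkbRoot_ne_zero h
  field_simp; norm_num

/-- The characteristic equation `u² - u + τ / 4 = 0` of the recurrence. -/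
theorem four_mul_wkbRatio (τ : ℂ) : τ = 4 * wkbRatio τ * (1 - wkbRatio τ) := by
  have := wkbRoot_sq τ
  rw [wkbRatio]; linear_combination this

theorem wkbRoot_eq (τ : ℂ) : wkbRoot τ = 2 * wkbRatio τ - 1 := by
  rw [wkbRatio]; ring

/-- The first derivative of `wkbLog y` with respect to the index. -/
noncomputable def wkbLogDeriv1 (y : ℂ) (M : ℝ) : ℂ :=
  Complex.log (wkbRatio (M * y)) + y / (4 * wkbRoot (M * y) ^ 2)
/-- The second derivative of `wkbLog y` with respect to the index. -/
noncomputable def wkbLogDeriv2 (y : ℂ) (M : ℝ) : ℂ :=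
  -y / (4 * (wkbRoot (M * y) * wkbRatio (M * y))) + y ^ 2 / (4 * wkbRoot (M * y) ^ 4)
/-- The third derivative of `wkbLog y` with respect to the index. -/
noncomputable def wkbLogDeriv3 (y : ℂ) (M : ℝ) : ℂ :=
  -y ^ 2 * (1 + 2 * wkbRoot (M * y)) / (16 * (wkbRoot (M * y) ^ 3 * wkbRatio (M * y) ^ 2))
    + y ^ 3 / (2 * wkbRoot (M * y) ^ 6)

theorem hasDerivAt_wkbLog {y : ℂ} {M : ℝ} (h : 0 < (wkbRoot (M * y)).re) :
    HasDerivAt (wkbLog y) (wkbLogDeriv1 y M) M := by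
  have hU := hasDerivAt_wkbRatio h
  have hR := hasDerivAt_wkbRoot h
  have hU0 := wkbRatio_ne_zero h
  have hR0 := wkbRoot_ne_zero h
  have hid : HasDerivAt (fun M : ℝ => (M : ℂ)) 1 M := (hasDerivAt_id (M : ℂ)).comp_ofReal
  have hlogU := hU.clog_real (wkbRatio_mem_slitPlane h)
  have hlogR := hR.clog_real (Complex.mem_slitPlane_iff.2 (Or.inl h))
  have hinv : HasDerivAt (fun M : ℝ => 1 / (2 * wkbRatio (M * y)))
      (-(2 * (-y / (4 * wkbRoot (M * y)))) / (2 * wkbRatio (M * y)) ^ 2) M := by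
    have := (hU.const_mul 2).fun_inv (mul_ne_zero two_ne_zero hU0)
    simpa only [one_div] using this
  refine ((hid.mul ((hlogU.add hinv).sub_const _)).sub (hlogR.div_const 2)).congr_deriv ?_
  rw [wkbLogDeriv1]
  have ht := four_mul_wkbRatio (M * y)
  have hr := wkbRoot_eq (M * y)
  simp only [Pi.add_apply]
  generalize Complex.log (wkbRatio (M * y)) = ℓ at *
  generalize hu : wkbRatio (M * y) = u at *
  generalize hrr : wkbRoot (M * y) = r at *
  have key : (M : ℂ) * (-y / (4 * r) / u + -(2 * (-y / (4 * r))) / (2 * u) ^ 2)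
      = -(1 / (2 * u)) + 1 / 2 := by
    have : (M : ℂ) * (-y / (4 * r) / u + -(2 * (-y / (4 * r))) / (2 * u) ^ 2)
      = (M * y) * ((1 - 2 * u) / (8 * r * u ^ 2)) := by field_simp; ring
    rw [this, ht]
    have : 1 - 2 * u = - r := by rw [hr]; ring
    rw [this]; field_simp; ring
  rw [key]; field_simp; ring

theorem hasDerivAt_wkbLogDeriv1 {y : ℂ} {M : ℝ} (h : 0 < (wkbRoot (M * y)).re) :
    HasDerivAt (wkbLogDeriv1 y) (wkbLogDeriv2 y M) M := by
  have hU := hasDerivAt_wkbRatio h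
  have hR := hasDerivAt_wkbRoot h
  have hU0 := wkbRatio_ne_zero h
  have hR0 := wkbRoot_ne_zero h
  have h1 := hU.clog_real (wkbRatio_mem_slitPlane h)
  have h2 := (((hR.pow 2).const_mul 4).inv (mul_ne_zero (by norm_num : (4 : ℂ) ≠ 0) (pow_ne_zero 2 hR0))).const_mul y
  refine (h1.add h2).congr_deriv ?_
  rw [wkbLogDeriv2]
  simp only [Pi.pow_apply]
  generalize wkbRatio (M * y) = u at *
  generalize wkbRoot (M * y) = r at *
  field_simp
  norm_num
  field_simp

theorem hasDerivAt_wkbLogDeriv2 {y : ℂ} {M : ℝ} (h : 0 < (wkbRoot (M * y)).re) :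
    HasDerivAt (wkbLogDeriv2 y) (wkbLogDeriv3 y M) M := by
  have hU := hasDerivAt_wkbRatio h
  have hR := hasDerivAt_wkbRoot h
  have hU0 := wkbRatio_ne_zero h
  have hR0 := wkbRoot_ne_zero h
  have h1 := (((hR.mul hU).const_mul 4).inv
    (mul_ne_zero (by norm_num : (4 : ℂ) ≠ 0) (mul_ne_zero hR0 hU0))).const_mul (-y)
  have h2 := (((hR.pow 4).const_mul 4).inv (mul_ne_zero (by norm_num : (4 : ℂ) ≠ 0) (pow_ne_zero 4 hR0))).const_mul
    (y ^ 2)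
  refine (h1.add h2).congr_deriv ?_
  rw [wkbLogDeriv3]
  simp only [Pi.mul_apply, Pi.pow_apply]
  have hr := wkbRoot_eq (M * y)
  generalize hu : wkbRatio (M * y) = u at *
  generalize hrr : wkbRoot (M * y) = r at *
  field_simp
  norm_num
  field_simp
  rw [hr]; ring

/-- A third-order Taylor bound on a unit interval for vector-valued functions. -/
theorem norm_taylor_two_le {f f1 f2 f3 : ℝ → ℂ} {C : ℝ} (hC : 0 ≤ C)
    (h0 : ∀ s ∈ Set.Icc (0 : ℝ) 1, HasDerivAt f (f1 s) s)
    (h1 : ∀ s ∈ Set.Icc (0 : ℝ) 1, HasDerivAt f1 (f2 s) s)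
    (h2 : ∀ s ∈ Set.Icc (0 : ℝ) 1, HasDerivAt f2 (f3 s) s)
    (h3 : ∀ s ∈ Set.Icc (0 : ℝ) 1, ‖f3 s‖ ≤ C) :
    ‖f 1 - f 0 - f1 0 - f2 0 / 2‖ ≤ C := by
  have b2 : ∀ s ∈ Set.Icc (0 : ℝ) 1, ‖f2 s - f2 0‖ ≤ C := by
    intro s hs
    have := norm_image_sub_le_of_norm_deriv_le_segment' (f := f2) (a := 0) (b := 1) (C := C)
      (fun x hx => (h2 x hx).hasDerivWithinAt) (fun x hx => h3 x ⟨hx.1, hx.2.le⟩) s hs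
    nlinarith [hs.1, hs.2]
  have d1 : ∀ s ∈ Set.Icc (0 : ℝ) 1,
      HasDerivAt (fun s : ℝ => f1 s - (s : ℂ) * f2 0) (f2 s - f2 0) s := by
    intro s hs
    have := (h1 s hs).sub ((hasDerivAt_id (s : ℂ)).comp_ofReal.mul_const (f2 0))
    refine this.congr_deriv ?_
    simp
  have b1 : ∀ s ∈ Set.Icc (0 : ℝ) 1, ‖f1 s - s * f2 0 - f1 0‖ ≤ C := by
    intro s hs
    have := norm_image_sub_le_of_norm_deriv_le_segment' (a := 0) (b := 1) (C := C)
      (fun x hx => (d1 x hx).hasDerivWithinAt) (fun x hx => b2 x ⟨hx.1, hx.2.le⟩) s hs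
    simp only [Complex.ofReal_zero, zero_mul, sub_zero] at this
    nlinarith [hs.1, hs.2]
  have d0 : ∀ s ∈ Set.Icc (0 : ℝ) 1,
      HasDerivAt (fun s : ℝ => f s - (s : ℂ) * f1 0 - (s : ℂ) ^ 2 / 2 * f2 0)
        (f1 s - s * f2 0 - f1 0) s := by
    intro s hs
    have hid : HasDerivAt (fun s : ℝ => (s : ℂ)) 1 s := (hasDerivAt_id (s : ℂ)).comp_ofReal
    have := ((h0 s hs).sub (hid.mul_const (f1 0))).sub (((hid.pow 2).div_const 2).mul_const (f2 0))
    refine this.congr_deriv ?_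
    norm_num; ring
  have := norm_image_sub_le_of_norm_deriv_le_segment_01' (C := C)
      (fun x hx => (d0 x hx).hasDerivWithinAt) (fun x hx => b1 x ⟨hx.1, hx.2.le⟩)
  refine le_trans (le_of_eq ?_) this
  congr 1; push_cast; ring

/-! ### One step of the recurrence against the WKB approximation -/

theorem norm_exp_sub_one_sub_le {w : ℂ} {K : ℝ} (hw : ‖w‖ ≤ K) :
    ‖Complex.exp w - 1 - w‖ ≤ Real.exp K * ‖w‖ ^ 2 := by
  have h := Complex.norm_exp_sub_sum_le_norm_mul_exp w 2
  simp only [Finset.sum_range_succ, Finset.sum_range_zero, pow_zero, Nat.factorial, Nat.cast_one,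
    div_one, zero_add, pow_one, mul_one] at h
  rw [sub_sub, mul_comm]
  exact h.trans (by gcongr)

/-- The quotient of the subdominant by the dominant characteristic root is bounded away from the
unit circle: the rate at which the subdominant part of a solution dies out. -/
theorem norm_one_sub_wkbRatio_div_le {τ : ℂ} {c R : ℝ} (hc : 0 < c) (hcr : c ≤ (wkbRoot τ).re)
    (hR : ‖wkbRoot τ‖ ≤ R) :
    ‖(1 - wkbRatio τ) / wkbRatio τ‖ ≤ 1 - 2 * c / (1 + R) ^ 2 := by
  have hpos : 0 < (wkbRoot τ).re := hc.trans_le hcr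
  have hR0 : 0 < R := hpos.trans_le ((Complex.re_le_norm _).trans hR)
  have e : (1 - wkbRatio τ) / wkbRatio τ = (1 - wkbRoot τ) / (1 + wkbRoot τ) := by
    have h1 : (1 - wkbRatio τ) = (1 - wkbRoot τ) / 2 := by rw [wkbRatio]; ring
    rw [h1, wkbRatio, div_div_div_cancel_right₀ two_ne_zero]
  rw [e, norm_div]
  set r := wkbRoot τ
  have hp : 0 < ‖1 + r‖ := by
    refine lt_of_lt_of_le ?_ (Complex.re_le_norm _)
    simp; linarith
  have hle : ‖1 + r‖ ≤ 1 + R := (norm_add_le _ _).trans (by simpa using hR)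
  have hcR : c ≤ R := hcr.trans ((Complex.re_le_norm _).trans hR)
  have h2c : 2 * c / (1 + R) ^ 2 ≤ 1 := by rw [div_le_one (by positivity)]; nlinarith
  have hsq : ‖1 - r‖ ^ 2 = ‖1 + r‖ ^ 2 - 4 * r.re := by
    rw [Complex.sq_norm, Complex.sq_norm, Complex.normSq_apply, Complex.normSq_apply]
    simp; ring
  rw [div_le_iff₀ hp]
  refine abs_le_of_sq_le_sq' ?_ (mul_nonneg (by linarith) hp.le) |>.2
  rw [hsq]
  set b := 2 * c / (1 + R) ^ 2
  have hb : b * ‖1 + r‖ ^ 2 ≤ 2 * c := by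
    have : b * (1 + R) ^ 2 = 2 * c := by simp only [b]; field_simp
    rw [← this]; gcongr
  nlinarith [sq_nonneg (b * ‖1 + r‖)]

/-- Nondegeneracy of the recurrence near the index `M`: the two characteristic roots stay apart. -/
def WkbRegular (c R : ℝ) (y : ℂ) (M : ℝ) : Prop :=
  ∀ M' ∈ Set.Icc (M - 1) (M + 1), c ≤ (wkbRoot (M' * y)).re ∧ ‖wkbRoot (M' * y)‖ ≤ R

theorem WkbRegular.self {c R : ℝ} {y : ℂ} {M : ℝ} (h : WkbRegular c R y M) :
    c ≤ (wkbRoot (M * y)).re ∧ ‖wkbRoot (M * y)‖ ≤ R := h M (by constructor <;> linarith)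

/-- One unit step of the logarithm of the WKB approximation is its second-order Taylor polynomial up
to `O(y²)`, as the third derivative is `O(y²)`. -/
theorem WkbRegular.taylor {c R : ℝ} (hc : 0 < c) :
    ∃ C : ℝ, 0 ≤ C ∧ ∀ (y : ℂ) (M : ℝ), ‖y‖ ≤ 1 → WkbRegular c R y M →
      ‖wkbLog y (M + 1) - wkbLog y M - wkbLogDeriv1 y M - wkbLogDeriv2 y M / 2‖ ≤ C * ‖y‖ ^ 2 ∧
      ‖wkbLog y (M - 1) - wkbLog y M + wkbLogDeriv1 y M - wkbLogDeriv2 y M / 2‖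
        ≤ C * ‖y‖ ^ 2 := by
  set C : ℝ := (1 + 2 * |R|) / (16 * (c ^ 3 * (1 / 2) ^ 2)) + 1 / (2 * c ^ 6)
  have hC : 0 ≤ C := by positivity
  refine ⟨C, hC, fun y M hy hM => ?_⟩
  have hpos : ∀ M' ∈ Set.Icc (M - 1) (M + 1), 0 < (wkbRoot (M' * y)).re := fun M' h =>
    hc.trans_le (hM M' h).1
  have h3 : ∀ M' ∈ Set.Icc (M - 1) (M + 1), ‖wkbLogDeriv3 y M'‖ ≤ C * ‖y‖ ^ 2 := by
    intro M' h
    have hr : c ≤ ‖wkbRoot (M' * y)‖ := (hM M' h).1.trans (Complex.re_le_norm _)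
    have hu := half_le_norm_wkbRatio (hpos M' h)
    have hR : ‖wkbRoot (M' * y)‖ ≤ |R| := (hM M' h).2.trans (le_abs_self R)
    rw [wkbLogDeriv3]
    refine (norm_add_le _ _).trans ?_
    simp only [norm_div, norm_mul, norm_neg, norm_pow, Complex.norm_ofNat]
    have e1 : ‖1 + 2 * wkbRoot (M' * y)‖ ≤ 1 + 2 * |R| := by
      refine (norm_add_le _ _).trans ?_
      rw [norm_one, norm_mul, Complex.norm_ofNat]; linarith
    have : ‖y‖ ^ 2 * ‖1 + 2 * wkbRoot (M' * y)‖ /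
        (16 * (‖wkbRoot (M' * y)‖ ^ 3 * ‖wkbRatio (M' * y)‖ ^ 2))
        ≤ ‖y‖ ^ 2 * (1 + 2 * |R|) / (16 * (c ^ 3 * (1 / 2) ^ 2)) := by gcongr
    have : ‖y‖ ^ 3 / (2 * ‖wkbRoot (M' * y)‖ ^ 6) ≤ ‖y‖ ^ 2 / (2 * c ^ 6) := by
      gcongr ?_ / (2 * ?_ ^ 6)
      exact pow_le_pow_of_le_one (norm_nonneg _) hy (by norm_num)
    calc _ ≤ _ := add_le_add ‹_› this
      _ = C * ‖y‖ ^ 2 := by simp only [C]; ring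
  have shift : ∀ (σ : ℝ) (f f' : ℝ → ℂ) (s : ℝ), HasDerivAt f (f' (M + σ * s)) (M + σ * s) →
      HasDerivAt (fun s => f (M + σ * s)) (σ * f' (M + σ * s)) s := by
    intro σ f f' s h
    have h1 : HasDerivAt (fun s : ℝ => M + σ * s) σ s := by
      simpa using ((hasDerivAt_id s).const_mul σ).const_add M
    refine (h.scomp s h1).congr_deriv ?_
    simp
  have main : ∀ σ : ℝ, |σ| = 1 →
      ‖wkbLog y (M + σ * 1) - wkbLog y (M + σ * 0) - σ * wkbLogDeriv1 y (M + σ * 0)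
        - σ * (σ * wkbLogDeriv2 y (M + σ * 0)) / 2‖ ≤ C * ‖y‖ ^ 2 := by
    intro σ hσ
    have hmem : ∀ s ∈ Set.Icc (0 : ℝ) 1, M + σ * s ∈ Set.Icc (M - 1) (M + 1) := by
      intro s hs
      have : |σ * s| ≤ 1 := by rw [abs_mul, hσ, one_mul, abs_of_nonneg hs.1]; exact hs.2
      constructor <;> linarith [(abs_le.1 this).1, (abs_le.1 this).2]
    refine norm_taylor_two_le (f := fun s => wkbLog y (M + σ * s))
      (f1 := fun s => σ * wkbLogDeriv1 y (M + σ * s))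
      (f2 := fun s => σ * (σ * wkbLogDeriv2 y (M + σ * s)))
      (f3 := fun s => σ * (σ * (σ * wkbLogDeriv3 y (M + σ * s)))) (by positivity) ?_ ?_ ?_ ?_
    · exact fun s hs => shift σ _ _ s (hasDerivAt_wkbLog (hpos _ (hmem s hs)))
    · exact fun s hs => (shift σ _ _ s (hasDerivAt_wkbLogDeriv1 (hpos _ (hmem s hs)))).const_mul _
    · exact fun s hs => ((shift σ _ _ s
        (hasDerivAt_wkbLogDeriv2 (hpos _ (hmem s hs)))).const_mul _).const_mul _
    · intro s hs
      simp only [norm_mul, Complex.norm_real, Real.norm_eq_abs, hσ, one_mul]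
      exact h3 _ (hmem s hs)
  constructor
  · simpa using main 1 (by simp)
  · simpa [sub_eq_add_neg] using main (-1) (by simp)

set_option maxHeartbeats 1000000 in
/-- The WKB approximation satisfies the unperturbed recurrence `q₊ = q - (ν / 4) y q₋`,
`ν = M - 1 / 2`, up to a relative residual `O(y²)`; the other bounds control the coefficients of
the recurrence for the quotient of an exact solution by the approximation. -/
theorem WkbRegular.step {c R : ℝ} (hc : 0 < c) :
    ∃ C : ℝ, 0 ≤ C ∧ ∀ (y : ℂ) (M : ℝ), ‖y‖ ≤ 1 → WkbRegular c R y M →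
      ‖Complex.exp (wkbLog y (M + 1) - wkbLog y M)
        + (M - 1 / 2) / 4 * y * Complex.exp (wkbLog y (M - 1) - wkbLog y M) - 1‖ ≤ C * ‖y‖ ^ 2 ∧
      ‖(M - 1 / 2) / 4 * y * Complex.exp (wkbLog y (M - 1) - wkbLog y M)
        * Complex.exp (-(wkbLog y (M + 1) - wkbLog y M))‖
          ≤ (1 - 2 * c / (1 + R) ^ 2) + C * ‖y‖ ∧
      ‖Complex.exp (wkbLog y (M - 1) - wkbLog y M)
        * Complex.exp (-(wkbLog y (M + 1) - wkbLog y M)) - 1‖ ≤ C * (‖(M : ℂ) * y‖ + ‖y‖) ∧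
      ‖Complex.exp (-(wkbLog y (M + 1) - wkbLog y M))‖ ≤ C := by
  obtain ⟨C0, hC0, hT⟩ := WkbRegular.taylor (R := R) hc
  obtain ⟨C1, hC1⟩ : ∃ C1 : ℝ, C1 = C0 + 1 / (8 * c ^ 4) := ⟨_, rfl⟩
  obtain ⟨K, hK⟩ : ∃ K : ℝ, K = C1 + 1 / (4 * c ^ 2) + 1 / (4 * c) := ⟨_, rfl⟩
  obtain ⟨E, hE⟩ : ∃ E : ℝ, E = Real.exp (2 * K) * (2 * K) ^ 2 := ⟨_, rfl⟩
  obtain ⟨V, hV⟩ : ∃ V : ℝ, V = 1 + |R| := ⟨_, rfl⟩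
  have hC1' : 0 ≤ C1 := by rw [hC1]; positivity
  have hK' : 0 ≤ K := by rw [hK]; positivity
  have hE' : 0 ≤ E := by rw [hE]; positivity
  have hV1 : 1 ≤ V := by simp [hV]
  obtain ⟨Ct, hCt⟩ : ∃ Ct : ℝ, Ct = (V * C1 + V * E + (1 + V) * C1 + (1 + V) * E
    + 2 / 8 * (2 * K + E)) + ((1 + V) * 2 * (2 * K + E) + Real.exp (2 * K) / 2)
    + (2 ^ 3 * (1 + V) / 4 + 2 ^ 2 * (2 * K + E)) + 2 * Real.exp (2 * K) := ⟨_, rfl⟩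
  have hB1 : 0 ≤ V * C1 + V * E + (1 + V) * C1 + (1 + V) * E + 2 / 8 * (2 * K + E) := by positivity
  have hB2 : 0 ≤ (1 + V) * 2 * (2 * K + E) + Real.exp (2 * K) / 2 := by positivity
  have hB3 : 0 ≤ 2 ^ 3 * (1 + V) / 4 := by positivity
  have hB4 : 0 ≤ 2 ^ 2 * (2 * K + E) := by positivity
  have hB5 := (Real.exp_pos (2 * K)).le
  have hCt0 : 0 ≤ Ct := by rw [hCt]; positivity
  refine ⟨Ct, hCt0, fun y M hy hM => ?_⟩
  obtain ⟨hp, hm⟩ := hT y M hy hM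
  have hpos : 0 < (wkbRoot (M * y)).re := hc.trans_le hM.self.1
  have hlog := Complex.exp_log (wkbRatio_ne_zero hpos)
  have hr : c ≤ ‖wkbRoot (M * y)‖ := hM.self.1.trans (Complex.re_le_norm _)
  have hr' : ‖wkbRoot (M * y)‖ ≤ |R| := hM.self.2.trans (le_abs_self _)
  have hu := half_le_norm_wkbRatio hpos
  have hu0 := wkbRatio_ne_zero hpos
  have hr0 := wkbRoot_ne_zero hpos
  have hcontr := norm_one_sub_wkbRatio_div_le hc hM.self.1 hM.self.2
  have hre := wkbRoot_eq (M * y)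
  have hfour := four_mul_wkbRatio (M * y)
  have huV : ‖wkbRatio (M * y)‖ ≤ V := by
    rw [wkbRatio, norm_div, Complex.norm_ofNat]
    have : ‖1 + wkbRoot (M * y)‖ ≤ 1 + |R| := (norm_add_le _ _).trans (by simpa using hr')
    rw [div_le_iff₀ two_pos]; linarith
  rw [wkbLogDeriv1, wkbLogDeriv2] at hp hm
  generalize wkbLog y (M + 1) - wkbLog y M = Lp at *
  generalize wkbLog y (M - 1) - wkbLog y M = Lm at *
  generalize Complex.log (wkbRatio (M * y)) = ℓ at *
  generalize wkbRatio (M * y) = u at *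
  generalize wkbRoot (M * y) = r at *
  obtain ⟨a, rfl⟩ : ∃ a, Lp = ℓ + a := ⟨Lp - ℓ, by ring⟩
  obtain ⟨b, rfl⟩ : ∃ b, Lm = -ℓ + b := ⟨Lm + ℓ, by ring⟩
  obtain ⟨P, hP⟩ : ∃ P, P = y / (4 * r ^ 2) := ⟨_, rfl⟩
  obtain ⟨Q, hQ⟩ : ∃ Q, Q = -y / (8 * (r * u)) := ⟨_, rfl⟩
  have hy2 : ‖y‖ ^ 2 ≤ ‖y‖ := by nlinarith [norm_nonneg y]
  have hS : ‖y ^ 2 / (8 * r ^ 4)‖ ≤ 1 / (8 * c ^ 4) * ‖y‖ ^ 2 := by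
    simp only [norm_div, norm_mul, norm_pow, Complex.norm_ofNat]
    calc ‖y‖ ^ 2 / (8 * ‖r‖ ^ 4) ≤ ‖y‖ ^ 2 / (8 * c ^ 4) := by gcongr
      _ = _ := by ring
  have hPn : ‖P‖ ≤ 1 / (4 * c ^ 2) * ‖y‖ := by
    simp only [hP, norm_div, norm_mul, norm_pow, Complex.norm_ofNat]
    calc ‖y‖ / (4 * ‖r‖ ^ 2) ≤ ‖y‖ / (4 * c ^ 2) := by gcongr
      _ = _ := by ring
  have hQn : ‖Q‖ ≤ 1 / (4 * c) * ‖y‖ := by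
    simp only [hQ, norm_div, norm_mul, norm_neg, Complex.norm_ofNat]
    calc ‖y‖ / (8 * (‖r‖ * ‖u‖)) ≤ ‖y‖ / (8 * (c * (1 / 2))) := by gcongr
      _ = _ := by ring
  have ha : ‖a - (P + Q)‖ ≤ C1 * ‖y‖ ^ 2 := by
    have e : a - (P + Q) = (ℓ + a - (ℓ + y / (4 * r ^ 2)) - (-y / (4 * (r * u)) + y ^ 2 / (4 * r ^ 4)) / 2)
        + y ^ 2 / (8 * r ^ 4) := by rw [hP, hQ]; field_simp; ring
    rw [e]
    refine (norm_add_le _ _).trans ((add_le_add hp hS).trans (le_of_eq ?_))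
    rw [hC1]; ring
  have hb : ‖b - (-P + Q)‖ ≤ C1 * ‖y‖ ^ 2 := by
    have e : b - (-P + Q) = (-ℓ + b + (ℓ + y / (4 * r ^ 2)) - (-y / (4 * (r * u)) + y ^ 2 / (4 * r ^ 4)) / 2)
        + y ^ 2 / (8 * r ^ 4) := by rw [hP, hQ]; field_simp; ring
    rw [e]
    refine (norm_add_le _ _).trans ((add_le_add hm hS).trans (le_of_eq ?_))
    rw [hC1]; ring
  have han : ‖a‖ ≤ K * ‖y‖ := by
    have : a = (a - (P + Q)) + P + Q := by ring
    rw [this]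
    refine (norm_add₃_le ..).trans ?_
    have := mul_le_mul_of_nonneg_left hy2 hC1'
    rw [hK]; linarith
  have hbn : ‖b‖ ≤ K * ‖y‖ := by
    have : b = (b - (-P + Q)) + (-P) + Q := by ring
    rw [this]
    refine (norm_add₃_le ..).trans ?_
    have := mul_le_mul_of_nonneg_left hy2 hC1'
    rw [norm_neg, hK]; linarith
  have hEb : ∀ w : ℂ, ‖w‖ ≤ 2 * K * ‖y‖ → ‖Complex.exp w - 1 - w‖ ≤ E * ‖y‖ ^ 2 := by
    intro w hw
    have h2K : 2 * K * ‖y‖ ≤ 2 * K := by nlinarith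
    refine (norm_exp_sub_one_sub_le (hw.trans h2K)).trans ?_
    calc Real.exp (2 * K) * ‖w‖ ^ 2 ≤ Real.exp (2 * K) * (2 * K * ‖y‖) ^ 2 := by gcongr
      _ = _ := by rw [hE]; ring
  have hexp1 : ∀ w : ℂ, ‖w‖ ≤ 2 * K * ‖y‖ → ‖Complex.exp w - 1‖ ≤ (2 * K + E) * ‖y‖ := by
    intro w hw
    have : Complex.exp w - 1 = (Complex.exp w - 1 - w) + w := by ring
    rw [this]
    refine (norm_add_le _ _).trans ?_
    have := mul_le_mul_of_nonneg_left hy2 hE'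
    linarith [hEb w hw]
  have hexpn : ∀ w : ℂ, ‖w‖ ≤ 2 * K * ‖y‖ → ‖Complex.exp w‖ ≤ Real.exp (2 * K) := by
    intro w hw
    refine (Complex.norm_exp_le_exp_norm w).trans (Real.exp_le_exp.2 ?_)
    nlinarith
  have hu1 : ‖1 - u‖ ≤ 1 + V := (norm_sub_le _ _).trans (by simpa using huV)
  have huinv : ‖u⁻¹‖ ≤ 2 := by
    rw [norm_inv, inv_le_comm₀ (by linarith) two_pos]; linarith
  have hKy : 0 ≤ K * ‖y‖ := by positivity
  have ean := hEb a (by linarith)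
  have ebn := hEb b (by linarith)
  have hab : ‖b - a‖ ≤ 2 * K * ‖y‖ := (norm_sub_le _ _).trans (by linarith)
  have hna : ‖-a‖ ≤ 2 * K * ‖y‖ := by rw [norm_neg]; linarith
  have hMy : ((M : ℂ) - 1 / 2) / 4 * y = u * (1 - u) - y / 8 := by linear_combination hfour / 4
  have hEp : Complex.exp (ℓ + a) = u * Complex.exp a := by rw [Complex.exp_add, hlog]
  have hEm : Complex.exp (-ℓ + b) = u⁻¹ * Complex.exp b := by
    rw [Complex.exp_add, Complex.exp_neg, hlog]
  have hEn : Complex.exp (-(ℓ + a)) = u⁻¹ * Complex.exp (-a) := by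
    rw [neg_add, Complex.exp_add, Complex.exp_neg, hlog]
  have hEmn : Complex.exp (-ℓ + b) * Complex.exp (-(ℓ + a)) = u⁻¹ ^ 2 * Complex.exp (b - a) := by
    rw [hEm, hEn, sub_eq_add_neg, Complex.exp_add]; ring
  have hexpK : 1 ≤ Real.exp (2 * K) := Real.one_le_exp (by positivity)
  refine ⟨?_, ?_, ?_, ?_⟩
  · rw [hMy, hEp, hEm]
    have key : u * (P + Q) + (1 - u) * (-P + Q) - y / 8 * u⁻¹ = 0 := by
      rw [hP, hQ]; field_simp; rw [hre]; ring
    have e : u * Complex.exp a + (u * (1 - u) - y / 8) * (u⁻¹ * Complex.exp b) - 1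
        = u * (a - (P + Q)) + u * (Complex.exp a - 1 - a) + (1 - u) * (b - (-P + Q))
          + (1 - u) * (Complex.exp b - 1 - b) - y * (u⁻¹ / 8) * (Complex.exp b - 1) := by
      have : u * Complex.exp a + (u * (1 - u) - y / 8) * (u⁻¹ * Complex.exp b) - 1
        = u * Complex.exp a + ((u * u⁻¹) * (1 - u) - y / 8 * u⁻¹) * Complex.exp b - 1 := by ring
      rw [this, mul_inv_cancel₀ hu0]
      linear_combination key
    rw [e]
    have hb1 := hexp1 b (by linarith)
    have n1 : ‖u * (a - (P + Q))‖ ≤ V * (C1 * ‖y‖ ^ 2) := by rw [norm_mul]; gcongr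
    have n2 : ‖u * (Complex.exp a - 1 - a)‖ ≤ V * (E * ‖y‖ ^ 2) := by rw [norm_mul]; gcongr
    have n3 : ‖(1 - u) * (b - (-P + Q))‖ ≤ (1 + V) * (C1 * ‖y‖ ^ 2) := by rw [norm_mul]; gcongr
    have n4 : ‖(1 - u) * (Complex.exp b - 1 - b)‖ ≤ (1 + V) * (E * ‖y‖ ^ 2) := by
      rw [norm_mul]; gcongr
    have n5 : ‖y * (u⁻¹ / 8) * (Complex.exp b - 1)‖ ≤ ‖y‖ * (2 / 8) * ((2 * K + E) * ‖y‖) := by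
      rw [norm_mul, norm_mul, norm_div, Complex.norm_ofNat]; gcongr
    refine (norm_sub_le _ _).trans ((add_le_add ((norm_add_le _ _).trans (add_le_add
      (norm_add₃_le.trans (add_le_add_three n1 n2 n3)) n4)) n5).trans ?_)
    have hfin : V * C1 + V * E + (1 + V) * C1 + (1 + V) * E + (2 / 8) * (2 * K + E) ≤ Ct := by
      linarith
    calc _ = (V * C1 + V * E + (1 + V) * C1 + (1 + V) * E + (2 / 8) * (2 * K + E)) * ‖y‖ ^ 2 := by
          ring
      _ ≤ _ := by gcongr
  · rw [mul_assoc, hEmn, hMy]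
    have e : (u * (1 - u) - y / 8) * (u⁻¹ ^ 2 * Complex.exp (b - a))
        = (1 - u) / u + ((1 - u) * u⁻¹ * (Complex.exp (b - a) - 1)
          - y / 8 * u⁻¹ ^ 2 * Complex.exp (b - a)) := by field_simp; ring
    rw [e]
    refine (norm_add_le _ _).trans (add_le_add hcontr ((norm_sub_le _ _).trans ?_))
    have n1 : ‖(1 - u) * u⁻¹ * (Complex.exp (b - a) - 1)‖ ≤ (1 + V) * 2 * ((2 * K + E) * ‖y‖) := by
      rw [norm_mul, norm_mul]; gcongr; exact hexp1 _ hab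
    have n2 : ‖y / 8 * u⁻¹ ^ 2 * Complex.exp (b - a)‖ ≤ ‖y‖ / 8 * 2 ^ 2 * Real.exp (2 * K) := by
      rw [norm_mul, norm_mul, norm_div, Complex.norm_ofNat, norm_pow]; gcongr; exact hexpn _ hab
    refine (add_le_add n1 n2).trans ?_
    have hfin : (1 + V) * 2 * (2 * K + E) + Real.exp (2 * K) / 2 ≤ Ct := by
      linarith
    calc _ = ((1 + V) * 2 * (2 * K + E) + Real.exp (2 * K) / 2) * ‖y‖ := by ring
      _ ≤ _ := by gcongr
  · rw [hEmn]
    have e : u⁻¹ ^ 2 * Complex.exp (b - a) - 1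
        = (M * y) * (u⁻¹ ^ 3 * (1 + u) / 4) + u⁻¹ ^ 2 * (Complex.exp (b - a) - 1) := by
      rw [hfour]; field_simp; ring
    rw [e]
    have n1 : ‖(M * y) * (u⁻¹ ^ 3 * (1 + u) / 4)‖ ≤ ‖(M : ℂ) * y‖ * (2 ^ 3 * (1 + V) / 4) := by
      rw [norm_mul, norm_div, norm_mul (u⁻¹ ^ 3), norm_pow, Complex.norm_ofNat]
      gcongr
      exact (norm_add_le _ _).trans (by simpa using huV)
    have n2 : ‖u⁻¹ ^ 2 * (Complex.exp (b - a) - 1)‖ ≤ 2 ^ 2 * ((2 * K + E) * ‖y‖) := by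
      rw [norm_mul, norm_pow]; gcongr; exact hexp1 _ hab
    refine (norm_add_le _ _).trans ((add_le_add n1 n2).trans ?_)
    have h1 : 2 ^ 3 * (1 + V) / 4 ≤ Ct := by linarith
    have h2 : 2 ^ 2 * (2 * K + E) ≤ Ct := by linarith
    calc _ = ‖(M : ℂ) * y‖ * (2 ^ 3 * (1 + V) / 4) + 2 ^ 2 * (2 * K + E) * ‖y‖ := by ring
      _ ≤ ‖(M : ℂ) * y‖ * Ct + Ct * ‖y‖ := by gcongr
      _ = _ := by ring
  · rw [hEn, norm_mul]
    calc ‖u⁻¹‖ * ‖Complex.exp (-a)‖ ≤ 2 * Real.exp (2 * K) := by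
          gcongr; exact hexpn _ hna
      _ ≤ Ct := by
          linarith

/-! ### Summation of the perturbation in the exponential region -/

theorem harmonicSum_le_two_mul_sqrt (n : ℕ) (hn : 1 ≤ n) :
    ∑ j ∈ Finset.range n, 1 / ((j : ℝ) + 1) ≤ 2 * √n := by
  have h := harmonic_le_one_add_log n
  have e : ((harmonic n : ℚ) : ℝ) = ∑ j ∈ Finset.range n, 1 / ((j : ℝ) + 1) := by
    simp [harmonic, one_div]
  rw [e] at h
  have hn' : (0 : ℝ) < n := by exact_mod_cast hn
  have h2 : Real.log n = 2 * Real.log (√n) := by rw [Real.log_sqrt hn'.le]; ring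
  have h3 := Real.log_le_sub_one_of_pos (Real.sqrt_pos.2 hn')
  linarith

theorem abs_harmonicSum_sub_log_le (n : ℕ) (hn : 1 ≤ n) :
    |∑ j ∈ Finset.range n, 1 / ((j : ℝ) + 1) - Real.log n| ≤ 1 := by
  have e : ((harmonic n : ℚ) : ℝ) = ∑ j ∈ Finset.range n, 1 / ((j : ℝ) + 1) := by
    simp [harmonic, one_div]
  have h := harmonic_le_one_add_log n
  have h' := log_add_one_le_harmonic n
  have hn' : (0 : ℝ) < n := by exact_mod_cast hn
  have : Real.log n ≤ Real.log (n + 1 : ℕ) := Real.log_le_log hn' (by push_cast; linarith)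
  rw [e] at h h'
  rw [abs_le]; constructor <;> linarith

theorem sum_one_div_sq_le (n : ℕ) : ∑ j ∈ Finset.range n, 1 / ((j : ℝ) + 1) ^ 2 ≤ 2 := by
  suffices h : ∀ n : ℕ, ∑ j ∈ Finset.range (n + 1), 1 / ((j : ℝ) + 1) ^ 2 ≤ 2 - 1 / ((n : ℝ) + 1) by
    rcases n with _ | n
    · simp
    · exact (h n).trans (by have : (0 : ℝ) ≤ 1 / ((n : ℝ) + 1) := by positivity
                            linarith)
  intro n
  induction n with
  | zero => norm_num
  | succ n ih =>
    rw [Finset.sum_range_succ]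
    have : 1 / (((n + 1 : ℕ) : ℝ) + 1) ^ 2 ≤ 1 / ((n : ℝ) + 1) - 1 / (((n + 1 : ℕ) : ℝ) + 1) := by
      push_cast
      rw [div_sub_div _ _ (by positivity) (by positivity), div_le_div_iff₀ (by positivity) (by positivity)]
      nlinarith [(Nat.cast_nonneg n : (0 : ℝ) ≤ n)]
    linarith

set_option maxHeartbeats 1600000 in
/-- A sequence with values near `1`, whose increments are damped by factors `m k` of modulus at most
`q < 1` and driven by `d y g(k) / (k + β + 1 / 2)`, up to summable errors, grows like `1 + d y log
n`. The bound is uniform in `y` as long as `n ‖y‖` stays bounded. -/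
theorem slowly_varying_asymptotics (β d q K C1 : ℝ) (hβ : 0 < β) (hq0 : 0 ≤ q) (hq : q < 1)
    (hK : 0 ≤ K) (hC1 : 0 ≤ C1) :
    ∃ k0 : ℕ, 1 ≤ k0 ∧ ∀ B0 : ℝ, 0 ≤ B0 → ∃ B : ℝ, ∃ n0 : ℕ, ∀ n : ℕ, n0 ≤ n → ∀ y : ℂ, n * ‖y‖ ≤ C1 →
      ∀ g m e r : ℕ → ℂ,
      (∀ k, k0 ≤ k → k + 2 ≤ n → g (k + 2) - g (k + 1) = m k * (g (k + 1) - g k)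
        + d * y / (k + β + 1 / 2) * e k * g k - r k * g (k + 1)) →
      (∀ k, k0 ≤ k → k + 2 ≤ n → ‖m k‖ ≤ q ∧ ‖m k‖ ≤ K * ((k + 1) * ‖y‖) ∧
        ‖e k - 1‖ ≤ K * ((k + 1) * ‖y‖) ∧ ‖r k‖ ≤ K * ‖y‖ ^ 2) →
      ‖g k0 - 1‖ ≤ B0 * ‖y‖ → ‖g (k0 + 1) - 1‖ ≤ B0 * ‖y‖ →
      ‖g n - 1 - d * y * Real.log n‖ ≤ B * ‖y‖ := by
  -- For `k ≥ k0` one has `(k + 2) q ≤ (1 + q) / 2 (k + 1)`, so damping persists for the increments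
  -- weighted by `k + 1`.
  obtain ⟨k0, hk0⟩ := exists_nat_gt (2 / (1 - q))
  have h1q : 0 < 1 - q := by linarith
  have hk0pos : 1 ≤ k0 := by
    have : (0 : ℝ) < k0 := lt_trans (by positivity) hk0
    exact_mod_cast this
  refine ⟨k0, hk0pos, fun B0 hB0 => ?_⟩
  -- The driving terms and errors, weighted by `k + 1`, are at most `X ‖y‖`, and `B1` is such that
  -- `(1 + q) / 2 B1 + X ≤ B1`.
  obtain ⟨X, hX⟩ : ∃ X, X = 8 * |d| * (1 + K * C1) + 2 * K * C1 := ⟨_, rfl⟩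
  have hX0 : 0 ≤ X := by rw [hX]; positivity
  obtain ⟨B1, hB1⟩ : ∃ B1, B1 = 2 * B0 * (k0 + 1) + 2 * X / (1 - q) := ⟨_, rfl⟩
  have hB10 : 0 ≤ B1 := by rw [hB1]; positivity
  obtain ⟨a1, ha1⟩ : ∃ a1, a1 = K * B1 + 4 * K * |d| + 2 * K := ⟨_, rfl⟩
  obtain ⟨a2, ha2⟩ : ∃ a2, a2 = 2 * (β + 3 / 2) * |d| := ⟨_, rfl⟩
  obtain ⟨a3, ha3⟩ : ∃ a3, a3 = 2 * |d| * (B0 + B1) := ⟨_, rfl⟩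
  have ha10 : 0 ≤ a1 := by rw [ha1]; positivity
  have ha20 : 0 ≤ a2 := by rw [ha2]; positivity
  have ha30 : 0 ≤ a3 := by rw [ha3]; positivity
  obtain ⟨n1, hn1⟩ := exists_nat_gt ((4 * (B0 + B1) * C1 + 1) ^ 2)
  refine ⟨B0 + a1 * C1 + a2 * 2 + a3 * (4 * C1) + |d| * (k0 + 2), max n1 (k0 + 1), ?_⟩
  intro n hn y hy g m e r hrec hbd hg0 hg1
  have hnn1 : n1 ≤ n := (le_max_left _ _).trans hn
  have hnk0 : k0 + 1 ≤ n := (le_max_right _ _).trans hn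
  have hn1' : 1 ≤ n := by omega
  have hnpos : (0 : ℝ) < n := by exact_mod_cast hn1'
  have hy0 := norm_nonneg y
  obtain ⟨H, hH⟩ : ∃ H : ℕ → ℝ, ∀ k, H k = ∑ j ∈ Finset.range k, 1 / ((j : ℝ) + 1) :=
    ⟨_, fun k => rfl⟩
  have hHs : ∀ k, H (k + 1) = H k + 1 / ((k : ℝ) + 1) := by
    intro k; rw [hH, hH, Finset.sum_range_succ]
  have hHmono : Monotone H := monotone_nat_of_le_succ fun k => by
    rw [hHs]; have : (0 : ℝ) ≤ 1 / ((k : ℝ) + 1) := by positivity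
    linarith
  have hHn : H n ≤ 2 * √n := by rw [hH]; exact harmonicSum_le_two_mul_sqrt n hn1'
  have hH0 : H 0 = 0 := by rw [hH]; simp
  have hHn1 : 1 ≤ H n := by
    have := hHmono hn1'; rw [hHs 0, hH0] at this; simpa using this
  have hHnn : ∀ k, 0 ≤ H k := fun k => by rw [← hH0]; exact hHmono (Nat.zero_le k)
  have hsq := Real.sq_sqrt hnpos.le
  -- It suffices that the harmonic numbers are `O(√n)`, as `‖y‖ = O(1 / n)`.
  have hyH2 : ‖y‖ * (H n) ^ 2 ≤ 4 * C1 := by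
    calc ‖y‖ * H n ^ 2 ≤ ‖y‖ * (2 * √n) ^ 2 := by gcongr
      _ = 4 * (√n ^ 2 * ‖y‖) := by ring
      _ ≤ 4 * C1 := by rw [hsq]; linarith
  have hsmall : (B0 + B1) * (‖y‖ * H n) ≤ 1 := by
    have hs : 4 * (B0 + B1) * C1 + 1 ≤ √n := by
      apply Real.le_sqrt_of_sq_le
      exact hn1.le.trans (by exact_mod_cast hnn1)
    have h1 : ‖y‖ * H n * √n ≤ 2 * C1 := by
      calc ‖y‖ * H n * √n ≤ ‖y‖ * (2 * √n) * √n := by gcongr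
        _ = 2 * (√n ^ 2 * ‖y‖) := by ring
        _ ≤ 2 * C1 := by rw [hsq]; linarith
    have h2 : (B0 + B1) * (‖y‖ * H n) * √n ≤ 1 * √n := by
      have h3 := mul_le_mul_of_nonneg_left h1 (by positivity : 0 ≤ B0 + B1)
      have h4 : 0 ≤ (B0 + B1) * C1 := by positivity
      calc (B0 + B1) * (‖y‖ * H n) * √n = (B0 + B1) * (‖y‖ * H n * √n) := by ring
        _ ≤ 1 * √n := by linarith
    exact le_of_mul_le_mul_right h2 (by positivity)
  have hkn : ∀ k : ℕ, k + 1 ≤ n → ((k : ℝ) + 1) * ‖y‖ ≤ C1 := by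
    intro k hk
    have : (k : ℝ) + 1 ≤ n := by exact_mod_cast hk
    exact (mul_le_mul_of_nonneg_right this hy0).trans hy
  have gb : ∀ k, k ≤ n → ‖g k - 1‖ ≤ B0 * ‖y‖ + B1 * ‖y‖ * H k →
      ‖g k - 1‖ ≤ (B0 + B1) * (‖y‖ * H n) ∧ ‖g k‖ ≤ 2 := by
    intro k hk h
    have h1 : ‖g k - 1‖ ≤ (B0 + B1) * (‖y‖ * H n) := by
      refine h.trans ?_
      have i1 : B0 * ‖y‖ * 1 ≤ B0 * ‖y‖ * H n := by gcongr
      have i2 : B1 * ‖y‖ * H k ≤ B1 * ‖y‖ * H n := by gcongr; exact hHmono hk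
      linarith
    refine ⟨h1, ?_⟩
    have : g k = (g k - 1) + 1 := by ring
    rw [this]; refine (norm_add_le _ _).trans ?_
    rw [norm_one]; linarith
  -- A priori bound: the increments are `O(‖y‖ / k)`, hence `g k = 1 + O(‖y‖ H k)`.
  have P : ∀ k, k0 ≤ k → k + 1 ≤ n → (k + 1) * ‖g (k + 1) - g k‖ ≤ B1 * ‖y‖ ∧
      ‖g k - 1‖ ≤ B0 * ‖y‖ + B1 * ‖y‖ * H k ∧ ‖g (k + 1) - 1‖ ≤ B0 * ‖y‖ + B1 * ‖y‖ * H (k + 1) := by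
    intro k hk
    induction k, hk using Nat.le_induction with
    | base =>
      intro _
      refine ⟨?_, hg0.trans (by have := hHnn k0; have : 0 ≤ B1 * ‖y‖ * H k0 := by positivity
                                linarith),
        hg1.trans (by have := hHnn (k0 + 1); have : 0 ≤ B1 * ‖y‖ * H (k0 + 1) := by positivity
                      linarith)⟩
      have : g (k0 + 1) - g k0 = (g (k0 + 1) - 1) - (g k0 - 1) := by ring
      rw [this]
      calc ((k0 : ℝ) + 1) * ‖(g (k0 + 1) - 1) - (g k0 - 1)‖ ≤ (k0 + 1) * (B0 * ‖y‖ + B0 * ‖y‖) := by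
            gcongr; exact (norm_sub_le _ _).trans (add_le_add hg1 hg0)
        _ = 2 * B0 * (k0 + 1) * ‖y‖ := by ring
        _ ≤ B1 * ‖y‖ := by
            gcongr; rw [hB1]; have : 0 ≤ 2 * X / (1 - q) := by positivity
            linarith
    | succ k hk ih =>
      intro hk2
      obtain ⟨i1, i2, i3⟩ := ih (by omega)
      obtain ⟨b1, b2, b3, b4⟩ := hbd k hk (by omega)
      have hΔ : ((k + 1 : ℕ) + 1 : ℝ) * ‖g (k + 1 + 1) - g (k + 1)‖ ≤ B1 * ‖y‖ := by
        rw [show k + 1 + 1 = k + 2 from rfl, hrec k hk (by omega)]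
        have ge := (gb k (by omega) i2).2
        have ge1 := (gb (k + 1) (by omega) i3).2
        have hk1 := hkn k (by omega)
        have hk2' := hkn (k + 1) (by omega)
        push_cast at hk2' ⊢
        have en : ‖e k‖ ≤ 1 + K * C1 := by
          have : e k = (e k - 1) + 1 := by ring
          rw [this]; refine (norm_add_le _ _).trans ?_
          rw [norm_one]
          have := mul_le_mul_of_nonneg_left hk1 hK
          linarith
        have hkq : ((k : ℝ) + 1 + 1) * q ≤ (1 + q) / 2 * (k + 1) := by
          have : (k0 : ℝ) ≤ k := by exact_mod_cast hk
          have h2 : 2 / (1 - q) < k := hk0.trans_le this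
          rw [div_lt_iff₀ h1q] at h2
          linarith
        have t1 : ((k : ℝ) + 1 + 1) * ‖m k * (g (k + 1) - g k)‖ ≤ (1 + q) / 2 * (B1 * ‖y‖) := by
          rw [norm_mul]
          calc ((k : ℝ) + 1 + 1) * (‖m k‖ * ‖g (k + 1) - g k‖)
              ≤ ((k : ℝ) + 1 + 1) * (q * ‖g (k + 1) - g k‖) := by gcongr
            _ = ((k : ℝ) + 1 + 1) * q * ‖g (k + 1) - g k‖ := by ring
            _ ≤ (1 + q) / 2 * (k + 1) * ‖g (k + 1) - g k‖ := by gcongr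
            _ = (1 + q) / 2 * ((k + 1) * ‖g (k + 1) - g k‖) := by ring
            _ ≤ _ := by gcongr
        have hw : ‖(k : ℂ) + β + 1 / 2‖ = k + β + 1 / 2 := by
          have : (k : ℂ) + β + 1 / 2 = ((k + β + 1 / 2 : ℝ) : ℂ) := by push_cast; ring
          rw [this, Complex.norm_real, Real.norm_of_nonneg (by positivity)]
        have t2 : ((k : ℝ) + 1 + 1) * ‖d * y / (k + β + 1 / 2) * e k * g k‖
            ≤ 8 * |d| * (1 + K * C1) * ‖y‖ := by
          rw [norm_mul, norm_mul, norm_div, norm_mul, Complex.norm_real, Real.norm_eq_abs, hw]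
          have : ((k : ℝ) + 1 + 1) / (k + β + 1 / 2) ≤ 4 := by
            rw [div_le_iff₀ (by positivity)]; linarith [(Nat.cast_nonneg k : (0 : ℝ) ≤ k)]
          calc ((k : ℝ) + 1 + 1) * (|d| * ‖y‖ / (k + β + 1 / 2) * ‖e k‖ * ‖g k‖)
              = ((k : ℝ) + 1 + 1) / (k + β + 1 / 2) * (|d| * ‖y‖ * ‖e k‖ * ‖g k‖) := by ring
            _ ≤ 4 * (|d| * ‖y‖ * (1 + K * C1) * 2) := by gcongr
            _ = _ := by ring
        have t3 : ((k : ℝ) + 1 + 1) * ‖r k * g (k + 1)‖ ≤ 2 * K * C1 * ‖y‖ := by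
          rw [norm_mul]
          calc ((k : ℝ) + 1 + 1) * (‖r k‖ * ‖g (k + 1)‖) ≤ ((k : ℝ) + 1 + 1) * (K * ‖y‖ ^ 2 * 2) := by
                gcongr
            _ = 2 * K * (((k : ℝ) + 1 + 1) * ‖y‖) * ‖y‖ := by ring
            _ ≤ _ := by gcongr
        calc _ ≤ ((k : ℝ) + 1 + 1) * (‖m k * (g (k + 1) - g k)‖ + ‖d * y / (k + β + 1 / 2) * e k * g k‖
                + ‖r k * g (k + 1)‖) := by
              gcongr
              exact (norm_sub_le _ _).trans (by gcongr; exact norm_add_le _ _)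
          _ ≤ (1 + q) / 2 * (B1 * ‖y‖) + 8 * |d| * (1 + K * C1) * ‖y‖ + 2 * K * C1 * ‖y‖ := by
              rw [mul_add, mul_add]; gcongr
          _ = ((1 + q) / 2 * B1 + X) * ‖y‖ := by rw [hX]; ring
          _ ≤ B1 * ‖y‖ := by
              gcongr
              have : X ≤ (1 - q) / 2 * B1 := by
                rw [hB1, mul_add]
                have e1 : (1 - q) / 2 * (2 * X / (1 - q)) = X := by field_simp
                rw [e1]
                have : 0 ≤ (1 - q) / 2 * (2 * B0 * (k0 + 1)) := by positivity
                linarith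
              linarith
      refine ⟨hΔ, i3, ?_⟩
      have : g (k + 1 + 1) - 1 = (g (k + 1 + 1) - g (k + 1)) + (g (k + 1) - 1) := by ring
      rw [this, hHs (k + 1)]
      refine (norm_add_le _ _).trans ?_
      have : ‖g (k + 1 + 1) - g (k + 1)‖ ≤ B1 * ‖y‖ * (1 / ((k + 1 : ℕ) + 1)) := by
        rw [mul_one_div, le_div_iff₀ (by positivity), mul_comm]; exact hΔ
      linarith
  -- With the a priori bound, the increments are those of `d y H k` up to `‖y‖ E k`, and the sum of
  -- the `E k` is bounded.
  obtain ⟨E, hE⟩ : ∃ E : ℕ → ℝ, ∀ j, E j = a1 * ‖y‖ + a2 * (1 / ((j : ℝ) + 1) ^ 2)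
    + a3 * (‖y‖ * H n) * (1 / ((j : ℝ) + 1)) := ⟨_, fun j => rfl⟩
  have hE0 : ∀ j, 0 ≤ E j := fun j => by
    rw [hE]; have := hHnn n; positivity
  have inc : ∀ k, k0 ≤ k → k + 2 ≤ n →
      ‖g (k + 2) - g (k + 1) - d * y * ((H (k + 2) - H (k + 1) : ℝ) : ℂ)‖ ≤ ‖y‖ * E k := by
    intro k hk hk2
    obtain ⟨i1, i2, i3⟩ := P k hk (by omega)
    obtain ⟨b1, b2, b3, b4⟩ := hbd k hk (by omega)
    obtain ⟨ge', ge⟩ := gb k (by omega) i2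
    have ge1 := (gb (k + 1) (by omega) i3).2
    have hw : ‖(k : ℂ) + β + 1 / 2‖ = k + β + 1 / 2 := by
      have : (k : ℂ) + β + 1 / 2 = ((k + β + 1 / 2 : ℝ) : ℂ) := by push_cast; ring
      rw [this, Complex.norm_real, Real.norm_of_nonneg (by positivity)]
    have hw0 : (k : ℂ) + β + 1 / 2 ≠ 0 := by
      rw [← norm_pos_iff, hw]; positivity
    have hw2 : ((k : ℝ) + 1) / 2 ≤ k + β + 1 / 2 := by linarith [(Nat.cast_nonneg k : (0 : ℝ) ≤ k)]
    rw [hrec k hk hk2, hHs (k + 1)]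
    have hk2ne : (k : ℂ) + 2 ≠ 0 := by exact_mod_cast (by omega : k + 2 ≠ 0)
    have e0 : m k * (g (k + 1) - g k) + d * y / (k + β + 1 / 2) * e k * g k - r k * g (k + 1)
        - d * y * ((H (k + 1) + 1 / (((k + 1 : ℕ) : ℝ) + 1) - H (k + 1) : ℝ) : ℂ)
        = m k * (g (k + 1) - g k) + d * y / (k + β + 1 / 2) * ((e k - 1) * g k + (g k - 1))
          + d * y * ((3 / 2 - β) / ((k + β + 1 / 2) * (k + 2))) - r k * g (k + 1) := by
      have : (H (k + 1) + 1 / (((k + 1 : ℕ) : ℝ) + 1) - H (k + 1) : ℝ) = 1 / ((k : ℝ) + 2) := by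
        push_cast; ring
      rw [this]
      have e1 : (3 / 2 - (β : ℂ)) / ((k + β + 1 / 2) * (k + 2)) = 1 / (k + β + 1 / 2) - 1 / (k + 2) := by
        rw [div_sub_div _ _ hw0 hk2ne]; congr 1; ring
      rw [e1]; push_cast; ring
    rw [e0]
    have hk1pos : (0 : ℝ) < k + 1 := by positivity
    have t1 : ‖m k * (g (k + 1) - g k)‖ ≤ K * B1 * ‖y‖ ^ 2 := by
      rw [norm_mul]
      calc ‖m k‖ * ‖g (k + 1) - g k‖ ≤ K * ((k + 1) * ‖y‖) * ‖g (k + 1) - g k‖ := by gcongr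
        _ = K * ‖y‖ * ((k + 1) * ‖g (k + 1) - g k‖) := by ring
        _ ≤ K * ‖y‖ * (B1 * ‖y‖) := by gcongr
        _ = _ := by ring
    have hdy : ‖d * y / (k + β + 1 / 2)‖ ≤ 2 * |d| * ‖y‖ / (k + 1) := by
      rw [norm_div, norm_mul, Complex.norm_real, Real.norm_eq_abs, hw]
      calc |d| * ‖y‖ / (k + β + 1 / 2) ≤ |d| * ‖y‖ / (((k : ℝ) + 1) / 2) := by gcongr
        _ = _ := by field_simp
    have t2 : ‖d * y / (k + β + 1 / 2) * ((e k - 1) * g k + (g k - 1))‖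
        ≤ 4 * K * |d| * ‖y‖ ^ 2 + a3 * (‖y‖ * H n) * (1 / ((k : ℝ) + 1)) * ‖y‖ := by
      rw [norm_mul]
      have : ‖(e k - 1) * g k + (g k - 1)‖ ≤ K * ((k + 1) * ‖y‖) * 2 + (B0 + B1) * (‖y‖ * H n) := by
        refine (norm_add_le _ _).trans ?_
        rw [norm_mul]; gcongr
      calc _ ≤ 2 * |d| * ‖y‖ / (k + 1) * (K * ((k + 1) * ‖y‖) * 2 + (B0 + B1) * (‖y‖ * H n)) := by
            gcongr
        _ = _ := by rw [ha3]; field_simp; ring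
    have t3 : ‖d * y * ((3 / 2 - β) / ((k + β + 1 / 2) * (k + 2)))‖
        ≤ a2 * (1 / ((k : ℝ) + 1) ^ 2) * ‖y‖ := by
      rw [norm_mul, norm_mul, Complex.norm_real, Real.norm_eq_abs, norm_div, norm_mul, hw]
      have n1 : ‖(3 / 2 : ℂ) - β‖ ≤ β + 3 / 2 := by
        have : (3 / 2 : ℂ) - β = ((3 / 2 - β : ℝ) : ℂ) := by push_cast; ring
        rw [this, Complex.norm_real, Real.norm_eq_abs, abs_le]; constructor <;> linarith
      have n2 : ‖(k : ℂ) + 2‖ = k + 2 := by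
        have : (k : ℂ) + 2 = ((k + 2 : ℝ) : ℂ) := by push_cast; ring
        rw [this, Complex.norm_real, Real.norm_of_nonneg (by positivity)]
      rw [n2]
      calc |d| * ‖y‖ * (‖(3 / 2 : ℂ) - β‖ / ((k + β + 1 / 2) * (k + 2)))
          ≤ |d| * ‖y‖ * ((β + 3 / 2) / (((k : ℝ) + 1) / 2 * (k + 1))) := by
            gcongr; norm_num
        _ = _ := by rw [ha2]; field_simp
    have t4 : ‖r k * g (k + 1)‖ ≤ 2 * K * ‖y‖ ^ 2 := by
      rw [norm_mul]
      calc ‖r k‖ * ‖g (k + 1)‖ ≤ K * ‖y‖ ^ 2 * 2 := by gcongr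
        _ = _ := by ring
    refine (norm_sub_le _ _).trans ((add_le_add (norm_add₃_le.trans (add_le_add_three t1 t2 t3)) t4).trans
      (le_of_eq ?_))
    rw [hE, ha1]; ring
  have fin : ∀ j, k0 ≤ j → j + 1 ≤ n →
      ‖g (j + 1) - 1 - d * y * ((H (j + 1) - H (k0 + 1) : ℝ) : ℂ)‖
        ≤ B0 * ‖y‖ + ‖y‖ * ∑ i ∈ Finset.range j, E i := by
    intro j hj
    induction j, hj using Nat.le_induction with
    | base =>
      intro _
      simp only [sub_self, Complex.ofReal_zero, mul_zero, sub_zero]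
      have := Finset.sum_nonneg (s := Finset.range k0) (fun j _ => hE0 j)
      have : 0 ≤ ‖y‖ * ∑ j ∈ Finset.range k0, E j := by positivity
      linarith
    | succ j hj ih =>
      intro hkn'
      have i1 := ih (by omega)
      have i2 := inc j hj (by omega)
      have : g (j + 1 + 1) - 1 - d * y * ((H (j + 1 + 1) - H (k0 + 1) : ℝ) : ℂ)
          = (g (j + 1) - 1 - d * y * ((H (j + 1) - H (k0 + 1) : ℝ) : ℂ))
            + (g (j + 2) - g (j + 1) - d * y * ((H (j + 2) - H (j + 1) : ℝ) : ℂ)) := by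
        push_cast; ring
      rw [this]
      refine (norm_add_le _ _).trans ((add_le_add i1 i2).trans ?_)
      rw [Finset.sum_range_succ, mul_add, add_assoc]
  have hsum : ∑ j ∈ Finset.range n, E j ≤ a1 * C1 + a2 * 2 + a3 * (4 * C1) := by
    simp only [hE, Finset.sum_add_distrib, ← Finset.mul_sum, Finset.sum_const, Finset.card_range,
      nsmul_eq_mul]
    rw [← hH]
    have i2 := mul_le_mul_of_nonneg_left (sum_one_div_sq_le n) ha20
    have i1 := mul_le_mul_of_nonneg_left hy ha10
    have i3 := mul_le_mul_of_nonneg_left hyH2 ha30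
    have e3 : a3 * (‖y‖ * H n) * H n = a3 * (‖y‖ * H n ^ 2) := by ring
    rw [e3]; linarith
  obtain ⟨n', rfl⟩ : ∃ n', n = n' + 1 := ⟨n - 1, by omega⟩
  have h1 := fin n' (by omega) le_rfl
  have hsum' : ∑ j ∈ Finset.range n', E j ≤ a1 * C1 + a2 * 2 + a3 * (4 * C1) := by
    rw [Finset.sum_range_succ] at hsum; linarith [hE0 n']
  have hHk0 : H (k0 + 1) ≤ k0 + 1 := by
    rw [hH]
    calc _ ≤ ∑ j ∈ Finset.range (k0 + 1), (1 : ℝ) := Finset.sum_le_sum fun j _ => by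
          rw [div_le_one (by positivity)]; linarith [(Nat.cast_nonneg j : (0 : ℝ) ≤ j)]
      _ = _ := by simp
  have hlog := abs_harmonicSum_sub_log_le (n' + 1) hn1'
  rw [← hH] at hlog
  have : g (n' + 1) - 1 - d * y * Real.log (n' + 1 : ℕ) = (g (n' + 1) - 1 - d * y * ((H (n' + 1) - H (k0 + 1) : ℝ) : ℂ))
      + d * y * ((H (n' + 1) - Real.log (n' + 1) - H (k0 + 1) : ℝ) : ℂ) := by push_cast; ring
  rw [this]
  have t : ‖d * y * ((H (n' + 1) - Real.log (n' + 1) - H (k0 + 1) : ℝ) : ℂ)‖ ≤ |d| * (k0 + 2) * ‖y‖ := by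
    rw [norm_mul, norm_mul, Complex.norm_real, Complex.norm_real, Real.norm_eq_abs, Real.norm_eq_abs]
    have : |H (n' + 1) - Real.log (n' + 1) - H (k0 + 1)| ≤ k0 + 2 := by
      have := hHnn (k0 + 1)
      push_cast at hlog ⊢
      rw [abs_le] at hlog ⊢
      constructor <;> linarith [hlog.1, hlog.2]
    calc |d| * ‖y‖ * |H (n' + 1) - Real.log (n' + 1) - H (k0 + 1)| ≤ |d| * ‖y‖ * (k0 + 2) := by gcongr
      _ = _ := by ring
  refine (norm_add_le _ _).trans ((add_le_add h1 t).trans ?_)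
  have := mul_le_mul_of_nonneg_left hsum' hy0
  linarith

/-- For a fixed index the WKB approximation is `1 + O(y)`, like the polynomials themselves: this
fixes the constant of proportionality between them. -/
theorem exp_neg_wkbLog_sub_one_isBigO (M : ℝ) :
    (fun y : ℂ => Complex.exp (-wkbLog y M) - 1) =O[nhds 0] fun y : ℂ => y := by
  have h0 : wkbRoot 0 = 1 := by simp [wkbRoot]
  have hr : DifferentiableAt ℂ (fun y : ℂ => wkbRoot (M * y)) 0 := by
    unfold wkbRoot
    have h1 : DifferentiableAt ℂ (fun y : ℂ => 1 - M * y) 0 := by fun_prop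
    exact h1.cpow_const (by simp)
  have hu : DifferentiableAt ℂ (fun y : ℂ => wkbRatio (M * y)) 0 := by
    unfold wkbRatio; fun_prop
  have hu0 : wkbRatio (M * 0) = 1 := by simp [wkbRatio, h0]
  have hd : DifferentiableAt ℂ (fun y : ℂ => Complex.exp (-wkbLog y M)) 0 := by
    unfold wkbLog
    have h1 : DifferentiableAt ℂ (fun y : ℂ => Complex.log (wkbRatio (M * y))) 0 :=
      hu.clog (by rw [hu0]; simp)
    have h2 : DifferentiableAt ℂ (fun y : ℂ => Complex.log (wkbRoot (M * y))) 0 :=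
      hr.clog (by simp [h0])
    have h3 : DifferentiableAt ℂ (fun y : ℂ => 1 / (2 * wkbRatio (M * y))) 0 :=
      (differentiableAt_const _).div (hu.const_mul 2) (by rw [hu0]; norm_num)
    exact (((((h1.add h3).sub_const _).const_mul _).sub (h2.div_const 2)).neg).cexp
  have := hd.isBigO_sub
  simpa [wkbLog, hu0, h0, wkbRatio] using this

set_option maxHeartbeats 1600000 in
/-- Asymptotics of any solution of the three-term recurrence (scaled by the powers of `x`, with
`y = x⁻²`) that starts like `1 + O(y)`: it is the WKB approximation times `1 + d y log n + O(y)`,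
as long as no turning point is met. -/
theorem dominant_asymptotics (β d c R C1 : ℝ) (hβ : 0 < β) (hc : 0 < c) (hc1 : c ≤ 1) (hR : 1 ≤ R)
    (hC1 : 0 ≤ C1) :
    ∃ k0 : ℕ, ∀ B0 : ℝ, 0 ≤ B0 → ∃ B : ℝ, ∃ n0 : ℕ, ∀ n : ℕ, n0 ≤ n → ∀ y : ℂ, n * ‖y‖ ≤ C1 →
      (∀ M ∈ Set.Icc 0 (bigN β n), c ≤ (wkbRoot (M * y)).re ∧ ‖wkbRoot (M * y)‖ ≤ R) →
      ∀ q : ℕ → ℂ,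
      (∀ k, k0 ≤ k → k + 2 ≤ n → q (k + 2) = q (k + 1)
        - ((bigN β (k + 1) - 1 / 2) / 4 - d / (bigN β (k + 1) + 1 / 2)) * y * q k) →
      ‖q k0 - 1‖ ≤ B0 * ‖y‖ → ‖q (k0 + 1) - 1‖ ≤ B0 * ‖y‖ →
      ‖q n * Complex.exp (-wkbLog y (bigN β n)) - 1 - d * y * Real.log n‖ ≤ B * ‖y‖ := by
  obtain ⟨C, hC, hstep⟩ := WkbRegular.step (R := R) hc
  -- The rate `2 b` of damping that the separation of the characteristic roots provides; half of it
  -- is lost to the error terms in `WkbRegular.step`.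
  obtain ⟨b, hb⟩ : ∃ b, b = c / (1 + R) ^ 2 := ⟨_, rfl⟩
  have hb0 : 0 < b := by rw [hb]; positivity
  have hb1 : b ≤ 1 := by rw [hb, div_le_one (by positivity)]; nlinarith
  obtain ⟨K, hK⟩ : ∃ K, K = (β + 1) * (1 + C * ((β + 2) * C1)) + C * (β + 2) + C * C := ⟨_, rfl⟩
  have hK1 : 0 ≤ (β + 1) * (1 + C * ((β + 2) * C1)) := by positivity
  have hK2 : 0 ≤ C * (β + 2) := by positivity
  have hK3 : 0 ≤ C * C := by positivity
  have hK0 : 0 ≤ K := by linarith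
  obtain ⟨k0, hk0, hmain⟩ := slowly_varying_asymptotics β d (1 - b) K C1 hβ (by linarith) (by linarith)
    hK0 hC1
  refine ⟨k0, fun B0 hB0 => ?_⟩
  have hinit : ∃ A : ℝ, 0 ≤ A ∧ ∃ ε : ℝ, 0 < ε ∧ ∀ y : ℂ, ‖y‖ < ε → ∀ k ∈ ({k0, k0 + 1} : Set ℕ),
      ‖Complex.exp (-wkbLog y (bigN β k)) - 1‖ ≤ A * ‖y‖ := by
    obtain ⟨A, hA⟩ := (exp_neg_wkbLog_sub_one_isBigO (bigN β k0)).bound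
    obtain ⟨A', hA'⟩ := (exp_neg_wkbLog_sub_one_isBigO (bigN β (k0 + 1))).bound
    obtain ⟨ε, hε, h⟩ := Metric.eventually_nhds_iff.1 (hA.and hA')
    refine ⟨max 0 (max A A'), le_max_left _ _, ε, hε, fun y hy k hk => ?_⟩
    obtain ⟨h1, h2⟩ := h (y := y) (by simpa using hy)
    rcases hk with rfl | rfl
    · exact h1.trans (by gcongr; exact (le_max_left _ _).trans (le_max_right _ _))
    · exact h2.trans (by gcongr; exact (le_max_right _ _).trans (le_max_right _ _))
  obtain ⟨A, hA0, ε, hε, hA⟩ := hinit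
  obtain ⟨B, n1, hB⟩ := hmain (B0 + (1 + B0) * A) (by positivity)
  obtain ⟨n2, hn2⟩ := exists_nat_gt (C1 * (1 + C / b + 1 / ε))
  refine ⟨B, max n1 (max n2 1), fun n hn y hy hreg q hq h0 h1 => ?_⟩
  have hnn1 : n1 ≤ n := (le_max_left _ _).trans hn
  have hnn2 : n2 ≤ n := (le_max_left _ _).trans ((le_max_right _ _).trans hn)
  have hn1 : 1 ≤ n := (le_max_right _ _).trans ((le_max_right _ _).trans hn)
  have hnpos : (0 : ℝ) < n := by exact_mod_cast hn1
  have hn2' : C1 * (1 + C / b + 1 / ε) < n := hn2.trans_le (by exact_mod_cast hnn2)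
  have hy0 := norm_nonneg y
  have hysm : ‖y‖ * (1 + C / b + 1 / ε) < 1 := by
    by_contra hcon
    push Not at hcon
    have : n * 1 ≤ n * (‖y‖ * (1 + C / b + 1 / ε)) := by gcongr
    have h3 : n * ‖y‖ * (1 + C / b + 1 / ε) ≤ C1 * (1 + C / b + 1 / ε) := by gcongr
    linarith
  have hCb : 0 ≤ C / b := by positivity
  have hε1 : 0 < 1 / ε := by positivity
  have hp1 := mul_nonneg hy0 hCb
  have hp2 := mul_nonneg hy0 hε1.le
  rw [mul_add, mul_add, mul_one] at hysm
  have hy1 : ‖y‖ ≤ 1 := by linarith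
  have hyC : C * ‖y‖ ≤ b := by
    have : ‖y‖ * (C / b) ≤ 1 := by linarith
    rw [← mul_div_assoc, div_le_one hb0] at this; linarith
  have hyε : ‖y‖ < ε := by
    have : ‖y‖ * (1 / ε) < 1 := by linarith
    rwa [mul_one_div, div_lt_one hε] at this
  have hcase : ∀ k, k0 ≤ k → k + 2 ≤ n → WkbRegular c R y (bigN β (k + 1)) := by
    intro k hk hkn M' hM'
    apply hreg
    have e : bigN β (k + 1) = k + β := by simp [bigN]; ring
    rw [e] at hM'
    have h1k : (1 : ℝ) ≤ k := by exact_mod_cast hk0.trans hk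
    have h2k : (k : ℝ) + 2 ≤ n := by exact_mod_cast hkn
    constructor
    · linarith [hM'.1]
    · rw [bigN]; linarith [hM'.2]
  have e1 : ∀ k : ℕ, bigN β (k + 1) + 1 = bigN β (k + 2) := by intro k; rw [bigN, bigN]; push_cast; ring
  have e2 : ∀ k : ℕ, bigN β (k + 1) - 1 = bigN β k := by intro k; rw [bigN, bigN]; push_cast; ring
  have ginit : ∀ k ∈ ({k0, k0 + 1} : Set ℕ), ‖q k - 1‖ ≤ B0 * ‖y‖ →
      ‖q k * Complex.exp (-wkbLog y (bigN β k)) - 1‖ ≤ (B0 + (1 + B0) * A) * ‖y‖ := by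
    intro k hk hqk
    have hEk := hA y hyε k hk
    have hqn : ‖q k‖ ≤ 1 + B0 := by
      have : q k = (q k - 1) + 1 := by ring
      rw [this]; refine (norm_add_le _ _).trans ?_
      rw [norm_one]; have := mul_le_mul_of_nonneg_left hy1 hB0; linarith
    have : q k * Complex.exp (-wkbLog y (bigN β k)) - 1
        = (q k - 1) + q k * (Complex.exp (-wkbLog y (bigN β k)) - 1) := by ring
    rw [this]
    refine (norm_add_le _ _).trans ?_
    rw [norm_mul]
    calc ‖q k - 1‖ + ‖q k‖ * ‖Complex.exp (-wkbLog y (bigN β k)) - 1‖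
        ≤ B0 * ‖y‖ + (1 + B0) * (A * ‖y‖) := by gcongr
      _ = _ := by ring
  -- Apart from the term with `d`, the quotient `g` of the solution by the WKB approximation
  -- satisfies `g₊ = a₁ g - a₀ g₋` with `a₁ - a₀ = 1 + O(y²)`; hence its increments are multiplied
  -- by `a₀`.
  refine hB n hnn1 y hy (fun k => q k * Complex.exp (-wkbLog y (bigN β k)))
    (fun k => (bigN β (k + 1) - 1 / 2) / 4 * y
      * Complex.exp (wkbLog y (bigN β (k + 1) - 1) - wkbLog y (bigN β (k + 1)))
      * Complex.exp (-(wkbLog y (bigN β (k + 1) + 1) - wkbLog y (bigN β (k + 1)))))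
    (fun k => Complex.exp (wkbLog y (bigN β (k + 1) - 1) - wkbLog y (bigN β (k + 1)))
      * Complex.exp (-(wkbLog y (bigN β (k + 1) + 1) - wkbLog y (bigN β (k + 1)))))
    (fun k => (Complex.exp (wkbLog y (bigN β (k + 1) + 1) - wkbLog y (bigN β (k + 1)))
        + (bigN β (k + 1) - 1 / 2) / 4 * y
        * Complex.exp (wkbLog y (bigN β (k + 1) - 1) - wkbLog y (bigN β (k + 1))) - 1)
      * Complex.exp (-(wkbLog y (bigN β (k + 1) + 1) - wkbLog y (bigN β (k + 1)))))
    ?_ ?_ (ginit _ (by simp) h0) (ginit _ (by simp) h1)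
  · intro k hk hkn
    rw [hq k hk hkn, e1, e2]
    have eN : ((bigN β (k + 1) : ℝ) : ℂ) = k + β := by simp [bigN]; ring
    simp only [sub_eq_add_neg, neg_add, Complex.exp_add, neg_neg, Complex.exp_neg]
    rw [eN]
    have p0 := Complex.exp_ne_zero (wkbLog y (bigN β k))
    have p1 := Complex.exp_ne_zero (wkbLog y (bigN β (k + 1)))
    have p2 := Complex.exp_ne_zero (wkbLog y (bigN β (k + 2)))
    have hw0 : (k : ℂ) + β + 1 / 2 ≠ 0 := by
      have : (k : ℂ) + β + 1 / 2 = ((k + β + 1 / 2 : ℝ) : ℂ) := by push_cast; ring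
      rw [this, Complex.ofReal_ne_zero]; positivity
    generalize Complex.exp (wkbLog y (bigN β k)) = E0 at *
    generalize Complex.exp (wkbLog y (bigN β (k + 1))) = E1 at *
    generalize Complex.exp (wkbLog y (bigN β (k + 2))) = E2 at *
    generalize hw : (k : ℂ) + β + 1 / 2 = w at *
    have : (k : ℂ) + β = w - 1 / 2 := by rw [← hw]; ring
    rw [this]
    field_simp
    ring
  · intro k hk hkn
    obtain ⟨s1, s2, s3, s4⟩ := hstep y _ hy1 (hcase k hk hkn)
    have hk1 : ((k : ℝ) + 1) * ‖y‖ ≤ C1 := by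
      have : (k : ℝ) + 2 ≤ n := by exact_mod_cast hkn
      exact le_trans (by gcongr; linarith) hy
    have hk0' : (0 : ℝ) ≤ k := Nat.cast_nonneg k
    have eN : bigN β (k + 1) = k + β := by simp [bigN]; ring
    have hMy : ‖(bigN β (k + 1) : ℂ) * y‖ + ‖y‖ ≤ (β + 2) * ((k + 1) * ‖y‖) := by
      rw [norm_mul, Complex.norm_real, eN, Real.norm_of_nonneg (by positivity)]
      have : (k : ℝ) + β + 1 ≤ (β + 2) * (k + 1) := by
        have := mul_nonneg hβ.le hk0'; linarith
      calc (k + β) * ‖y‖ + ‖y‖ = (k + β + 1) * ‖y‖ := by ring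
        _ ≤ (β + 2) * (k + 1) * ‖y‖ := by gcongr
        _ = _ := by ring
    have s3' := s3.trans (mul_le_mul_of_nonneg_left hMy hC)
    generalize hP : Complex.exp (-(wkbLog y (bigN β (k + 1) + 1) - wkbLog y (bigN β (k + 1)))) = P at *
    generalize Complex.exp (wkbLog y (bigN β (k + 1) - 1) - wkbLog y (bigN β (k + 1))) = Q at *
    refine ⟨?_, ?_, ?_, ?_⟩
    · refine s2.trans ?_
      have : 2 * c / (1 + R) ^ 2 = 2 * b := by rw [hb]; ring
      rw [this]; linarith
    · rw [mul_assoc _ Q P, norm_mul]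
      have hQP : ‖Q * P‖ ≤ 1 + C * ((β + 2) * C1) := by
        have : Q * P = (Q * P - 1) + 1 := by ring
        rw [this]; refine (norm_add_le _ _).trans ?_
        rw [norm_one, add_comm]
        have : C * ((β + 2) * ((k + 1) * ‖y‖)) ≤ C * ((β + 2) * C1) := by gcongr
        linarith
      have hM : ‖((bigN β (k + 1) : ℂ) - 1 / 2) / 4 * y‖ ≤ (β + 1) * ((k + 1) * ‖y‖) := by
        rw [norm_mul, norm_div, Complex.norm_ofNat]
        have : (bigN β (k + 1) : ℂ) - 1 / 2 = ((k + β - 1 / 2 : ℝ) : ℂ) := by rw [eN]; push_cast; ring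
        rw [this, Complex.norm_real, Real.norm_eq_abs]
        have : |(k : ℝ) + β - 1 / 2| ≤ (β + 1) * (k + 1) * 4 := by
          have := mul_nonneg hβ.le hk0'
          rw [abs_le]; constructor <;> linarith
        calc |(k : ℝ) + β - 1 / 2| / 4 * ‖y‖ ≤ (β + 1) * (k + 1) * 4 / 4 * ‖y‖ := by gcongr
          _ = _ := by ring
      calc _ ≤ (β + 1) * ((k + 1) * ‖y‖) * (1 + C * ((β + 2) * C1)) := by gcongr
        _ = (β + 1) * (1 + C * ((β + 2) * C1)) * ((k + 1) * ‖y‖) := by ring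
        _ ≤ K * ((k + 1) * ‖y‖) := by gcongr; linarith
    · refine s3'.trans ?_
      rw [← mul_assoc]; gcongr; linarith
    · rw [norm_mul]
      calc _ ≤ C * ‖y‖ ^ 2 * C := by gcongr
        _ = C * C * ‖y‖ ^ 2 := by ring
        _ ≤ _ := by gcongr; linarith

/-! ### Branches of the elementary functions off `[-1, 1]` -/

/-- Identities between logarithms are proved by exponentiating and by bounding imaginary parts. -/
theorem eq_of_exp_eq_of_abs_im_sub_lt {a b : ℂ} (h : Complex.exp a = Complex.exp b)
    (hi : |a.im - b.im| < 2 * Real.pi) : a = b := by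
  obtain ⟨n, hn⟩ := Complex.exp_eq_exp_iff_exists_int.1 h
  have : a.im - b.im = n * (2 * Real.pi) := by
    rw [hn]; simp [mul_comm]
  rw [this, abs_mul, abs_of_pos Real.two_pi_pos] at hi
  have h1 : |(n : ℝ)| < 1 := by
    by_contra hcon
    push Not at hcon
    nlinarith [Real.two_pi_pos]
  have h2 : |n| < 1 := by exact_mod_cast h1
  have h3 : n = 0 := Int.abs_lt_one_iff.1 h2
  rw [hn, h3]; simp

theorem arg_bounds_of_im {σ : ℝ} (hσ : σ = 1 ∨ σ = -1) {z : ℂ} (h : 0 < σ * z.im) :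
    0 < σ * z.arg ∧ σ * z.arg < Real.pi := by
  rcases hσ with rfl | rfl
  · have hz : 0 < z.im := by simpa using h
    have h0 : 0 ≤ z.arg := Complex.arg_nonneg_iff.2 hz.le
    have h1 : z.arg ≠ 0 := fun h => hz.ne' (Complex.arg_eq_zero_iff.1 h).2
    have h2 : z.arg ≠ Real.pi := fun h => hz.ne' (Complex.arg_eq_pi_iff.1 h).2
    have := Complex.arg_le_pi z
    exact ⟨by rw [one_mul]; exact lt_of_le_of_ne h0 h1.symm,
      by rw [one_mul]; exact lt_of_le_of_ne this h2⟩
  · have hz : z.im < 0 := by linarith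
    have h0 := Complex.arg_neg_iff.2 hz
    have := Complex.neg_pi_lt_arg z
    constructor <;> linarith

theorem log_eq_of_im {a b c : ℂ} (ha : a ≠ 0) (hb : b ≠ 0) (h : c = a * b)
    (hi : |c.arg - (a.arg + b.arg)| < 2 * Real.pi) :
    Complex.log c = Complex.log a + Complex.log b := by
  apply eq_of_exp_eq_of_abs_im_sub_lt
  · rw [Complex.exp_add, Complex.exp_log ha, Complex.exp_log hb, Complex.exp_log, h]
    rw [h]; exact mul_ne_zero ha hb
  · simpa [Complex.log_im] using hi

/-- Off `[-1, 1]` no turning point is met: the discriminant `1 - s / z²` stays off the branch cut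
for all relative levels `s` in `[0, 1]`. -/
theorem one_sub_mem_slitPlane {z : ℂ} (hz : z ∉ Complex.ofReal '' Set.Icc (-1 : ℝ) 1) {s : ℝ}
    (hs : s ∈ Set.Icc (0 : ℝ) 1) : 1 - s / z ^ 2 ∈ Complex.slitPlane := by
  have hz0 : z ≠ 0 := by
    rintro rfl; exact hz ⟨0, by norm_num, by simp⟩
  by_contra hcon
  rw [Complex.mem_slitPlane_iff, not_or, not_lt, not_not] at hcon
  obtain ⟨h1, h2⟩ := hcon
  obtain ⟨t, ht⟩ : ∃ t : ℝ, (s : ℂ) / z ^ 2 = t := ⟨((s : ℂ) / z ^ 2).re, by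
    apply Complex.ext <;> simp at h2 ⊢; exact h2⟩
  rw [ht] at h1
  have ht1 : 1 ≤ t := by
    simp at h1; linarith
  have hz2 : z ^ 2 = ((s / t : ℝ) : ℂ) := by
    have : (t : ℂ) ≠ 0 := by
      rw [Complex.ofReal_ne_zero]; linarith
    push_cast
    rw [eq_div_iff this, ← ht]; field_simp
  have hu0 : 0 ≤ s / t := div_nonneg hs.1 (by linarith)
  have hu1 : s / t ≤ 1 := by rw [div_le_one (by linarith)]; linarith [hs.2]
  have hsq : z ^ 2 = ((√(s / t) : ℝ) : ℂ) ^ 2 := by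
    rw [hz2, ← Complex.ofReal_pow, Real.sq_sqrt hu0]
  have hle : √(s / t) ≤ 1 := Real.sqrt_le_one.2 hu1
  have h0 := Real.sqrt_nonneg (s / t)
  rcases sq_eq_sq_iff_eq_or_eq_neg.1 hsq with h | h
  · exact hz ⟨_, ⟨by linarith, hle⟩, h.symm⟩
  · exact hz ⟨-√(s / t), ⟨by linarith, by linarith⟩, by rw [h]; push_cast; rfl⟩

theorem wkbRoot_re_pos {τ : ℂ} (h : 1 - τ ∈ Complex.slitPlane) : 0 < (wkbRoot τ).re := by
  have h0 := Complex.slitPlane_ne_zero h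
  rw [wkbRoot, Complex.cpow_def_of_ne_zero h0, Complex.exp_re]
  refine mul_pos (Real.exp_pos _) (Real.cos_pos_of_mem_Ioo ?_)
  have h1 := Complex.neg_pi_lt_arg (1 - τ)
  have h2 := (Complex.arg_le_pi (1 - τ)).lt_of_ne (Complex.slitPlane_arg_ne_pi h)
  have e : (Complex.log (1 - τ) * (1 / 2)).im = (1 - τ).arg / 2 := by
    simp [Complex.mul_im, Complex.log_im]; ring
  rw [e]; constructor <;> linarith

theorem log_wkbRoot {τ : ℂ} (h : 1 - τ ∈ Complex.slitPlane) :
    Complex.log (wkbRoot τ) = Complex.log (1 - τ) / 2 := by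
  have h0 := Complex.slitPlane_ne_zero h
  have h1 := Complex.neg_pi_lt_arg (1 - τ)
  have h2 := Complex.arg_le_pi (1 - τ)
  have e : (Complex.log (1 - τ) * (1 / 2)).im = (1 - τ).arg / 2 := by
    simp [Complex.mul_im, Complex.log_im]; ring
  rw [wkbRoot, Complex.cpow_def_of_ne_zero h0, Complex.log_exp]
  · ring
  · rw [e]; linarith [Real.pi_pos]
  · rw [e]; linarith [Real.pi_pos]

theorem ne_zero_of_notMem_Icc
    {z : ℂ} (hz : z ∉ Complex.ofReal '' Set.Icc (-1 : ℝ) 1) : z ≠ 0 := by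
  rintro rfl; exact hz ⟨0, by norm_num, by simp⟩

theorem sub_one_ne_zero_of_notMem_Icc
    {z : ℂ} (hz : z ∉ Complex.ofReal '' Set.Icc (-1 : ℝ) 1) : z - 1 ≠ 0 := by
  intro h; exact hz ⟨1, by norm_num, by rw [sub_eq_zero] at h; simp [h]⟩

theorem add_one_ne_zero_of_notMem_Icc
    {z : ℂ} (hz : z ∉ Complex.ofReal '' Set.Icc (-1 : ℝ) 1) : z + 1 ≠ 0 := by
  intro h; exact hz ⟨-1, by norm_num, by rw [add_eq_zero_iff_eq_neg] at h; simp [h]⟩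

/-- Off `[-1, 1]` a number is nonreal, or its argument agrees with those of its translates
by `±1`. -/
theorem im_ne_zero_or_arg_eq
    {z : ℂ} (hz : z ∉ Complex.ofReal '' Set.Icc (-1 : ℝ) 1) : (∃ σ : ℝ, (σ = 1 ∨ σ = -1) ∧ 0 < σ * z.im) ∨
    (z.im = 0 ∧ (z - 1).arg = z.arg ∧ (z + 1).arg = z.arg ∧
      ∀ r : ℝ, 0 < r → (z * r).arg = z.arg) := by
  rcases lt_trichotomy z.im 0 with h | h | h
  · exact Or.inl ⟨-1, Or.inr rfl, by linarith⟩
  · right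
    obtain ⟨t, rfl⟩ : ∃ t : ℝ, z = t := ⟨z.re, by apply Complex.ext <;> simp [h]⟩
    refine ⟨h, ?_, ?_, fun r hr => ?_⟩
    rotate_left 2
    · rw [mul_comm]; exact Complex.arg_real_mul _ hr
    all_goals
      rcases lt_or_ge t (-1) with h1 | h1
      · rw [Complex.arg_ofReal_of_neg (by linarith)]
        rw [Complex.arg_eq_pi_iff]; simp; linarith
      · have h2 : 1 < t := by
          by_contra hcon; exact hz ⟨t, ⟨h1, not_lt.1 hcon⟩, rfl⟩
        rw [Complex.arg_ofReal_of_nonneg (by linarith)]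
        rw [Complex.arg_eq_zero_iff]; simp; linarith
  · exact Or.inl ⟨1, Or.inl rfl, by linarith⟩

theorem log_sub_one_add_log_add_one
    {z : ℂ} (hz : z ∉ Complex.ofReal '' Set.Icc (-1 : ℝ) 1) :
    Complex.log (z - 1) + Complex.log (z + 1)
      = 2 * Complex.log z + Complex.log (1 - 1 / z ^ 2) := by
  have hz0 := ne_zero_of_notMem_Icc hz
  have hzm := sub_one_ne_zero_of_notMem_Icc hz
  have hzp := add_one_ne_zero_of_notMem_Icc hz
  have hslit := one_sub_mem_slitPlane hz (s := 1) (by norm_num)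
  rw [Complex.ofReal_one] at hslit
  have hD1 := Complex.neg_pi_lt_arg (1 - 1 / z ^ 2)
  have hD2 := (Complex.arg_le_pi (1 - 1 / z ^ 2)).lt_of_ne (Complex.slitPlane_arg_ne_pi hslit)
  have hexp : Complex.exp (Complex.log (z - 1) + Complex.log (z + 1))
      = Complex.exp (2 * Complex.log z + Complex.log (1 - 1 / z ^ 2)) := by
    rw [Complex.exp_add, Complex.exp_add, two_mul, Complex.exp_add, Complex.exp_log hzm,
      Complex.exp_log hzp, Complex.exp_log hz0, Complex.exp_log (Complex.slitPlane_ne_zero hslit)]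
    field_simp
    ring
  rcases im_ne_zero_or_arg_eq hz with ⟨σ, hσ, him⟩ | ⟨-, h1, h2, -⟩
  · have im0 : (1 - 1 / z).im = z.im / Complex.normSq z := by
      simp [Complex.inv_im, neg_div]
    have im1 : (1 + 1 / z).im = -(z.im / Complex.normSq z) := by
      simp [Complex.inv_im, neg_div]
    have hns : 0 < Complex.normSq z := Complex.normSq_pos.2 hz0
    have B := arg_bounds_of_im hσ him
    have A := arg_bounds_of_im hσ (z := z - 1) (by simpa using him)
    have C := arg_bounds_of_im hσ (z := z + 1) (by simpa using him)
    have hq : 0 < σ * (z.im / Complex.normSq z) := by rw [← mul_div_assoc]; positivity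
    have P := arg_bounds_of_im hσ (z := 1 - 1 / z) (by rw [im0]; exact hq)
    have hσ' : -σ = 1 ∨ -σ = -1 := by rcases hσ with rfl | rfl <;> simp
    have Q := arg_bounds_of_im hσ' (z := 1 + 1 / z) (by rw [im1]; linarith)
    have e1 : 1 - 1 / z ≠ 0 := by
      intro h; rw [h] at im0; simp only [Complex.zero_im] at im0; rw [← im0] at hq; simp at hq
    have e2 : 1 + 1 / z ≠ 0 := by
      intro h; rw [h] at im1; simp only [Complex.zero_im] at im1
      have : z.im / Complex.normSq z = 0 := by linarith
      rw [this] at hq; simp at hq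
    have l1 : Complex.log (z - 1) = Complex.log z + Complex.log (1 - 1 / z) := by
      refine log_eq_of_im hz0 e1 (by field_simp) ?_
      rcases hσ with rfl | rfl <;> rw [abs_lt] <;> constructor <;> linarith
    have l2 : Complex.log (z + 1) = Complex.log z + Complex.log (1 + 1 / z) := by
      refine log_eq_of_im hz0 e2 (by field_simp) ?_
      rcases hσ with rfl | rfl <;> rw [abs_lt] <;> constructor <;> linarith
    have l3 : Complex.log (1 - 1 / z ^ 2) = Complex.log (1 - 1 / z) + Complex.log (1 + 1 / z) := by
      refine log_eq_of_im e1 e2 (by field_simp; ring) ?_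
      rcases hσ with rfl | rfl <;> rw [abs_lt] <;> constructor <;> linarith
    rw [l1, l2, l3]; ring
  · apply eq_of_exp_eq_of_abs_im_sub_lt hexp
    simp only [Complex.add_im, Complex.mul_im, Complex.log_im, Complex.re_ofNat, Complex.im_ofNat]
    rw [h1, h2, abs_lt]
    constructor <;> linarith [Real.pi_pos]

theorem sqSubOnePow_eq
    {z : ℂ} (hz : z ∉ Complex.ofReal '' Set.Icc (-1 : ℝ) 1) (p : ℂ) :
    sqSubOnePow p z = Complex.exp (p * (2 * Complex.log z + Complex.log (1 - 1 / z ^ 2))) := by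
  rw [sqSubOnePow, Complex.cpow_def_of_ne_zero (sub_one_ne_zero_of_notMem_Icc hz),
    Complex.cpow_def_of_ne_zero (add_one_ne_zero_of_notMem_Icc hz), ← Complex.exp_add,
    ← log_sub_one_add_log_add_one hz]
  congr 1; ring

theorem sqSubOnePow_half
    {z : ℂ} (hz : z ∉ Complex.ofReal '' Set.Icc (-1 : ℝ) 1) : sqSubOnePow (1 / 2) z = z * wkbRoot (1 / z ^ 2) := by
  have hslit := one_sub_mem_slitPlane hz (s := 1) (by norm_num)
  rw [Complex.ofReal_one] at hslit
  rw [sqSubOnePow_eq hz, wkbRoot, Complex.cpow_def_of_ne_zero (Complex.slitPlane_ne_zero hslit)]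
  conv_rhs => rw [← Complex.exp_log (ne_zero_of_notMem_Icc hz), ← Complex.exp_add]
  rw [Complex.exp_log (ne_zero_of_notMem_Icc hz)]
  congr 1; ring

/-- With `√(z² - 1) = z √(1 - z⁻²)`, the principal logarithm of `z + √(z² - 1)` splits as in the WKB
form of the exponent, on all of the complement of `[-1, 1]`. -/
theorem log_mul_one_add_wkbRoot
    {z : ℂ} (hz : z ∉ Complex.ofReal '' Set.Icc (-1 : ℝ) 1) :
    Complex.log (z + z * wkbRoot (1 / z ^ 2))
      = Complex.log z + Complex.log (1 + wkbRoot (1 / z ^ 2)) := by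
  have hslit := one_sub_mem_slitPlane hz (s := 1) (by norm_num)
  rw [Complex.ofReal_one] at hslit
  have hre := wkbRoot_re_pos hslit
  have hre1 : 0 < (1 + wkbRoot (1 / z ^ 2)).re := by
    rw [Complex.add_re, Complex.one_re]; linarith
  have h10 : 1 + wkbRoot (1 / z ^ 2) ≠ 0 := by intro h; rw [h] at hre1; simp at hre1
  have harg := Complex.abs_arg_lt_pi_div_two_iff.2 (Or.inl hre1)
  rw [abs_lt] at harg
  refine log_eq_of_im (ne_zero_of_notMem_Icc hz) h10 (by ring) ?_
  rcases im_ne_zero_or_arg_eq hz with ⟨σ, hσ, him⟩ | ⟨hi0, h1, h2, h3⟩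
  · have A := arg_bounds_of_im hσ (z := z - 1) (by simpa using him)
    have B := arg_bounds_of_im hσ him
    have C := arg_bounds_of_im hσ (z := z + 1) (by simpa using him)
    have hS : 0 < σ * (z * wkbRoot (1 / z ^ 2)).im := by
      rw [← sqSubOnePow_half hz, sqSubOnePow, Complex.cpow_def_of_ne_zero (sub_one_ne_zero_of_notMem_Icc hz),
        Complex.cpow_def_of_ne_zero (add_one_ne_zero_of_notMem_Icc hz), ← Complex.exp_add, Complex.exp_im]
      have e : (Complex.log (z - 1) * (1 / 2) + Complex.log (z + 1) * (1 / 2)).im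
          = ((z - 1).arg + (z + 1).arg) / 2 := by
        simp [Complex.mul_im, Complex.log_im]; ring
      rw [e]
      have : 0 < σ * Real.sin (((z - 1).arg + (z + 1).arg) / 2) := by
        rcases hσ with rfl | rfl
        · rw [one_mul]; apply Real.sin_pos_of_pos_of_lt_pi <;> linarith
        · rw [neg_one_mul, ← Real.sin_neg]; apply Real.sin_pos_of_pos_of_lt_pi <;> linarith
      rw [mul_left_comm]; exact mul_pos (Real.exp_pos _) this
    have D := arg_bounds_of_im hσ (z := z + z * wkbRoot (1 / z ^ 2)) (by
      rw [Complex.add_im, mul_add]; linarith)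
    rcases hσ with rfl | rfl <;> rw [abs_lt] <;> constructor <;> linarith
  · obtain ⟨t, rfl⟩ : ∃ t : ℝ, z = t := ⟨z.re, by apply Complex.ext <;> simp [hi0]⟩
    obtain ⟨r, hr, hr0⟩ : ∃ r : ℝ, wkbRoot (1 / (t : ℂ) ^ 2) = r ∧ 0 < r := by
      have hw : (1 : ℂ) - 1 / (t : ℂ) ^ 2 = ((1 - 1 / t ^ 2 : ℝ) : ℂ) := by push_cast; ring
      have hw0 : 0 < 1 - 1 / t ^ 2 := by
        rw [hw, Complex.ofReal_mem_slitPlane] at hslit; exact hslit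
      refine ⟨(1 - 1 / t ^ 2) ^ (1 / 2 : ℝ), ?_, Real.rpow_pos_of_pos hw0 _⟩
      rw [wkbRoot, hw, Complex.ofReal_cpow hw0.le]; push_cast; rfl
    rw [hr]
    have e : (t : ℂ) + t * r = t * ((1 + r : ℝ) : ℂ) := by push_cast; ring
    have e' : (1 : ℂ) + r = ((1 + r : ℝ) : ℂ) := by push_cast; ring
    rw [e, e', h3 _ (by linarith), Complex.arg_ofReal_of_nonneg (by linarith : (0 : ℝ) ≤ 1 + r)]
    simpa using Real.pi_pos

/-! ### The polynomials as solutions of the scaled recurrence -/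

/-- The monic polynomials proportional to `φ_n`. -/
noncomputable def monicPhi (α β : ℝ) : ℕ → ℂ → ℂ
  | 0, _ => 1
  | 1, x => x
  | n + 2, x => x * monicPhi α β (n + 1) x - (lam α β (n + 1) / 2 : ℝ) * monicPhi α β n x

/-- The polynomials in `y = x⁻²` with `x ^ n * scaledPhi n y = monicPhi n x`. -/
noncomputable def scaledPhi (α β : ℝ) : ℕ → ℂ → ℂ
  | 0, _ => 1
  | 1, _ => 1
  | n + 2, y => scaledPhi α β (n + 1) y - (lam α β (n + 1) / 2 : ℝ) * y * scaledPhi α β n y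

theorem lam_pos {α β : ℝ} (hα : 0 ≤ α) (hαβ : α < β) {k : ℕ} (hk : 1 ≤ k) : 0 < lam α β k := by
  have : (1 : ℝ) ≤ k := by exact_mod_cast hk
  unfold lam
  exact div_pos (mul_pos (by linarith) (by linarith)) (by linarith)

/-- The partial fraction form of the recurrence coefficient; it exhibits the perturbation `(α² - 1 /
4) / 4` that produces the logarithmic correction in `prefactor`. -/
theorem lam_succ_div_two {α β : ℝ} (hβ : 0 < β) (k : ℕ) :
    lam α β (k + 1) / 2 = (bigN β (k + 1) - 1 / 2) / 4
      - (α ^ 2 - 1 / 4) / 4 / (bigN β (k + 1) + 1 / 2) := by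
  unfold lam bigN
  push_cast
  have h1 : (k : ℝ) + 1 + β - 1 / 2 ≠ 0 := by
    have : (0 : ℝ) ≤ k := Nat.cast_nonneg k
    intro h; linarith
  have h2 : (k : ℝ) + 1 + β - 1 + 1 / 2 ≠ 0 := by
    intro h; apply h1; linarith
  have hw : (k : ℝ) + 1 + β - 1 + 1 / 2 = k + 1 + β - 1 / 2 := by ring
  rw [hw] at h2 ⊢
  have hw2 : (k : ℝ) = (k + 1 + β - 1 / 2) - (1 + β - 1 / 2) := by ring
  generalize (k : ℝ) + 1 + β - 1 / 2 = w at *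
  rw [hw2]
  field_simp
  ring

theorem gam_succ {α β : ℝ} (hα : 0 ≤ α) (hαβ : α < β) (n : ℕ) :
    gam α β (n + 1) * √(lam α β (n + 1) / 2) = gam α β n := by
  have hpos := lam_pos hα hαβ (k := n + 1) (by omega)
  have hprod : 0 < ∏ k ∈ Finset.Icc 1 n, lam α β k :=
    Finset.prod_pos fun k hk => lam_pos hα hαβ (Finset.mem_Icc.1 hk).1
  unfold gam
  rw [← Real.sqrt_mul (div_nonneg (by positivity)
    (Finset.prod_nonneg fun k hk => (lam_pos hα hαβ (Finset.mem_Icc.1 hk).1).le)),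
    Finset.prod_Icc_succ_top (by omega)]
  congr 1
  field_simp
  ring

theorem gam_pos {α β : ℝ} (hα : 0 ≤ α) (hαβ : α < β) (n : ℕ) : 0 < gam α β n := by
  unfold gam
  exact Real.sqrt_pos.2 (div_pos (by positivity)
    (Finset.prod_pos fun k hk => lam_pos hα hαβ (Finset.mem_Icc.1 hk).1))

theorem phi_eq_gam_mul_monicPhi {α β : ℝ} (hα : 0 ≤ α) (hαβ : α < β) (x : ℂ) (n : ℕ) :
    phi α β n x = gam α β n * monicPhi α β n x := by
  induction n using Nat.twoStepInduction with
  | zero => simp [phi, monicPhi, gam]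
  | one =>
    have h1 : gam α β 1 = √(2 / lam α β 1) := by simp [gam]
    rw [phi, monicPhi, h1]
  | more n ih1 ih2 =>
    have hs : (√(lam α β (n + 2) / 2) : ℝ) ≠ 0 :=
      (Real.sqrt_pos.2 (half_pos (lam_pos hα hαβ (by omega)))).ne'
    have hs' : ((√(lam α β (n + 2) / 2) : ℝ) : ℂ) ≠ 0 := by exact_mod_cast hs
    rw [phi, monicPhi, ih1, ih2, div_eq_iff hs', ← gam_succ hα hαβ n]
    have h2 := gam_succ hα hαβ (n + 1)
    have h3 : √(lam α β (n + 1) / 2) * √(lam α β (n + 1) / 2) = lam α β (n + 1) / 2 :=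
      Real.mul_self_sqrt (half_pos (lam_pos hα hαβ (by omega))).le
    have h2' : (gam α β (n + 1) : ℂ) = gam α β (n + 2) * (√(lam α β (n + 2) / 2) : ℝ) := by
      rw [← h2]; push_cast; rfl
    have h3' : ((lam α β (n + 1) / 2 : ℝ) : ℂ)
        = (√(lam α β (n + 1) / 2) : ℝ) * (√(lam α β (n + 1) / 2) : ℝ) := by
      rw [← Complex.ofReal_mul, h3]
    rw [h3', Complex.ofReal_mul, h2']
    ring

theorem monicPhi_eq_pow_mul_scaledPhi (α β : ℝ) {x : ℂ} (hx : x ≠ 0) (n : ℕ) :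
    monicPhi α β n x = x ^ n * scaledPhi α β n (1 / x ^ 2) := by
  induction n using Nat.twoStepInduction with
  | zero => simp [monicPhi, scaledPhi]
  | one => simp [monicPhi, scaledPhi]
  | more n ih1 ih2 =>
    rw [monicPhi, scaledPhi, ih1, ih2]
    field_simp
    ring

/-- For a fixed index the scaled polynomial is `1 + O(y)`. -/
theorem exists_norm_scaledPhi_sub_one_le (α β : ℝ) (k : ℕ) :
    ∃ B : ℝ, 0 ≤ B ∧ ∀ y : ℂ, ‖y‖ ≤ 1 → ‖scaledPhi α β k y - 1‖ ≤ B * ‖y‖ := by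
  induction k using Nat.twoStepInduction with
  | zero => exact ⟨0, le_rfl, fun y _ => by simp [scaledPhi]⟩
  | one => exact ⟨0, le_rfl, fun y _ => by simp [scaledPhi]⟩
  | more k ih1 ih2 =>
    obtain ⟨B1, hB1, h1⟩ := ih1
    obtain ⟨B2, hB2, h2⟩ := ih2
    refine ⟨B2 + |lam α β (k + 1) / 2| * (1 + B1), by positivity, fun y hy => ?_⟩
    have hn : ‖scaledPhi α β k y‖ ≤ 1 + B1 := by
      have : scaledPhi α β k y = (scaledPhi α β k y - 1) + 1 := by ring
      rw [this]; refine (norm_add_le _ _).trans ?_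
      rw [norm_one]
      have := h1 y hy
      have := mul_le_mul_of_nonneg_left hy hB1
      linarith
    rw [scaledPhi]
    have : scaledPhi α β (k + 1) y - (lam α β (k + 1) / 2 : ℝ) * y * scaledPhi α β k y - 1
      = (scaledPhi α β (k + 1) y - 1) - (lam α β (k + 1) / 2 : ℝ) * y * scaledPhi α β k y := by ring
    rw [this]
    refine (norm_sub_le _ _).trans ?_
    rw [norm_mul, norm_mul, Complex.norm_real, Real.norm_eq_abs]
    calc _ ≤ B2 * ‖y‖ + |lam α β (k + 1) / 2| * ‖y‖ * (1 + B1) := by gcongr; exact h2 y hy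
      _ = _ := by ring

/-! ### Uniform asymptotics off `[-1, 1]` -/

/-- On a compact set off `[-1, 1]` the characteristic roots of the recurrence stay apart for all
indices up to `n`. -/
theorem exists_wkbRoot_bounds {K : Set ℂ} (hK : IsCompact K)
    (hKsub : K ⊆ (Complex.ofReal '' Set.Icc (-1 : ℝ) 1)ᶜ) :
    ∃ c R m : ℝ, 0 < c ∧ c ≤ 1 ∧ 1 ≤ R ∧ 0 < m ∧ ∀ z ∈ K, m ≤ ‖z‖ ∧ ‖z‖ ≤ R ∧
      ∀ s ∈ Set.Icc (0 : ℝ) 1, c ≤ (wkbRoot (s / z ^ 2)).re ∧ ‖wkbRoot (s / z ^ 2)‖ ≤ R := by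
  have hcont : ContinuousOn (fun p : ℝ × ℂ => wkbRoot (p.1 / p.2 ^ 2)) (Set.Icc (0 : ℝ) 1 ×ˢ K) := by
    rintro ⟨s, z⟩ ⟨hs, hz⟩
    apply ContinuousAt.continuousWithinAt
    unfold wkbRoot
    have hz0 : z ≠ 0 := ne_zero_of_notMem_Icc (hKsub hz)
    refine ContinuousAt.cpow ?_ continuousAt_const (one_sub_mem_slitPlane (hKsub hz) hs)
    refine continuousAt_const.sub ?_
    refine ContinuousAt.div ?_ ?_ (pow_ne_zero 2 hz0)
    · exact (Complex.continuous_ofReal.comp continuous_fst).continuousAt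
    · exact (continuous_snd.pow 2).continuousAt
  have hc : IsCompact (Set.Icc (0 : ℝ) 1 ×ˢ K) := isCompact_Icc.prod hK
  obtain ⟨R1, hR1⟩ := hc.exists_bound_of_continuousOn hcont
  obtain ⟨R2, hR2⟩ := hK.exists_bound_of_continuousOn (f := fun z => z) continuousOn_id
  obtain ⟨c, hc0, hc'⟩ : ∃ c : ℝ, 0 < c ∧ ∀ p ∈ Set.Icc (0 : ℝ) 1 ×ˢ K,
      c ≤ (wkbRoot ((p.1 : ℂ) / p.2 ^ 2)).re :=
    hc.exists_forall_le' (Complex.continuous_re.comp_continuousOn hcont)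
      fun p hp => wkbRoot_re_pos (one_sub_mem_slitPlane (hKsub hp.2) hp.1)
  obtain ⟨m, hm0, hm⟩ : ∃ m : ℝ, 0 < m ∧ ∀ z ∈ K, m ≤ ‖z‖ :=
    hK.exists_forall_le' continuous_norm.continuousOn
      fun z hz => norm_pos_iff.2 (ne_zero_of_notMem_Icc (hKsub hz))
  refine ⟨min c 1, max 1 (max R1 R2), m, lt_min hc0 one_pos, min_le_right _ _, le_max_left _ _, hm0,
    fun z hz => ⟨hm z hz, (hR2 z hz).trans ((le_max_right _ _).trans (le_max_right _ _)),
      fun s hs => ⟨(min_le_left _ _).trans (hc' (s, z) ⟨hs, hz⟩), ?_⟩⟩⟩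
  exact (hR1 (s, z) ⟨hs, hz⟩).trans ((le_max_left _ _).trans (le_max_right _ _))

theorem prefactor_eq_exp {α β : ℝ} {n : ℕ} (hN : 0 < bigN β n) (z : ℂ) :
    prefactor α β n z = gam α β n * (√(bigN β n) : ℝ) ^ n *
      Complex.exp (-(bigN β n : ℂ) * Real.log 2 - bigN β n / 2 + bigN β n * z ^ 2
        + ((α : ℂ) ^ 2 - 1 / 4) / 4 * (1 / (bigN β n * z ^ 2)) *
          Complex.log ((bigN β n : ℂ) * z ^ 2)) := by
  have h1 : ((4 * Real.exp 1) ^ (-(bigN β n) / 2) : ℝ)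
      = Real.exp (-(bigN β n) * Real.log 2 - bigN β n / 2) := by
    rw [Real.rpow_def_of_pos (by positivity), Real.log_mul (by norm_num) (Real.exp_pos _).ne',
      Real.log_exp, show (4 : ℝ) = 2 ^ 2 by norm_num, Real.log_pow]
    congr 1; push_cast; ring
  have h2 : (bigN β n ^ ((n : ℝ) / 2) : ℝ) = √(bigN β n) ^ n := by
    rw [Real.sqrt_eq_rpow, ← Real.rpow_natCast, ← Real.rpow_mul hN.le]
    congr 1; ring
  rw [prefactor, h1, h2]
  push_cast
  rw [add_assoc, Complex.exp_add (_ - _)]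
  have h3 : ((α : ℂ) ^ 2 - 1 / 4) / 4 * (1 / (bigN β n * z ^ 2)) *
          Complex.log ((bigN β n : ℂ) * z ^ 2)
      = ((α : ℂ) ^ 2 - 1 / 4) * Complex.log ((bigN β n : ℂ) * z ^ 2) / (4 * (bigN β n : ℂ) * z ^ 2) := by
    simp only [div_eq_mul_inv, mul_inv]; ring
  rw [h3]
  ring

theorem outerTerm_eq_exp {α β : ℝ} {n : ℕ} (hN : 0 < bigN β n) {z : ℂ}
    (hz : z ∉ Complex.ofReal '' Set.Icc (-1 : ℝ) 1) :
    outerTerm α β n z = gam α β n * ((√(bigN β n) : ℝ) * z) ^ n *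
      Complex.exp (wkbLog (1 / (bigN β n * z ^ 2)) (bigN β n)) *
      Complex.exp (((α : ℂ) ^ 2 - 1 / 4) / 4 * (1 / (bigN β n * z ^ 2)) *
          Complex.log ((bigN β n : ℂ) * z ^ 2)) := by
  have hNc : (bigN β n : ℂ) ≠ 0 := by exact_mod_cast hN.ne'
  have hz0 := ne_zero_of_notMem_Icc hz
  have hslit := one_sub_mem_slitPlane hz (s := 1) (by norm_num)
  rw [Complex.ofReal_one] at hslit
  have hre := wkbRoot_re_pos hslit
  have hMy : (bigN β n : ℂ) * (1 / (bigN β n * z ^ 2)) = 1 / z ^ 2 := by field_simp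
  have hpow : z ^ n = Complex.exp (n * Complex.log z) := by
    rw [Complex.exp_nat_mul, Complex.exp_log hz0]
  rw [outerTerm, prefactor_eq_exp hN, sqSubOnePow_half hz, log_mul_one_add_wkbRoot hz,
    sqSubOnePow_eq hz, Complex.cpow_def_of_ne_zero hz0, mul_pow, hpow, wkbLog, hMy,
    ← Complex.exp_add]
  have hρ := log_wkbRoot hslit
  have hlU : Complex.log (wkbRatio (1 / z ^ 2))
      = Complex.log (1 + wkbRoot (1 / z ^ 2)) - Real.log 2 := by
    have h1 : wkbRatio (1 / z ^ 2) = ((1 / 2 : ℝ) : ℂ) * (1 + wkbRoot (1 / z ^ 2)) := by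
      rw [wkbRatio]; push_cast; ring
    have h10 : 1 + wkbRoot (1 / z ^ 2) ≠ 0 := by
      intro h; have := congrArg Complex.re h
      rw [Complex.add_re, Complex.one_re, Complex.zero_re] at this; linarith
    rw [h1, Complex.log_ofReal_mul (by norm_num) h10]
    rw [one_div, Real.log_inv]; push_cast; ring
  have hU : 1 / (2 * wkbRatio (1 / z ^ 2)) = z ^ 2 - z ^ 2 * wkbRoot (1 / z ^ 2) := by
    have h10 : 1 + wkbRoot (1 / z ^ 2) ≠ 0 := by
      intro h; have := congrArg Complex.re h
      rw [Complex.add_re, Complex.one_re, Complex.zero_re] at this; linarith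
    have h2 := wkbRoot_sq (1 / z ^ 2)
    rw [wkbRatio, mul_div_cancel₀ _ two_ne_zero, div_eq_iff h10]
    have : (z ^ 2 - z ^ 2 * wkbRoot (1 / z ^ 2)) * (1 + wkbRoot (1 / z ^ 2))
      = z ^ 2 * (1 - wkbRoot (1 / z ^ 2) ^ 2) := by ring
    rw [this, h2]; field_simp; ring
  rw [hlU, hU, hρ, div_mul_eq_mul_div]
  rw [div_eq_iff (Complex.exp_ne_zero _)]
  have hNn : (bigN β n : ℂ) = n + β - 1 := by unfold bigN; push_cast; ring
  simp only [mul_assoc, ← Complex.exp_add]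
  congr 3
  generalize (α ^ 2 - 1 / 4 : ℂ) / 4 * (1 / (bigN β n * z ^ 2) * Complex.log (bigN β n * z ^ 2)) = E
  rw [hNn]
  ring

/-- The factor `1 + D log n` produced by the recurrence is absorbed by the exponential correction
in the prefactor. -/
theorem norm_mul_exp_neg_sub_one_le {Y T : ℝ} (hY : 0 ≤ Y) (hT : 0 ≤ T) :
    ∃ C : ℝ, 0 ≤ C ∧ ∀ N : ℝ, 1 ≤ N → ∀ (D r L : ℂ) (l : ℝ), ‖D‖ ≤ Y / N → ‖r‖ ≤ Y / N →
      l ^ 2 ≤ T * N → ‖L - l‖ ≤ T →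
      ‖(1 + D * l + r) * Complex.exp (-(D * L)) - 1‖ ≤ C / N := by
  obtain ⟨P, hP⟩ : ∃ P, P = 2 * T + 2 * T ^ 2 := ⟨_, rfl⟩
  have hP0 : 0 ≤ P := by rw [hP]; positivity
  obtain ⟨K, hK⟩ : ∃ K, K = Y * (1 + P) := ⟨_, rfl⟩
  refine ⟨Y * T + Y ^ 2 * (T + P) + (1 + Y * (1 + T)) * (Real.exp K * (Y ^ 2 * P))
    + Y * Real.exp K, by positivity, fun N hN D r L l hD hr hl hL => ?_⟩
  have hN0 : 0 < N := by linarith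
  have hl' : |l| ≤ (1 + T) * N := by nlinarith [sq_abs l, sq_nonneg (|l| - 1)]
  have hLn : ‖L‖ ≤ |l| + T := by
    have : L = (L - l) + l := by ring
    rw [this]; refine (norm_add_le _ _).trans ?_
    rw [Complex.norm_real, Real.norm_eq_abs]; linarith
  have hL2 : ‖L‖ ^ 2 ≤ P * N := by
    have h1 : ‖L‖ ^ 2 ≤ (|l| + T) ^ 2 := by gcongr
    rw [hP]
    nlinarith [sq_abs l, sq_nonneg (|l| - T), mul_nonneg (sq_nonneg T) (by linarith : 0 ≤ N - 1)]
  have hL1 : ‖L‖ ≤ (1 + P) * N := by nlinarith [sq_nonneg (‖L‖ - 1)]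
  have hDN : ‖D‖ * N ≤ Y := (le_div_iff₀ hN0).1 hD
  have hDL : ‖-(D * L)‖ ≤ K := by
    rw [norm_neg, norm_mul, hK]
    calc ‖D‖ * ‖L‖ ≤ ‖D‖ * ((1 + P) * N) := by gcongr
      _ = ‖D‖ * N * (1 + P) := by ring
      _ ≤ _ := by gcongr
  have hD2 : ∀ a : ℝ, 0 ≤ a → ‖D‖ ^ 2 * (a * N) ≤ Y ^ 2 * a / N := by
    intro a ha
    rw [le_div_iff₀ hN0]
    calc ‖D‖ ^ 2 * (a * N) * N = (‖D‖ * N) ^ 2 * a := by ring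
      _ ≤ _ := by gcongr
  have hs := norm_exp_sub_one_sub_le hDL
  have hs' : ‖Complex.exp (-(D * L)) - 1 - -(D * L)‖ ≤ Real.exp K * (Y ^ 2 * P / N) := by
    refine hs.trans ?_
    gcongr
    rw [norm_neg, norm_mul, mul_pow]
    exact (mul_le_mul_of_nonneg_left hL2 (by positivity)).trans (hD2 P hP0)
  have hexp : ‖Complex.exp (-(D * L))‖ ≤ Real.exp K :=
    (Complex.norm_exp_le_exp_norm _).trans (Real.exp_le_exp.2 hDL)
  have hcross : ‖D * D * l * L‖ ≤ Y ^ 2 * (T + P) / N := by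
    refine le_trans ?_ (hD2 (T + P) (by positivity))
    rw [norm_mul, norm_mul, norm_mul, Complex.norm_real, Real.norm_eq_abs]
    have : |l| * ‖L‖ ≤ (T + P) * N := by nlinarith [sq_nonneg (|l| - ‖L‖), sq_abs l]
    calc _ = ‖D‖ ^ 2 * (|l| * ‖L‖) := by ring
      _ ≤ _ := by gcongr
  have hlin : ‖1 + D * l‖ ≤ 1 + Y * (1 + T) := by
    refine (norm_add_le _ _).trans ?_
    rw [norm_one, norm_mul, Complex.norm_real, Real.norm_eq_abs]
    refine add_le_add_right ?_ 1
    calc ‖D‖ * |l| ≤ ‖D‖ * ((1 + T) * N) := by gcongr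
      _ = ‖D‖ * N * (1 + T) := by ring
      _ ≤ _ := by gcongr
  -- All terms of first order in `D` combine to `D (L - l)`, which is `O(1 / N)` although `D L` is
  -- not.
  have key : (1 + D * l + r) * Complex.exp (-(D * L)) - 1
      = -(D * (L - l)) - D * D * l * L
        + (1 + D * l) * (Complex.exp (-(D * L)) - 1 - -(D * L)) + r * Complex.exp (-(D * L)) := by
    ring
  rw [key]
  refine (norm_add_le _ _).trans ?_
  refine (add_le_add ((norm_add_le _ _).trans (add_le_add (norm_sub_le _ _) le_rfl)) le_rfl).trans ?_
  rw [norm_neg, norm_mul D (L - l), norm_mul (1 + D * l), norm_mul r]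
  calc _ ≤ Y / N * T + Y ^ 2 * (T + P) / N + (1 + Y * (1 + T)) * (Real.exp K * (Y ^ 2 * P / N))
        + Y / N * Real.exp K := by gcongr
    _ = _ := by ring

/-- The asymptotic form of any solution of the scaled recurrence, in terms of the large parameter,
on a compact set off the cut. -/
theorem scaled_outer_asymptotics (β d : ℝ) (hβ : 0 < β) (K : Set ℂ) (hK : IsCompact K)
    (hKsub : K ⊆ (Complex.ofReal '' Set.Icc (-1 : ℝ) 1)ᶜ) :
    ∃ k0 : ℕ, ∀ B0 : ℝ, 0 ≤ B0 → ∃ C : ℝ, ∃ n0 : ℕ, ∀ n : ℕ, n0 ≤ n → 0 < bigN β n ∧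
      ∀ z ∈ K, ∀ y, y = 1 / (bigN β n * z ^ 2) → ∀ q : ℕ → ℂ,
      (∀ k, k0 ≤ k → k + 2 ≤ n → q (k + 2) = q (k + 1)
        - ((bigN β (k + 1) - 1 / 2) / 4 - d / (bigN β (k + 1) + 1 / 2)) * y * q k) →
      ‖q k0 - 1‖ ≤ B0 * ‖y‖ → ‖q (k0 + 1) - 1‖ ≤ B0 * ‖y‖ →
      ‖q n * Complex.exp (-wkbLog y (bigN β n))
        * Complex.exp (-(d * y * Complex.log (bigN β n * z ^ 2))) - 1‖ ≤ C / bigN β n := by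
  obtain ⟨c, R, m, hc, hc1, hR, hm, hb⟩ := exists_wkbRoot_bounds hK hKsub
  obtain ⟨k0, hk0⟩ := dominant_asymptotics β d c R (2 / m ^ 2) hβ hc hc1 hR (by positivity)
  refine ⟨k0, fun B0 hB0 => ?_⟩
  obtain ⟨B, n0, hmain⟩ := hk0 B0 hB0
  obtain ⟨T, hT⟩ : ∃ T, T = 2 * (|Real.log m| + |Real.log R|) + Real.pi + (β + 1) + 8 := ⟨_, rfl⟩
  have hT0 : 0 ≤ T := by rw [hT]; positivity
  obtain ⟨Y, hY⟩ : ∃ Y, Y = (|d| + |B|) / m ^ 2 := ⟨_, rfl⟩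
  have hY0 : 0 ≤ Y := by rw [hY]; positivity
  obtain ⟨C, hC0, hC⟩ := norm_mul_exp_neg_sub_one_le hY0 hT0
  refine ⟨C, max n0 2, fun n hn => ?_⟩
  have hn0 : n0 ≤ n := (le_max_left _ _).trans hn
  have hn2 : (2 : ℝ) ≤ n := by exact_mod_cast (le_max_right _ _).trans hn
  have hN : bigN β n = n + β - 1 := rfl
  have hN1 : 1 ≤ bigN β n := by rw [hN]; linarith
  have hN0 : 0 < bigN β n := by linarith
  have hNn : (n : ℝ) ≤ 2 * bigN β n := by rw [hN]; linarith
  refine ⟨hN0, fun z hz y hy q hq h0 h1 => ?_⟩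
  obtain ⟨hmz, hzR, hs⟩ := hb z hz
  have hz0 : z ≠ 0 := norm_pos_iff.1 (hm.trans_le hmz)
  have hNc : (bigN β n : ℂ) ≠ 0 := by exact_mod_cast hN0.ne'
  have hyn : ‖y‖ ≤ 1 / m ^ 2 / bigN β n := by
    rw [hy, norm_div, norm_mul, norm_pow, norm_one, Complex.norm_real, Real.norm_of_nonneg hN0.le,
      div_div, mul_comm (m ^ 2)]
    gcongr
  have hreg : ∀ M ∈ Set.Icc 0 (bigN β n), c ≤ (wkbRoot (M * y)).re ∧ ‖wkbRoot (M * y)‖ ≤ R := by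
    intro M hM
    have : (M : ℂ) * y = ((M / bigN β n : ℝ) : ℂ) / z ^ 2 := by
      rw [hy]; push_cast; field_simp
    rw [this]
    exact hs _ ⟨div_nonneg hM.1 hN0.le, (div_le_one hN0).2 hM.2⟩
  have hmain' := hmain n hn0 y (by
    calc (n : ℝ) * ‖y‖ ≤ 2 * bigN β n * (1 / m ^ 2 / bigN β n) := by gcongr
      _ = 2 / m ^ 2 := by field_simp) hreg q hq h0 h1
  have key := hC (bigN β n) hN1 (d * y) (q n * Complex.exp (-wkbLog y (bigN β n)) - 1
    - d * y * Real.log n) (Complex.log (bigN β n * z ^ 2)) (Real.log n) ?_ ?_ ?_ ?_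
  · convert key using 2
    ring_nf
  · rw [norm_mul, Complex.norm_real, Real.norm_eq_abs, hY]
    calc |d| * ‖y‖ ≤ |d| * (1 / m ^ 2 / bigN β n) := by gcongr
      _ ≤ (|d| + |B|) * (1 / m ^ 2 / bigN β n) := by gcongr; linarith [abs_nonneg B]
      _ = _ := by ring
  · rw [hY]
    calc _ ≤ B * ‖y‖ := hmain'
      _ ≤ |B| * (1 / m ^ 2 / bigN β n) := by gcongr; exact le_abs_self B
      _ ≤ (|d| + |B|) * (1 / m ^ 2 / bigN β n) := by gcongr; linarith [abs_nonneg d]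
      _ = _ := by ring
  · have h1 : Real.log n ≤ 2 * √n := by
      have := Real.log_le_sub_one_of_pos (x := √(n : ℝ)) (Real.sqrt_pos.2 (by linarith))
      rw [Real.log_sqrt (by linarith)] at this
      linarith
    have h2 : 0 ≤ Real.log n := Real.log_nonneg (by linarith)
    calc Real.log n ^ 2 ≤ (2 * √(n : ℝ)) ^ 2 := by gcongr
      _ = 4 * (n : ℝ) := by rw [mul_pow, Real.sq_sqrt (by linarith)]; ring
      _ ≤ 8 * bigN β n := by linarith
      _ ≤ _ := by
        gcongr; rw [hT]
        have := abs_nonneg (Real.log m); have := abs_nonneg (Real.log R); have := Real.pi_pos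
        linarith
  · rw [Complex.log_ofReal_mul hN0 (pow_ne_zero 2 hz0)]
    have hz2 : ‖Complex.log (z ^ 2)‖ ≤ 2 * (|Real.log m| + |Real.log R|) + Real.pi := by
      refine (Complex.norm_le_abs_re_add_abs_im _).trans ?_
      rw [Complex.log_re, Complex.log_im, norm_pow, Real.log_pow]
      refine add_le_add ?_ (Complex.abs_arg_le_pi _)
      rw [abs_mul]
      have h1 : Real.log m ≤ Real.log ‖z‖ := Real.log_le_log hm hmz
      have h2 : Real.log ‖z‖ ≤ Real.log R := Real.log_le_log (hm.trans_le hmz) hzR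
      have : |Real.log ‖z‖| ≤ |Real.log m| + |Real.log R| := by
        rw [abs_le]
        have := neg_abs_le (Real.log m); have := le_abs_self (Real.log R)
        have := abs_nonneg (Real.log m); have := abs_nonneg (Real.log R)
        constructor <;> linarith
      norm_num
      linarith
    have hlog : |Real.log (bigN β n) - Real.log n| ≤ β + 1 := by
      rw [← Real.log_div hN0.ne' (by linarith), abs_le]
      have hn' : (0 : ℝ) < n := by linarith
      constructor
      · have h3 := Real.one_sub_inv_le_log_of_pos (div_pos hN0 hn')
        rw [inv_div] at h3
        have : (n : ℝ) / bigN β n ≤ 2 := by rw [div_le_iff₀ hN0]; linarith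
        linarith
      · have h3 := Real.log_le_sub_one_of_pos (div_pos hN0 hn')
        have : bigN β n / n ≤ 1 + β := by rw [div_le_iff₀ hn', hN]; nlinarith
        linarith
    have : ((Real.log (bigN β n) : ℝ) : ℂ) + Complex.log (z ^ 2) - (Real.log n : ℝ)
        = Complex.log (z ^ 2) + ((Real.log (bigN β n) - Real.log n : ℝ) : ℂ) := by push_cast; ring
    rw [this]
    refine (norm_add_le _ _).trans ?_
    rw [Complex.norm_real, Real.norm_eq_abs, hT]
    linarith

/-- The asymptotics in the exponential region, for the polynomials themselves. -/
theorem phi_outer_asymptotics {α β : ℝ} (hα : 0 ≤ α) (hαβ : α < β) {K : Set ℂ} (hK : IsCompact K)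
    (hKsub : K ⊆ (Complex.ofReal '' Set.Icc (-1 : ℝ) 1)ᶜ) :
    ∃ C : ℝ, ∀ᶠ n : ℕ in Filter.atTop, ∀ z ∈ K, ∃ ε : ℂ, ‖ε‖ ≤ C / bigN β n ∧
      phi α β n ((√(bigN β n) : ℝ) * z) = outerTerm α β n z * (1 + ε) := by
  obtain ⟨c, R, m, hc, hc1, hR, hm, hb⟩ := exists_wkbRoot_bounds hK hKsub
  have hβ : 0 < β := by linarith
  obtain ⟨k0, hk0⟩ := scaled_outer_asymptotics β ((α ^ 2 - 1 / 4) / 4) hβ K hK hKsub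
  obtain ⟨B1, hB1, h1⟩ := exists_norm_scaledPhi_sub_one_le α β k0
  obtain ⟨B2, hB2, h2⟩ := exists_norm_scaledPhi_sub_one_le α β (k0 + 1)
  obtain ⟨C, n0, hC⟩ := hk0 (max B1 B2) (le_max_of_le_left hB1)
  have hev : ∀ᶠ n : ℕ in Filter.atTop, 1 / m ^ 2 + 1 ≤ (n : ℝ) :=
    tendsto_natCast_atTop_atTop.eventually_ge_atTop _
  refine ⟨C, ?_⟩
  filter_upwards [Filter.eventually_ge_atTop n0, hev] with n hn hn1 z hz
  obtain ⟨hN0, hmain⟩ := hC n hn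
  obtain ⟨hmz, hzR, -⟩ := hb z hz
  have hz0 : z ≠ 0 := norm_pos_iff.1 (hm.trans_le hmz)
  have hx0 : ((√(bigN β n) : ℝ) : ℂ) * z ≠ 0 :=
    mul_ne_zero (by exact_mod_cast (Real.sqrt_pos.2 hN0).ne') hz0
  have hx2 : (((√(bigN β n) : ℝ) : ℂ) * z) ^ 2 = bigN β n * z ^ 2 := by
    rw [mul_pow, ← Complex.ofReal_pow, Real.sq_sqrt hN0.le]
  have hy1 : ‖1 / ((bigN β n : ℂ) * z ^ 2)‖ ≤ 1 := by
    have hN : bigN β n = n + β - 1 := rfl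
    rw [norm_div, norm_mul, norm_pow, norm_one, Complex.norm_real, Real.norm_of_nonneg hN0.le,
      div_le_one (by positivity)]
    calc (1 : ℝ) = 1 / m ^ 2 * m ^ 2 := by field_simp
      _ ≤ bigN β n * ‖z‖ ^ 2 := by gcongr; linarith
  have hrec : ∀ k, scaledPhi α β (k + 2) (1 / (bigN β n * z ^ 2))
      = scaledPhi α β (k + 1) (1 / (bigN β n * z ^ 2)) - ((bigN β (k + 1) - 1 / 2) / 4
        - ((α ^ 2 - 1 / 4) / 4 : ℝ) / (bigN β (k + 1) + 1 / 2)) * (1 / (bigN β n * z ^ 2))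
          * scaledPhi α β k (1 / (bigN β n * z ^ 2)) := by
    intro k
    rw [scaledPhi, lam_succ_div_two hβ]
    push_cast; rfl
  have hε := hmain z hz _ rfl (fun k => scaledPhi α β k (1 / (bigN β n * z ^ 2)))
    (fun k _ _ => hrec k)
    ((h1 _ hy1).trans (by gcongr; exact le_max_left _ _))
    ((h2 _ hy1).trans (by gcongr; exact le_max_right _ _))
  refine ⟨_, hε, ?_⟩
  rw [phi_eq_gam_mul_monicPhi hα hαβ, monicPhi_eq_pow_mul_scaledPhi α β hx0, hx2,
    outerTerm_eq_exp hN0 (hKsub hz), add_sub_cancel, Complex.exp_neg, Complex.exp_neg]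
  have e1 := Complex.exp_ne_zero (wkbLog (1 / (bigN β n * z ^ 2)) (bigN β n))
  have e2 := Complex.exp_ne_zero (((α : ℂ) ^ 2 - 1 / 4) / 4 * (1 / (bigN β n * z ^ 2)) *
          Complex.log ((bigN β n : ℂ) * z ^ 2))
  push_cast
  generalize Complex.exp (wkbLog (1 / (bigN β n * z ^ 2)) (bigN β n)) = e at *
  generalize Complex.exp (((α : ℂ) ^ 2 - 1 / 4) / 4 * (1 / (bigN β n * z ^ 2)) *
          Complex.log ((bigN β n : ℂ) * z ^ 2)) = e' at *
  field_simp

/-! ### Broken-line contours from the origin to infinity -/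

/-- The broken line from `0` to `Q` and then along the ray from `Q` in direction `v`. -/
noncomputable def brokenLine (Q v : ℂ) (t : ℝ) : ℂ := (min t 1 : ℝ) * Q + (max (t - 1) 0 : ℝ) * v

/-- The velocity of `brokenLine`, away from the corner `t = 1`. -/
noncomputable def brokenLineVel (Q v : ℂ) (t : ℝ) : ℂ := if t < 1 then Q else v

/-- Uniform bounds on the broken line: it stays in the right half-plane, and the real part of
`(ζ - z) ^ 2` decreases along it at a positive rate. -/
structure BrokenLineBounds (c C : ℝ) (z Q v : ℂ) : Prop where
  c_pos : 0 < c
  norm_z : ‖z‖ ≤ C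
  norm_Q : ‖Q‖ ≤ C
  norm_v : ‖v‖ ≤ C
  re_Q : c ≤ Q.re
  re_v : c ≤ v.re
  start : (-z * Q).re ≤ -c
  corner : ((Q - z) * Q).re ≤ -c
  corner' : ((Q - z) * v).re ≤ -c
  sq : (v * v).re ≤ -c

theorem brokenLine_of_le {Q v : ℂ} {t : ℝ} (ht : t ≤ 1) : brokenLine Q v t = t * Q := by
  rw [brokenLine, min_eq_left ht, max_eq_right (by linarith)]; simp

theorem brokenLine_of_ge {Q v : ℂ} {t : ℝ} (ht : 1 ≤ t) :
    brokenLine Q v t = Q + ((t : ℂ) - 1) * v := by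
  rw [brokenLine, min_eq_right ht, max_eq_left (by linarith)]; push_cast; ring

theorem continuous_brokenLine (Q v : ℂ) : Continuous (brokenLine Q v) := by
  unfold brokenLine; fun_prop

theorem measurable_brokenLineVel (Q v : ℂ) : Measurable (brokenLineVel Q v) :=
  Measurable.ite measurableSet_Iio measurable_const measurable_const

theorem hasDerivAt_brokenLine {Q v : ℂ} {t : ℝ} (ht : t ≠ 1) :
    HasDerivAt (brokenLine Q v) (brokenLineVel Q v t) t := by
  rcases lt_or_gt_of_ne ht with h | h
  · have h1 : HasDerivAt (fun t : ℝ => (t : ℂ) * Q) Q t := by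
      simpa using (hasDerivAt_id (t : ℂ)).comp_ofReal.mul_const Q
    rw [brokenLineVel, if_pos h]
    refine h1.congr_of_eventuallyEq ?_
    filter_upwards [Iio_mem_nhds h] with s hs
    exact brokenLine_of_le hs.le
  · have h1 : HasDerivAt (fun t : ℝ => Q + ((t : ℂ) - 1) * v) v t := by
      simpa using (((hasDerivAt_id (t : ℂ)).comp_ofReal.sub_const 1).mul_const v).const_add Q
    rw [brokenLineVel, if_neg (not_lt.2 h.le)]
    refine h1.congr_of_eventuallyEq ?_
    filter_upwards [Ioi_mem_nhds h] with s hs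
    exact brokenLine_of_ge (le_of_lt hs)

namespace BrokenLineBounds

variable {c C : ℝ} {z Q v : ℂ}

theorem C_pos (h : BrokenLineBounds c C z Q v) : 0 < C :=
  h.c_pos.trans_le (h.re_Q.trans ((Complex.re_le_norm _).trans h.norm_Q))

theorem norm_vel_le (h : BrokenLineBounds c C z Q v) (t : ℝ) : ‖brokenLineVel Q v t‖ ≤ C := by
  unfold brokenLineVel; split_ifs
  exacts [h.norm_Q, h.norm_v]

theorem re_ge (h : BrokenLineBounds c C z Q v) {t : ℝ} (ht : 0 ≤ t) :
    c * t ≤ (brokenLine Q v t).re := by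
  have := h.re_Q; have := h.re_v; have := h.c_pos
  rcases le_total t 1 with h1 | h1
  · rw [brokenLine_of_le h1, Complex.re_ofReal_mul]; nlinarith
  · have : (brokenLine Q v t).re = Q.re + (t - 1) * v.re := by
      rw [brokenLine_of_ge h1, Complex.add_re, ← Complex.ofReal_one, ← Complex.ofReal_sub,
        Complex.re_ofReal_mul]
    rw [this]; nlinarith

theorem re_pos (h : BrokenLineBounds c C z Q v) {t : ℝ} (ht : 0 < t) :
    0 < (brokenLine Q v t).re := (mul_pos h.c_pos ht).trans_le (h.re_ge ht.le)

theorem mem_slitPlane (h : BrokenLineBounds c C z Q v) {t : ℝ} (ht : 0 < t) :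
    brokenLine Q v t ∈ Complex.slitPlane := Complex.mem_slitPlane_iff.2 (Or.inl (h.re_pos ht))

theorem ne_zero (h : BrokenLineBounds c C z Q v) {t : ℝ} (ht : 0 < t) :
    brokenLine Q v t ≠ 0 := Complex.slitPlane_ne_zero (h.mem_slitPlane ht)

theorem norm_ge (h : BrokenLineBounds c C z Q v) {t : ℝ} (ht : 0 ≤ t) :
    c * t ≤ ‖brokenLine Q v t‖ := (h.re_ge ht).trans (Complex.re_le_norm _)

theorem norm_le (h : BrokenLineBounds c C z Q v) {t : ℝ} (ht : 0 ≤ t) :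
    ‖brokenLine Q v t‖ ≤ C * t := by
  have := h.norm_Q; have := h.norm_v
  rcases le_total t 1 with h1 | h1
  · rw [brokenLine_of_le h1, norm_mul, Complex.norm_real, Real.norm_of_nonneg ht]; nlinarith
  · rw [brokenLine_of_ge h1, ← Complex.ofReal_one, ← Complex.ofReal_sub]
    refine (norm_add_le _ _).trans ?_
    rw [norm_mul, Complex.norm_real, Real.norm_of_nonneg (by linarith)]
    nlinarith

theorem re_sq_le_of_le_one (h : BrokenLineBounds c C z Q v) {s r : ℝ} (hs : 0 ≤ s) (hsr : s ≤ r)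
    (hr : r ≤ 1) :
    ((brokenLine Q v r - z) ^ 2).re ≤ ((brokenLine Q v s - z) ^ 2).re - 2 * c * (r - s) := by
  rw [brokenLine_of_le hr, brokenLine_of_le (hsr.trans hr)]
  have key : (((r : ℂ) * Q - z) ^ 2).re - (((s : ℂ) * Q - z) ^ 2).re
      = (r - s) * ((r + s) * ((Q - z) * Q).re + (2 - (r + s)) * (-z * Q).re) := by
    simp only [pow_two, Complex.mul_re, Complex.sub_re, Complex.sub_im, Complex.ofReal_re,
      Complex.mul_im, Complex.ofReal_im, Complex.neg_re, Complex.neg_im]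
    ring
  have h1 := mul_le_mul_of_nonneg_left h.corner (by linarith : 0 ≤ r + s)
  have h2 := mul_le_mul_of_nonneg_left h.start (by linarith : 0 ≤ 2 - (r + s))
  have h3 := mul_le_mul_of_nonneg_left (add_le_add h1 h2) (by linarith : 0 ≤ r - s)
  linarith

theorem re_sq_le_of_one_le (h : BrokenLineBounds c C z Q v) {s r : ℝ} (hs : 1 ≤ s) (hsr : s ≤ r) :
    ((brokenLine Q v r - z) ^ 2).re ≤ ((brokenLine Q v s - z) ^ 2).re - 2 * c * (r - s)
      - c * ((r - 1) ^ 2 - (s - 1) ^ 2) := by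
  rw [brokenLine_of_ge hs, brokenLine_of_ge (hs.trans hsr)]
  have key : ((Q + ((r : ℂ) - 1) * v - z) ^ 2).re - ((Q + ((s : ℂ) - 1) * v - z) ^ 2).re
      = (r - s) * (2 * ((Q - z) * v).re + (r - 1 + (s - 1)) * (v * v).re) := by
    simp only [pow_two, Complex.mul_re, Complex.sub_re, Complex.sub_im, Complex.ofReal_re,
      Complex.mul_im, Complex.ofReal_im, Complex.add_re, Complex.add_im, Complex.one_re,
      Complex.one_im]
    ring
  have h1 := h.corner'
  have h2 := mul_le_mul_of_nonneg_left h.sq (by linarith : 0 ≤ r - 1 + (s - 1))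
  have h3 := mul_le_mul_of_nonneg_left (add_le_add (mul_le_mul_of_nonneg_left h1 zero_le_two) h2)
    (by linarith : 0 ≤ r - s)
  linarith

theorem re_sq_le (h : BrokenLineBounds c C z Q v) {s r : ℝ} (hs : 0 ≤ s) (hsr : s ≤ r) :
    ((brokenLine Q v r - z) ^ 2).re ≤ ((brokenLine Q v s - z) ^ 2).re - 2 * c * (r - s) := by
  rcases le_total r 1 with hr | hr
  · exact h.re_sq_le_of_le_one hs hsr hr
  rcases le_total s 1 with h1 | h1
  · have := h.re_sq_le_of_le_one hs h1 le_rfl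
    have := h.re_sq_le_of_one_le le_rfl hr
    nlinarith [h.c_pos, sq_nonneg (r - 1)]
  · have := h.re_sq_le_of_one_le h1 hsr
    have : 0 ≤ c * ((r - 1) ^ 2 - (s - 1) ^ 2) :=
      mul_nonneg h.c_pos.le (by nlinarith)
    linarith

/-- Gaussian decay along the ray. -/
theorem re_sq_le_gaussian (h : BrokenLineBounds c C z Q v) {t : ℝ} (ht : 0 ≤ t) :
    ((brokenLine Q v t - z) ^ 2).re ≤ C ^ 2 + c - c * t ^ 2 := by
  have h0 : ((brokenLine Q v 0 - z) ^ 2).re ≤ C ^ 2 := by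
    have : brokenLine Q v 0 = 0 := by simp [brokenLine_of_le]
    rw [this]
    refine (Complex.re_le_norm _).trans ?_
    rw [norm_pow, zero_sub, norm_neg]
    exact pow_le_pow_left₀ (norm_nonneg _) h.norm_z 2
  rcases le_total t 1 with h1 | h1
  · have := h.re_sq_le le_rfl ht
    nlinarith [h.c_pos, mul_nonneg h.c_pos.le ht, mul_nonneg (mul_nonneg h.c_pos.le ht) (sub_nonneg.2 h1)]
  · have := h.re_sq_le le_rfl zero_le_one
    have := h.re_sq_le_of_one_le le_rfl h1
    nlinarith [h.c_pos]

end BrokenLineBounds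

/-! ### The amplitude equation -/

open MeasureTheory Set in
/-- The tail integral is continuous on `(0, ∞)` also if the function is not integrable at `0`. -/
theorem continuousOn_integral_Ioi {f : ℝ → ℂ} (hf : ∀ t : ℝ, 0 < t → IntegrableOn f (Ioi t)) :
    ContinuousOn (fun t => ∫ s in Ioi t, f s) (Ioi 0) := by
  intro t ht
  have ht' : (0 : ℝ) < t := ht
  exact (((hf _ (half_pos ht')).continuousOn_Ici_primitive_Ioi).continuousAt
    (Ici_mem_nhds (half_lt_self ht'))).continuousWithinAt

open MeasureTheory Set in
theorem hasDerivAt_integral_Ioi {f : ℝ → ℂ} {t : ℝ} (ht : 0 < t)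
    (hf : ∀ t : ℝ, 0 < t → IntegrableOn f (Ioi t)) (hc : ContinuousAt f t) :
    HasDerivAt (fun t => ∫ s in Ioi t, f s) (-f t) t := by
  have hint := hf _ (half_pos ht)
  have h1 : HasDerivAt (fun u => ∫ s in (t / 2)..u, f s) (f t) t := by
    refine intervalIntegral.integral_hasDerivAt_right ?_ ?_ hc
    · rw [intervalIntegrable_iff_integrableOn_Ioc_of_le (by linarith)]
      exact hint.mono_set Ioc_subset_Ioi_self
    · exact ⟨Ioi (t / 2), Ioi_mem_nhds (by linarith), hint.aestronglyMeasurable⟩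
  have h2 := h1.const_sub (∫ s in Ioi (t / 2), f s)
  refine h2.congr_of_eventuallyEq ?_
  filter_upwards [Ioi_mem_nhds (half_lt_self ht)] with u hu
  rw [← intervalIntegral.integral_Ioi_sub_Ioi hint (le_of_lt hu)]; ring

open MeasureTheory Set in
/-- The weight `(1 + 1 / (N t)) ^ m` reproduces itself under the bound for the outer integral of the
amplitude equation, with a factor `1 / m` that can be made small. -/
theorem integral_Ioi_amplitudeWeight {N : ℝ} (hN : 0 < N) {m : ℕ} (hm : 1 ≤ m) {t : ℝ} (ht : 0 < t) :
    IntegrableOn (fun s => (1 + 1 / (N * s)) ^ m / (s * (1 + N * s))) (Ioi t) ∧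
    ∫ s in Ioi t, (1 + 1 / (N * s)) ^ m / (s * (1 + N * s)) = ((1 + 1 / (N * t)) ^ m - 1) / m := by
  have hm' : (m : ℝ) ≠ 0 := by exact_mod_cast (by omega : m ≠ 0)
  have hd : ∀ s ∈ Ici t, HasDerivAt (fun s : ℝ => -((1 + 1 / (N * s)) ^ m / m))
      ((1 + 1 / (N * s)) ^ m / (s * (1 + N * s))) s := by
    intro s hs
    have hs0 : 0 < s := ht.trans_le hs
    have h1 : HasDerivAt (fun s : ℝ => 1 + 1 / (N * s)) (-(1 / (N * s ^ 2))) s := by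
      have := ((hasDerivAt_inv hs0.ne').const_mul (1 / N)).const_add 1
      refine (this.congr_deriv ?_).congr_of_eventuallyEq (Filter.Eventually.of_forall fun u => ?_)
      · field_simp
      · simp only [one_div, mul_inv]
    refine (((h1.pow m).div_const (m : ℝ)).neg).congr_deriv ?_
    obtain ⟨j, rfl⟩ : ∃ j, m = j + 1 := ⟨m - 1, by omega⟩
    have h2 : 0 < 1 + N * s := by positivity
    have h3 : 1 + 1 / (N * s) = (1 + N * s) / (N * s) := by field_simp; ring
    rw [Nat.add_sub_cancel, h3, pow_succ ((1 + N * s) / (N * s)) j]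
    have h4 : N * s ≠ 0 := by positivity
    generalize ((1 + N * s) / (N * s)) ^ j = X
    field_simp
  have hlim : Filter.Tendsto (fun s : ℝ => -((1 + 1 / (N * s)) ^ m / m)) Filter.atTop
      (nhds (-((1 + 0) ^ m / m))) := by
    refine (((tendsto_const_nhds.add ?_).pow m).div_const _).neg
    simp only [one_div, mul_inv]
    rw [← mul_zero N⁻¹]
    exact tendsto_inv_atTop_zero.const_mul _
  have hpos : ∀ s ∈ Ioi t, 0 ≤ (1 + 1 / (N * s)) ^ m / (s * (1 + N * s)) := fun s hs => by
    have : 0 < s := ht.trans hs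
    positivity
  refine ⟨integrableOn_Ioi_deriv_of_nonneg' hd hpos hlim, ?_⟩
  rw [integral_Ioi_of_hasDerivAt_of_nonneg' hd hpos hlim]
  simp; ring

open MeasureTheory Set in
/-- The inner integral of the amplitude equation: as `Re (ζ - z)²` decreases along the contour, it is
effectively over a stretch of length `O(1 / N)`. -/
theorem amplitude_kernel_bound (c C d : ℝ) :
    ∃ C0 : ℝ, 0 ≤ C0 ∧ ∀ N : ℝ, 1 ≤ N → ∀ z Q v : ℂ, BrokenLineBounds c C z Q v →
      ∀ (m : ℕ) (B : ℝ) (φ : ℝ → ℂ), ContinuousOn φ (Ioi 0) → 0 ≤ B →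
      (∀ t, 0 < t → ‖φ t‖ ≤ B * (1 + 1 / (N * t)) ^ m) → ∀ s, 0 < s →
      IntegrableOn (fun r => Complex.exp (2 * N * (brokenLine Q v r - z) ^ 2) *
        (4 * d / brokenLine Q v r ^ 2) * brokenLineVel Q v r * φ r) (Ioi s) ∧
      ‖Complex.exp (-(2 * N * (brokenLine Q v s - z) ^ 2)) *
        ∫ r in Ioi s, Complex.exp (2 * N * (brokenLine Q v r - z) ^ 2) *
          (4 * d / brokenLine Q v r ^ 2) * brokenLineVel Q v r * φ r‖
        ≤ C0 * B * ((1 + 1 / (N * s)) ^ m / (s * (1 + N * s))) := by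
  refine ⟨|4 * |d| * C / c ^ 2 * (1 + 1 / (4 * c))|, abs_nonneg _, fun N hN z Q v h m B φ hφ hB hφB s hs => ?_⟩
  have hc := h.c_pos
  have hC := h.C_pos
  have hN0 : 0 < N := by linarith
  rw [abs_of_nonneg (by positivity)]
  set f : ℝ → ℂ := fun r => Complex.exp (2 * N * (brokenLine Q v r - z) ^ 2) *
          (4 * d / brokenLine Q v r ^ 2) * brokenLineVel Q v r * φ r with hf
  set e := Complex.exp (-(2 * N * (brokenLine Q v s - z) ^ 2)) with he
  set A := 4 * |d| * C / c ^ 2 * B * (1 + 1 / (N * s)) ^ m with hA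
  have hA0 : 0 ≤ A := by positivity
  have hbound : ∀ r ∈ Ioi s, ‖e * f r‖ ≤ A * (Real.exp (-(4 * N * c) * (r - s)) * (r ^ 2)⁻¹) := by
    intro r hr
    have hr' : s < r := hr
    have hr0 : 0 < r := hs.trans hr
    have h1 : ‖e * Complex.exp (2 * N * (brokenLine Q v r - z) ^ 2)‖
        ≤ Real.exp (-(4 * N * c) * (r - s)) := by
      rw [he, ← Complex.exp_add, Complex.norm_exp]
      apply Real.exp_le_exp.2
      have h2 := h.re_sq_le hs.le hr'.le
      have h3 : (-(2 * N * (brokenLine Q v s - z) ^ 2) + 2 * N * (brokenLine Q v r - z) ^ 2 : ℂ)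
        = ((2 * N : ℝ) : ℂ) * ((brokenLine Q v r - z) ^ 2 - (brokenLine Q v s - z) ^ 2) := by
        push_cast; ring
      rw [h3, Complex.re_ofReal_mul, Complex.sub_re]
      have h4 := mul_le_mul_of_nonneg_left h2 (by positivity : 0 ≤ 2 * N)
      linarith
    have h2 : ‖(4 * d / brokenLine Q v r ^ 2 : ℂ)‖ ≤ 4 * |d| / c ^ 2 * (r ^ 2)⁻¹ := by
      have := h.norm_ge hr0.le
      rw [norm_div, norm_mul, norm_pow, Complex.norm_real, Real.norm_eq_abs, Complex.norm_ofNat,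
        ← div_eq_mul_inv, div_div, ← mul_pow]
      gcongr
    have h3 := hφB r hr0
    have h4 : (1 + 1 / (N * r)) ^ m ≤ (1 + 1 / (N * s)) ^ m := by gcongr
    have h5 := h.norm_vel_le r
    calc ‖e * f r‖ = ‖e * Complex.exp (2 * N * (brokenLine Q v r - z) ^ 2)‖ *
          ‖(4 * d / brokenLine Q v r ^ 2 : ℂ)‖ * ‖brokenLineVel Q v r‖ * ‖φ r‖ := by
          rw [hf]; simp only [norm_mul]; ring
      _ ≤ Real.exp (-(4 * N * c) * (r - s)) * (4 * |d| / c ^ 2 * (r ^ 2)⁻¹) * C *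
          (B * (1 + 1 / (N * s)) ^ m) := by
          gcongr
          exact h3.trans (by gcongr)
      _ = _ := by rw [hA]; ring
  have hexp1 : ∀ r ∈ Ioi s, Real.exp (-(4 * N * c) * (r - s)) ≤ 1 := fun r hr => by
    have hr' : s < r := hr
    rw [Real.exp_le_one_iff]
    have : 0 ≤ 4 * N * c * (r - s) := mul_nonneg (by positivity) (by linarith)
    linarith
  have hint1 : IntegrableOn (fun r : ℝ => (r ^ 2)⁻¹) (Ioi s) ∧ ∫ r in Ioi s, (r ^ 2)⁻¹ = s⁻¹ := by
    have hd : ∀ r ∈ Ici s, HasDerivAt (fun r : ℝ => -r⁻¹) ((r ^ 2)⁻¹) r := fun r hr => by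
      have := (hasDerivAt_inv (hs.trans_le hr).ne').fun_neg
      simpa using this
    have hl : Filter.Tendsto (fun r : ℝ => -r⁻¹) Filter.atTop (nhds (-0)) :=
      tendsto_inv_atTop_zero.neg
    refine ⟨integrableOn_Ioi_deriv_of_nonneg' hd (fun r _ => by positivity) hl, ?_⟩
    rw [integral_Ioi_of_hasDerivAt_of_nonneg' hd (fun r _ => by positivity) hl]; simp
  have hmeas : AEStronglyMeasurable f (volume.restrict (Ioi s)) := by
    have hsub : Ioi s ⊆ Ioi (0 : ℝ) := Ioi_subset_Ioi hs.le
    have hcont := (continuous_brokenLine Q v)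
    have c1 : ContinuousOn (fun r => Complex.exp (2 * N * (brokenLine Q v r - z) ^ 2) *
          (4 * d / brokenLine Q v r ^ 2)) (Ioi s) := by
      refine ContinuousOn.mul (by fun_prop) ?_
      refine continuousOn_const.div (by fun_prop) fun r hr => pow_ne_zero 2 (h.ne_zero (hsub hr))
    exact ((c1.aestronglyMeasurable measurableSet_Ioi).mul
      (measurable_brokenLineVel Q v).aestronglyMeasurable).mul
      ((hφ.mono hsub).aestronglyMeasurable measurableSet_Ioi)
  have he0 : e ≠ 0 := Complex.exp_ne_zero _
  have hint_ef : IntegrableOn (fun r => e * f r) (Ioi s) := by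
    refine Integrable.mono' (hint1.1.const_mul A) (hmeas.const_mul e) ?_
    refine (ae_restrict_iff' measurableSet_Ioi).2 (Filter.Eventually.of_forall fun r hr => ?_)
    refine (hbound r hr).trans ?_
    have := hexp1 r hr
    gcongr
    exact mul_le_of_le_one_left (by positivity) this
  refine ⟨?_, ?_⟩
  · have := hint_ef.const_mul e⁻¹
    refine this.congr (Filter.Eventually.of_forall fun r => ?_)
    simp only
    rw [← mul_assoc, inv_mul_cancel₀ he0, one_mul]
  · rw [← integral_const_mul]
    have b1 : ‖∫ r in Ioi s, e * f r‖ ≤ A * s⁻¹ := by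
      rw [← hint1.2, ← integral_const_mul]
      refine norm_integral_le_of_norm_le (hint1.1.const_mul A) ?_
      refine (ae_restrict_iff' measurableSet_Ioi).2 (Filter.Eventually.of_forall fun r hr => ?_)
      refine (hbound r hr).trans ?_
      have := hexp1 r hr
      gcongr
      exact mul_le_of_le_one_left (by positivity) this
    have hneg : -(4 * N * c) < 0 := by
      have : 0 < 4 * N * c := by positivity
      linarith
    have b2 : ‖∫ r in Ioi s, e * f r‖ ≤ A * ((s ^ 2)⁻¹ * (1 / (4 * N * c))) := by
      have hi := (integrableOn_exp_mul_Ioi hneg s).const_mul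
        (A * (s ^ 2)⁻¹ * Real.exp (4 * N * c * s))
      have hv : ∫ r in Ioi s, A * (s ^ 2)⁻¹ * Real.exp (4 * N * c * s) * Real.exp (-(4 * N * c) * r)
          = A * ((s ^ 2)⁻¹ * (1 / (4 * N * c))) := by
        rw [integral_const_mul, integral_exp_mul_Ioi hneg, neg_mul, Real.exp_neg]
        have := (Real.exp_pos (4 * N * c * s)).ne'
        field_simp
      rw [← hv]
      refine norm_integral_le_of_norm_le hi ?_
      refine (ae_restrict_iff' measurableSet_Ioi).2 (Filter.Eventually.of_forall fun r hr => ?_)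
      refine (hbound r hr).trans ?_
      have hr' : s < r := hr
      have e1 : Real.exp (-(4 * N * c) * (r - s))
          = Real.exp (4 * N * c * s) * Real.exp (-(4 * N * c) * r) := by
        rw [← Real.exp_add]; congr 1; ring
      rw [e1]
      calc _ ≤ A * (Real.exp (4 * N * c * s) * Real.exp (-(4 * N * c) * r) * (s ^ 2)⁻¹) := by
            gcongr
        _ = _ := by ring
    have b3 : A * ((s ^ 2)⁻¹ * (1 / (4 * N * c))) = A * s⁻¹ / (N * s) * (1 / (4 * c)) := by
      field_simp
    rw [b3] at b2
    have b4 : ‖∫ r in Ioi s, e * f r‖ * (1 + N * s) ≤ A * s⁻¹ * (1 + 1 / (4 * c)) := by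
      have b5 : ‖∫ r in Ioi s, e * f r‖ * (N * s) ≤ A * s⁻¹ * (1 / (4 * c)) := by
        calc _ ≤ A * s⁻¹ / (N * s) * (1 / (4 * c)) * (N * s) := by gcongr
          _ = _ := by field_simp
      linarith
    calc ‖∫ r in Ioi s, e * f r‖ ≤ A * s⁻¹ * (1 + 1 / (4 * c)) / (1 + N * s) := by
          rwa [le_div_iff₀ (by positivity)]
      _ = _ := by rw [hA]; field_simp

open MeasureTheory Set in
/-- The amplitude equation as a pair of integral equations for `F` and `U = exp (2 N (ζ - z)²) F'`
with `F = 1`, `U = 0` at infinity, solved by contraction. -/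
theorem exists_amplitude_fixedPoint (c C d : ℝ) :
    ∃ m : ℕ, 1 ≤ m ∧ ∀ N : ℝ, 1 ≤ N → ∀ z Q v : ℂ, BrokenLineBounds c C z Q v →
      ∃ F U : ℝ → ℂ, ContinuousOn F (Ioi 0) ∧
        (∀ t, 0 < t → IntegrableOn (fun r => Complex.exp (2 * N * (brokenLine Q v r - z) ^ 2) *
          (4 * d / brokenLine Q v r ^ 2) * brokenLineVel Q v r * F r) (Ioi t)) ∧
        (∀ t, U t = -∫ r in Ioi t, Complex.exp (2 * N * (brokenLine Q v r - z) ^ 2) *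
          (4 * d / brokenLine Q v r ^ 2) * brokenLineVel Q v r * F r) ∧
        (∀ t, 0 < t → IntegrableOn (fun s => brokenLineVel Q v s *
          (Complex.exp (-(2 * N * (brokenLine Q v s - z) ^ 2)) * U s)) (Ioi t)) ∧
        (∀ t, 0 < t → F t = 1 - ∫ s in Ioi t, brokenLineVel Q v s *
          (Complex.exp (-(2 * N * (brokenLine Q v s - z) ^ 2)) * U s)) ∧
        (∀ t, 0 < t → ‖Complex.exp (-(2 * N * (brokenLine Q v t - z) ^ 2)) * U t‖
          ≤ m * ((1 + 1 / (N * t)) ^ m / (t * (1 + N * t)))) ∧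
        (∀ t, 0 < t → ‖F t - 1‖ ≤ (1 + 1 / (N * t)) ^ m - 1) := by
  obtain ⟨C0, hC0, hker⟩ := amplitude_kernel_bound c C d
  -- With the weight `W t = (1 + 1 / (N t)) ^ m` and `m` this large, the integral operator has norm
  -- at most `1 / 2`.
  obtain ⟨m, hm⟩ := exists_nat_ge (max 1 (2 * (C0 * (1 + |C|))))
  have hm1 : 1 ≤ m := by exact_mod_cast (le_max_left _ _).trans hm
  have hm0 : (0 : ℝ) < m := by exact_mod_cast (by omega : 0 < m)
  have hmC : 2 * (C0 * (1 + |C|)) ≤ m := (le_max_right _ _).trans hm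
  refine ⟨m, hm1, fun N hN z Q v h => ?_⟩
  have hN0 : 0 < N := by linarith
  have hC := h.C_pos
  rw [abs_of_pos hC] at hmC
  obtain ⟨W, hW⟩ : ∃ W : ℝ → ℝ, ∀ t, W t = (1 + 1 / (N * t)) ^ m := ⟨_, fun _ => rfl⟩
  have hW1 : ∀ t, 0 < t → 1 ≤ W t := fun t ht => by
    rw [hW]; exact one_le_pow₀ (by have : 0 < 1 / (N * t) := by positivity
                                   linarith)
  have hWc : ContinuousOn W (Ioi 0) := by
    rw [show W = fun t => (1 + 1 / (N * t)) ^ m from funext hW]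
    refine (continuousOn_const.add (continuousOn_const.div (by fun_prop) fun t ht => ?_)).pow m
    exact (mul_pos hN0 ht).ne'
  -- the inner and the outer integrals, for an arbitrary function
  obtain ⟨V, hV⟩ : ∃ V : (ℝ → ℂ) → ℝ → ℂ, ∀ φ t, V φ t = -∫ r in Ioi t,
      Complex.exp (2 * N * (brokenLine Q v r - z) ^ 2) *
        (4 * d / brokenLine Q v r ^ 2) * brokenLineVel Q v r * φ r := ⟨_, fun _ _ => rfl⟩
  obtain ⟨G, hG⟩ : ∃ G : (ℝ → ℂ) → ℝ → ℂ, ∀ φ s, G φ s = brokenLineVel Q v s *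
      (Complex.exp (-(2 * N * (brokenLine Q v s - z) ^ 2)) * V φ s) := ⟨_, fun _ _ => rfl⟩
  have hVb : ∀ (B : ℝ) (φ : ℝ → ℂ), ContinuousOn φ (Ioi 0) → 0 ≤ B →
      (∀ t, 0 < t → ‖φ t‖ ≤ B * W t) → ∀ s, 0 < s →
      ‖Complex.exp (-(2 * N * (brokenLine Q v s - z) ^ 2)) * V φ s‖
        ≤ C0 * B * (W s / (s * (1 + N * s))) := by
    intro B φ hφ hB hφB s hs
    rw [hV, mul_neg, norm_neg, hW]
    exact (hker N hN z Q v h m B φ hφ hB (fun t ht => hW t ▸ hφB t ht) s hs).2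
  have hVi : ∀ (B : ℝ) (φ : ℝ → ℂ), ContinuousOn φ (Ioi 0) → 0 ≤ B →
      (∀ t, 0 < t → ‖φ t‖ ≤ B * W t) → ∀ s, 0 < s →
      IntegrableOn (fun r => Complex.exp (2 * N * (brokenLine Q v r - z) ^ 2) *
        (4 * d / brokenLine Q v r ^ 2) * brokenLineVel Q v r * φ r) (Ioi s) :=
    fun B φ hφ hB hφB s hs =>
      (hker N hN z Q v h m B φ hφ hB (fun t ht => hW t ▸ hφB t ht) s hs).1
  have hGb : ∀ (B : ℝ) (φ : ℝ → ℂ), ContinuousOn φ (Ioi 0) → 0 ≤ B →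
      (∀ t, 0 < t → ‖φ t‖ ≤ B * W t) → ∀ s, 0 < s →
      ‖G φ s‖ ≤ m / 2 * B * (W s / (s * (1 + N * s))) := by
    intro B φ hφ hB hφB s hs
    rw [hG, norm_mul]
    have h1 := hVb B φ hφ hB hφB s hs
    have h2 := hW1 s hs
    have h3 : 0 ≤ W s / (s * (1 + N * s)) := div_nonneg (by linarith) (by positivity)
    calc _ ≤ C * (C0 * B * (W s / (s * (1 + N * s)))) := by
          gcongr
          exact h.norm_vel_le s
      _ = C0 * C * (B * (W s / (s * (1 + N * s)))) := by ring
      _ ≤ m / 2 * (B * (W s / (s * (1 + N * s)))) := by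
          gcongr
          nlinarith
      _ = _ := by ring
  have hGi : ∀ (B : ℝ) (φ : ℝ → ℂ), ContinuousOn φ (Ioi 0) → 0 ≤ B →
      (∀ t, 0 < t → ‖φ t‖ ≤ B * W t) → ∀ t, 0 < t → IntegrableOn (G φ) (Ioi t) ∧
      ‖∫ s in Ioi t, G φ s‖ ≤ B / 2 * (W t - 1) := by
    intro B φ hφ hB hφB t ht
    obtain ⟨hi, hv⟩ := integral_Ioi_amplitudeWeight hN0 hm1 ht
    have hsub : Ioi t ⊆ Ioi (0 : ℝ) := Ioi_subset_Ioi ht.le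
    have hVc : ContinuousOn (V φ) (Ioi 0) := by
      have := (continuousOn_integral_Ioi (hVi B φ hφ hB hφB)).neg
      exact this.congr fun s _ => hV φ s
    have hmeas : AEStronglyMeasurable (G φ) (volume.restrict (Ioi t)) := by
      rw [show G φ = fun s => brokenLineVel Q v s *
        (Complex.exp (-(2 * N * (brokenLine Q v s - z) ^ 2)) * V φ s) from funext (hG φ)]
      refine (measurable_brokenLineVel Q v).aestronglyMeasurable.mul
        (ContinuousOn.aestronglyMeasurable ?_ measurableSet_Ioi)
      have := continuous_brokenLine Q v
      exact ContinuousOn.mul (by fun_prop) (hVc.mono hsub)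
    have hle : ∀ᵐ s ∂(volume.restrict (Ioi t)), ‖G φ s‖ ≤
        m / 2 * B * ((1 + 1 / (N * s)) ^ m / (s * (1 + N * s))) := by
      refine (ae_restrict_iff' measurableSet_Ioi).2 (Filter.Eventually.of_forall fun s hs => ?_)
      rw [← hW]
      exact hGb B φ hφ hB hφB s (hsub hs)
    refine ⟨Integrable.mono' (hi.const_mul _) hmeas hle, ?_⟩
    refine (norm_integral_le_of_norm_le (hi.const_mul _) hle).trans ?_
    rw [integral_const_mul, hv, ← hW]
    apply le_of_eq; field_simp
  -- the operator on bounded continuous functions of `log t`, weighted by `W`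
  obtain ⟨φ, hφ⟩ : ∃ φ : (BoundedContinuousFunction ℝ ℂ) → ℝ → ℂ,
      ∀ g t, φ g t = W t * g (Real.log t) := ⟨_, fun _ _ => rfl⟩
  have hφc : ∀ g, ContinuousOn (φ g) (Ioi 0) := fun g => by
    rw [show φ g = fun t => W t * g (Real.log t) from funext (hφ g)]
    refine (Complex.continuous_ofReal.comp_continuousOn hWc).mul
      (g.continuous.comp_continuousOn (Real.continuousOn_log.mono fun t ht => ?_))
    exact (ne_of_gt ht)
  have hφb : ∀ g, ∀ t, 0 < t → ‖φ g t‖ ≤ ‖g‖ * W t := fun g t ht => by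
    rw [hφ, norm_mul, Complex.norm_real, Real.norm_of_nonneg (by linarith [hW1 t ht]), mul_comm]
    exact mul_le_mul_of_nonneg_right (g.norm_coe_le_norm _) (by linarith [hW1 t ht])
  have hVsub : ∀ g₁ g₂, ∀ s, 0 < s → V (φ g₁) s - V (φ g₂) s = V (φ (g₁ - g₂)) s := by
    intro g₁ g₂ s hs
    rw [hV, hV, hV, ← neg_sub', ← integral_sub (hVi _ _ (hφc g₁) (norm_nonneg g₁) (hφb g₁) s hs)
      (hVi _ _ (hφc g₂) (norm_nonneg g₂) (hφb g₂) s hs)]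
    congr 2; funext r
    rw [hφ, hφ, hφ, BoundedContinuousFunction.sub_apply]; ring
  have hGsub : ∀ g₁ g₂, ∀ t, 0 < t → (∫ s in Ioi t, G (φ g₁) s) - ∫ s in Ioi t, G (φ g₂) s
      = ∫ s in Ioi t, G (φ (g₁ - g₂)) s := by
    intro g₁ g₂ t ht
    rw [← integral_sub (hGi _ _ (hφc g₁) (norm_nonneg g₁) (hφb g₁) t ht).1
      (hGi _ _ (hφc g₂) (norm_nonneg g₂) (hφb g₂) t ht).1]
    refine setIntegral_congr_fun measurableSet_Ioi fun s hs => ?_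
    rw [hG, hG, hG, ← hVsub g₁ g₂ s (ht.trans hs)]; ring
  have hTcont : ∀ g, Continuous (fun u : ℝ => (1 - ∫ s in Ioi (Real.exp u), G (φ g) s) /
      (W (Real.exp u) : ℂ)) := by
    intro g
    have h1 := continuousOn_integral_Ioi
      fun t ht => (hGi _ _ (hφc g) (norm_nonneg g) (hφb g) t ht).1
    have h2 : Continuous (fun u : ℝ => ∫ s in Ioi (Real.exp u), G (φ g) s) :=
      h1.comp_continuous Real.continuous_exp fun u => Real.exp_pos u
    have h3 : Continuous (fun u : ℝ => W (Real.exp u)) :=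
      hWc.comp_continuous Real.continuous_exp fun u => Real.exp_pos u
    refine (continuous_const.sub h2).div (Complex.continuous_ofReal.comp h3) fun u => ?_
    have := hW1 _ (Real.exp_pos u)
    exact_mod_cast (by linarith : W (Real.exp u) ≠ 0)
  have hTb : ∀ g, ∀ u : ℝ, ‖(1 - ∫ s in Ioi (Real.exp u), G (φ g) s) / (W (Real.exp u) : ℂ)‖
      ≤ 1 + ‖g‖ / 2 := by
    intro g u
    have h1 := (hGi _ _ (hφc g) (norm_nonneg g) (hφb g) _ (Real.exp_pos u)).2
    have h2 := hW1 _ (Real.exp_pos u)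
    rw [norm_div, Complex.norm_real, Real.norm_of_nonneg (by linarith), div_le_iff₀ (by linarith)]
    refine (norm_sub_le _ _).trans ?_
    rw [norm_one]
    nlinarith [norm_nonneg g]
  obtain ⟨T, hT⟩ : ∃ T : BoundedContinuousFunction ℝ ℂ → BoundedContinuousFunction ℝ ℂ,
      ∀ g u, T g u = (1 - ∫ s in Ioi (Real.exp u), G (φ g) s) / (W (Real.exp u) : ℂ) :=
    ⟨fun g => BoundedContinuousFunction.ofNormedAddCommGroup _ (hTcont g) _ (hTb g),
      fun _ _ => rfl⟩
  have hcontr : ContractingWith (1 / 2) T := by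
    refine ⟨by rw [← NNReal.coe_lt_coe]; norm_num, LipschitzWith.of_dist_le_mul fun g₁ g₂ => ?_⟩
    rw [dist_eq_norm, dist_eq_norm]
    refine (BoundedContinuousFunction.norm_le (by positivity)).2 fun u => ?_
    have h1 := (hGi _ _ (hφc (g₁ - g₂)) (norm_nonneg _) (hφb (g₁ - g₂)) _ (Real.exp_pos u)).2
    have h2 := hW1 _ (Real.exp_pos u)
    rw [BoundedContinuousFunction.sub_apply, hT, hT, ← sub_div, sub_sub_sub_cancel_left,
      ← neg_sub (∫ s in Ioi (Real.exp u), G (φ g₁) s), hGsub g₁ g₂ _ (Real.exp_pos u), norm_div,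
      norm_neg, Complex.norm_real, Real.norm_of_nonneg (by linarith), div_le_iff₀ (by linarith)]
    push_cast
    nlinarith [norm_nonneg (g₁ - g₂)]
  obtain ⟨g, hg⟩ : ∃ g, T g = g := ⟨_, hcontr.fixedPoint_isFixedPt⟩
  have hgn : ‖g‖ ≤ 2 := by
    have : ‖g‖ ≤ 1 + ‖g‖ / 2 := by
      conv_lhs => rw [← hg]
      refine (BoundedContinuousFunction.norm_le (by positivity)).2 fun u => ?_
      rw [hT]; exact hTb g u
    linarith
  have hF : ∀ t, 0 < t → φ g t = 1 - ∫ s in Ioi t, G (φ g) s := by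
    intro t ht
    have h2 := hW1 t ht
    have h3 : (W t : ℂ) ≠ 0 := by exact_mod_cast (by linarith : W t ≠ 0)
    rw [hφ]
    conv_lhs => rw [← hg]
    rw [hT, Real.exp_log ht]
    field_simp
  have hφ2 : ∀ t, 0 < t → ‖φ g t‖ ≤ 2 * W t := fun t ht =>
    (hφb g t ht).trans (mul_le_mul_of_nonneg_right hgn (by linarith [hW1 t ht]))
  refine ⟨φ g, V (φ g), hφc g, hVi 2 _ (hφc g) zero_le_two hφ2, hV (φ g), ?_, ?_, ?_, ?_⟩
  · intro t ht
    exact (hGi 2 _ (hφc g) zero_le_two hφ2 t ht).1.congr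
      (Filter.Eventually.of_forall fun s => hG (φ g) s)
  · intro t ht
    rw [hF t ht]
    congr 2; funext s; exact hG (φ g) s
  · intro t ht
    refine (hVb 2 _ (hφc g) zero_le_two hφ2 t ht).trans ?_
    rw [hW]
    gcongr
    nlinarith
  · intro t ht
    rw [hF t ht, sub_sub_cancel_left, norm_neg, ← hW]
    have := (hGi 2 _ (hφc g) zero_le_two hφ2 t ht).2
    linarith

/-- Solutions `F` of `F'' + 4 N (ζ - z) F' = (4 d / ζ²) F` along the broken line, with
`U = exp (2 N (ζ - z)²) F'`, written as a first-order system in the parameter of the line. -/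
structure IsAmplitude (d N : ℝ) (z Q v : ℂ) (F U : ℝ → ℂ) : Prop where
  contF : ContinuousOn F (Set.Ioi 0)
  contU : ContinuousOn U (Set.Ioi 0)
  derivF : ∀ t, 0 < t → t ≠ 1 → HasDerivAt F (brokenLineVel Q v t *
    (Complex.exp (-(2 * N * (brokenLine Q v t - z) ^ 2)) * U t)) t
  derivU : ∀ t, 0 < t → t ≠ 1 → HasDerivAt U (Complex.exp (2 * N * (brokenLine Q v t - z) ^ 2) *
    (4 * d / brokenLine Q v t ^ 2) * brokenLineVel Q v t * F t) t

theorem one_add_pow_sub_one_le {x : ℝ} (hx : 0 ≤ x) (m : ℕ) :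
    (1 + x) ^ m - 1 ≤ m * x * (1 + x) ^ m := by
  induction m with
  | zero => simp
  | succ k ih =>
    have h1 : 1 ≤ (1 + x) ^ k := one_le_pow₀ (by linarith)
    have h2 : (0 : ℝ) ≤ k := Nat.cast_nonneg k
    push_cast
    rw [pow_succ]
    nlinarith [mul_nonneg hx hx, mul_nonneg h2 hx, mul_le_mul_of_nonneg_right ih hx,
      mul_nonneg (mul_nonneg hx hx) (by linarith : 0 ≤ (1 + x) ^ k)]

open Set in
theorem continuousAt_brokenLineVel (Q v : ℂ) {t : ℝ} (ht : t ≠ 1) :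
    ContinuousAt (brokenLineVel Q v) t := by
  rcases lt_or_gt_of_ne ht with h | h
  · refine (continuousAt_const (y := Q)).congr ?_
    filter_upwards [Iio_mem_nhds h] with s hs
    rw [brokenLineVel, if_pos (mem_Iio.1 hs)]
  · refine (continuousAt_const (y := v)).congr ?_
    filter_upwards [Ioi_mem_nhds h] with s hs
    rw [brokenLineVel, if_neg (not_lt.2 (le_of_lt hs))]

open Set in
/-- There is an amplitude tending to `1` at infinity, and it is `1 + O(1 / N)` away from the
origin. -/
theorem exists_isAmplitude (c C d : ℝ) :
    ∃ m : ℕ, ∀ N : ℝ, 1 ≤ N → ∀ z Q v : ℂ, BrokenLineBounds c C z Q v →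
      ∃ F U : ℝ → ℂ, IsAmplitude d N z Q v F U ∧
        (∀ t, 0 < t → ‖F t - 1‖ ≤ m / N * (1 + 1 / t) ^ m) ∧
        (∀ t, 0 < t → ‖Complex.exp (-(2 * N * (brokenLine Q v t - z) ^ 2)) * U t‖
          ≤ m * (1 + 1 / t) ^ m) := by
  obtain ⟨m, hm, H⟩ := exists_amplitude_fixedPoint c C d
  refine ⟨m + 1, fun N hN z Q v h => ?_⟩
  obtain ⟨F, U, hFc, hUi, hU, hFi, hF, hUb, hFb⟩ := H N hN z Q v h
  have hN0 : 0 < N := by linarith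
  have hζ := continuous_brokenLine Q v
  have hUc : ContinuousOn U (Ioi 0) :=
    ((continuousOn_integral_Ioi hUi).neg).congr fun t _ => hU t
  refine ⟨F, U, ⟨hFc, hUc, fun t ht ht1 => ?_, fun t ht ht1 => ?_⟩, fun t ht => ?_, fun t ht => ?_⟩
  · have h1 := (hasDerivAt_integral_Ioi ht hFi ?_).const_sub 1
    · rw [neg_neg] at h1
      refine h1.congr_of_eventuallyEq ?_
      filter_upwards [Ioi_mem_nhds ht] with s hs
      exact hF s hs
    · refine (continuousAt_brokenLineVel Q v ht1).mul (ContinuousAt.mul ?_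
        (hUc.continuousAt (Ioi_mem_nhds ht)))
      exact Continuous.continuousAt (by fun_prop)
  · have h1 := (hasDerivAt_integral_Ioi ht hUi ?_).fun_neg
    · rw [neg_neg] at h1
      exact h1.congr_of_eventuallyEq (Filter.Eventually.of_forall hU)
    · refine ContinuousAt.mul (ContinuousAt.mul (ContinuousAt.mul ?_ ?_)
        (continuousAt_brokenLineVel Q v ht1)) (hFc.continuousAt (Ioi_mem_nhds ht))
      · exact Continuous.continuousAt (by fun_prop)
      · exact continuousAt_const.div (hζ.pow 2).continuousAt (pow_ne_zero 2 (h.ne_zero ht))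
  · refine (hFb t ht).trans ((one_add_pow_sub_one_le (by positivity) m).trans ?_)
    have h1 : 1 / (N * t) = 1 / t / N := by field_simp
    have h2 : 1 / t / N ≤ 1 / t := div_le_self (by positivity) hN
    rw [h1]
    push_cast
    rw [pow_succ]
    calc (m : ℝ) * (1 / t / N) * (1 + 1 / t / N) ^ m ≤ m * (1 / t / N) * (1 + 1 / t) ^ m := by
          gcongr
      _ = m / N * ((1 + 1 / t) ^ m * (1 / t)) := by ring
      _ ≤ _ := by gcongr <;> linarith
  · refine (hUb t ht).trans ?_
    have h1 : 1 / (N * t) ≤ 1 / t := by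
      apply one_div_le_one_div_of_le ht; nlinarith
    have h2 : t ≤ t * (1 + N * t) := le_mul_of_one_le_right ht.le (by nlinarith)
    push_cast
    rw [pow_succ]
    calc (m : ℝ) * ((1 + 1 / (N * t)) ^ m / (t * (1 + N * t)))
        ≤ m * ((1 + 1 / t) ^ m / t) := by gcongr
      _ = m * ((1 + 1 / t) ^ m * (1 / t)) := by ring
      _ ≤ _ := by gcongr <;> linarith

/-! ### Contour integral solutions of the recurrence -/

/-- The contour integral `∫ ζ ^ ν exp (2 N (ζ - z)²) F dζ` along a broken line. -/
noncomputable def contourIntegral (N : ℝ) (z Q v : ℂ) (F : ℝ → ℂ) (ν : ℂ) : ℂ :=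
  ∫ t in Set.Ioi (0 : ℝ), brokenLineVel Q v t *
    (brokenLine Q v t ^ ν * (Complex.exp (2 * N * (brokenLine Q v t - z) ^ 2) * F t))

theorem exp_mul_sub_sq_le {b p t : ℝ} (hb : 0 < b) :
    p * t - b * t ^ 2 ≤ (p + 1) ^ 2 / (4 * b) - t := by
  rw [← sub_nonneg]
  have : (p + 1) ^ 2 / (4 * b) - t - (p * t - b * t ^ 2) = b * (t - (p + 1) / (2 * b)) ^ 2 := by
    field_simp; ring
  rw [this]; positivity

/-- Integrability bound for the contour integrand, `j` being the order of the singularity of the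
amplitude at the origin. -/
theorem norm_contour_integrand_le {c C : ℝ} (hc : 0 < c) (hC : 0 < C) {N : ℝ} (hN : 0 < N) (j : ℕ)
    {ν₁ : ℝ} :
    ∃ K : ℝ, 0 ≤ K ∧ ∀ z Q v : ℂ, BrokenLineBounds c C z Q v → ∀ ν : ℝ, (j : ℝ) + 1 ≤ ν → ν ≤ ν₁ →
      ∀ t, 0 < t → ∀ B : ℝ, ∀ A : ℂ, ‖A‖ ≤ B * (1 + 1 / t) ^ j →
      ‖brokenLine Q v t ^ (ν : ℂ) * (Complex.exp (2 * N * (brokenLine Q v t - z) ^ 2) * A)‖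
        ≤ B * (K * (t * Real.exp (-t))) := by
  refine ⟨(1 + C) ^ ν₁ * Real.exp (2 * N * (C ^ 2 + c)) *
    Real.exp ((ν₁ + 1) ^ 2 / (4 * (2 * N * c))), by positivity, fun z Q v h ν hν hν₁ t ht B A hA => ?_⟩
  have hj : (0 : ℝ) ≤ j := Nat.cast_nonneg j
  have hCν : C ^ ν ≤ (1 + C) ^ ν₁ :=
    (Real.rpow_le_rpow hC.le (by linarith) (by linarith)).trans
      (Real.rpow_le_rpow_of_exponent_le (by linarith) hν₁)
  have hν1 : Real.exp ((ν + 1) ^ 2 / (4 * (2 * N * c))) ≤ Real.exp ((ν₁ + 1) ^ 2 / (4 * (2 * N * c))) := by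
    apply Real.exp_le_exp.2
    have : 0 ≤ ν + 1 := by linarith
    gcongr
  have h1 : ‖brokenLine Q v t ^ (ν : ℂ)‖ ≤ C ^ ν * t ^ ν := by
    rw [Complex.norm_cpow_of_ne_zero (h.ne_zero ht)]
    simp only [Complex.ofReal_re, Complex.ofReal_im, mul_zero, Real.exp_zero, div_one]
    rw [← Real.mul_rpow hC.le ht.le]
    exact Real.rpow_le_rpow (norm_nonneg _) (h.norm_le ht.le) (by linarith)
  have h2 : ‖Complex.exp (2 * N * (brokenLine Q v t - z) ^ 2)‖
      ≤ Real.exp (2 * N * (C ^ 2 + c)) * Real.exp (-(2 * N * c * t ^ 2)) := by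
    rw [← Real.exp_add, Complex.norm_exp]
    apply Real.exp_le_exp.2
    have h3 : (2 * N * (brokenLine Q v t - z) ^ 2 : ℂ)
      = ((2 * N : ℝ) : ℂ) * (brokenLine Q v t - z) ^ 2 := by push_cast; ring
    rw [h3, Complex.re_ofReal_mul]
    have := mul_le_mul_of_nonneg_left (h.re_sq_le_gaussian ht.le) (by positivity : 0 ≤ 2 * N)
    linarith
  have hB : 0 ≤ B := by
    have := (norm_nonneg A).trans hA
    exact nonneg_of_mul_nonneg_left this (by positivity)
  have h4 : t ^ ν * (1 + 1 / t) ^ j ≤ t * Real.exp (ν * t) := by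
    have e1 : t ^ ν = t * (t ^ j * t ^ (ν - 1 - j)) := by
      rw [← Real.rpow_natCast, ← Real.rpow_add ht]
      nth_rw 2 [← Real.rpow_one t]
      rw [← Real.rpow_add ht]; congr 1; ring
    have e2 : t ^ j * (1 + 1 / t) ^ j = (1 + t) ^ j := by
      rw [← mul_pow]; congr 1; field_simp; ring
    have e3 : t ^ (ν - 1 - j) ≤ Real.exp (t * (ν - 1 - j)) := by
      rw [Real.exp_mul]
      exact Real.rpow_le_rpow ht.le (by linarith [Real.add_one_le_exp t]) (by linarith)
    have e4 : (1 + t) ^ j ≤ Real.exp (j * t) := by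
      rw [Real.exp_nat_mul]
      exact pow_le_pow_left₀ (by positivity) (by linarith [Real.add_one_le_exp t]) j
    calc t ^ ν * (1 + 1 / t) ^ j = t * (t ^ (ν - 1 - j) * (t ^ j * (1 + 1 / t) ^ j)) := by
          rw [e1]; ring
      _ ≤ t * (Real.exp (t * (ν - 1 - j)) * Real.exp (j * t)) := by
          rw [e2]; gcongr
      _ = t * Real.exp ((ν - 1) * t) := by rw [← Real.exp_add]; congr 2; ring
      _ ≤ _ := by
          gcongr
          linarith
  have h5 : Real.exp (ν * t) * Real.exp (-(2 * N * c * t ^ 2))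
      ≤ Real.exp ((ν + 1) ^ 2 / (4 * (2 * N * c))) * Real.exp (-t) := by
    rw [← Real.exp_add, ← Real.exp_add]
    apply Real.exp_le_exp.2
    have := exp_mul_sub_sq_le (p := ν) (t := t) (b := 2 * N * c) (by positivity)
    linarith
  rw [norm_mul, norm_mul]
  calc _ ≤ (C ^ ν * t ^ ν) * ((Real.exp (2 * N * (C ^ 2 + c)) * Real.exp (-(2 * N * c * t ^ 2))) *
        (B * (1 + 1 / t) ^ j)) := by gcongr
    _ = B * (C ^ ν * Real.exp (2 * N * (C ^ 2 + c))) * (t ^ ν * (1 + 1 / t) ^ j) *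
        Real.exp (-(2 * N * c * t ^ 2)) := by ring
    _ ≤ B * (C ^ ν * Real.exp (2 * N * (C ^ 2 + c))) * (t * Real.exp (ν * t)) *
        Real.exp (-(2 * N * c * t ^ 2)) := by gcongr
    _ = B * (C ^ ν * Real.exp (2 * N * (C ^ 2 + c))) * t * (Real.exp (ν * t) *
        Real.exp (-(2 * N * c * t ^ 2))) := by ring
    _ ≤ B * (C ^ ν * Real.exp (2 * N * (C ^ 2 + c))) * t *
        (Real.exp ((ν + 1) ^ 2 / (4 * (2 * N * c))) * Real.exp (-t)) := by gcongr
    _ ≤ B * ((1 + C) ^ ν₁ * Real.exp (2 * N * (C ^ 2 + c))) * t *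
        (Real.exp ((ν₁ + 1) ^ 2 / (4 * (2 * N * c))) * Real.exp (-t)) := by gcongr
    _ = _ := by ring

open MeasureTheory Set in
theorem integrableOn_mul_exp_neg : IntegrableOn (fun t : ℝ => t * Real.exp (-t)) (Ioi 0) := by
  have := Real.GammaIntegral_convergent (s := 2) (by norm_num)
  refine this.congr_fun (fun t ht => ?_) measurableSet_Ioi
  norm_num
  ring

open MeasureTheory Set in
theorem BrokenLineBounds.integrableOn_integrand {c C : ℝ} {z Q v : ℂ}
    (h : BrokenLineBounds c C z Q v) {N : ℝ} (hN : 0 < N) {j : ℕ} {ν : ℝ} (hν : (j : ℝ) + 1 ≤ ν)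
    {F : ℝ → ℂ} (hF : ContinuousOn F (Ioi 0)) {B : ℝ}
    (hFB : ∀ t, 0 < t → ‖F t‖ ≤ B * (1 + 1 / t) ^ j) :
    IntegrableOn (fun t => brokenLineVel Q v t * (brokenLine Q v t ^ (ν : ℂ) *
      (Complex.exp (2 * N * (brokenLine Q v t - z) ^ 2) * F t))) (Ioi 0) := by
  obtain ⟨K, hK0, hK'⟩ := norm_contour_integrand_le h.c_pos h.C_pos hN j (ν₁ := ν)
  have hK := hK' z Q v h ν hν le_rfl
  refine Integrable.mono' ((integrableOn_mul_exp_neg.const_mul K).const_mul (C * B)) ?_ ?_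
  · refine (measurable_brokenLineVel Q v).aestronglyMeasurable.mul
      (ContinuousOn.aestronglyMeasurable ?_ measurableSet_Ioi)
    have hζ := continuous_brokenLine Q v
    refine ContinuousOn.mul ?_ (ContinuousOn.mul (by fun_prop) hF)
    exact hζ.continuousOn.cpow_const fun t ht => h.mem_slitPlane ht
  · refine (ae_restrict_iff' measurableSet_Ioi).2 (Filter.Eventually.of_forall fun t ht => ?_)
    rw [norm_mul, mul_assoc C B]
    exact mul_le_mul (h.norm_vel_le t) (hK t ht B _ (hFB t ht)) (norm_nonneg _) h.C_pos.le

open MeasureTheory Set Filter Topology in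
/-- A function on the half-line with a corner at `1`, vanishing at both ends, has a derivative of
integral zero. -/
theorem integral_Ioi_eq_zero_of_corner {G g : ℝ → ℂ} (hc : ContinuousOn G (Ioi 0))
    (hd : ∀ t, 0 < t → t ≠ 1 → HasDerivAt G (g t) t) (hi : IntegrableOn g (Ioi 0))
    (h0 : Tendsto G (𝓝[>] 0) (𝓝 0)) (hinf : Tendsto G atTop (𝓝 0)) :
    ∫ t in Ioi (0 : ℝ), g t = 0 := by
  have hi1 : IntegrableOn g (Ioi 1) := hi.mono_set (Ioi_subset_Ioi zero_le_one)
  rw [← intervalIntegral.integral_interval_add_Ioi hi hi1]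
  have hG1 : ContinuousAt G 1 := hc.continuousAt (Ioi_mem_nhds one_pos)
  rw [integral_Ioi_of_hasDerivAt_of_tendsto hG1.continuousWithinAt
    (fun t ht => hd t (one_pos.trans ht) (ne_of_gt ht)) hi1 hinf]
  rw [intervalIntegral.integral_eq_sub_of_hasDerivAt_of_tendsto (f := G) one_pos
    (fun t ht => hd t ht.1 (ne_of_lt ht.2)) ?_ h0 (hG1.tendsto.mono_left nhdsWithin_le_nhds)]
  · ring
  · rw [intervalIntegrable_iff_integrableOn_Ioc_of_le zero_le_one]
    exact hi.mono_set Ioc_subset_Ioi_self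

open MeasureTheory Set Filter Topology in
/-- The contour integrals satisfy the scaled recurrence, exactly. -/
theorem contourIntegral_recurrence {c C : ℝ} {z Q v : ℂ} (h : BrokenLineBounds c C z Q v) {N : ℝ}
    (hN : 0 < N) {d : ℝ} {F U : ℝ → ℂ} (hFU : IsAmplitude d N z Q v F U) {B : ℝ} {j : ℕ}
    (hFB : ∀ t, 0 < t → ‖F t‖ ≤ B * (1 + 1 / t) ^ j)
    (hUB : ∀ t, 0 < t → ‖Complex.exp (-(2 * N * (brokenLine Q v t - z) ^ 2)) * U t‖
      ≤ B * (1 + 1 / t) ^ j) {ν : ℝ} (hν : (j : ℝ) + 2 ≤ ν) :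
    contourIntegral N z Q v F (ν + 1 : ℝ) = z * contourIntegral N z Q v F ν
      - (ν / (4 * N) - d / (N * (ν + 1))) * contourIntegral N z Q v F (ν - 1 : ℝ) := by
  have hj : (0 : ℝ) ≤ j := Nat.cast_nonneg j
  have hζ := continuous_brokenLine Q v
  set e : ℝ → ℂ := fun t => Complex.exp (2 * N * (brokenLine Q v t - z) ^ 2) with he
  set ζ := brokenLine Q v with hζdef
  have i1 := h.integrableOn_integrand hN (by linarith : (j : ℝ) + 1 ≤ ν + 1) hFU.contF hFB
  have i2 := h.integrableOn_integrand hN (by linarith : (j : ℝ) + 1 ≤ ν) hFU.contF hFB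
  have i3 := h.integrableOn_integrand hN (by linarith : (j : ℝ) + 1 ≤ ν - 1) hFU.contF hFB
  have hν1 : ((ν : ℂ) + 1) ≠ 0 := by exact_mod_cast (by linarith : ν + 1 ≠ 0)
  have hNc : (N : ℂ) ≠ 0 := by exact_mod_cast hN.ne'
  -- the primitive
  set G : ℝ → ℂ := fun t => 1 / (4 * N) * ((ν + 1) * (ζ t ^ (ν : ℂ) * (e t * F t))
    - ζ t ^ ((ν + 1 : ℝ) : ℂ) * (e t * (Complex.exp (-(2 * N * (ζ t - z) ^ 2)) * U t))) with hG
  set f₁ : ℝ → ℂ := fun t => brokenLineVel Q v t * (ζ t ^ ((ν + 1 : ℝ) : ℂ) * (e t * F t)) with hf₁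
  set f₂ : ℝ → ℂ := fun t => brokenLineVel Q v t * (ζ t ^ (ν : ℂ) * (e t * F t)) with hf₂
  set f₃ : ℝ → ℂ := fun t => brokenLineVel Q v t * (ζ t ^ ((ν - 1 : ℝ) : ℂ) * (e t * F t)) with hf₃
  have hsum : (∫ t in Ioi (0 : ℝ), ((ν + 1) * f₁ t - (ν + 1) * z * f₂ t
      + ((ν + 1) * ν / (4 * N) - d / N) * f₃ t)) = 0 := by
    obtain ⟨K₁, -, hK₁'⟩ := norm_contour_integrand_le h.c_pos h.C_pos hN j (ν₁ := ν)
    obtain ⟨K₂, -, hK₂'⟩ := norm_contour_integrand_le h.c_pos h.C_pos hN j (ν₁ := ν + 1)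
    have hK₁ := hK₁' z Q v h ν (by linarith) le_rfl
    have hK₂ := hK₂' z Q v h (ν + 1) (by linarith) le_rfl
    obtain ⟨K, hK⟩ : ∃ K : ℝ, ∀ t, 0 < t → ‖G t‖ ≤ K * (t ^ 1 * Real.exp (-t)) := by
      refine ⟨‖(1 / (4 * N) : ℂ)‖ * (‖(ν + 1 : ℂ)‖ * (B * K₁) + B * K₂), fun t ht => ?_⟩
      have b1 := hK₁ t ht B _ (hFB t ht)
      have b2 := hK₂ t ht B _ (hUB t ht)
      have b3 : ‖((ν : ℂ) + 1) * (ζ t ^ (ν : ℂ) * (e t * F t))‖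
          ≤ ‖(ν + 1 : ℂ)‖ * (B * (K₁ * (t * Real.exp (-t)))) := by
        rw [norm_mul]
        exact mul_le_mul_of_nonneg_left b1 (norm_nonneg _)
      have b4 := (norm_sub_le (((ν : ℂ) + 1) * (ζ t ^ (ν : ℂ) * (e t * F t))) (ζ t ^ ((ν + 1 : ℝ) : ℂ) *
        (e t * (Complex.exp (-(2 * N * (ζ t - z) ^ 2)) * U t)))).trans (add_le_add b3 b2)
      have b5 := mul_le_mul_of_nonneg_left b4 (norm_nonneg (1 / (4 * N) : ℂ))
      rw [← norm_mul] at b5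
      exact b5.trans (le_of_eq (by ring))
    refine integral_Ioi_eq_zero_of_corner (G := G) ?_ ?_ ?_ ?_ ?_
    · have a1 : ContinuousOn (fun t => ζ t ^ (ν : ℂ)) (Ioi 0) :=
        hζ.continuousOn.cpow_const fun t ht => h.mem_slitPlane ht
      have a2 : ContinuousOn (fun t => ζ t ^ ((ν + 1 : ℝ) : ℂ)) (Ioi 0) :=
        hζ.continuousOn.cpow_const fun t ht => h.mem_slitPlane ht
      have a3 : ContinuousOn e (Ioi 0) := by rw [he]; fun_prop
      have a4 : ContinuousOn (fun t => Complex.exp (-(2 * N * (ζ t - z) ^ 2))) (Ioi 0) := by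
        fun_prop
      exact continuousOn_const.mul ((continuousOn_const.mul (a1.mul (a3.mul hFU.contF))).sub
        (a2.mul (a3.mul (a4.mul hFU.contU))))
    · intro t ht ht1
      have dζ := hasDerivAt_brokenLine (Q := Q) (v := v) ht1
      have hsl := h.mem_slitPlane ht
      have h0 : ζ t ≠ 0 := h.ne_zero ht
      have d1 : HasDerivAt (fun t => ζ t ^ (ν : ℂ)) (ν * ζ t ^ ((ν : ℂ) - 1) * brokenLineVel Q v t) t :=
        (HasDerivAt.comp t ((hasDerivAt_id (ζ t)).cpow_const (c := (ν : ℂ)) hsl) dζ).congr_deriv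
          (by simp)
      have d2 : HasDerivAt (fun t => ζ t ^ ((ν + 1 : ℝ) : ℂ))
          ((ν + 1) * ζ t ^ (ν : ℂ) * brokenLineVel Q v t) t :=
        (HasDerivAt.comp t ((hasDerivAt_id (ζ t)).cpow_const (c := ((ν + 1 : ℝ) : ℂ)) hsl)
          dζ).congr_deriv (by simp)
      have d3 : HasDerivAt e (e t * (4 * N * (ζ t - z) * brokenLineVel Q v t)) t := by
        have := (((dζ.sub_const z).fun_pow 2).const_mul (2 * N : ℂ)).cexp
        refine this.congr_deriv ?_
        simp only [he]; push_cast; ring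
      have d4 := hFU.derivF t ht ht1
      have d5 := hFU.derivU t ht ht1
      have hee : ∀ t, e t * Complex.exp (-(2 * N * (ζ t - z) ^ 2)) = 1 := fun t => by
        rw [he]; simp only; rw [← Complex.exp_add, add_neg_cancel, Complex.exp_zero]
      have hG' : G = fun t => 1 / (4 * N) * ((ν + 1) * (ζ t ^ (ν : ℂ) * (e t * F t))
          - ζ t ^ ((ν + 1 : ℝ) : ℂ) * U t) := by
        funext t
        rw [hG]; simp only
        rw [← mul_assoc (e t), hee, one_mul]
      rw [hG']
      refine ((((d1.mul (d3.mul d4)).const_mul ((ν : ℂ) + 1)).sub (d2.mul d5)).const_mul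
        (1 / (4 * N : ℂ))).congr_deriv ?_
      have p1 : ζ t ^ (ν : ℂ) = ζ t ^ ((ν : ℂ) - 1) * ζ t := by
        rw [Complex.cpow_sub _ _ h0, Complex.cpow_one]; field_simp
      have p2 : ζ t ^ ((ν + 1 : ℝ) : ℂ) = ζ t ^ ((ν : ℂ) - 1) * ζ t ^ 2 := by
        push_cast; rw [Complex.cpow_add _ _ h0, Complex.cpow_one, p1]; ring
      have p3 : ((ν - 1 : ℝ) : ℂ) = (ν : ℂ) - 1 := by push_cast; ring
      have hee' := hee t
      simp only [hf₁, hf₂, hf₃]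
      rw [p3, p2, p1]
      change 1 / (4 * (N : ℂ)) * ((ν + 1) * _ - (_ + _ * (e t * (4 * d / ζ t ^ 2) * _ * F t))) = _
      simp only [Pi.mul_apply]
      generalize brokenLineVel Q v t = V
      generalize ζ t ^ ((ν : ℂ) - 1) = X
      generalize hY : Complex.exp (-(2 * N * (ζ t - z) ^ 2)) = Y at *
      generalize e t = E at *
      generalize F t = f
      generalize U t = u
      have hu : E * (V * (Y * u)) = V * u := by
        calc _ = (E * Y) * (V * u) := by ring
          _ = _ := by rw [hee', one_mul]
      rw [mul_add, mul_add, hu] 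
      field_simp
      ring
    · exact (((i1.const_mul _).sub (i2.const_mul _)).add (i3.const_mul _))
    · refine squeeze_zero_norm' (a := fun t => K * (t ^ 1 * Real.exp (-t))) ?_ ?_
      · filter_upwards [self_mem_nhdsWithin] with t ht using hK t ht
      · have hcont : Continuous (fun t : ℝ => K * (t ^ 1 * Real.exp (-t))) := by fun_prop
        have := hcont.tendsto 0
        simp only [pow_one, zero_mul, mul_zero] at this
        simpa using this.mono_left nhdsWithin_le_nhds
    · refine squeeze_zero_norm' (a := fun t => K * (t ^ 1 * Real.exp (-t))) ?_ ?_
      · filter_upwards [eventually_gt_atTop 0] with t ht using hK t ht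
      · simpa using (Real.tendsto_pow_mul_exp_neg_atTop_nhds_zero 1).const_mul K
  have hA : IntegrableOn (fun t => ((ν : ℂ) + 1) * f₁ t - (ν + 1) * z * f₂ t) (Ioi 0) :=
    (i1.const_mul _).sub (i2.const_mul _)
  rw [integral_add hA (i3.const_mul _),
    integral_sub (i1.const_mul _) (i2.const_mul _), integral_const_mul, integral_const_mul,
    integral_const_mul] at hsum
  change (ν + 1) * contourIntegral N z Q v F (ν + 1 : ℝ)
    - (ν + 1) * z * contourIntegral N z Q v F ν
    + ((ν + 1) * ν / (4 * N) - d / N) * contourIntegral N z Q v F (ν - 1 : ℝ) = 0 at hsum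
  apply mul_left_cancel₀ hν1
  rw [← sub_eq_zero, ← hsum]
  field_simp
  ring

/-! ### Laplace's method along a broken line -/

/-- A saddle point of `κ log ζ + 2 (ζ - z)²` at the parameter `ts` of a broken line that descends
from it on both sides, with uniform bounds. -/
structure SaddleBounds (c C ts ρ : ℝ) (z Q v : ℂ) (κ : ℝ) : Prop where
  line : BrokenLineBounds c C z Q v
  κ_ge : c ≤ κ
  κ_le : κ ≤ 1
  straight : ∀ τ : ℝ, |τ| ≤ ρ → brokenLine Q v (ts + τ) = brokenLine Q v ts + τ * brokenLineVel Q v ts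
  vel : ∀ τ : ℝ, |τ| ≤ ρ → brokenLineVel Q v (ts + τ) = brokenLineVel Q v ts
  saddle : 4 * brokenLine Q v ts * (z - brokenLine Q v ts) = κ
  re_ge : c ≤ ((κ / 2 - 2 * brokenLine Q v ts ^ 2) *
    (brokenLineVel Q v ts / brokenLine Q v ts) ^ 2).re
  decay : ∀ t, 0 < t → κ * Real.log ‖brokenLine Q v t‖ + 2 * ((brokenLine Q v t - z) ^ 2).re
    - (κ * Real.log ‖brokenLine Q v ts‖ + 2 * ((brokenLine Q v ts - z) ^ 2).re) ≤ -c * (t - ts) ^ 2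

/-- The exponential of the phase `N (κ log ζ + 2 (ζ - z)²)`. -/
noncomputable def saddleExp (N : ℝ) (z ζ : ℂ) (κ : ℝ) : ℂ :=
  Complex.exp (N * (κ * Complex.log ζ + 2 * (ζ - z) ^ 2))

theorem norm_saddleExp (N : ℝ) (z ζ : ℂ) (κ : ℝ) :
    ‖saddleExp N z ζ κ‖ = Real.exp (N * (κ * Real.log ‖ζ‖ + 2 * ((ζ - z) ^ 2).re)) := by
  rw [saddleExp, Complex.norm_exp]
  congr 1
  have h : (N * (κ * Complex.log ζ + 2 * (ζ - z) ^ 2) : ℂ)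
    = (N : ℂ) * ((κ : ℂ) * Complex.log ζ + ((2 : ℝ) : ℂ) * (ζ - z) ^ 2) := by push_cast; ring
  rw [h, Complex.re_ofReal_mul, Complex.add_re, Complex.re_ofReal_mul, Complex.re_ofReal_mul,
    Complex.log_re]

theorem cpow_mul_exp_eq_saddleExp {ζ : ℂ} (hζ : ζ ≠ 0) (N κ r : ℝ) (z : ℂ) :
    ζ ^ ((N * κ + r : ℝ) : ℂ) * Complex.exp (2 * N * (ζ - z) ^ 2)
      = saddleExp N z ζ κ * ζ ^ (r : ℂ) := by
  rw [Complex.cpow_def_of_ne_zero hζ, Complex.cpow_def_of_ne_zero hζ, saddleExp, ← Complex.exp_add,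
    ← Complex.exp_add]
  congr 1; push_cast; ring

theorem exists_pow_mul_exp_neg_le {b : ℝ} (hb : 0 < b) (j : ℕ) :
    ∃ K : ℝ, 0 ≤ K ∧ ∀ x : ℝ, 0 ≤ x → x ^ j * Real.exp (-(b * x)) ≤ K * Real.exp (-(b / 2 * x)) := by
  refine ⟨j.factorial / (b / 2) ^ j, by positivity, fun x hx => ?_⟩
  have h1 := Real.pow_div_factorial_le_exp (b / 2 * x) (by positivity) j
  rw [div_le_iff₀ (by positivity), mul_pow] at h1
  have h2 : Real.exp (-(b * x)) = Real.exp (-(b / 2 * x)) * Real.exp (-(b / 2 * x)) := by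
    rw [← Real.exp_add]; congr 1; ring
  have h3 : Real.exp (b / 2 * x) * Real.exp (-(b / 2 * x)) = 1 := by
    rw [← Real.exp_add]; simp
  rw [h2, div_mul_eq_mul_div (j.factorial : ℝ), le_div_iff₀ (by positivity)]
  calc x ^ j * (Real.exp (-(b / 2 * x)) * Real.exp (-(b / 2 * x))) * (b / 2) ^ j
      = ((b / 2) ^ j * x ^ j) * Real.exp (-(b / 2 * x)) * Real.exp (-(b / 2 * x)) := by ring
    _ ≤ (Real.exp (b / 2 * x) * j.factorial) * Real.exp (-(b / 2 * x)) * Real.exp (-(b / 2 * x)) := by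
        gcongr
    _ = (Real.exp (b / 2 * x) * Real.exp (-(b / 2 * x))) * (j.factorial * Real.exp (-(b / 2 * x))) := by
        ring
    _ = _ := by rw [h3, one_mul]

/-- Global bound for the contour integrand relative to its value at the saddle point. -/
theorem saddle_integrand_le {c C ts : ℝ} (hc : 0 < c) (hC : 0 < C) (hts : 0 < ts) (j : ℕ)
    {r : ℝ} (hr : |r| ≤ 1) :
    ∃ K N0 : ℝ, 0 ≤ K ∧ ∀ ρ N : ℝ, N0 ≤ N → ∀ z Q v : ℂ, ∀ κ : ℝ, SaddleBounds c C ts ρ z Q v κ →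
      ∀ t, 0 < t → ∀ B : ℝ, ∀ A : ℂ, ‖A‖ ≤ B * (1 + 1 / t) ^ j →
      ‖brokenLine Q v t ^ ((N * κ + r : ℝ) : ℂ) *
        (Complex.exp (2 * N * (brokenLine Q v t - z) ^ 2) * A)‖
        ≤ K * B * ‖saddleExp N z (brokenLine Q v ts) κ‖ * Real.exp (-(c / 2 * (N * (t - ts) ^ 2))) := by
  obtain ⟨M, hM⟩ : ∃ M : ℝ, M = (j + 2) / c := ⟨_, rfl⟩
  have hM0 : 0 < M := by rw [hM]; positivity
  have hMc : M * c = j + 2 := by rw [hM]; field_simp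
  obtain ⟨K, hK0, hK⟩ := norm_contour_integrand_le hc hC hM0 j (ν₁ := M + 1)
  obtain ⟨L, hL⟩ : ∃ L : ℝ, L = M * (|Real.log (c * ts)| + |Real.log (C * ts)| + 2 * (C * ts + C) ^ 2) :=
    ⟨_, rfl⟩
  refine ⟨K * Real.exp L, 2 * M, by positivity, fun ρ N hN z Q v κ h t ht B A hA => ?_⟩
  have hκ := h.κ_ge
  have hκ1 := h.κ_le
  have hr' := abs_le.1 hr
  have hζ0 := h.line.ne_zero ht
  have hζs0 := h.line.ne_zero hts
  have hN0 : 0 < N := by linarith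
  have h1 := hK z Q v h.line (M * κ + r) (by nlinarith) (by nlinarith) t ht B A hA
  have hB : 0 ≤ B := nonneg_of_mul_nonneg_left ((norm_nonneg A).trans hA) (by positivity)
  have ht1 : t * Real.exp (-t) ≤ 1 := by
    have := Real.add_one_le_exp t
    rw [Real.exp_neg, ← div_eq_mul_inv, div_le_one (Real.exp_pos t)]; linarith
  have h2 : ‖brokenLine Q v t ^ ((M * κ + r : ℝ) : ℂ) *
        (Complex.exp (2 * M * (brokenLine Q v t - z) ^ 2) * A)‖ ≤ B * K :=
    h1.trans (by
      calc B * (K * (t * Real.exp (-t))) ≤ B * (K * 1) := by gcongr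
        _ = _ := by ring)
  rw [← mul_assoc, cpow_mul_exp_eq_saddleExp hζ0] at h2 ⊢
  have h3 : saddleExp N z (brokenLine Q v t) κ
      = saddleExp M z (brokenLine Q v t) κ * saddleExp (N - M) z (brokenLine Q v t) κ := by
    rw [saddleExp, saddleExp, saddleExp, ← Complex.exp_add]; congr 1; push_cast; ring
  have h4 : ‖saddleExp (N - M) z (brokenLine Q v t) κ‖
      ≤ ‖saddleExp N z (brokenLine Q v ts) κ‖ * Real.exp L *
        Real.exp (-(c / 2 * (N * (t - ts) ^ 2))) := by
    rw [norm_saddleExp, norm_saddleExp, ← Real.exp_add, ← Real.exp_add]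
    apply Real.exp_le_exp.2
    have d1 := mul_le_mul_of_nonneg_left (h.decay t ht) (by linarith : 0 ≤ N - M)
    have d2 : (N - M) * (-c * (t - ts) ^ 2) ≤ -(c / 2 * (N * (t - ts) ^ 2)) := by
      have : 0 ≤ c * (t - ts) ^ 2 := by positivity
      nlinarith
    have d3 : -(M * (κ * Real.log ‖brokenLine Q v ts‖ + 2 * ((brokenLine Q v ts - z) ^ 2).re)) ≤ L := by
      rw [hL, ← mul_neg]
      refine mul_le_mul_of_nonneg_left ?_ hM0.le
      have e1 : Real.log (c * ts) ≤ Real.log ‖brokenLine Q v ts‖ :=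
        Real.log_le_log (by positivity) (h.line.norm_ge hts.le)
      have e3 : -(κ * Real.log ‖brokenLine Q v ts‖) ≤ |Real.log (c * ts)| := by
        have e4 := neg_abs_le (Real.log (c * ts))
        have e5 : 0 ≤ |Real.log (c * ts)| := abs_nonneg _
        have e6 : 0 ≤ κ := by linarith
        have e7 := mul_le_mul_of_nonneg_left (e4.trans e1) e6
        nlinarith
      have e4 : -((brokenLine Q v ts - z) ^ 2).re ≤ (C * ts + C) ^ 2 := by
        refine (neg_le_abs _).trans ((Complex.abs_re_le_norm _).trans ?_)
        rw [norm_pow]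
        exact pow_le_pow_left₀ (norm_nonneg _) ((norm_sub_le _ _).trans
          (add_le_add (h.line.norm_le hts.le) h.line.norm_z)) 2
      have e5 : 0 ≤ |Real.log (C * ts)| := abs_nonneg _
      linarith
    linarith
  calc ‖saddleExp N z (brokenLine Q v t) κ * brokenLine Q v t ^ (r : ℂ) * A‖
      = ‖saddleExp M z (brokenLine Q v t) κ * brokenLine Q v t ^ (r : ℂ) * A‖ *
        ‖saddleExp (N - M) z (brokenLine Q v t) κ‖ := by rw [h3]; simp only [norm_mul]; ring
    _ ≤ (B * K) * (‖saddleExp N z (brokenLine Q v ts) κ‖ * Real.exp L *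
        Real.exp (-(c / 2 * (N * (t - ts) ^ 2)))) := by gcongr
    _ = _ := by ring

set_option maxHeartbeats 800000 in
/-- Second-order comparison with a Gaussian near the saddle point. -/
theorem norm_saddle_expansion_le {c W : ℝ} (hc : 0 < c) (hW : 0 ≤ W) :
    ∃ ρ K : ℝ, 0 < ρ ∧ 0 ≤ K ∧ ∀ N r κ τ : ℝ, ∀ ω q : ℂ, 1 ≤ N → |r| ≤ 1 → 0 ≤ κ → κ ≤ 1 →
      |τ| ≤ ρ → ‖ω‖ ≤ W → c ≤ q.re → ∀ s : ℂ, q = (κ / 2 - s) * ω ^ 2 →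
      ‖ω * τ‖ ≤ 1 / 2 ∧
      ‖Complex.exp (r * Complex.log (1 + ω * τ) + N * (κ * (Complex.log (1 + ω * τ) - ω * τ)
          + s * (ω * τ) ^ 2))
        - Complex.exp (-(N * q) * τ ^ 2) * (1 + (r * ω * τ + N * κ * ω ^ 3 * τ ^ 3 / 3))‖
        ≤ K / N * Real.exp (-(c / 4 * (N * τ ^ 2))) := by
  obtain ⟨K1, hK1, hK1'⟩ := exists_pow_mul_exp_neg_le (half_pos hc) 1
  obtain ⟨K2, hK2, hK2'⟩ := exists_pow_mul_exp_neg_le (half_pos hc) 2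
  obtain ⟨K3, hK3, hK3'⟩ := exists_pow_mul_exp_neg_le (half_pos hc) 3
  refine ⟨min (1 / (2 * (W + 1))) (c / (4 * (W + 1) ^ 3)),
    W ^ 2 * K1 + W ^ 4 * K2 + Real.exp 1 * (8 * W ^ 2 * K1 + 8 * W ^ 6 * K3), by positivity,
    by positivity, fun N r κ τ ω q hN hr hκ0 hκ1 hτ hω hq s hqs => ?_⟩
  have hN0 : 0 < N := by linarith
  have hτ1 : |τ| ≤ 1 / (2 * (W + 1)) := hτ.trans (min_le_left _ _)
  have hτ2 : |τ| ≤ c / (4 * (W + 1) ^ 3) := hτ.trans (min_le_right _ _)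
  set e : ℂ := ω * τ with he
  have hen : ‖e‖ = ‖ω‖ * |τ| := by rw [he, norm_mul, Complex.norm_real, Real.norm_eq_abs]
  have heW : ‖e‖ ≤ W * |τ| := by rw [hen]; gcongr
  have he2 : ‖e‖ ≤ 1 / 2 := by
    refine heW.trans ?_
    calc W * |τ| ≤ (W + 1) * (1 / (2 * (W + 1))) := by gcongr; linarith
      _ = 1 / 2 := by field_simp
  refine ⟨he2, ?_⟩
  have l1 : ‖Complex.log (1 + e) - e‖ ≤ ‖e‖ ^ 2 := by
    have := Complex.norm_log_one_add_sub_self_le (z := e) (by linarith)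
    refine this.trans ?_
    have h2 : (1 - ‖e‖)⁻¹ ≤ 2 := by
      rw [inv_le_comm₀ (by linarith) (by norm_num)]; linarith
    nlinarith [sq_nonneg ‖e‖]
  have hlt : ‖e‖ < 1 := by linarith
  have l2 : ‖Complex.log (1 + e) - (e - e ^ 2 / 2)‖ ≤ ‖e‖ ^ 3 := by
    have := Complex.norm_log_sub_logTaylor_le 2 hlt
    have h3 : Complex.logTaylor 3 e = e - e ^ 2 / 2 := by
      simp [Complex.logTaylor, Finset.sum_range_succ]; ring
    rw [h3] at this
    refine this.trans ?_
    have h2 : (1 - ‖e‖)⁻¹ ≤ 2 := by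
      rw [inv_le_comm₀ (by linarith) (by norm_num)]; linarith
    have h4 : 0 ≤ ‖e‖ ^ 3 := by positivity
    norm_num
    nlinarith
  have l3 : ‖Complex.log (1 + e) - (e - e ^ 2 / 2 + e ^ 3 / 3)‖ ≤ ‖e‖ ^ 4 := by
    have := Complex.norm_log_sub_logTaylor_le 3 hlt
    have h3 : Complex.logTaylor 4 e = e - e ^ 2 / 2 + e ^ 3 / 3 := by
      simp [Complex.logTaylor, Finset.sum_range_succ]; ring
    rw [h3] at this
    refine this.trans ?_
    have h2 : (1 - ‖e‖)⁻¹ ≤ 2 := by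
      rw [inv_le_comm₀ (by linarith) (by norm_num)]; linarith
    have h4 : 0 ≤ ‖e‖ ^ 4 := by positivity
    norm_num
    nlinarith
  obtain ⟨X, hX⟩ : ∃ X : ℂ, X = r * Complex.log (1 + e) + N * κ * (Complex.log (1 + e) - e + e ^ 2 / 2) :=
    ⟨_, rfl⟩
  have hfac : Complex.exp (r * Complex.log (1 + e) + N * (κ * (Complex.log (1 + e) - e) + s * e ^ 2))
      = Complex.exp (-(N * q) * τ ^ 2) * Complex.exp X := by
    rw [← Complex.exp_add, hX, hqs, he]; congr 1; ring
  have hlin : (r * ω * τ + N * κ * ω ^ 3 * τ ^ 3 / 3 : ℂ) = r * e + N * κ * (e ^ 3 / 3) := by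
    rw [he]; ring
  have hrc : ‖(r : ℂ)‖ ≤ 1 := by rw [Complex.norm_real]; exact hr
  have hNκ : ‖(N * κ : ℂ)‖ ≤ N := by
    rw [norm_mul, Complex.norm_real, Complex.norm_real, Real.norm_of_nonneg hN0.le,
      Real.norm_of_nonneg hκ0]
    nlinarith
  have b1 : ‖X - (r * e + N * κ * (e ^ 3 / 3))‖ ≤ ‖e‖ ^ 2 + N * ‖e‖ ^ 4 := by
    have : X - (r * e + N * κ * (e ^ 3 / 3)) = r * (Complex.log (1 + e) - e)
      + N * κ * (Complex.log (1 + e) - (e - e ^ 2 / 2 + e ^ 3 / 3)) := by rw [hX]; ring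
    rw [this]
    refine (norm_add_le _ _).trans ?_
    rw [norm_mul, norm_mul (N * κ : ℂ)]
    refine add_le_add ((mul_le_mul hrc l1 (norm_nonneg _) zero_le_one).trans (by rw [one_mul])) ?_
    exact mul_le_mul hNκ l3 (norm_nonneg _) hN0.le
  have b2 : ‖X‖ ≤ 2 * ‖e‖ + N * ‖e‖ ^ 3 := by
    rw [hX]
    refine (norm_add_le _ _).trans ?_
    rw [norm_mul, norm_mul (N * κ : ℂ)]
    have l2' : ‖Complex.log (1 + e) - e + e ^ 2 / 2‖ ≤ ‖e‖ ^ 3 := by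
      rwa [show Complex.log (1 + e) - e + e ^ 2 / 2 = Complex.log (1 + e) - (e - e ^ 2 / 2) by ring]
    refine add_le_add ?_ (mul_le_mul hNκ l2' (norm_nonneg _) hN0.le)
    have l0 : ‖Complex.log (1 + e)‖ ≤ 2 * ‖e‖ := by
      have : Complex.log (1 + e) = (Complex.log (1 + e) - e) + e := by ring
      rw [this]; refine (norm_add_le _ _).trans ?_
      nlinarith [norm_nonneg e]
    exact (mul_le_mul hrc l0 (norm_nonneg _) zero_le_one).trans (by rw [one_mul])
  have b3 : ‖X‖ ≤ 1 + c / 2 * (N * τ ^ 2) := by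
    have h3 : N * ‖e‖ ^ 3 ≤ c / 2 * (N * τ ^ 2) := by
      calc N * ‖e‖ ^ 3 ≤ N * (W * |τ|) ^ 3 := by gcongr
        _ = N * τ ^ 2 * (W ^ 3 * |τ|) := by rw [← sq_abs τ]; ring
        _ ≤ N * τ ^ 2 * ((W + 1) ^ 3 * (c / (4 * (W + 1) ^ 3))) := by gcongr; linarith
        _ = c / 4 * (N * τ ^ 2) := by field_simp
        _ ≤ _ := by gcongr; norm_num
    linarith
  have b4 : ‖Complex.exp (-(N * q) * τ ^ 2)‖ ≤ Real.exp (-(c * (N * τ ^ 2))) := by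
    rw [Complex.norm_exp]
    apply Real.exp_le_exp.2
    have : (-(N * q) * τ ^ 2 : ℂ) = ((-(N * τ ^ 2) : ℝ) : ℂ) * q := by push_cast; ring
    rw [this, Complex.re_ofReal_mul]
    have := mul_le_mul_of_nonneg_left hq (by positivity : 0 ≤ N * τ ^ 2)
    linarith
  have b5 : ‖Complex.exp X - (1 + (r * e + N * κ * (e ^ 3 / 3)))‖
      ≤ ‖e‖ ^ 2 + N * ‖e‖ ^ 4 + (8 * ‖e‖ ^ 2 + 2 * N ^ 2 * ‖e‖ ^ 6) *
        (Real.exp 1 * Real.exp (c / 2 * (N * τ ^ 2))) := by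
    have : Complex.exp X - (1 + (r * e + N * κ * (e ^ 3 / 3)))
      = (X - (r * e + N * κ * (e ^ 3 / 3))) + (Complex.exp X - 1 - X) := by ring
    rw [this]
    refine (norm_add_le _ _).trans (add_le_add b1 ?_)
    refine (norm_exp_sub_one_sub_le le_rfl).trans ?_
    rw [mul_comm, ← Real.exp_add]
    have : ‖X‖ ^ 2 ≤ 8 * ‖e‖ ^ 2 + 2 * N ^ 2 * ‖e‖ ^ 6 := by
      calc ‖X‖ ^ 2 ≤ (2 * ‖e‖ + N * ‖e‖ ^ 3) ^ 2 := by gcongr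
        _ ≤ _ := by nlinarith [sq_nonneg (2 * ‖e‖ - N * ‖e‖ ^ 3)]
    gcongr
  rw [hfac, hlin, ← mul_sub, norm_mul]
  obtain ⟨x, hx⟩ : ∃ x, x = N * τ ^ 2 := ⟨_, rfl⟩
  have hx0 : 0 ≤ x := by rw [hx]; positivity
  rw [← hx] at b4 b5 ⊢
  have m1 := hK1' x hx0
  have m2 := hK2' x hx0
  have m3 := hK3' x hx0
  have hc4 : c / 2 / 2 = c / 4 := by ring
  rw [hc4] at m1 m2 m3
  have hEsplit : Real.exp (-(c * x)) * Real.exp (c / 2 * x) = Real.exp (-(c / 2 * x)) := by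
    rw [← Real.exp_add]; congr 1; ring
  have hEle : Real.exp (-(c * x)) ≤ Real.exp (-(c / 2 * x)) := by
    have := mul_nonneg hc.le hx0
    apply Real.exp_le_exp.2; linarith
  have e2 : ‖e‖ ^ 2 ≤ W ^ 2 * x / N := by
    rw [le_div_iff₀ hN0, hx]
    calc ‖e‖ ^ 2 * N ≤ (W * |τ|) ^ 2 * N := by gcongr
      _ = _ := by rw [mul_pow, sq_abs]; ring
  have e4 : N * ‖e‖ ^ 4 ≤ W ^ 4 * x ^ 2 / N := by
    calc N * ‖e‖ ^ 4 = N * (‖e‖ ^ 2) ^ 2 := by ring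
      _ ≤ N * (W ^ 2 * x / N) ^ 2 := by gcongr
      _ = _ := by field_simp
  have e6 : N ^ 2 * ‖e‖ ^ 6 ≤ W ^ 6 * x ^ 3 / N := by
    calc N ^ 2 * ‖e‖ ^ 6 = N ^ 2 * (‖e‖ ^ 2) ^ 3 := by ring
      _ ≤ N ^ 2 * (W ^ 2 * x / N) ^ 3 := by gcongr
      _ = _ := by field_simp
  rw [pow_one] at m1
  calc _ ≤ Real.exp (-(c * x)) * (‖e‖ ^ 2 + N * ‖e‖ ^ 4 + (8 * ‖e‖ ^ 2 + 2 * N ^ 2 * ‖e‖ ^ 6) *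
        (Real.exp 1 * Real.exp (c / 2 * x))) := by gcongr
    _ = Real.exp (-(c * x)) * (‖e‖ ^ 2 + N * ‖e‖ ^ 4) + Real.exp 1 * (8 * ‖e‖ ^ 2
        + 2 * (N ^ 2 * ‖e‖ ^ 6)) * (Real.exp (-(c * x)) * Real.exp (c / 2 * x)) := by ring
    _ ≤ Real.exp (-(c / 2 * x)) * (W ^ 2 * x / N + W ^ 4 * x ^ 2 / N) + Real.exp 1 *
        (8 * (W ^ 2 * x / N) + 2 * (W ^ 6 * x ^ 3 / N)) * Real.exp (-(c / 2 * x)) := by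
        rw [hEsplit]; gcongr
    _ = 1 / N * (W ^ 2 * (x * Real.exp (-(c / 2 * x))) + W ^ 4 * (x ^ 2 * Real.exp (-(c / 2 * x)))
        + Real.exp 1 * (8 * W ^ 2 * (x * Real.exp (-(c / 2 * x)))
          + 2 * W ^ 6 * (x ^ 3 * Real.exp (-(c / 2 * x))))) := by ring
    _ ≤ 1 / N * (W ^ 2 * (K1 * Real.exp (-(c / 4 * x))) + W ^ 4 * (K2 * Real.exp (-(c / 4 * x)))
        + Real.exp 1 * (8 * W ^ 2 * (K1 * Real.exp (-(c / 4 * x)))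
          + 8 * W ^ 6 * (K3 * Real.exp (-(c / 4 * x))))) := by gcongr; norm_num
    _ = _ := by ring

/-- Near the saddle point no branch of the logarithm is crossed. -/
theorem log_add_of_re_pos {ζ e : ℂ} (hζ : 0 < ζ.re) (he : ‖e‖ ≤ 1 / 2) :
    Complex.log (ζ * (1 + e)) = Complex.log ζ + Complex.log (1 + e) := by
  have h1 : 0 < (1 + e).re := by
    have := (abs_le.1 ((Complex.abs_re_le_norm e).trans he)).1
    rw [Complex.add_re, Complex.one_re]; linarith
  have a1 := Complex.abs_arg_lt_pi_div_two_iff.2 (Or.inl hζ)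
  have a2 := Complex.abs_arg_lt_pi_div_two_iff.2 (Or.inl h1)
  rw [abs_lt] at a1 a2
  refine Complex.log_mul ?_ ?_ ⟨by linarith, by linarith⟩
  · rintro rfl; simp at hζ
  · intro h; rw [h] at h1; simp at h1

/-- The contour integrand near the saddle point, in the relative coordinate. -/
theorem saddle_integrand_eq {ζ z e : ℂ} {κ : ℝ} (hζ : 0 < ζ.re) (he : ‖e‖ ≤ 1 / 2)
    (hs : 4 * ζ * (z - ζ) = κ) (N r : ℝ) :
    (ζ * (1 + e)) ^ ((N * κ + r : ℝ) : ℂ) * Complex.exp (2 * N * (ζ * (1 + e) - z) ^ 2)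
      = saddleExp N z ζ κ * ζ ^ (r : ℂ) * Complex.exp (r * Complex.log (1 + e)
        + N * (κ * (Complex.log (1 + e) - e) + 2 * ζ ^ 2 * e ^ 2)) := by
  have h0 : ζ ≠ 0 := by rintro rfl; simp at hζ
  have h1 : 1 + e ≠ 0 := by
    intro h
    have : ‖e‖ = 1 := by rw [show e = -1 by linear_combination h]; simp
    linarith
  rw [cpow_mul_exp_eq_saddleExp (mul_ne_zero h0 h1), saddleExp, saddleExp,
    Complex.cpow_def_of_ne_zero (mul_ne_zero h0 h1), Complex.cpow_def_of_ne_zero h0,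
    log_add_of_re_pos hζ he, ← Complex.exp_add, ← Complex.exp_add, ← Complex.exp_add, ← hs]
  congr 1; ring

theorem norm_cpow_le_of_bounds {ζ : ℂ} {a b r : ℝ} (ha : 0 < a) (h1 : a ≤ ‖ζ‖) (h2 : ‖ζ‖ ≤ b)
    (hr : |r| ≤ 1) : ‖ζ ^ (r : ℂ)‖ ≤ 1 + b + a⁻¹ := by
  have h0 : 0 < ‖ζ‖ := ha.trans_le h1
  have hr' := abs_le.1 hr
  rw [Complex.norm_cpow_of_ne_zero (norm_pos_iff.1 h0)]
  simp only [Complex.ofReal_re, Complex.ofReal_im, mul_zero, Real.exp_zero, div_one]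
  have hai : 0 < a⁻¹ := by positivity
  rcases le_total 1 ‖ζ‖ with h | h
  · have := Real.rpow_le_rpow_of_exponent_le h hr'.2
    rw [Real.rpow_one] at this; linarith
  · have := Real.rpow_le_rpow_of_exponent_ge h0 h hr'.1
    rw [Real.rpow_neg_one] at this
    have h3 : ‖ζ‖⁻¹ ≤ a⁻¹ := by gcongr
    linarith

open MeasureTheory Set in
set_option maxHeartbeats 1000000 in
/-- Laplace's method with relative error `O(1 / N)` for the contour integrals. -/
theorem contourIntegral_laplace {c C ts ρ : ℝ} (hc : 0 < c) (hC : 0 < C) (hts : 0 < ts) (hρ : 0 < ρ)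
    (hρts : ρ < ts) (m : ℕ) {r : ℝ} (hr : |r| ≤ 1) :
    ∃ K N0 : ℝ, 0 ≤ K ∧ ∀ N : ℝ, N0 ≤ N → ∀ z Q v : ℂ, ∀ κ : ℝ, SaddleBounds c C ts ρ z Q v κ →
      ∀ F : ℝ → ℂ, ContinuousOn F (Ioi 0) → (∀ t, 0 < t → ‖F t - 1‖ ≤ m / N * (1 + 1 / t) ^ m) →
      ‖contourIntegral N z Q v F (N * κ + r : ℝ) - saddleExp N z (brokenLine Q v ts) κ *
          brokenLine Q v ts ^ (r : ℂ) * brokenLineVel Q v ts *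
          (Real.pi / (N * ((κ / 2 - 2 * brokenLine Q v ts ^ 2) *
            (brokenLineVel Q v ts / brokenLine Q v ts) ^ 2))) ^ (1 / 2 : ℂ)‖
        ≤ K / (N * √N) * ‖saddleExp N z (brokenLine Q v ts) κ‖ := by
  obtain ⟨K1, N1, hK1, hup⟩ := saddle_integrand_le hc hC hts m hr
  obtain ⟨W, hW⟩ : ∃ W, W = C / (c * ts) := ⟨_, rfl⟩
  have hW0 : 0 < W := by rw [hW]; positivity
  obtain ⟨ρ1, K2, hρ1, hK2, hloc⟩ := norm_saddle_expansion_le hc hW0.le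
  obtain ⟨M1, hM1, hM1'⟩ := exists_pow_mul_exp_neg_le (half_pos hc) 1
  obtain ⟨M2, hM2, hM2'⟩ := exists_pow_mul_exp_neg_le (half_pos hc) 2
  obtain ⟨p, hp⟩ : ∃ p, p = min ρ ρ1 := ⟨_, rfl⟩
  have hp0 : 0 < p := by rw [hp]; exact lt_min hρ hρ1
  obtain ⟨R, hR⟩ : ∃ R, R = 1 + C * ts + (c * ts)⁻¹ := ⟨_, rfl⟩
  have hR0 : 0 < R := by rw [hR]; positivity
  obtain ⟨K3, hK3⟩ : ∃ K3, K3 = (C * R * K2 + C * K1 * m) + (C * K1 * (1 + m) * (M1 / p ^ 2)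
    + R * C * ((1 / p ^ 2 + W / p) * M1 + W ^ 3 / p * M2)) := ⟨_, rfl⟩
  have hK30 : 0 ≤ K3 := by rw [hK3]; positivity
  refine ⟨K3 * √(Real.pi / (c / 4)), max (max N1 1) ((m + 2) / c), by positivity,
    fun N hN z Q v κ h F hFc hF => ?_⟩
  have hN1 : N1 ≤ N := (le_max_left _ _).trans ((le_max_left _ _).trans hN)
  have hN1' : 1 ≤ N := (le_max_right _ _).trans ((le_max_left _ _).trans hN)
  have hNm : (m : ℝ) + 2 ≤ N * c := by
    have := (le_max_right _ _).trans hN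
    rwa [div_le_iff₀ hc] at this
  have hN0 : 0 < N := by linarith
  have hκ0 : 0 ≤ κ := hc.le.trans h.κ_ge
  have hr' := abs_le.1 hr
  set ζ := brokenLine Q v ts with hζ
  set V := brokenLineVel Q v ts with hV
  set S := saddleExp N z ζ κ with hS
  set ω := V / ζ with hω
  set q := ((κ : ℂ) / 2 - 2 * ζ ^ 2) * ω ^ 2 with hq
  have hζ0 : ζ ≠ 0 := h.line.ne_zero hts
  have hζre : 0 < ζ.re := h.line.re_pos hts
  have hVC : ‖V‖ ≤ C := h.line.norm_vel_le ts
  have hωW : ‖ω‖ ≤ W := by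
    rw [hω, hW, norm_div]
    exact div_le_div₀ hC.le hVC (by positivity) (h.line.norm_ge hts.le)
  have hζr : ‖ζ ^ (r : ℂ)‖ ≤ R := by
    rw [hR]
    exact norm_cpow_le_of_bounds (by positivity) (h.line.norm_ge hts.le) (h.line.norm_le hts.le) hr
  have hqre : c ≤ q.re := h.re_ge
  -- the integrand, and its model at the saddle point
  set f : ℝ → ℂ := fun t => brokenLineVel Q v t * (brokenLine Q v t ^ ((N * κ + r : ℝ) : ℂ) *
    (Complex.exp (2 * N * (brokenLine Q v t - z) ^ 2) * F t)) with hf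
  have hFB : ∀ t, 0 < t → ‖F t‖ ≤ (1 + m) * (1 + 1 / t) ^ m := fun t ht => by
    have h1 : 1 ≤ (1 + 1 / t) ^ m := one_le_pow₀ (by have : 0 < 1 / t := by positivity
                                                     linarith)
    have h2 : F t = (F t - 1) + 1 := by ring
    rw [h2]
    refine (norm_add_le _ _).trans ?_
    rw [norm_one]
    have h3 := hF t ht
    have h4 : (m : ℝ) / N ≤ m := div_le_self (Nat.cast_nonneg m) hN1'
    nlinarith [mul_le_mul_of_nonneg_right h4 (by linarith : 0 ≤ (1 + 1 / t) ^ m)]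
  have hfi : IntegrableOn f (Ioi 0) := h.line.integrableOn_integrand hN0
    (by nlinarith [h.κ_ge]) hFc hFB
  have hfb : ∀ t, 0 < t → ‖f t‖ ≤ C * (K1 * (1 + m) * ‖S‖ * Real.exp (-(c / 2 * (N * (t - ts) ^ 2)))) :=
    fun t ht => by
      rw [hf]; simp only; rw [norm_mul]
      exact mul_le_mul (h.line.norm_vel_le t) (hup ρ N hN1 z Q v κ h t ht _ _ (hFB t ht))
        (norm_nonneg _) hC.le
  -- The correction of relative order `N ^ (-1 / 2)` is odd in `τ`, so it does not contribute to the
  -- integral of the model.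
  set o : ℝ → ℂ := fun τ => r * ω * τ + N * κ * ω ^ 3 * τ ^ 3 / 3 with ho
  set g : ℝ → ℂ := fun τ => S * ζ ^ (r : ℂ) * V * (Complex.exp (-(N * q) * τ ^ 2) * (1 + o τ)) with hg
  set H : ℝ → ℂ := fun τ => (Ioi (0 : ℝ)).indicator f (ts + τ) with hH
  have hHint : Integrable H := ((integrable_indicator_iff measurableSet_Ioi).2 hfi).comp_add_left ts
  have hHval : ∫ τ, H τ = contourIntegral N z Q v F (N * κ + r : ℝ) := by
    rw [hH, integral_add_left_eq_self (fun t => (Ioi (0 : ℝ)).indicator f t) ts,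
      integral_indicator measurableSet_Ioi]; rfl
  have hpt : ∀ τ, ‖H τ - g τ‖ ≤ K3 / N * ‖S‖ * Real.exp (-(c / 4) * N * τ ^ 2) := by
    intro τ
    obtain ⟨x, hx⟩ : ∃ x, x = N * τ ^ 2 := ⟨_, rfl⟩
    have hx0 : 0 ≤ x := by rw [hx]; positivity
    have hex : Real.exp (-(c / 4) * N * τ ^ 2) = Real.exp (-(c / 4 * x)) := by rw [hx]; congr 1; ring
    have hc4 : c / 2 / 2 = c / 4 := by ring
    rw [hex]
    -- Within distance `p` of the saddle point the expansion applies; beyond it both the integrand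
    -- and the model are small, since `1 ≤ N τ² / (N p²)`.
    rcases le_or_gt |τ| p with hτ | hτ
    · have hτρ : |τ| ≤ ρ := hτ.trans (hp ▸ min_le_left _ _)
      have hτ1 : |τ| ≤ ρ1 := hτ.trans (hp ▸ min_le_right _ _)
      have ht0 : 0 < ts + τ := by linarith [neg_abs_le τ]
      obtain ⟨he, hexp⟩ := hloc N r κ τ ω q hN1' hr hκ0 h.κ_le hτ1 hωW hqre (2 * ζ ^ 2) rfl
      have hpos : brokenLine Q v (ts + τ) = ζ * (1 + ω * τ) := by
        rw [h.straight τ hτρ, hω]; field_simp; ring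
      have hHτ : H τ = V * (S * ζ ^ (r : ℂ) * Complex.exp (r * Complex.log (1 + ω * τ)
        + N * (κ * (Complex.log (1 + ω * τ) - ω * τ) + 2 * ζ ^ 2 * (ω * τ) ^ 2)))
        + V * (brokenLine Q v (ts + τ) ^ ((N * κ + r : ℝ) : ℂ) *
          (Complex.exp (2 * N * (brokenLine Q v (ts + τ) - z) ^ 2) * (F (ts + τ) - 1))) := by
        rw [hH]; simp only
        rw [indicator_of_mem (mem_Ioi.2 ht0), hf]; simp only
        rw [h.vel τ hτρ, ← saddle_integrand_eq hζre he h.saddle, hpos]; ring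
      have hsec := hup ρ N hN1 z Q v κ h _ ht0 _ _ (hF _ ht0)
      rw [show ts + τ - ts = τ by ring, ← hx] at hsec
      rw [← hx] at hexp
      have hEle : Real.exp (-(c / 2 * x)) ≤ Real.exp (-(c / 4 * x)) := by
        have := mul_nonneg hc.le hx0
        apply Real.exp_le_exp.2; linarith
      have hsplit : H τ - g τ = V * (S * ζ ^ (r : ℂ)) *
          (Complex.exp (r * Complex.log (1 + ω * τ)
            + N * (κ * (Complex.log (1 + ω * τ) - ω * τ) + 2 * ζ ^ 2 * (ω * τ) ^ 2))
            - Complex.exp (-(N * q) * τ ^ 2) * (1 + o τ))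
        + V * (brokenLine Q v (ts + τ) ^ ((N * κ + r : ℝ) : ℂ) *
          (Complex.exp (2 * N * (brokenLine Q v (ts + τ) - z) ^ 2) * (F (ts + τ) - 1))) := by
        rw [hHτ, hg]; ring
      rw [hsplit]
      refine (norm_add_le _ _).trans ?_
      rw [norm_mul, norm_mul V (S * _), norm_mul S, norm_mul V]
      calc _ ≤ C * (‖S‖ * R) * (K2 / N * Real.exp (-(c / 4 * x)))
            + C * (K1 * (m / N) * ‖S‖ * Real.exp (-(c / 4 * x))) := by
            gcongr
            exact hsec.trans (by gcongr)
        _ = (C * R * K2 + C * K1 * m) / N * ‖S‖ * Real.exp (-(c / 4 * x)) := by ring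
        _ ≤ _ := by
            gcongr
            rw [hK3]
            exact le_add_of_nonneg_right (by positivity)
    · have hτ0 : 0 < |τ| := hp0.trans hτ
      have hp2 : 1 ≤ x / (N * p ^ 2) := by
        rw [one_le_div (by positivity), hx]
        have : p ^ 2 ≤ τ ^ 2 := by rw [← sq_abs τ]; gcongr
        exact mul_le_mul_of_nonneg_left this hN0.le
      have m1 := hM1' x hx0
      have m2 := hM2' x hx0
      rw [hc4] at m1 m2
      rw [pow_one] at m1
      have hHb : ‖H τ‖ ≤ C * K1 * (1 + m) * (M1 / p ^ 2) / N * ‖S‖ * Real.exp (-(c / 4 * x)) := by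
        by_cases ht0 : 0 < ts + τ
        · have h1 := hfb _ ht0
          rw [show ts + τ - ts = τ by ring, ← hx] at h1
          have h2 : H τ = f (ts + τ) := by
            rw [hH]; simp only; rw [indicator_of_mem (mem_Ioi.2 ht0)]
          rw [h2]
          refine h1.trans ?_
          calc _ = C * (K1 * (1 + m) * ‖S‖) * (1 * Real.exp (-(c / 2 * x))) := by ring
            _ ≤ C * (K1 * (1 + m) * ‖S‖) * (x / (N * p ^ 2) * Real.exp (-(c / 2 * x))) := by gcongr
            _ = C * (K1 * (1 + m) * ‖S‖) / (N * p ^ 2) * (x * Real.exp (-(c / 2 * x))) := by ring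
            _ ≤ C * (K1 * (1 + m) * ‖S‖) / (N * p ^ 2) * (M1 * Real.exp (-(c / 4 * x))) := by gcongr
            _ = _ := by ring
        · have h2 : H τ = 0 := by
            rw [hH]; simp only; rw [indicator_of_notMem (by rwa [mem_Ioi])]
          rw [h2, norm_zero]; positivity
      have hgb : ‖g τ‖ ≤ R * C * ((1 / p ^ 2 + W / p) * M1 + W ^ 3 / p * M2) / N * ‖S‖ *
          Real.exp (-(c / 4 * x)) := by
        have b4 : ‖Complex.exp (-(N * q) * τ ^ 2)‖ ≤ Real.exp (-(c / 2 * x)) := by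
          rw [Complex.norm_exp]
          apply Real.exp_le_exp.2
          have h5 : (-(N * q) * τ ^ 2 : ℂ) = ((-x : ℝ) : ℂ) * q := by rw [hx]; push_cast; ring
          rw [h5, Complex.re_ofReal_mul]
          have := mul_le_mul_of_nonneg_left hqre hx0
          have := mul_nonneg hc.le hx0
          linarith
        have b6 : |τ| ≤ x / (N * p) := by
          rw [le_div_iff₀ (by positivity), hx, ← sq_abs τ]
          nlinarith [mul_le_mul_of_nonneg_left hτ.le (by positivity : 0 ≤ N * |τ|)]
        have b7 : N * |τ| ^ 3 ≤ x ^ 2 / (N * p) := by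
          rw [le_div_iff₀ (by positivity), hx, ← sq_abs τ]
          nlinarith [mul_le_mul_of_nonneg_left hτ.le (by positivity : 0 ≤ N ^ 2 * |τ| ^ 3)]
        have b5 : ‖1 + o τ‖ ≤ x / (N * p ^ 2) + W * (x / (N * p)) + W ^ 3 * (x ^ 2 / (N * p)) := by
          rw [ho]; simp only; rw [← add_assoc]
          refine (norm_add_le _ _).trans (add_le_add ((norm_add_le _ _).trans (add_le_add ?_ ?_)) ?_)
          · rw [norm_one]; exact hp2
          · rw [norm_mul, norm_mul, Complex.norm_real, Complex.norm_real, Real.norm_eq_abs,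
              Real.norm_eq_abs]
            calc |r| * ‖ω‖ * |τ| ≤ 1 * W * (x / (N * p)) := by gcongr
              _ = _ := by ring
          · rw [norm_div, norm_mul, norm_mul, norm_mul, norm_pow, norm_pow, Complex.norm_real,
              Complex.norm_real, Complex.norm_real, Real.norm_eq_abs, Real.norm_eq_abs,
              Real.norm_eq_abs, abs_of_pos hN0, abs_of_nonneg hκ0, Complex.norm_ofNat]
            calc N * κ * ‖ω‖ ^ 3 * |τ| ^ 3 / 3 ≤ N * κ * ‖ω‖ ^ 3 * |τ| ^ 3 :=
                  div_le_self (by positivity) (by norm_num)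
              _ = κ * ‖ω‖ ^ 3 * (N * |τ| ^ 3) := by ring
              _ ≤ 1 * W ^ 3 * (x ^ 2 / (N * p)) := by gcongr; exact h.κ_le
              _ = _ := by ring
        rw [hg]; simp only
        rw [norm_mul, norm_mul, norm_mul, norm_mul]
        calc _ ≤ ‖S‖ * R * C * (Real.exp (-(c / 2 * x)) *
              (x / (N * p ^ 2) + W * (x / (N * p)) + W ^ 3 * (x ^ 2 / (N * p)))) := by gcongr
          _ = ‖S‖ * R * C / N * ((1 / p ^ 2 + W / p) * (x * Real.exp (-(c / 2 * x)))
              + W ^ 3 / p * (x ^ 2 * Real.exp (-(c / 2 * x)))) := by field_simp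
          _ ≤ ‖S‖ * R * C / N * ((1 / p ^ 2 + W / p) * (M1 * Real.exp (-(c / 4 * x)))
              + W ^ 3 / p * (M2 * Real.exp (-(c / 4 * x)))) := by gcongr
          _ = _ := by ring
      refine (norm_sub_le _ _).trans ((add_le_add hHb hgb).trans ?_)
      rw [← add_mul, ← add_mul, ← add_div]
      gcongr
      rw [hK3]
      exact le_add_of_nonneg_left (by positivity)
  have hcN : 0 < c / 4 * N := by positivity
  have hgauss : Integrable (fun τ : ℝ => K3 / N * ‖S‖ * Real.exp (-(c / 4) * N * τ ^ 2)) := by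
    have := (integrable_exp_neg_mul_sq hcN).const_mul (K3 / N * ‖S‖)
    refine this.congr (Filter.Eventually.of_forall fun τ => ?_)
    simp only; congr 2; ring
  have hgcont : Continuous g := by rw [hg, ho]; fun_prop
  have hHg : Integrable (fun τ => H τ - g τ) :=
    hgauss.mono' (hHint.aestronglyMeasurable.sub hgcont.aestronglyMeasurable)
      (Filter.Eventually.of_forall hpt)
  have hgi : Integrable g := by
    refine (hHint.sub hHg).congr (Filter.Eventually.of_forall fun τ => ?_)
    simp
  have hqN : 0 < ((N : ℂ) * q).re := by
    rw [Complex.re_ofReal_mul]; exact mul_pos hN0 (hc.trans_le hqre)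
  have hgval : ∫ τ, g τ = S * ζ ^ (r : ℂ) * V * (Real.pi / (N * q)) ^ (1 / 2 : ℂ) := by
    have i1 := (integrable_cexp_neg_mul_sq hqN).const_mul (S * ζ ^ (r : ℂ) * V)
    have hodd : ∫ τ : ℝ, (g τ - S * ζ ^ (r : ℂ) * V * Complex.exp (-(N * q) * τ ^ 2)) = 0 := by
      have h1 := integral_neg_eq_self
        (fun τ : ℝ => g τ - S * ζ ^ (r : ℂ) * V * Complex.exp (-(N * q) * τ ^ 2)) volume
      have h2 : (fun τ : ℝ => g (-τ) - S * ζ ^ (r : ℂ) * V * Complex.exp (-(N * q) * (-τ : ℝ) ^ 2))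
          = fun τ : ℝ => -(g τ - S * ζ ^ (r : ℂ) * V * Complex.exp (-(N * q) * τ ^ 2)) := by
        funext τ
        rw [hg, ho]; simp only; push_cast; ring_nf
      rw [h2, integral_neg] at h1
      exact self_eq_neg.1 h1.symm
    have h4 : ∫ τ : ℝ, S * ζ ^ (r : ℂ) * V * Complex.exp (-(N * q) * τ ^ 2)
        = S * ζ ^ (r : ℂ) * V * (Real.pi / (N * q)) ^ (1 / 2 : ℂ) := by
      rw [integral_const_mul, integral_gaussian_complex hqN]
    rw [integral_sub hgi i1, h4, sub_eq_zero] at hodd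
    exact hodd
  rw [← hHval, ← hgval, ← integral_sub hHint hgi]
  refine (norm_integral_le_of_norm_le hgauss (Filter.Eventually.of_forall hpt)).trans ?_
  rw [integral_const_mul]
  have : ∫ τ : ℝ, Real.exp (-(c / 4) * N * τ ^ 2) = √(Real.pi / (c / 4)) / √N := by
    have h1 := integral_gaussian (c / 4 * N)
    rw [← Real.sqrt_div (by positivity), div_div, ← h1]
    congr 1; funext τ; congr 1; ring
  rw [this]
  apply le_of_eq
  field_simp

/-! ### Stability of the descent conditions -/

/-- An upper bound for the phase near a saddle point, to second order, with a cubic error. -/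
theorem re_phase_expansion {ζ z e : ℂ} {κ : ℝ} (hζ : ζ ≠ 0) (he : ‖e‖ ≤ 1 / 2) (hκ : 0 ≤ κ)
    (hs : 4 * ζ * (z - ζ) = κ) :
    κ * Real.log ‖ζ * (1 + e)‖ + 2 * ((ζ * (1 + e) - z) ^ 2).re
      - (κ * Real.log ‖ζ‖ + 2 * ((ζ - z) ^ 2).re)
      ≤ -((κ / 2 - 2 * ζ ^ 2) * e ^ 2).re + κ * ‖e‖ ^ 3 := by
  have h1 : 1 + e ≠ 0 := by
    intro h
    have : ‖e‖ = 1 := by rw [show e = -1 by linear_combination h]; simp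
    linarith
  have hlog : Real.log ‖ζ * (1 + e)‖ = Real.log ‖ζ‖ + (Complex.log (1 + e)).re := by
    rw [norm_mul, Real.log_mul (norm_ne_zero_iff.2 hζ) (norm_ne_zero_iff.2 h1), Complex.log_re]
  have l2 : ‖Complex.log (1 + e) - (e - e ^ 2 / 2)‖ ≤ ‖e‖ ^ 3 := by
    have := Complex.norm_log_sub_logTaylor_le 2 (z := e) (by linarith)
    have h3 : Complex.logTaylor 3 e = e - e ^ 2 / 2 := by
      simp [Complex.logTaylor, Finset.sum_range_succ]; ring
    rw [h3] at this
    refine this.trans ?_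
    have h2 : (1 - ‖e‖)⁻¹ ≤ 2 := by
      rw [inv_le_comm₀ (by linarith) (by norm_num)]; linarith
    have h4 : 0 ≤ ‖e‖ ^ 3 := by positivity
    norm_num
    nlinarith
  have l3 := mul_le_mul_of_nonneg_left ((Complex.re_le_norm _).trans l2) hκ
  have hsq : (ζ * (1 + e) - z) ^ 2 = (ζ - z) ^ 2 - ((κ / 2 : ℝ) : ℂ) * e + ζ ^ 2 * e ^ 2 := by
    push_cast
    rw [← hs]; ring
  have hq : ((κ / 2 - 2 * ζ ^ 2) * e ^ 2 : ℂ)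
      = ((κ / 2 : ℝ) : ℂ) * e ^ 2 - ((2 : ℝ) : ℂ) * (ζ ^ 2 * e ^ 2) := by push_cast; ring
  have h2 : (e ^ 2 / 2 : ℂ) = ((1 / 2 : ℝ) : ℂ) * e ^ 2 := by push_cast; ring
  rw [Complex.sub_re, Complex.sub_re, h2, Complex.re_ofReal_mul] at l3
  rw [hlog, hsq, hq]
  simp only [Complex.add_re, Complex.sub_re, Complex.re_ofReal_mul]
  linarith

theorem BrokenLineBounds.mono {c C c' C' : ℝ} {z Q v : ℂ} (h : BrokenLineBounds c C z Q v)
    (hc : 0 < c') (hcc : c' ≤ c) (hCC : C ≤ C') : BrokenLineBounds c' C' z Q v where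
  c_pos := hc
  norm_z := h.norm_z.trans hCC
  norm_Q := h.norm_Q.trans hCC
  norm_v := h.norm_v.trans hCC
  re_Q := hcc.trans h.re_Q
  re_v := hcc.trans h.re_v
  start := h.start.trans (by linarith)
  corner := h.corner.trans (by linarith)
  corner' := h.corner'.trans (by linarith)
  sq := h.sq.trans (by linarith)

open Filter Topology Asymptotics

/-- The bounds on the broken line are open conditions, up to a change of the constants. -/
theorem eventually_brokenLineBounds {P : Type*} [TopologicalSpace P] {p₀ : P} {z Q v : P → ℂ}
    (hz : ContinuousAt z p₀) (hQ : ContinuousAt Q p₀) (hv : ContinuousAt v p₀) {c C : ℝ}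
    (h : BrokenLineBounds c C (z p₀) (Q p₀) (v p₀)) :
    ∀ᶠ p in 𝓝 p₀, BrokenLineBounds (c / 2) (C + 1) (z p) (Q p) (v p) := by
  have hc := h.c_pos
  have hre : ∀ {f : P → ℂ}, ContinuousAt f p₀ → ContinuousAt (fun p => (f p).re) p₀ :=
    fun hf => Complex.continuous_re.continuousAt.comp hf
  have e1 := hz.norm.eventually_lt_const (h.norm_z.trans_lt (lt_add_one C))
  have e2 := hQ.norm.eventually_lt_const (h.norm_Q.trans_lt (lt_add_one C))
  have e3 := hv.norm.eventually_lt_const (h.norm_v.trans_lt (lt_add_one C))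
  have e4 := (hre hQ).eventually_const_lt ((half_lt_self hc).trans_le h.re_Q)
  have e5 := (hre hv).eventually_const_lt ((half_lt_self hc).trans_le h.re_v)
  have hlt : -c < -(c / 2) := by linarith
  have e6 := (hre (hz.neg.mul hQ)).eventually_lt_const (h.start.trans_lt hlt)
  have e7 := (hre ((hQ.sub hz).mul hQ)).eventually_lt_const (h.corner.trans_lt hlt)
  have e8 := (hre ((hQ.sub hz).mul hv)).eventually_lt_const (h.corner'.trans_lt hlt)
  have e9 := (hre (hv.mul hv)).eventually_lt_const (h.sq.trans_lt hlt)
  filter_upwards [e1, e2, e3, e4, e5, e6, e7, e8, e9] with p h1 h2 h3 h4 h5 h6 h7 h8 h9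
  exact ⟨half_pos hc, h1.le, h2.le, h3.le, h4.le, h5.le, h6.le, h7.le, h8.le, h9.le⟩

/-- Local descent: near a nondegenerate saddle point the phase drops quadratically. -/
theorem phase_decay_near {c C ts ρ : ℝ} {z Q v : ℂ} {κ b : ℝ} (hts : 0 < ts) (hb : 0 < b)
    (h : BrokenLineBounds c C z Q v) (hκ0 : 0 ≤ κ) (hκ1 : κ ≤ 1)
    (hstr : ∀ τ : ℝ, |τ| ≤ ρ →
      brokenLine Q v (ts + τ) = brokenLine Q v ts + τ * brokenLineVel Q v ts)
    (hs : 4 * brokenLine Q v ts * (z - brokenLine Q v ts) = κ)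
    (hre : b ≤ ((κ / 2 - 2 * brokenLine Q v ts ^ 2) *
      (brokenLineVel Q v ts / brokenLine Q v ts) ^ 2).re)
    {t : ℝ} (h1 : |t - ts| ≤ ρ) (h2 : |t - ts| ≤ c * ts / (2 * C))
    (h3 : |t - ts| ≤ b / 2 * (c * ts / C) ^ 3) :
    κ * Real.log ‖brokenLine Q v t‖ + 2 * ((brokenLine Q v t - z) ^ 2).re
      - (κ * Real.log ‖brokenLine Q v ts‖ + 2 * ((brokenLine Q v ts - z) ^ 2).re)
      ≤ -(b / 2) * (t - ts) ^ 2 := by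
  have hc := h.c_pos
  have hC := h.C_pos
  have hζ0 := h.ne_zero hts
  set ζ := brokenLine Q v ts
  set V := brokenLineVel Q v ts
  obtain ⟨τ, hτ⟩ : ∃ τ, τ = t - ts := ⟨_, rfl⟩
  rw [← hτ] at h1 h2 h3 ⊢
  have hW : ‖V / ζ‖ ≤ C / (c * ts) := by
    rw [norm_div]
    exact div_le_div₀ hC.le (h.norm_vel_le ts) (by positivity) (h.norm_ge hts.le)
  have he : ‖V / ζ * τ‖ ≤ C / (c * ts) * |τ| := by
    rw [norm_mul, Complex.norm_real, Real.norm_eq_abs]; gcongr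
  have he2 : ‖V / ζ * τ‖ ≤ 1 / 2 := he.trans (by
    calc C / (c * ts) * |τ| ≤ C / (c * ts) * (c * ts / (2 * C)) := by gcongr
      _ = 1 / 2 := by field_simp)
  have hpos : brokenLine Q v t = ζ * (1 + V / ζ * τ) := by
    have := hstr τ h1
    rw [show ts + τ = t by rw [hτ]; ring] at this
    rw [this]; field_simp
  rw [hpos]
  refine (re_phase_expansion hζ0 he2 hκ0 hs).trans ?_
  have e1 : ((κ / 2 - 2 * ζ ^ 2) * (V / ζ * τ) ^ 2 : ℂ)
      = ((τ ^ 2 : ℝ) : ℂ) * ((κ / 2 - 2 * ζ ^ 2) * (V / ζ) ^ 2) := by push_cast; ring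
  rw [e1, Complex.re_ofReal_mul]
  have e2 : κ * ‖V / ζ * τ‖ ^ 3 ≤ b / 2 * τ ^ 2 := by
    calc κ * ‖V / ζ * τ‖ ^ 3 ≤ 1 * (C / (c * ts) * |τ|) ^ 3 := by gcongr
      _ = (C / (c * ts)) ^ 3 * τ ^ 2 * |τ| := by rw [← sq_abs τ]; ring
      _ ≤ (C / (c * ts)) ^ 3 * τ ^ 2 * (b / 2 * (c * ts / C) ^ 3) := by gcongr
      _ = b / 2 * τ ^ 2 := by field_simp
  have e3 := mul_le_mul_of_nonneg_left hre (sq_nonneg τ)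
  linarith

/-- Far descent: the Gaussian factor dominates at the far end of the line. -/
theorem exists_phase_decay_far {c C ts : ℝ} (hc : 0 < c) (hC : 0 < C) (hts : 0 < ts) :
    ∃ T : ℝ, ∀ z Q v : ℂ, ∀ κ : ℝ, BrokenLineBounds c C z Q v → 0 ≤ κ → κ ≤ 1 → ∀ t, T ≤ t →
    κ * Real.log ‖brokenLine Q v t‖ + 2 * ((brokenLine Q v t - z) ^ 2).re
      - (κ * Real.log ‖brokenLine Q v ts‖ + 2 * ((brokenLine Q v ts - z) ^ 2).re)
      ≤ -(c / 2) * (t - ts) ^ 2 := by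
  obtain ⟨L, hL⟩ : ∃ L, L = |Real.log (c * ts)| + 2 * (C * ts + C) ^ 2 := ⟨_, rfl⟩
  have hL0 : 0 ≤ L := by rw [hL]; positivity
  refine ⟨1 + (C + 2 * C ^ 2 + 2 * c + L + c * ts ^ 2) / c, fun z Q v κ h hκ0 hκ1 t ht => ?_⟩
  have ht1 : 1 ≤ t := le_trans (by
    have : 0 ≤ (C + 2 * C ^ 2 + 2 * c + L + c * ts ^ 2) / c := by positivity
    linarith) ht
  have ht0 : 0 < t := by linarith
  have ht2 : (C + 2 * C ^ 2 + 2 * c + L + c * ts ^ 2) ≤ c * t := by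
    have : (C + 2 * C ^ 2 + 2 * c + L + c * ts ^ 2) / c ≤ t := by linarith
    rw [div_le_iff₀ hc] at this; linarith
  have a1 : κ * Real.log ‖brokenLine Q v t‖ ≤ C * t := by
    have h1 : Real.log ‖brokenLine Q v t‖ ≤ C * t := by
      have := Real.log_le_sub_one_of_pos (norm_pos_iff.2 (h.ne_zero ht0))
      linarith [h.norm_le ht0.le]
    calc _ ≤ κ * (C * t) := by gcongr
      _ ≤ 1 * (C * t) := by gcongr
      _ = _ := one_mul _
  have a2 := h.re_sq_le_gaussian ht0.le
  have a3 : -(κ * Real.log ‖brokenLine Q v ts‖) ≤ |Real.log (c * ts)| := by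
    have e1 : Real.log (c * ts) ≤ Real.log ‖brokenLine Q v ts‖ :=
      Real.log_le_log (by positivity) (h.norm_ge hts.le)
    have e5 : 0 ≤ |Real.log (c * ts)| := abs_nonneg _
    have e7 := mul_le_mul_of_nonneg_left ((neg_abs_le (Real.log (c * ts))).trans e1) hκ0
    nlinarith
  have a4 : -((brokenLine Q v ts - z) ^ 2).re ≤ (C * ts + C) ^ 2 := by
    refine (neg_le_abs _).trans ((Complex.abs_re_le_norm _).trans ?_)
    rw [norm_pow]
    exact pow_le_pow_left₀ (norm_nonneg _) ((norm_sub_le _ _).trans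
      (add_le_add (h.norm_le hts.le) h.norm_z)) 2
  have a5 : (C + 2 * C ^ 2 + 2 * c + L + c * ts ^ 2) * t ≤ c * t ^ 2 := by
    calc _ ≤ c * t * t := by gcongr
      _ = _ := by ring
  have a6 : C * t + (2 * C ^ 2 + 2 * c + L + c * ts ^ 2)
      ≤ (C + 2 * C ^ 2 + 2 * c + L + c * ts ^ 2) * t := by
    have : 0 ≤ 2 * C ^ 2 + 2 * c + L + c * ts ^ 2 := by positivity
    nlinarith
  have a7 : c / 2 * (t - ts) ^ 2 ≤ c * t ^ 2 + c * ts ^ 2 := by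
    nlinarith [sq_nonneg (t + ts)]
  rw [hL] at a6 a5
  linarith

theorem continuousAt_brokenLine {P : Type*} [TopologicalSpace P] {p₀ : P} {Q v : P → ℂ}
    (hQ : ContinuousAt Q p₀) (hv : ContinuousAt v p₀) {s : P → ℝ} (hs : ContinuousAt s p₀) :
    ContinuousAt (fun p => brokenLine (Q p) (v p) (s p)) p₀ := by
  unfold brokenLine
  refine ContinuousAt.add (ContinuousAt.mul ?_ hQ) (ContinuousAt.mul ?_ hv)
  · exact Complex.continuous_ofReal.continuousAt.comp (hs.min continuousAt_const)
  · exact Complex.continuous_ofReal.continuousAt.comp ((hs.sub continuousAt_const).max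
      continuousAt_const)

open Set in
/-- Intermediate descent: a strict inequality at the base point persists with a quadratic gap, by
compactness. -/
theorem exists_phase_decay_compact {P : Type*} [TopologicalSpace P] {p₀ : P} {z Q v : P → ℂ}
    {κ : P → ℝ} (hz : ContinuousAt z p₀) (hQ : ContinuousAt Q p₀) (hv : ContinuousAt v p₀)
    (hκ : ContinuousAt κ p₀) (hκ0 : 0 < κ p₀) {ts : ℝ} {K : Set ℝ} (hK : IsCompact K)
    (hpos : ∀ t, 0 < t → brokenLine (Q p₀) (v p₀) t ≠ 0) (hts : 0 < ts) (hK0 : ∀ t ∈ K, 0 ≤ t)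
    (hstrict : ∀ t ∈ K, 0 < t →
      κ p₀ * Real.log ‖brokenLine (Q p₀) (v p₀) t‖ + 2 * ((brokenLine (Q p₀) (v p₀) t - z p₀) ^ 2).re
        < κ p₀ * Real.log ‖brokenLine (Q p₀) (v p₀) ts‖
          + 2 * ((brokenLine (Q p₀) (v p₀) ts - z p₀) ^ 2).re) :
    ∃ c : ℝ, 0 < c ∧ ∀ᶠ p in 𝓝 p₀, (∀ t, 0 < t → brokenLine (Q p) (v p) t ≠ 0) →
      ∀ t ∈ K, 0 < t →
      κ p * Real.log ‖brokenLine (Q p) (v p) t‖ + 2 * ((brokenLine (Q p) (v p) t - z p) ^ 2).re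
        - (κ p * Real.log ‖brokenLine (Q p) (v p) ts‖
          + 2 * ((brokenLine (Q p) (v p) ts - z p) ^ 2).re) ≤ -c * (t - ts) ^ 2 := by
  obtain ⟨M, hM⟩ : ∃ M : P → ℝ → ℝ → ℝ, ∀ p c t, M p c t = ‖brokenLine (Q p) (v p) t‖ ^ (κ p) *
      Real.exp (2 * ((brokenLine (Q p) (v p) t - z p) ^ 2).re + c * (t - ts) ^ 2) :=
    ⟨_, fun _ _ _ => rfl⟩
  have hMlog : ∀ p c t, brokenLine (Q p) (v p) t ≠ 0 → M p c t =
      Real.exp (κ p * Real.log ‖brokenLine (Q p) (v p) t‖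
        + 2 * ((brokenLine (Q p) (v p) t - z p) ^ 2).re + c * (t - ts) ^ 2) := by
    intro p c t h
    rw [hM, Real.rpow_def_of_pos (norm_pos_iff.2 h), ← Real.exp_add]; congr 1; ring
  have hcont : ∀ t : ℝ, (0 < t ∨ t = 0) → ContinuousAt (fun x : (P × ℝ) × ℝ => M x.1.1 x.1.2 x.2)
      ((p₀, 0), t) := by
    intro t ht
    rw [show (fun x : (P × ℝ) × ℝ => M x.1.1 x.1.2 x.2) = fun x : (P × ℝ) × ℝ =>
      ‖brokenLine (Q x.1.1) (v x.1.1) x.2‖ ^ (κ x.1.1) *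
      Real.exp (2 * ((brokenLine (Q x.1.1) (v x.1.1) x.2 - z x.1.1) ^ 2).re + x.1.2 * (x.2 - ts) ^ 2)
      from funext fun x => hM _ _ _]
    have c1 : ContinuousAt (fun x : (P × ℝ) × ℝ => x.1.1) ((p₀, 0), t) :=
      (continuous_fst.comp continuous_fst).continuousAt
    have hQ' : ContinuousAt (fun x : (P × ℝ) × ℝ => Q x.1.1) ((p₀, 0), t) :=
      ContinuousAt.comp (f := fun x : (P × ℝ) × ℝ => x.1.1) (g := Q) hQ c1
    have hv' : ContinuousAt (fun x : (P × ℝ) × ℝ => v x.1.1) ((p₀, 0), t) :=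
      ContinuousAt.comp (f := fun x : (P × ℝ) × ℝ => x.1.1) (g := v) hv c1
    have hz' : ContinuousAt (fun x : (P × ℝ) × ℝ => z x.1.1) ((p₀, 0), t) :=
      ContinuousAt.comp (f := fun x : (P × ℝ) × ℝ => x.1.1) (g := z) hz c1
    have hκ' : ContinuousAt (fun x : (P × ℝ) × ℝ => κ x.1.1) ((p₀, 0), t) :=
      ContinuousAt.comp (f := fun x : (P × ℝ) × ℝ => x.1.1) (g := κ) hκ c1
    have hb := continuousAt_brokenLine hQ' hv' (s := fun x : (P × ℝ) × ℝ => x.2)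
      continuous_snd.continuousAt
    refine ContinuousAt.mul (hb.norm.rpow hκ' (Or.inr hκ0)) ?_
    refine Real.continuous_exp.continuousAt.comp (ContinuousAt.add ?_ ?_)
    · exact continuousAt_const.mul (Complex.continuous_re.continuousAt.comp ((hb.sub hz').pow 2))
    · exact Continuous.continuousAt (by fun_prop)
  have hev : ∀ᶠ x : P × ℝ in 𝓝 (p₀, 0), ∀ t ∈ K, M x.1 x.2 t < M x.1 x.2 ts := by
    refine hK.eventually_forall_of_forall_eventually fun t ht => ?_
    have h1 := hcont t ((hK0 t ht).lt_or_eq.imp id Eq.symm)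
    have h2 : ContinuousAt (fun x : (P × ℝ) × ℝ => M x.1.1 x.1.2 ts) ((p₀, 0), t) := by
      have := hcont ts (Or.inl hts)
      exact ContinuousAt.comp (f := fun x : (P × ℝ) × ℝ => (x.1, ts))
        (g := fun x : (P × ℝ) × ℝ => M x.1.1 x.1.2 x.2) this
        (Continuous.continuousAt (by fun_prop))
    refine h1.eventually_lt h2 ?_
    rw [hMlog p₀ 0 ts (hpos ts hts)]
    rcases (hK0 t ht).lt_or_eq with h0 | h0
    · simp only
      rw [hMlog p₀ 0 t (hpos t h0)]
      apply Real.exp_lt_exp.2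
      have := hstrict t ht h0
      linarith
    · simp only
      rw [hM, ← h0]
      have : brokenLine (Q p₀) (v p₀) 0 = 0 := by simp [brokenLine_of_le]
      rw [this, norm_zero, Real.zero_rpow hκ0.ne', zero_mul]
      exact Real.exp_pos _
  rw [nhds_prod_eq, eventually_prod_iff] at hev
  obtain ⟨pa, hpa, pb, hpb, hab⟩ := hev
  obtain ⟨c, hcb, hc0⟩ : ∃ c, pb c ∧ 0 < c :=
    ((hpb.filter_mono nhdsWithin_le_nhds).and (self_mem_nhdsWithin : Ioi (0 : ℝ) ∈ 𝓝[>] 0)).exists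
  refine ⟨c, hc0, ?_⟩
  filter_upwards [hpa] with p hp hne t ht ht0
  have := hab hp hcb t ht
  simp only at this
  rw [hMlog p c t (hne t ht0), hMlog p c ts (hne ts hts), Real.exp_lt_exp] at this
  simp only [sub_self, ne_eq, OfNat.ofNat_ne_zero, not_false_eq_true, zero_pow, mul_zero] at this
  linarith

open Set in
/-- The descent conditions on a broken line hold uniformly near a point where they hold strictly. -/
theorem exists_saddleBounds {P : Type*} [TopologicalSpace P] {p₀ : P} {z Q v : P → ℂ}
    {κ : P → ℝ} (hz : ContinuousAt z p₀) (hQ : ContinuousAt Q p₀) (hv : ContinuousAt v p₀)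
    (hκ : ContinuousAt κ p₀) (hκ0 : 0 < κ p₀) (hκ1 : ∀ᶠ p in 𝓝 p₀, κ p ≤ 1) {c₀ C₀ : ℝ}
    (h : BrokenLineBounds c₀ C₀ (z p₀) (Q p₀) (v p₀)) {ts : ℝ} (hts : 0 < ts) (hts1 : ts ≠ 1)
    (hsad : ∀ᶠ p in 𝓝 p₀, 4 * brokenLine (Q p) (v p) ts * (z p - brokenLine (Q p) (v p) ts) = κ p)
    (hre : 0 < ((κ p₀ / 2 - 2 * brokenLine (Q p₀) (v p₀) ts ^ 2) *
      (brokenLineVel (Q p₀) (v p₀) ts / brokenLine (Q p₀) (v p₀) ts) ^ 2).re)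
    (hstrict : ∀ t, 0 < t → t ≠ ts →
      κ p₀ * Real.log ‖brokenLine (Q p₀) (v p₀) t‖ + 2 * ((brokenLine (Q p₀) (v p₀) t - z p₀) ^ 2).re
        < κ p₀ * Real.log ‖brokenLine (Q p₀) (v p₀) ts‖
          + 2 * ((brokenLine (Q p₀) (v p₀) ts - z p₀) ^ 2).re) :
    ∃ c C ρ : ℝ, 0 < c ∧ 0 < C ∧ 0 < ρ ∧ ρ < ts ∧
      ∀ᶠ p in 𝓝 p₀, SaddleBounds c C ts ρ (z p) (Q p) (v p) (κ p) := by
  have hc₀ := h.c_pos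
  have hC₀ := h.C_pos
  obtain ⟨b, hb⟩ : ∃ b, b = ((κ p₀ / 2 - 2 * brokenLine (Q p₀) (v p₀) ts ^ 2) *
      (brokenLineVel (Q p₀) (v p₀) ts / brokenLine (Q p₀) (v p₀) ts) ^ 2).re / 2 := ⟨_, rfl⟩
  have hb0 : 0 < b := by rw [hb]; exact half_pos hre
  obtain ⟨c₁, hc₁⟩ : ∃ c₁, c₁ = c₀ / 2 := ⟨_, rfl⟩
  obtain ⟨C₁, hC₁⟩ : ∃ C₁, C₁ = C₀ + 1 := ⟨_, rfl⟩
  have hc₁0 : 0 < c₁ := by rw [hc₁]; linarith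
  have hC₁0 : 0 < C₁ := by rw [hC₁]; linarith
  -- The radius `ρ` keeps clear of the origin and of the corner at `t = 1`, and is small enough for
  -- the local estimate `phase_decay_near`.
  obtain ⟨ρ, hρ⟩ : ∃ ρ, ρ = min (min (ts / 2) (|ts - 1| / 2))
    (min (c₁ * ts / (2 * C₁)) (b / 2 * (c₁ * ts / C₁) ^ 3)) := ⟨_, rfl⟩
  have habs : 0 < |ts - 1| := abs_pos.2 (sub_ne_zero.2 hts1)
  have hρ0 : 0 < ρ := by
    rw [hρ]
    exact lt_min (lt_min (half_pos hts) (half_pos habs)) (lt_min (by positivity) (by positivity))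
  have hρ1 : ρ ≤ ts / 2 := by rw [hρ]; exact (min_le_left _ _).trans (min_le_left _ _)
  have hρ2 : ρ ≤ |ts - 1| / 2 := by rw [hρ]; exact (min_le_left _ _).trans (min_le_right _ _)
  have hρ3 : ρ ≤ c₁ * ts / (2 * C₁) := by rw [hρ]; exact (min_le_right _ _).trans (min_le_left _ _)
  have hρ4 : ρ ≤ b / 2 * (c₁ * ts / C₁) ^ 3 := by
    rw [hρ]; exact (min_le_right _ _).trans (min_le_right _ _)
  have hside : ∀ τ : ℝ, |τ| ≤ ρ → (ts + τ < 1 ∧ ts < 1) ∨ (1 < ts + τ ∧ 1 < ts) := by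
    intro τ hτ
    have h1 := abs_le.1 (hτ.trans hρ2)
    rcases lt_or_gt_of_ne hts1 with hlt | hgt
    · left; rw [abs_of_neg (by linarith)] at h1; constructor <;> linarith
    · right; rw [abs_of_pos (by linarith)] at h1; constructor <;> linarith
  have hvel : ∀ (Q v : ℂ) (τ : ℝ), |τ| ≤ ρ → brokenLineVel Q v (ts + τ) = brokenLineVel Q v ts := by
    intro Q v τ hτ
    unfold brokenLineVel
    rcases hside τ hτ with ⟨h1, h2⟩ | ⟨h1, h2⟩
    · rw [if_pos h1, if_pos h2]
    · rw [if_neg (not_lt.2 h1.le), if_neg (not_lt.2 h2.le)]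
  have hstr : ∀ (Q v : ℂ) (τ : ℝ), |τ| ≤ ρ →
      brokenLine Q v (ts + τ) = brokenLine Q v ts + τ * brokenLineVel Q v ts := by
    intro Q v τ hτ
    unfold brokenLineVel
    rcases hside τ hτ with ⟨h1, h2⟩ | ⟨h1, h2⟩
    · rw [if_pos h2, brokenLine_of_le h1.le, brokenLine_of_le h2.le]; push_cast; ring
    · rw [if_neg (not_lt.2 h2.le), brokenLine_of_ge h1.le, brokenLine_of_ge h2.le]; push_cast; ring
  -- The line is divided into a neighbourhood of the saddle point, a far end `t ≥ T`, and a compact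
  -- remainder, on which the strict inequality yields a quadratic gap.
  obtain ⟨T, hT⟩ := exists_phase_decay_far hc₁0 hC₁0 hts
  obtain ⟨c₂, hc₂, hmid⟩ := exists_phase_decay_compact hz hQ hv hκ hκ0 (ts := ts)
    (K := Icc 0 (ts - ρ) ∪ Icc (ts + ρ) T) (isCompact_Icc.union isCompact_Icc)
    (fun t ht => h.ne_zero ht) hts
    (by rintro t (ht | ht)
        · exact ht.1
        · linarith [ht.1])
    (by rintro t (ht | ht) ht0
        · exact hstrict t ht0 (by rintro rfl; linarith [ht.2])
        · exact hstrict t ht0 (by rintro rfl; linarith [ht.1]))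
  have hζc : ContinuousAt (fun p => brokenLine (Q p) (v p) ts) p₀ :=
    continuousAt_brokenLine hQ hv continuousAt_const
  have hVc : ContinuousAt (fun p => brokenLineVel (Q p) (v p) ts) p₀ := by
    unfold brokenLineVel
    split_ifs
    exacts [hQ, hv]
  have hqc : ContinuousAt (fun p => ((κ p / 2 - 2 * brokenLine (Q p) (v p) ts ^ 2) *
      (brokenLineVel (Q p) (v p) ts / brokenLine (Q p) (v p) ts) ^ 2 : ℂ).re) p₀ := by
    refine Complex.continuous_re.continuousAt.comp (ContinuousAt.mul (ContinuousAt.sub ?_ ?_) ?_)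
    · exact (Complex.continuous_ofReal.continuousAt.comp hκ).div_const 2
    · exact continuousAt_const.mul (hζc.pow 2)
    · exact (hVc.div hζc (h.ne_zero hts)).pow 2
  have eq := hqc.eventually_const_lt (show b < _ by rw [hb]; exact half_lt_self hre)
  have eκ := hκ.eventually_const_lt (half_lt_self hκ0)
  obtain ⟨c, hc⟩ : ∃ c, c = min (min c₁ (κ p₀ / 2)) (min (min b (b / 2)) (min (c₁ / 2) c₂)) := ⟨_, rfl⟩
  have hc0 : 0 < c := by
    rw [hc]
    exact lt_min (lt_min hc₁0 (half_pos hκ0)) (lt_min (lt_min hb0 (half_pos hb0))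
      (lt_min (half_pos hc₁0) hc₂))
  have hcc₁ : c ≤ c₁ := by rw [hc]; exact (min_le_left _ _).trans (min_le_left _ _)
  have hcκ : c ≤ κ p₀ / 2 := by rw [hc]; exact (min_le_left _ _).trans (min_le_right _ _)
  have hcb : c ≤ b := by
    rw [hc]; exact (min_le_right _ _).trans ((min_le_left _ _).trans (min_le_left _ _))
  have hcb2 : c ≤ b / 2 := by
    rw [hc]; exact (min_le_right _ _).trans ((min_le_left _ _).trans (min_le_right _ _))
  have hcc₁2 : c ≤ c₁ / 2 := by
    rw [hc]; exact (min_le_right _ _).trans ((min_le_right _ _).trans (min_le_left _ _))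
  have hcc₂ : c ≤ c₂ := by
    rw [hc]; exact (min_le_right _ _).trans ((min_le_right _ _).trans (min_le_right _ _))
  refine ⟨c, C₁, ρ, hc0, hC₁0, hρ0, by linarith, ?_⟩
  filter_upwards [eventually_brokenLineBounds hz hQ hv h, hκ1, hsad, hmid, eq, eκ]
    with p hp hp1 hps hpm hpq hpκ
  rw [← hc₁, ← hC₁] at hp
  have hκp : 0 ≤ κ p := by linarith
  refine ⟨hp.mono hc0 hcc₁ le_rfl, by linarith, hp1, hstr _ _, hvel _ _, hps, by linarith, ?_⟩
  intro t ht
  have key : ∀ c' : ℝ, c ≤ c' → -c' * (t - ts) ^ 2 ≤ -c * (t - ts) ^ 2 := fun c' h' => by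
    have := mul_le_mul_of_nonneg_right h' (sq_nonneg (t - ts))
    linarith
  rcases le_or_gt |t - ts| ρ with h1 | h1
  · exact (phase_decay_near hts hb0 hp hκp hp1 (hstr _ _) hps hpq.le h1 (h1.trans hρ3)
      (h1.trans hρ4)).trans (key _ hcb2)
  · rcases le_total T t with h2 | h2
    · exact (hT _ _ _ _ hp hκp hp1 t h2).trans (key _ hcc₁2)
    · refine (hpm (fun t ht => hp.ne_zero ht) t ?_ ht).trans (key _ hcc₂)
      rcases lt_abs.1 h1 with h3 | h3
      · right; exact ⟨by linarith, h2⟩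
      · left; exact ⟨ht.le, by linarith⟩

/-! ### The contours for points of the oscillatory interval -/

/-- The saddle point of `κ log ζ + 2 (ζ - z)²` that is close to the origin for small `κ`. -/
noncomputable def smallSaddle (z : ℂ) (κ : ℝ) : ℂ := z * (1 - wkbRoot (κ / z ^ 2)) / 2

/-- The two saddle points `(z ± i √(1 - z²)) / 2` of `log ζ + 2 (ζ - z)²`, for `σ = ± 1`. -/
noncomputable def turningSaddle (σ : ℝ) (z : ℂ) : ℂ :=
  (z + σ * Complex.I * (1 - z ^ 2) ^ (1 / 2 : ℂ)) / 2

/-- The saddle point equation: the derivative `κ / ζ + 4 (ζ - z)` of the phase vanishes. -/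
theorem smallSaddle_eq {z : ℂ} (hz : z ≠ 0) (κ : ℝ) :
    4 * smallSaddle z κ * (z - smallSaddle z κ) = κ := by
  have h := wkbRoot_sq (κ / z ^ 2)
  have h1 : 4 * smallSaddle z κ * (z - smallSaddle z κ) = z ^ 2 * (1 - wkbRoot (κ / z ^ 2) ^ 2) := by
    rw [smallSaddle]; ring
  rw [h1, h]; field_simp; ring

theorem sqrt_one_sub_sq (z : ℂ) : ((1 - z ^ 2) ^ (1 / 2 : ℂ)) ^ 2 = 1 - z ^ 2 := by
  rw [← Complex.cpow_nat_mul]; norm_num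

/-- The saddle point equation for `κ = 1`. -/
theorem turningSaddle_eq {σ : ℝ} (hσ : σ ^ 2 = 1) (z : ℂ) :
    4 * turningSaddle σ z * (z - turningSaddle σ z) = 1 := by
  have h := sqrt_one_sub_sq z
  have hσ' : (σ : ℂ) ^ 2 = 1 := by exact_mod_cast hσ
  have h1 : 4 * turningSaddle σ z * (z - turningSaddle σ z)
      = z ^ 2 - (σ : ℂ) ^ 2 * Complex.I ^ 2 * ((1 - z ^ 2) ^ (1 / 2 : ℂ)) ^ 2 := by
    rw [turningSaddle]; ring
  rw [h1, h, hσ', Complex.I_sq]; ring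

theorem strictMono_phase {κ x₀ a b : ℝ} (ha : 0 < a) (hab : a < b)
    (h : ∀ x ∈ Set.Ioo a b, 0 < κ - 4 * x * (x₀ - x)) :
    κ * Real.log a + 2 * (a - x₀) ^ 2 < κ * Real.log b + 2 * (b - x₀) ^ 2 := by
  have hd : ∀ x : ℝ, 0 < x → HasDerivAt (fun x : ℝ => κ * Real.log x + 2 * (x - x₀) ^ 2)
      ((κ - 4 * x * (x₀ - x)) / x) x := by
    intro x hx
    have h1 := ((Real.hasDerivAt_log hx.ne').const_mul κ).add
      ((((hasDerivAt_id x).sub_const x₀).fun_pow 2).const_mul 2)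
    refine h1.congr_deriv ?_
    simp only [id]
    field_simp
    ring
  refine strictMonoOn_of_deriv_pos (f := fun x : ℝ => κ * Real.log x + 2 * (x - x₀) ^ 2)
    (convex_Icc a b) (fun x hx => ?_) (fun x hx => ?_)
    (Set.left_mem_Icc.2 hab.le) (Set.right_mem_Icc.2 hab.le) hab
  · exact (hd x (ha.trans_le hx.1)).continuousAt.continuousWithinAt
  · rw [interior_Icc] at hx
    rw [(hd x (ha.trans hx.1)).deriv]
    exact div_pos (h x hx) (ha.trans hx.1)

theorem strictAnti_phase {κ x₀ a b : ℝ} (ha : 0 < a) (hab : a < b)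
    (h : ∀ x ∈ Set.Ioo a b, κ - 4 * x * (x₀ - x) < 0) :
    κ * Real.log b + 2 * (b - x₀) ^ 2 < κ * Real.log a + 2 * (a - x₀) ^ 2 := by
  have hd : ∀ x : ℝ, 0 < x → HasDerivAt (fun x : ℝ => κ * Real.log x + 2 * (x - x₀) ^ 2)
      ((κ - 4 * x * (x₀ - x)) / x) x := by
    intro x hx
    have h1 := ((Real.hasDerivAt_log hx.ne').const_mul κ).add
      ((((hasDerivAt_id x).sub_const x₀).fun_pow 2).const_mul 2)
    refine h1.congr_deriv ?_
    simp only [id]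
    field_simp
    ring
  refine strictAntiOn_of_deriv_neg (f := fun x : ℝ => κ * Real.log x + 2 * (x - x₀) ^ 2)
    (convex_Icc a b) (fun x hx => ?_) (fun x hx => ?_)
    (Set.left_mem_Icc.2 hab.le) (Set.right_mem_Icc.2 hab.le) hab
  · exact (hd x (ha.trans_le hx.1)).continuousAt.continuousWithinAt
  · rw [interior_Icc] at hx
    rw [(hd x (ha.trans hx.1)).deriv]
    exact div_neg_of_neg_of_pos (h x hx) (ha.trans hx.1)

/-- On the real axis, up to the second critical point, the phase is largest at the first one. -/
theorem phase_lt_of_ne {κ x₀ r x : ℝ} (hr0 : 0 < r) (hr : 4 * r * (x₀ - r) = κ) (hr2 : r < x₀ - r)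
    (hx0 : 0 < x) (hx : x ≤ x₀ - r) (hxr : x ≠ r) :
    κ * Real.log x + 2 * (x - x₀) ^ 2 < κ * Real.log r + 2 * (r - x₀) ^ 2 := by
  have hfac : ∀ x, κ - 4 * x * (x₀ - x) = 4 * ((r - x) * (x₀ - r - x)) := fun x => by
    rw [← hr]; ring
  rcases lt_or_gt_of_ne hxr with h' | h'
  · refine strictMono_phase hx0 h' fun y hy => ?_
    rw [hfac]
    exact mul_pos four_pos (mul_pos (by linarith [hy.2]) (by linarith [hy.2]))
  · refine strictAnti_phase hr0 h' fun y hy => ?_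
    rw [hfac]
    exact mul_neg_of_pos_of_neg four_pos
      (mul_neg_of_neg_of_pos (by linarith [hy.1]) (by linarith [hy.2]))

/-- The real data of the contour at a point `x₀` of `(0, 1)`: the line starts along the real axis up
to `(1/2 - μ) x₀` and continues in the direction `μ x₀ ± i √(1 - x₀²) / 2`. -/
structure ContourData (x₀ a μ y₀ q₀ : ℝ) : Prop where
  x_pos : 0 < x₀
  x_lt : x₀ < 1
  a_eq : a = 1 - x₀ ^ 2
  μ_eq : μ = a / 16
  y_eq : y₀ = √a / 2
  q_eq : q₀ = (1 / 2 - μ) * x₀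

namespace ContourData

variable {x₀ a μ y₀ q₀ : ℝ}

theorem a_pos (D : ContourData x₀ a μ y₀ q₀) : 0 < a := by
  rw [D.a_eq]; nlinarith [D.x_pos, D.x_lt]

theorem a_lt (D : ContourData x₀ a μ y₀ q₀) : a < 1 := by
  rw [D.a_eq]; nlinarith [D.x_pos, D.x_lt]

theorem μ_pos (D : ContourData x₀ a μ y₀ q₀) : 0 < μ := by
  rw [D.μ_eq]; linarith [D.a_pos]

theorem μ_lt (D : ContourData x₀ a μ y₀ q₀) : μ < 1 / 16 := by
  rw [D.μ_eq]; linarith [D.a_lt]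

theorem y_sq (D : ContourData x₀ a μ y₀ q₀) : 4 * y₀ ^ 2 = a := by
  rw [D.y_eq, div_pow, Real.sq_sqrt D.a_pos.le]; ring

theorem y_pos (D : ContourData x₀ a μ y₀ q₀) : 0 < y₀ := by
  rw [D.y_eq]; exact half_pos (Real.sqrt_pos.2 D.a_pos)

theorem y_lt (D : ContourData x₀ a μ y₀ q₀) : y₀ < 1 / 2 := by
  nlinarith [D.y_sq, D.y_pos, D.a_lt]

theorem q_pos (D : ContourData x₀ a μ y₀ q₀) : 0 < q₀ := by
  rw [D.q_eq]; exact mul_pos (by linarith [D.μ_lt]) D.x_pos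

theorem q_lt (D : ContourData x₀ a μ y₀ q₀) : q₀ < x₀ / 2 := by
  rw [D.q_eq]; nlinarith [D.μ_pos, D.x_pos]

theorem μ_sq_lt (D : ContourData x₀ a μ y₀ q₀) : μ ^ 2 * x₀ ^ 2 < y₀ ^ 2 := by
  have h1 : x₀ ^ 2 < 1 := by nlinarith [D.x_pos, D.x_lt]
  have h2 : μ ^ 2 * x₀ ^ 2 ≤ μ ^ 2 := by nlinarith [sq_nonneg μ]
  have h3 : μ ^ 2 < a / 4 := by rw [D.μ_eq]; nlinarith [D.a_pos, D.a_lt]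
  linarith [D.y_sq]

theorem re_im_ge {σ : ℝ} {t : ℝ} (ht : 1 ≤ t) :
    (brokenLine q₀ (μ * x₀ + σ * Complex.I * y₀) t).re = q₀ + (t - 1) * (μ * x₀) ∧
    (brokenLine q₀ (μ * x₀ + σ * Complex.I * y₀) t).im = σ * ((t - 1) * y₀) := by
  rw [brokenLine_of_ge ht]
  constructor <;> simp
  ring

theorem re_sq_ge {σ : ℝ} (hσ : σ ^ 2 = 1) {t : ℝ} (ht : 1 ≤ t) :
    ((brokenLine q₀ (μ * x₀ + σ * Complex.I * y₀) t - x₀) ^ 2).re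
      = (q₀ + (t - 1) * (μ * x₀) - x₀) ^ 2 - ((t - 1) * y₀) ^ 2 := by
  obtain ⟨h1, h2⟩ := re_im_ge (q₀ := q₀) (μ := μ) (x₀ := x₀) (y₀ := y₀) (σ := σ) ht
  rw [pow_two, Complex.mul_re, Complex.sub_re, Complex.sub_im, h1, h2, Complex.ofReal_re,
    Complex.ofReal_im]
  linear_combination (-((t - 1) * y₀) ^ 2) * hσ

theorem norm_sq_ge {σ : ℝ} (hσ : σ ^ 2 = 1) {t : ℝ} (ht : 1 ≤ t) :
    ‖brokenLine q₀ (μ * x₀ + σ * Complex.I * y₀) t‖ ^ 2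
      = (q₀ + (t - 1) * (μ * x₀)) ^ 2 + ((t - 1) * y₀) ^ 2 := by
  obtain ⟨h1, h2⟩ := re_im_ge (q₀ := q₀) (μ := μ) (x₀ := x₀) (y₀ := y₀) (σ := σ) ht
  rw [← Complex.normSq_eq_norm_sq, Complex.normSq_apply, h1, h2]
  linear_combination (((t - 1) * y₀) ^ 2) * hσ

theorem re_sq_le {v : ℂ} {t : ℝ} (ht : t ≤ 1) :
    ((brokenLine q₀ v t - x₀) ^ 2).re = (t * q₀ - x₀) ^ 2 := by
  rw [brokenLine_of_le ht, ← Complex.ofReal_mul, ← Complex.ofReal_sub, ← Complex.ofReal_pow,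
    Complex.ofReal_re]

theorem norm_le (hq : 0 ≤ q₀) {v : ℂ} {t : ℝ} (ht0 : 0 ≤ t) (ht : t ≤ 1) :
    ‖brokenLine q₀ v t‖ = t * q₀ := by
  rw [brokenLine_of_le ht, ← Complex.ofReal_mul, Complex.norm_real,
    Real.norm_of_nonneg (mul_nonneg ht0 hq)]

/-- The broken line stays in the right half-plane and `Re (ζ - x₀)²` decreases along it. -/
theorem exists_lineBounds (D : ContourData x₀ a μ y₀ q₀) {σ : ℝ} (hσ : σ ^ 2 = 1) :
    ∃ c C : ℝ, BrokenLineBounds c C x₀ q₀ (μ * x₀ + σ * Complex.I * y₀) := by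
  have hx := D.x_pos; have hμ := D.μ_pos; have hq := D.q_pos; have hq2 := D.q_lt
  have hμx : 0 < μ * x₀ := mul_pos hμ hx
  have h1 := D.μ_sq_lt
  obtain ⟨C, hC⟩ : ∃ C : ℝ, C = ‖(x₀ : ℂ)‖ + ‖(q₀ : ℂ)‖ + ‖(μ * x₀ + σ * Complex.I * y₀ : ℂ)‖ :=
    ⟨_, rfl⟩
  have n1 := norm_nonneg (x₀ : ℂ); have n2 := norm_nonneg (q₀ : ℂ)
  have n3 := norm_nonneg (μ * x₀ + σ * Complex.I * y₀ : ℂ)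
  obtain ⟨c, hc⟩ : ∃ c : ℝ, c = min (min (min q₀ (μ * x₀)) (min (x₀ * q₀) ((x₀ - q₀) * q₀)))
    (min ((x₀ - q₀) * (μ * x₀)) (y₀ ^ 2 - μ ^ 2 * x₀ ^ 2)) := ⟨_, rfl⟩
  have hxq : 0 < x₀ - q₀ := by linarith
  refine ⟨c, C, ?_, by rw [hC]; linarith, by rw [hC]; linarith, by rw [hC]; linarith, ?_, ?_, ?_, ?_,
    ?_, ?_⟩
  · rw [hc]
    exact lt_min (lt_min (lt_min hq hμx) (lt_min (mul_pos hx hq) (mul_pos hxq hq)))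
      (lt_min (mul_pos hxq hμx) (by linarith))
  · rw [Complex.ofReal_re, hc]
    exact (min_le_left _ _).trans ((min_le_left _ _).trans (min_le_left _ _))
  · have : (μ * x₀ + σ * Complex.I * y₀ : ℂ).re = μ * x₀ := by simp
    rw [this, hc]
    exact (min_le_left _ _).trans ((min_le_left _ _).trans (min_le_right _ _))
  · have : (-x₀ * q₀ : ℂ).re = -(x₀ * q₀) := by simp
    rw [this, hc]
    exact neg_le_neg ((min_le_left _ _).trans ((min_le_right _ _).trans (min_le_left _ _)))
  · have : ((q₀ - x₀) * q₀ : ℂ).re = -((x₀ - q₀) * q₀) := by simp; ring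
    rw [this, hc]
    exact neg_le_neg ((min_le_left _ _).trans ((min_le_right _ _).trans (min_le_right _ _)))
  · have : ((q₀ - x₀) * (μ * x₀ + σ * Complex.I * y₀) : ℂ).re = -((x₀ - q₀) * (μ * x₀)) := by
      simp; ring
    rw [this, hc]
    exact neg_le_neg ((min_le_right _ _).trans (min_le_left _ _))
  · have : ((μ * x₀ + σ * Complex.I * y₀) * (μ * x₀ + σ * Complex.I * y₀) : ℂ).re
        = -(y₀ ^ 2 - μ ^ 2 * x₀ ^ 2) := by
      simp; linear_combination (-y₀ ^ 2) * hσ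
    rw [this, hc]
    exact neg_le_neg ((min_le_right _ _).trans (min_le_right _ _))

/-- On the ray, the phase with `κ = 1` is largest at the saddle point. With `p = 2 ‖ζ‖`, the bound
`log p ≤ p - 1` reduces this to the comparison of `(p - 1)² / 2` with a multiple of the square of
the real displacement from the saddle point, which the choice of a small slope `μ` decides. -/
theorem strict_ray (D : ContourData x₀ a μ y₀ q₀) {σ : ℝ} (hσ : σ ^ 2 = 1) {t : ℝ} (ht : 1 ≤ t)
    (ht2 : t ≠ 2) :
    Real.log ‖brokenLine q₀ (μ * x₀ + σ * Complex.I * y₀) t‖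
      + 2 * ((brokenLine q₀ (μ * x₀ + σ * Complex.I * y₀) t - x₀) ^ 2).re
      < -Real.log 2 + x₀ ^ 2 - 1 / 2 := by
  have hx := D.x_pos; have hx1 := D.x_lt; have hμ := D.μ_pos; have hμ1 := D.μ_lt
  have hy := D.y_pos; have hy1 := D.y_lt; have hy2 := D.y_sq; have ha := D.a_pos
  obtain ⟨p, hp⟩ : ∃ p, p = 2 * ‖brokenLine q₀ (μ * x₀ + σ * Complex.I * y₀) t‖ := ⟨_, rfl⟩
  obtain ⟨s, hs⟩ : ∃ s, s = t - 2 := ⟨_, rfl⟩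
  have hs1 : -1 ≤ s := by linarith
  have hs0 : s ≠ 0 := by rw [hs]; exact sub_ne_zero.2 ht2
  have hp2 : p ^ 2 = (x₀ + 2 * μ * x₀ * s) ^ 2 + (1 + s) ^ 2 * a := by
    rw [hp, mul_pow, norm_sq_ge hσ ht, D.q_eq, ← hy2, hs]; ring
  have hp0 : 0 ≤ p := by rw [hp]; positivity
  have hA : 0 < x₀ + 2 * μ * x₀ * s := by
    have : 0 < 1 + 2 * μ * s := by nlinarith
    nlinarith [mul_pos hx this]
  have hpp : 0 < p := by
    refine lt_of_le_of_ne hp0 fun h => ?_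
    rw [← h] at hp2
    have := mul_nonneg (sq_nonneg (1 + s)) ha.le
    nlinarith [mul_pos hA hA]
  have hplus : p + 1 ≤ 3 * (s + 2) := by
    have e1 : x₀ + 2 * μ * x₀ * s ≤ 1 + (1 + s) / 8 := by
      have e0 : 2 * μ * x₀ * s ≤ 2 * μ * x₀ * (1 + s) := by
        apply mul_le_mul_of_nonneg_left _ (by positivity); linarith
      have e2 : 2 * μ * x₀ ≤ 1 / 8 := by nlinarith
      nlinarith
    have e3 : p ^ 2 ≤ (3 * s + 5) ^ 2 := by
      have e4 : (x₀ + 2 * μ * x₀ * s) ^ 2 ≤ (1 + (1 + s) / 8) ^ 2 := by gcongr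
      have e5 : (1 + s) ^ 2 * a ≤ (1 + s) ^ 2 * 1 := by gcongr; exact D.a_lt.le
      nlinarith
    have := abs_le_of_sq_le_sq' e3 (by linarith)
    linarith [this.2]
  have hminus : s ^ 2 * a ^ 2 ≤ 9 * (p - 1) ^ 2 := by
    obtain ⟨w, hw⟩ : ∃ w, w = a * (2 + s) + 4 * μ * x₀ ^ 2 * (1 + μ * s) := ⟨_, rfl⟩
    have hwle : a * (2 + s) ≤ w := by
      rw [hw]
      have : 0 ≤ 1 + μ * s := by nlinarith
      have : 0 ≤ 4 * μ * x₀ ^ 2 * (1 + μ * s) := by positivity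
      linarith
    have hfac : (p - 1) * (p + 1) = s * w := by
      have : (p - 1) * (p + 1) = p ^ 2 - 1 := by ring
      rw [this, hp2, hw, D.a_eq]; ring
    have h1 : s ^ 2 * (a * (2 + s)) ^ 2 ≤ (p - 1) ^ 2 * (3 * (s + 2)) ^ 2 := by
      have h2 : 0 ≤ a * (2 + s) := mul_nonneg ha.le (by linarith)
      calc s ^ 2 * (a * (2 + s)) ^ 2 ≤ s ^ 2 * w ^ 2 := by gcongr
        _ = ((p - 1) * (p + 1)) ^ 2 := by rw [hfac]; ring
        _ = (p - 1) ^ 2 * (p + 1) ^ 2 := by ring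
        _ ≤ _ := by gcongr
    have h3 : 0 < (s + 2) ^ 2 := by
      have : 0 < s + 2 := by linarith
      positivity
    refine le_of_mul_le_mul_right ?_ h3
    linarith
  have hlog : Real.log ‖brokenLine q₀ (μ * x₀ + σ * Complex.I * y₀) t‖ ≤ p - 1 - Real.log 2 := by
    have h1 : Real.log p = Real.log 2 + Real.log ‖brokenLine q₀ (μ * x₀ + σ * Complex.I * y₀) t‖ := by
      rw [hp, Real.log_mul two_ne_zero]
      intro h; rw [h, mul_zero] at hp; exact hpp.ne' hp
    linarith [Real.log_le_sub_one_of_pos hpp]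
  have hre : 2 * ((brokenLine q₀ (μ * x₀ + σ * Complex.I * y₀) t - x₀) ^ 2).re
      = (2 * μ * x₀ * s) ^ 2 + x₀ ^ 2 - p ^ 2 / 2 := by
    rw [re_sq_ge hσ ht, hp2, D.q_eq, ← hy2, hs]; ring
  have hs2 : 0 < s ^ 2 * a ^ 2 := by positivity
  have hfin : (2 * μ * x₀ * s) ^ 2 < (p - 1) ^ 2 / 2 := by
    have h1 : (2 * μ * x₀ * s) ^ 2 = s ^ 2 * a ^ 2 * (x₀ ^ 2 / 64) := by rw [D.μ_eq]; ring
    have h2 : x₀ ^ 2 / 64 ≤ 1 / 64 := by nlinarith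
    rw [h1]
    nlinarith [mul_le_mul_of_nonneg_left h2 hs2.le]
  rw [hre]
  nlinarith

/-- The phase with `κ = 1` at its saddle point, which the line passes at `t = 2`. -/
theorem at_two (D : ContourData x₀ a μ y₀ q₀) {σ : ℝ} (hσ : σ ^ 2 = 1) :
    Real.log ‖brokenLine q₀ (μ * x₀ + σ * Complex.I * y₀) 2‖
      + 2 * ((brokenLine q₀ (μ * x₀ + σ * Complex.I * y₀) 2 - x₀) ^ 2).re
      = -Real.log 2 + x₀ ^ 2 - 1 / 2 := by
  have h1 := norm_sq_ge (q₀ := q₀) (μ := μ) (x₀ := x₀) (y₀ := y₀) hσ (one_le_two (α := ℝ))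
  have h2 : ‖brokenLine q₀ (μ * x₀ + σ * Complex.I * y₀) 2‖ = 1 / 2 := by
    have : ‖brokenLine q₀ (μ * x₀ + σ * Complex.I * y₀) 2‖ ^ 2 = (1 / 2) ^ 2 := by
      rw [h1, D.q_eq]; linear_combination (1 / 4) * D.y_sq + (1 / 4) * D.a_eq
    exact (pow_left_inj₀ (norm_nonneg _) (by norm_num) two_ne_zero).1 this
  rw [re_sq_ge hσ one_le_two, h2, one_div, Real.log_inv, D.q_eq]
  linear_combination (-1 / 2) * D.y_sq - (1 / 2) * D.a_eq

/-- Along the whole line the phase with `κ = 1` is largest at `turningSaddle`: on the initial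
segment, which is real and ends before `x₀ / 2`, it increases. -/
theorem strict_turning (D : ContourData x₀ a μ y₀ q₀) {σ : ℝ} (hσ : σ ^ 2 = 1) {t : ℝ} (ht : 0 < t)
    (ht2 : t ≠ 2) :
    1 * Real.log ‖brokenLine q₀ (μ * x₀ + σ * Complex.I * y₀) t‖
      + 2 * ((brokenLine q₀ (μ * x₀ + σ * Complex.I * y₀) t - x₀) ^ 2).re
      < 1 * Real.log ‖brokenLine q₀ (μ * x₀ + σ * Complex.I * y₀) 2‖
      + 2 * ((brokenLine q₀ (μ * x₀ + σ * Complex.I * y₀) 2 - x₀) ^ 2).re := by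
  rw [one_mul, one_mul, D.at_two hσ]
  rcases lt_or_ge t 1 with h | h
  · have h1 := D.strict_ray hσ le_rfl (by norm_num : (1 : ℝ) ≠ 2)
    rw [re_sq_le le_rfl, norm_le D.q_pos.le zero_le_one le_rfl] at h1
    rw [re_sq_le h.le, norm_le D.q_pos.le ht.le h.le]
    have h2 := strictMono_phase (κ := 1) (x₀ := x₀) (mul_pos ht D.q_pos)
      (mul_lt_mul_of_pos_right h D.q_pos) (fun x hx => by
        nlinarith [sq_nonneg (2 * x - x₀), D.x_pos, D.x_lt])
    linarith
  · exact D.strict_ray hσ h ht2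

theorem norm_ray_le (D : ContourData x₀ a μ y₀ q₀) {σ : ℝ} (hσ : σ ^ 2 = 1) {t : ℝ} (h : 1 ≤ t) :
    ‖brokenLine q₀ (μ * x₀ + σ * Complex.I * y₀) t‖ ≤ t := by
  have hq := D.q_pos; have hq2 := D.q_lt; have hx := D.x_pos; have hμ := D.μ_pos; have hμ1 := D.μ_lt
  have hy := D.y_pos; have hx1 := D.x_lt; have hy1 := D.y_lt
  have h1 := norm_sq_ge (q₀ := q₀) (μ := μ) (x₀ := x₀) (y₀ := y₀) hσ h
  refine (abs_le_of_sq_le_sq' ?_ (by linarith)).2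
  rw [h1]
  have e1 : q₀ + (t - 1) * (μ * x₀) ≤ 1 / 2 + (t - 1) / 2 := by
    have : μ * x₀ ≤ 1 / 2 := by nlinarith
    have := mul_le_mul_of_nonneg_left this (by linarith : 0 ≤ t - 1)
    linarith
  have e2 : (t - 1) * y₀ ≤ (t - 1) / 2 := by
    have := mul_le_mul_of_nonneg_left hy1.le (by linarith : 0 ≤ t - 1)
    linarith
  have e3 : 0 ≤ q₀ + (t - 1) * (μ * x₀) :=
    add_nonneg hq.le (mul_nonneg (by linarith) (by positivity))
  have e4 : 0 ≤ (t - 1) * y₀ := mul_nonneg (by linarith) hy.le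
  have e5 : (q₀ + (t - 1) * (μ * x₀)) ^ 2 ≤ (1 / 2 + (t - 1) / 2) ^ 2 := by gcongr
  have e6 : ((t - 1) * y₀) ^ 2 ≤ ((t - 1) / 2) ^ 2 := by gcongr
  have e7 : t ^ 2 - ((1 / 2 + (t - 1) / 2) ^ 2 + ((t - 1) / 2) ^ 2)
    = (t - 1) * (t + 1) / 2 + (t - 1) / 2 + 3 / 4 := by ring
  have e8 : 0 ≤ (t - 1) * (t + 1) := mul_nonneg (by linarith) (by linarith)
  linarith

/-- Along the whole line the phase with a small `κ` is largest at the small saddle point: on the ray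
it is below its value at `x₀ / 8`, since there `κ log ‖ζ‖` is negligible and the Gaussian factor has
already decreased. -/
theorem strict_small (D : ContourData x₀ a μ y₀ q₀) {σ : ℝ} (hσ : σ ^ 2 = 1) {κ r : ℝ} (hκ : 0 < κ)
    (hκ1 : κ ≤ 2 * μ * x₀ ^ 2) (hκ2 : κ * (1 + |Real.log (x₀ / 8)|) ≤ x₀ ^ 2 / 4)
    (hr0 : 0 < r) (hrx : r < q₀) (hr : 4 * r * (x₀ - r) = κ) {t : ℝ} (ht : 0 < t) (htr : t ≠ r / q₀) :
    κ * Real.log ‖brokenLine q₀ (μ * x₀ + σ * Complex.I * y₀) t‖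
      + 2 * ((brokenLine q₀ (μ * x₀ + σ * Complex.I * y₀) t - x₀) ^ 2).re
      < κ * Real.log ‖brokenLine q₀ (μ * x₀ + σ * Complex.I * y₀) (r / q₀)‖
      + 2 * ((brokenLine q₀ (μ * x₀ + σ * Complex.I * y₀) (r / q₀) - x₀) ^ 2).re := by
  have hq := D.q_pos; have hq2 := D.q_lt; have hx := D.x_pos; have hμ := D.μ_pos; have hμ1 := D.μ_lt
  have hμs := D.μ_sq_lt
  have hrq1 : r / q₀ ≤ 1 := (div_le_one hq).2 hrx.le
  have hrq : r / q₀ * q₀ = r := by field_simp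
  rw [re_sq_le hrq1, norm_le hq.le (by positivity) hrq1, hrq]
  rcases le_or_gt t 1 with h | h
  · rw [re_sq_le h, norm_le hq.le ht.le h]
    have htq : t * q₀ ≤ q₀ := mul_le_of_le_one_left hq.le h
    have hne : t * q₀ ≠ r := fun h' => htr (by rw [eq_div_iff hq.ne']; exact h')
    exact phase_lt_of_ne hr0 hr (by linarith) (mul_pos ht hq) (by linarith) hne
  · -- compare both sides with the value of the phase at `x₀ / 8`
    have hcmp : κ * Real.log (x₀ / 8) + 2 * (x₀ / 8 - x₀) ^ 2
        ≤ κ * Real.log r + 2 * (r - x₀) ^ 2 := by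
      rcases eq_or_ne (x₀ / 8) r with h' | h'
      · rw [h']
      · exact (phase_lt_of_ne hr0 hr (by linarith) (by linarith) (by linarith) h').le
    refine lt_of_lt_of_le ?_ hcmp
    have hlog : Real.log ‖brokenLine q₀ (μ * x₀ + σ * Complex.I * y₀) t‖ ≤ t - 1 := by
      have hn := D.norm_ray_le hσ h.le
      rcases (norm_nonneg (brokenLine q₀ (μ * x₀ + σ * Complex.I * y₀) t)).eq_or_lt with h0 | h0
      · rw [← h0, Real.log_zero]; linarith
      · linarith [Real.log_le_sub_one_of_pos h0]
    have h1 := mul_le_mul_of_nonneg_left hlog hκ.le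
    rw [re_sq_ge hσ h.le]
    have h2 := mul_le_mul_of_nonneg_left (neg_abs_le (Real.log (x₀ / 8))) hκ.le
    have h3 := mul_le_mul_of_nonneg_right hκ1 (by linarith : 0 ≤ t - 1)
    have h4 : 0 ≤ (y₀ ^ 2 - μ ^ 2 * x₀ ^ 2) * (t - 1) ^ 2 :=
      mul_nonneg (by linarith) (sq_nonneg _)
    have h5 : 0 ≤ μ ^ 2 * x₀ ^ 2 * (t - 1) := mul_nonneg (by positivity) (by linarith)
    have hx2 : 0 < x₀ ^ 2 := by positivity
    have h6 : μ * x₀ ^ 2 ≤ x₀ ^ 2 / 16 := by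
      have := mul_le_mul_of_nonneg_right hμ1.le hx2.le
      linarith
    have h7 : μ ^ 2 * x₀ ^ 2 ≤ x₀ ^ 2 / 256 := by
      have h8 : μ ^ 2 ≤ (1 / 16) ^ 2 := by gcongr
      have := mul_le_mul_of_nonneg_right h8 hx2.le
      linarith
    have h8 : 2 * ((q₀ + (t - 1) * (μ * x₀) - x₀) ^ 2 - ((t - 1) * y₀) ^ 2)
        = x₀ ^ 2 / 2 + 2 * (μ * x₀ ^ 2) + 2 * (μ ^ 2 * x₀ ^ 2) - 2 * (μ * x₀ ^ 2 * (t - 1))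
          - 4 * (μ ^ 2 * x₀ ^ 2 * (t - 1)) - 2 * ((y₀ ^ 2 - μ ^ 2 * x₀ ^ 2) * (t - 1) ^ 2) := by
      rw [D.q_eq]; ring
    have h9 : 2 * (x₀ / 8 - x₀) ^ 2 = x₀ ^ 2 * (49 / 32) := by ring
    have h10 : κ * (1 + |Real.log (x₀ / 8)|) = κ + κ * |Real.log (x₀ / 8)| := by ring
    rw [h8, h9]
    linarith

end ContourData

/-- The corner of the contour, on the ray through the small saddle point, which is passed at the
parameter `ts`. -/
noncomputable def contourCorner (ts : ℝ) (z : ℂ) (κ : ℝ) : ℂ := smallSaddle z κ / ts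

/-- The direction of the contour after the corner; the saddle point `turningSaddle σ z` is passed at
the parameter `2`. -/
noncomputable def contourDir (ts σ : ℝ) (z : ℂ) (κ : ℝ) : ℂ :=
  turningSaddle σ z - contourCorner ts z κ

theorem brokenLine_contour_two (ts σ : ℝ) (z : ℂ) (κ : ℝ) :
    brokenLine (contourCorner ts z κ) (contourDir ts σ z κ) 2 = turningSaddle σ z := by
  rw [brokenLine_of_ge one_le_two, contourDir]; push_cast; ring

theorem brokenLine_contour_small {ts : ℝ} (hts : 0 < ts) (hts1 : ts < 1) (σ : ℝ) (z : ℂ) (κ : ℝ) :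
    brokenLine (contourCorner ts z κ) (contourDir ts σ z κ) ts = smallSaddle z κ := by
  have : (ts : ℂ) ≠ 0 := by exact_mod_cast hts.ne'
  rw [brokenLine_of_le hts1.le, contourCorner]; field_simp

theorem brokenLineVel_contour_two (ts σ : ℝ) (z : ℂ) (κ : ℝ) :
    brokenLineVel (contourCorner ts z κ) (contourDir ts σ z κ) 2 = contourDir ts σ z κ := by
  rw [brokenLineVel, if_neg (by norm_num)]

theorem brokenLineVel_contour_small {ts : ℝ} (hts1 : ts < 1) (σ : ℝ) (z : ℂ) (κ : ℝ) :
    brokenLineVel (contourCorner ts z κ) (contourDir ts σ z κ) ts = contourCorner ts z κ := by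
  rw [brokenLineVel, if_pos hts1]

theorem continuousAt_smallSaddle {x₀ κ₀ : ℝ} (hx : 0 < x₀) (hκ : κ₀ < x₀ ^ 2) :
    ContinuousAt (fun p : ℂ × ℝ => smallSaddle p.1 p.2) ((x₀ : ℂ), κ₀) := by
  have hx0 : (x₀ : ℂ) ≠ 0 := by exact_mod_cast hx.ne'
  unfold smallSaddle wkbRoot
  refine (continuous_fst.continuousAt.mul (continuousAt_const.sub ?_)).div_const 2
  refine ContinuousAt.cpow (continuousAt_const.sub (ContinuousAt.div ?_ ?_ (pow_ne_zero 2 hx0)))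
    continuousAt_const ?_
  · exact (Complex.continuous_ofReal.comp continuous_snd).continuousAt
  · exact (continuous_fst.pow 2).continuousAt
  · have : (1 - (κ₀ : ℂ) / (x₀ : ℂ) ^ 2) = ((1 - κ₀ / x₀ ^ 2 : ℝ) : ℂ) := by push_cast; ring
    simp only
    rw [this, Complex.ofReal_mem_slitPlane, sub_pos, div_lt_one (by positivity)]
    exact hκ

theorem continuousAt_sqrt_one_sub_sq {x₀ : ℝ} (hx : 0 < x₀) (hx1 : x₀ < 1) (s : ℂ) :
    ContinuousAt (fun z : ℂ => (1 - z ^ 2) ^ s) (x₀ : ℂ) := by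
  refine ContinuousAt.cpow (Continuous.continuousAt (by fun_prop)) continuousAt_const ?_
  have : (1 - (x₀ : ℂ) ^ 2) = ((1 - x₀ ^ 2 : ℝ) : ℂ) := by push_cast; ring
  rw [this, Complex.ofReal_mem_slitPlane]
  nlinarith

theorem continuousAt_turningSaddle {x₀ : ℝ} (hx : 0 < x₀) (hx1 : x₀ < 1) (σ : ℝ) :
    ContinuousAt (turningSaddle σ) (x₀ : ℂ) := by
  unfold turningSaddle
  exact (continuousAt_id.add (continuousAt_const.mul (continuousAt_sqrt_one_sub_sq hx hx1 _))).div_const 2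

theorem sqrt_one_sub_sq_ofReal {x₀ : ℝ} (hx : x₀ ^ 2 ≤ 1) :
    (1 - (x₀ : ℂ) ^ 2) ^ (1 / 2 : ℂ) = (√(1 - x₀ ^ 2) : ℝ) := by
  rw [Real.sqrt_eq_rpow, Complex.ofReal_cpow (by linarith)]; push_cast; rfl

theorem turningSaddle_ofReal {x₀ : ℝ} (hx : x₀ ^ 2 ≤ 1) (σ : ℝ) :
    turningSaddle σ x₀ = x₀ / 2 + σ * Complex.I * ((√(1 - x₀ ^ 2) / 2 : ℝ) : ℂ) := by
  rw [turningSaddle, sqrt_one_sub_sq_ofReal hx]; push_cast; ring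

theorem smallSaddle_ofReal {x₀ κ : ℝ} (hκ : κ ≤ x₀ ^ 2) (hx : x₀ ≠ 0) :
    smallSaddle x₀ κ = ((x₀ * (1 - √(1 - κ / x₀ ^ 2)) / 2 : ℝ) : ℂ) := by
  have h1 : 0 ≤ 1 - κ / x₀ ^ 2 := by
    rw [sub_nonneg, div_le_one (by positivity)]; exact hκ
  rw [smallSaddle, wkbRoot, Real.sqrt_eq_rpow]
  push_cast
  rw [Complex.ofReal_cpow h1]
  push_cast
  rfl

/-- The line crosses the saddle point `turningSaddle` in a direction of descent. -/
theorem re_turning_curvature {x₀ a μ y₀ q₀ : ℝ} (D : ContourData x₀ a μ y₀ q₀) {σ : ℝ}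
    (hσ : σ ^ 2 = 1) {ζ v : ℂ} (hζ : ζ = x₀ / 2 + σ * Complex.I * y₀)
    (hv : v = μ * x₀ + σ * Complex.I * y₀) :
    0 < ((1 / 2 - 2 * ζ ^ 2) * (v / ζ) ^ 2 : ℂ).re := by
  have hσ' : (σ : ℂ) ^ 2 = 1 := by exact_mod_cast hσ
  have hy' : (4 : ℂ) * y₀ ^ 2 = 1 - x₀ ^ 2 := by
    have := D.y_sq; rw [D.a_eq] at this; exact_mod_cast this
  have h1 : 4 * ζ * (x₀ - ζ) = 1 := by
    rw [hζ]
    linear_combination (-4 * Complex.I ^ 2 * (y₀ : ℂ) ^ 2) * hσ' - 4 * (y₀ : ℂ) ^ 2 * Complex.I_sq + hy'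
  have hζ0 : ζ ≠ 0 := by rintro h; rw [h] at h1; simp at h1
  have h2 : ((1 / 2 - 2 * ζ ^ 2) * (v / ζ) ^ 2 : ℂ) = -16 * σ * Complex.I * y₀ * (x₀ - ζ) * v ^ 2 := by
    have h3 : (1 / 2 - 2 * ζ ^ 2 : ℂ) = 2 * ζ * (x₀ - 2 * ζ) := by linear_combination (-1 / 2) * h1
    have h4 : 1 / ζ = 4 * (x₀ - ζ) := by field_simp; linear_combination -h1
    have h5 : (x₀ : ℂ) - 2 * ζ = -2 * σ * Complex.I * y₀ := by rw [hζ]; ring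
    have h6 : 2 * ζ * (x₀ - 2 * ζ) * (v / ζ) ^ 2 = 2 * (x₀ - 2 * ζ) * v ^ 2 * (1 / ζ) := by
      field_simp
    rw [h3, h6, h4, h5]; ring
  have h3 : (-16 * σ * Complex.I * y₀ * (x₀ - ζ) * v ^ 2 : ℂ).re
      = 16 * y₀ ^ 2 * (y₀ ^ 2 - μ ^ 2 * x₀ ^ 2) + 16 * μ * x₀ ^ 2 * y₀ ^ 2 := by
    have : (-16 * σ * Complex.I * y₀ * (x₀ - ζ) * v ^ 2 : ℂ)
        = ((16 * y₀ ^ 2 * (y₀ ^ 2 - μ ^ 2 * x₀ ^ 2) + 16 * μ * x₀ ^ 2 * y₀ ^ 2 : ℝ) : ℂ)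
          + ((σ * (-8 * x₀ * y₀ * (μ ^ 2 * x₀ ^ 2 - y₀ ^ 2) - 32 * μ * x₀ * y₀ ^ 3) : ℝ) : ℂ) * Complex.I := by
      rw [hζ, hv]; push_cast
      have hI : Complex.I ^ 2 = -1 := Complex.I_sq
      have hI3 : Complex.I ^ 3 = -Complex.I := by rw [pow_succ, hI]; ring
      have hI4 : Complex.I ^ 4 = 1 := by
        rw [show 4 = 2 * 2 by norm_num, pow_mul, hI]; norm_num
      have hσ3 : (σ : ℂ) ^ 3 = σ := by rw [pow_succ, hσ']; ring
      have hσ4 : (σ : ℂ) ^ 4 = 1 := by rw [show 4 = 2 * 2 by norm_num, pow_mul, hσ']; ring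
      ring_nf
      rw [hI, hI3, hI4, hσ', hσ3, hσ4]
      ring
    rw [this, Complex.add_re, Complex.ofReal_re, Complex.re_ofReal_mul, Complex.I_re, mul_zero,
      add_zero]
  rw [h2, h3]
  have := D.y_pos; have := D.μ_sq_lt; have := D.μ_pos; have := D.x_pos
  have h4 : 0 < y₀ ^ 2 - μ ^ 2 * x₀ ^ 2 := by linarith
  positivity

/-- Near every point of `(0, 1)` there is a contour passing through both saddle points, along which
the phases descend from them. -/
theorem exists_contour {x₀ : ℝ} (hx : 0 < x₀) (hx1 : x₀ < 1) :
    ∃ κ₀ ts q₀ : ℝ, 0 < κ₀ ∧ κ₀ < x₀ ^ 2 ∧ 0 < ts ∧ ts < 1 ∧ q₀ < x₀ / 2 ∧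
      contourCorner ts x₀ κ₀ = q₀ ∧ ∀ σ : ℝ, σ ^ 2 = 1 →
      (∃ c C ρ : ℝ, 0 < c ∧ 0 < C ∧ 0 < ρ ∧ ρ < 2 ∧ ∀ᶠ p : ℂ × ℝ in 𝓝 ((x₀ : ℂ), κ₀),
        SaddleBounds c C 2 ρ p.1 (contourCorner ts p.1 p.2) (contourDir ts σ p.1 p.2) 1) ∧
      (∃ c C ρ : ℝ, 0 < c ∧ 0 < C ∧ 0 < ρ ∧ ρ < ts ∧ ∀ᶠ p : ℂ × ℝ in 𝓝 ((x₀ : ℂ), κ₀),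
        SaddleBounds c C ts ρ p.1 (contourCorner ts p.1 p.2) (contourDir ts σ p.1 p.2) p.2) := by
  obtain ⟨a, ha⟩ : ∃ a, a = 1 - x₀ ^ 2 := ⟨_, rfl⟩
  obtain ⟨μ, hμ⟩ : ∃ μ, μ = a / 16 := ⟨_, rfl⟩
  obtain ⟨y₀, hy⟩ : ∃ y₀, y₀ = √a / 2 := ⟨_, rfl⟩
  obtain ⟨q₀, hq⟩ : ∃ q₀, q₀ = (1 / 2 - μ) * x₀ := ⟨_, rfl⟩
  have D : ContourData x₀ a μ y₀ q₀ := ⟨hx, hx1, ha, hμ, hy, hq⟩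
  have hx2 : 0 < x₀ ^ 2 := by positivity
  have hx21 : x₀ ^ 2 < 1 := by nlinarith
  have hl : 0 < 1 + |Real.log (x₀ / 8)| := by positivity
  -- These are the two smallness conditions on the level in `ContourData.strict_small`.
  obtain ⟨κ₀, hκ⟩ : ∃ κ₀, κ₀ = min (2 * μ * x₀ ^ 2) (x₀ ^ 2 / 4 / (1 + |Real.log (x₀ / 8)|)) := ⟨_, rfl⟩
  have hκ1 : κ₀ ≤ 2 * μ * x₀ ^ 2 := by rw [hκ]; exact min_le_left _ _
  have hκ2 : κ₀ * (1 + |Real.log (x₀ / 8)|) ≤ x₀ ^ 2 / 4 := by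
    rw [← le_div_iff₀ hl, hκ]; exact min_le_right _ _
  have hκ0 : 0 < κ₀ := by
    rw [hκ]; exact lt_min (mul_pos (mul_pos two_pos D.μ_pos) hx2) (by positivity)
  have hκx : κ₀ < x₀ ^ 2 := by
    have := mul_lt_mul_of_pos_right D.μ_lt hx2
    linarith
  obtain ⟨r, hr⟩ : ∃ r, r = x₀ * (1 - √(1 - κ₀ / x₀ ^ 2)) / 2 := ⟨_, rfl⟩
  have hrs : smallSaddle x₀ κ₀ = r := by rw [hr]; exact smallSaddle_ofReal hκx.le hx.ne'
  have hx0c : (x₀ : ℂ) ≠ 0 := by exact_mod_cast hx.ne'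
  have hreq : 4 * r * (x₀ - r) = κ₀ := by
    have := smallSaddle_eq hx0c κ₀
    rw [hrs] at this
    exact_mod_cast this
  have hs0 : 0 ≤ √(1 - κ₀ / x₀ ^ 2) := Real.sqrt_nonneg _
  have hs1 : √(1 - κ₀ / x₀ ^ 2) < 1 := by
    rw [Real.sqrt_lt' one_pos]
    have : 0 < κ₀ / x₀ ^ 2 := by positivity
    linarith
  have hr0 : 0 < r := by rw [hr]; exact half_pos (mul_pos hx (by linarith))
  have hr2 : r ≤ x₀ / 2 := by
    rw [hr]
    have := mul_nonneg hx.le hs0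
    linarith
  have hrμ : r ≤ μ * x₀ := by
    have h1 : 4 * r * (x₀ / 2) ≤ κ₀ := by
      rw [← hreq]; exact mul_le_mul_of_nonneg_left (by linarith) (by linarith)
    have h2 : r * x₀ ≤ μ * x₀ * x₀ := by linarith
    exact le_of_mul_le_mul_right h2 hx
  have hrq : r < q₀ := by
    rw [hq]
    have := mul_lt_mul_of_pos_right D.μ_lt hx
    linarith
  have hq0 := D.q_pos
  have hq2 := D.q_lt
  obtain ⟨ts, hts⟩ : ∃ ts, ts = r / q₀ := ⟨_, rfl⟩
  have hts0 : 0 < ts := by rw [hts]; positivity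
  have hts1 : ts < 1 := by rw [hts, div_lt_one hq0]; exact hrq
  have hQ₀ : contourCorner ts x₀ κ₀ = q₀ := by
    rw [contourCorner, hrs, hts]
    have : (r : ℂ) ≠ 0 := by exact_mod_cast hr0.ne'
    have : (q₀ : ℂ) ≠ 0 := by exact_mod_cast hq0.ne'
    push_cast; field_simp
  have hζ₀ : ∀ σ : ℝ, turningSaddle σ x₀ = x₀ / 2 + σ * Complex.I * y₀ := fun σ => by
    rw [turningSaddle_ofReal hx21.le, hy, ha]
  have hv₀ : ∀ σ : ℝ, contourDir ts σ x₀ κ₀ = μ * x₀ + σ * Complex.I * y₀ := fun σ => by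
    rw [contourDir, hQ₀, hζ₀, hq]; push_cast; ring
  refine ⟨κ₀, ts, q₀, hκ0, hκx, hts0, hts1, hq2, hQ₀, fun σ hσ => ?_⟩
  have cz : ContinuousAt (fun p : ℂ × ℝ => p.1) ((x₀ : ℂ), κ₀) := continuous_fst.continuousAt
  have cQ : ContinuousAt (fun p : ℂ × ℝ => contourCorner ts p.1 p.2) ((x₀ : ℂ), κ₀) :=
    (continuousAt_smallSaddle hx hκx).div_const _
  have cv : ContinuousAt (fun p : ℂ × ℝ => contourDir ts σ p.1 p.2) ((x₀ : ℂ), κ₀) := by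
    refine ContinuousAt.sub ?_ cQ
    exact ContinuousAt.comp (f := fun p : ℂ × ℝ => p.1) (g := turningSaddle σ)
      (continuousAt_turningSaddle hx hx1 σ) cz
  obtain ⟨c₀, C₀, hline⟩ := D.exists_lineBounds hσ
  have hne : ∀ᶠ p : ℂ × ℝ in 𝓝 ((x₀ : ℂ), κ₀), p.1 ≠ 0 := cz.eventually_ne hx0c
  constructor
  · refine exists_saddleBounds (z := fun p : ℂ × ℝ => p.1) (κ := fun _ => 1) cz cQ cv
      continuousAt_const one_pos (Eventually.of_forall fun _ => le_rfl) (c₀ := c₀) (C₀ := C₀)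
      ?_ two_pos (by norm_num) ?_ ?_ ?_
    · simp only; rw [hQ₀, hv₀]; exact hline
    · filter_upwards with p
      rw [brokenLine_contour_two, turningSaddle_eq hσ]; norm_num
    · simp only
      rw [brokenLine_contour_two, brokenLineVel_contour_two, Complex.ofReal_one]
      exact re_turning_curvature D hσ (hζ₀ σ) (hv₀ σ)
    · intro t ht ht2
      simp only
      rw [hQ₀, hv₀]
      exact D.strict_turning hσ ht ht2
  · refine exists_saddleBounds (z := fun p : ℂ × ℝ => p.1) (κ := fun p : ℂ × ℝ => p.2) cz cQ cv
      continuous_snd.continuousAt hκ0 ?_ (c₀ := c₀) (C₀ := C₀) ?_ hts0 hts1.ne ?_ ?_ ?_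
    · have : κ₀ < 1 := by linarith
      filter_upwards [(continuous_snd.continuousAt (x := ((x₀ : ℂ), κ₀))).eventually_lt_const this]
        with p hp using le_of_lt hp
    · simp only; rw [hQ₀, hv₀]; exact hline
    · filter_upwards [hne] with p hp
      rw [brokenLine_contour_small hts0 hts1, smallSaddle_eq hp]
    · simp only
      rw [brokenLine_contour_small hts0 hts1, brokenLineVel_contour_small hts1, hQ₀, hrs]
      have h1 : (((κ₀ : ℂ) / 2 - 2 * (r : ℂ) ^ 2) * ((q₀ : ℂ) / r) ^ 2)
          = (((κ₀ / 2 - 2 * r ^ 2) * (q₀ / r) ^ 2 : ℝ) : ℂ) := by push_cast; ring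
      rw [h1, Complex.ofReal_re]
      have h2 : 0 < κ₀ / 2 - 2 * r ^ 2 := by
        rw [← hreq]
        have : 0 < 2 * r * (x₀ - 2 * r) := mul_pos (by linarith) (by linarith)
        linarith
      positivity
    · intro t ht htr
      simp only
      rw [hQ₀, hv₀, hts]
      exact D.strict_small hσ hκ0 hκ1 hκ2 hr0 hrq hreq ht (by rwa [← hts])

/-! ### Relative asymptotic equality -/

/-- `f` equals `g` up to a relative error `O(ε)` along the filter `l`. -/
def RelEquiv {P : Type*} (l : Filter P) (ε : P → ℝ) (f g : P → ℂ) : Prop :=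
  ∃ e : P → ℂ, e =O[l] ε ∧ ∀ᶠ p in l, f p = g p * (1 + e p)

namespace RelEquiv

variable {P : Type*} {l : Filter P} {ε : P → ℝ} {f f₁ f₂ g g₁ g₂ : P → ℂ}

theorem refl (f : P → ℂ) : RelEquiv l ε f f :=
  ⟨fun _ => 0, isBigO_zero _ _, Eventually.of_forall fun p => by simp⟩

theorem congr_right (h : RelEquiv l ε f g₁) (hg : ∀ᶠ p in l, g₁ p = g₂ p) : RelEquiv l ε f g₂ := by
  obtain ⟨e, he, h⟩ := h
  refine ⟨e, he, ?_⟩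
  filter_upwards [h, hg] with p h1 h2
  rw [h1, h2]

theorem congr_left (h : RelEquiv l ε f₁ g) (hf : ∀ᶠ p in l, f₁ p = f₂ p) : RelEquiv l ε f₂ g := by
  obtain ⟨e, he, h⟩ := h
  refine ⟨e, he, ?_⟩
  filter_upwards [h, hf] with p h1 h2
  rw [← h2, h1]

theorem of_norm_sub_le {K : ℝ} (h : ∀ᶠ p in l, ‖f p - g p‖ ≤ K * |ε p| * ‖g p‖) :
    RelEquiv l ε f g := by
  refine ⟨fun p => if g p = 0 then 0 else f p / g p - 1, IsBigO.of_bound (max K 0) ?_, ?_⟩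
  · filter_upwards [h] with p hp
    split_ifs with hg
    · rw [norm_zero]; positivity
    · rw [div_sub_one hg, norm_div, div_le_iff₀ (norm_pos_iff.2 hg), Real.norm_eq_abs]
      refine hp.trans ?_
      gcongr
      exact le_max_left _ _
  · filter_upwards [h] with p hp
    split_ifs with hg
    · rw [hg, norm_zero, mul_zero, sub_zero] at hp
      rw [norm_le_zero_iff.1 hp, hg, zero_mul]
    · field_simp; ring

theorem mul (hε : Tendsto ε l (𝓝 0)) (h₁ : RelEquiv l ε f₁ g₁) (h₂ : RelEquiv l ε f₂ g₂) :
    RelEquiv l ε (fun p => f₁ p * f₂ p) (fun p => g₁ p * g₂ p) := by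
  obtain ⟨e₁, he₁, h₁⟩ := h₁
  obtain ⟨e₂, he₂, h₂⟩ := h₂
  refine ⟨fun p => e₁ p + e₂ p + e₁ p * e₂ p, (he₁.add he₂).add ?_, ?_⟩
  · have := he₁.mul ((he₂.trans_tendsto hε).isBigO_one ℝ)
    simpa using this
  · filter_upwards [h₁, h₂] with p h1 h2
    rw [h1, h2]; ring

theorem trans {h : P → ℂ} (hε : Tendsto ε l (𝓝 0)) (h₁ : RelEquiv l ε f g)
    (h₂ : RelEquiv l ε g h) : RelEquiv l ε f h := by
  obtain ⟨e₁, he₁, h₁⟩ := h₁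
  obtain ⟨e₂, he₂, h₂⟩ := h₂
  refine ⟨fun p => e₁ p + e₂ p + e₁ p * e₂ p, (he₁.add he₂).add ?_, ?_⟩
  · have := he₁.mul ((he₂.trans_tendsto hε).isBigO_one ℝ)
    simpa using this
  · filter_upwards [h₁, h₂] with p h1 h2
    rw [h1, h2]; ring

theorem inv (hε : Tendsto ε l (𝓝 0)) (h : RelEquiv l ε f g) :
    RelEquiv l ε (fun p => (f p)⁻¹) (fun p => (g p)⁻¹) := by
  obtain ⟨e, he, h⟩ := h
  have ht : Tendsto e l (𝓝 0) := he.trans_tendsto hε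
  have h1 : ∀ᶠ p in l, ‖e p‖ < 1 / 2 := by
    have := ht.norm
    rw [norm_zero] at this
    exact this.eventually (gt_mem_nhds (by norm_num))
  have h2 : ∀ᶠ p in l, 1 / 2 ≤ ‖1 + e p‖ := by
    filter_upwards [h1] with p hp
    have := norm_sub_le (1 + e p) (e p)
    rw [add_sub_cancel_right, norm_one] at this
    linarith
  refine ⟨fun p => -e p / (1 + e p), ?_, ?_⟩
  · refine IsBigO.trans (IsBigO.of_bound 2 ?_) he
    filter_upwards [h2] with p hp
    rw [norm_div, norm_neg, div_le_iff₀ (by linarith)]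
    nlinarith [norm_nonneg (e p)]
  · filter_upwards [h, h2] with p hp hp2
    have : 1 + e p ≠ 0 := norm_pos_iff.1 (by linarith)
    have h3 : 1 + -e p / (1 + e p) = (1 + e p)⁻¹ := by field_simp; ring
    rw [hp, mul_inv, h3]

theorem div (hε : Tendsto ε l (𝓝 0)) (h₁ : RelEquiv l ε f₁ g₁) (h₂ : RelEquiv l ε f₂ g₂) :
    RelEquiv l ε (fun p => f₁ p / f₂ p) (fun p => g₁ p / g₂ p) := by
  simpa only [div_eq_mul_inv] using h₁.mul hε (h₂.inv hε)

/-- A difference keeps its relative accuracy if its terms do not nearly cancel. -/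
theorem sub (h₁ : RelEquiv l ε f₁ g₁) (h₂ : RelEquiv l ε f₂ g₂) {C : ℝ}
    (hC : ∀ᶠ p in l, ‖g₁ p‖ ≤ C * ‖g₁ p - g₂ p‖ ∧ ‖g₂ p‖ ≤ C * ‖g₁ p - g₂ p‖) :
    RelEquiv l ε (fun p => f₁ p - f₂ p) (fun p => g₁ p - g₂ p) := by
  obtain ⟨e₁, he₁, h₁⟩ := h₁
  obtain ⟨e₂, he₂, h₂⟩ := h₂
  obtain ⟨c₁, hc₁⟩ := he₁.bound
  obtain ⟨c₂, hc₂⟩ := he₂.bound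
  refine of_norm_sub_le (K := |c₁| * C + |c₂| * C) ?_
  filter_upwards [h₁, h₂, hC, hc₁, hc₂] with p h1 h2 h3 h4 h5
  have h6 : f₁ p - f₂ p - (g₁ p - g₂ p) = e₁ p * g₁ p - e₂ p * g₂ p := by rw [h1, h2]; ring
  rw [h6]
  have a1 : ‖e₁ p‖ ≤ |c₁| * |ε p| := h4.trans (by
    rw [Real.norm_eq_abs]; gcongr; exact le_abs_self _)
  have a2 : ‖e₂ p‖ ≤ |c₂| * |ε p| := h5.trans (by
    rw [Real.norm_eq_abs]; gcongr; exact le_abs_self _)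
  calc _ ≤ ‖e₁ p‖ * ‖g₁ p‖ + ‖e₂ p‖ * ‖g₂ p‖ := by
        rw [← norm_mul, ← norm_mul]; exact norm_sub_le _ _
    _ ≤ (|c₁| * |ε p|) * (C * ‖g₁ p - g₂ p‖) + (|c₂| * |ε p|) * (C * ‖g₁ p - g₂ p‖) := by
        gcongr
        exacts [h3.1, h3.2]
    _ = _ := by ring

/-- If a factor separates the terms of a difference, that difference keeps its relative
accuracy. -/
theorem sub_mul (h₁ : RelEquiv l ε f₁ fun p => g₁ p * g p) (h₂ : RelEquiv l ε f₂ fun p => g₂ p * g p)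
    {a₁ a₂ : ℂ} (t₁ : Tendsto g₁ l (𝓝 a₁)) (t₂ : Tendsto g₂ l (𝓝 a₂)) (ha : a₁ ≠ a₂) :
    RelEquiv l ε (fun p => f₁ p - f₂ p) (fun p => (g₁ p - g₂ p) * g p) := by
  have hd : 0 < ‖a₁ - a₂‖ := norm_pos_iff.2 (sub_ne_zero.2 ha)
  refine (sub h₁ h₂ (C := (‖a₁‖ + ‖a₂‖ + 1) / (‖a₁ - a₂‖ / 2)) ?_).congr_right
    (Eventually.of_forall fun p => by ring)
  filter_upwards [(t₁.sub t₂).norm.eventually (lt_mem_nhds (half_lt_self hd)),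
    t₁.norm.eventually (gt_mem_nhds (lt_add_one _)),
    t₂.norm.eventually (gt_mem_nhds (lt_add_one _))] with p h3 h4 h5
  rw [← _root_.sub_mul, norm_mul, norm_mul, norm_mul, ← mul_assoc]
  have h6 : ‖a₁‖ + ‖a₂‖ + 1 ≤ (‖a₁‖ + ‖a₂‖ + 1) / (‖a₁ - a₂‖ / 2) * ‖g₁ p - g₂ p‖ := by
    rw [div_mul_eq_mul_div, le_div_iff₀ (half_pos hd)]
    gcongr
  have := norm_nonneg a₁; have := norm_nonneg a₂
  constructor <;> refine mul_le_mul_of_nonneg_right ?_ (norm_nonneg _) <;> linarith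

/-- A factor whose logarithm is `O(ε)` may be dropped. -/
theorem trans_mul_exp {w : P → ℂ} {K : ℝ} (h : RelEquiv l ε f fun p => g₁ p * Complex.exp (w p))
    (hε : Tendsto ε l (𝓝 0)) (hw : ∀ᶠ p in l, ‖w p‖ ≤ K * |ε p|) (hg : ∀ᶠ p in l, g₁ p = g p) :
    RelEquiv l ε f g := by
  have hwO : w =O[l] ε := IsBigO.of_bound K (by simpa only [Real.norm_eq_abs] using hw)
  have he : RelEquiv l ε (fun p => Complex.exp (w p)) (fun _ => 1) := by
    refine of_norm_sub_le (K := 2 * K) ?_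
    filter_upwards [hw, ((hwO.trans_tendsto hε).norm.eventually (gt_mem_nhds
      (show ‖(0 : ℂ)‖ < 1 by simp)))] with p h1 h2
    rw [norm_one, mul_one, mul_assoc]
    exact (Complex.norm_exp_sub_one_le h2.le).trans (by gcongr)
  refine (h.trans hε (((refl g₁).mul hε he))).congr_right ?_
  filter_upwards [hg] with p hp
  rw [mul_one, hp]

end RelEquiv

/-! ### The Casoratian and the product of the recurrence coefficients -/

/-- The Casoratian of two solutions of a three-term recurrence is multiplied at each step by the
coefficient of the recurrence (Abel's identity). -/
theorem casoratian_eq_prod {z : ℂ} {b : ℕ → ℂ} {f g : ℕ → ℂ} {k n : ℕ} (hkn : k ≤ n)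
    (hf : ∀ j, k ≤ j → f (j + 2) = z * f (j + 1) - b (j + 1) * f j)
    (hg : ∀ j, k ≤ j → g (j + 2) = z * g (j + 1) - b (j + 1) * g j) :
    f (n + 1) * g n - f n * g (n + 1)
      = (∏ j ∈ Finset.Ioc k n, b j) * (f (k + 1) * g k - f k * g (k + 1)) := by
  induction n, hkn using Nat.le_induction with
  | base => simp
  | succ n hn ih =>
    rw [← Finset.insert_Ioc_right_eq_Ioc_add_one hn, Finset.prod_insert (by simp), mul_assoc, ← ih,
      hf n hn, hg n hn]
    ring

/-- Up to an error `O(M⁻²)`, and a constant, the logarithm of the recurrence coefficient at the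
level `M` is the increment of `M log M - M` over `[M - 1, M]`, so that its sums telescope. -/
theorem exists_abs_log_lam_sub_le (α β : ℝ) :
    ∃ C R : ℝ, 0 ≤ C ∧ ∀ k : ℕ, R ≤ bigN β k → 0 < lam α β k ∧ |Real.log (lam α β k / 2)
      - (bigN β k * Real.log (bigN β k) - bigN β k - ((bigN β k - 1) * Real.log (bigN β k - 1)
        - (bigN β k - 1)) - Real.log 4)| ≤ C / bigN β k ^ 2 := by
  refine ⟨2 * α ^ 2 + 3, 2 + 2 * α ^ 2, by positivity, fun k hk => ?_⟩
  obtain ⟨M, hM⟩ : ∃ M, M = bigN β k := ⟨_, rfl⟩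
  have hl : lam α β k = (M ^ 2 - α ^ 2) / (2 * (M + 1 / 2)) := by
    rw [hM, lam, bigN]; congr 1 <;> ring
  rw [hl, ← hM]
  rw [← hM] at hk
  have hM2 : 2 ≤ M := by nlinarith [sq_nonneg α]
  have hM0 : 0 < M := by linarith
  obtain ⟨u, hu⟩ : ∃ u, u = 1 / M := ⟨_, rfl⟩
  have hu0 : 0 < u := by rw [hu]; positivity
  have hu2 : u ≤ 1 / 2 := by rw [hu]; gcongr
  have hMu : M * u = 1 := by rw [hu]; field_simp
  have hαu : α ^ 2 * u ^ 2 ≤ 1 / 2 := by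
    have : α ^ 2 * u ≤ 1 := by
      have : 2 * α ^ 2 * u ≤ M * u := by gcongr; linarith
      nlinarith
    nlinarith
  have e1 : 1 - α ^ 2 * u ^ 2 = (M ^ 2 - α ^ 2) / M ^ 2 := by rw [hu]; field_simp
  have e2 : 1 - -(u / 2) = (M + 1 / 2) / M := by rw [hu]; field_simp; ring
  have e3 : 1 - u = (M - 1) / M := by rw [hu]; field_simp
  have p1 : 0 < M ^ 2 - α ^ 2 := by
    have : 0 < (M ^ 2 - α ^ 2) / M ^ 2 := by rw [← e1]; linarith
    exact (div_pos_iff_of_pos_right (by positivity)).1 this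
  refine ⟨by positivity, ?_⟩
  have hx0 : 0 ≤ α ^ 2 * u ^ 2 := by positivity
  have hv0 : 0 ≤ u / 2 := by positivity
  have l1 := Real.abs_log_sub_add_sum_range_le (x := α ^ 2 * u ^ 2)
    (by rw [abs_of_nonneg hx0]; linarith) 0
  have l2 := Real.abs_log_sub_add_sum_range_le (x := -(u / 2))
    (by rw [abs_neg, abs_of_nonneg hv0]; linarith) 1
  have l3 := Real.abs_log_sub_add_sum_range_le (x := u)
    (by rw [abs_of_nonneg hu0.le]; linarith) 2
  rw [e1, Real.log_div p1.ne' (pow_pos hM0 2).ne', Real.log_pow, abs_of_nonneg hx0] at l1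
  rw [e2, Real.log_div (by linarith) hM0.ne', abs_neg, abs_of_nonneg hv0] at l2
  rw [e3, Real.log_div (by linarith) hM0.ne', abs_of_nonneg hu0.le] at l3
  simp only [Finset.sum_range_succ, Finset.sum_range_zero, Nat.cast_zero, Nat.cast_one] at l1 l2 l3
  have h1 : (α ^ 2 * u ^ 2) ^ (0 + 1) / (1 - α ^ 2 * u ^ 2) ≤ 2 * α ^ 2 * u ^ 2 := by
    rw [div_le_iff₀ (by linarith), zero_add, pow_one]
    nlinarith [mul_nonneg hx0 (sub_nonneg.2 hαu)]
  have h2 : (u / 2) ^ (1 + 1) / (1 - u / 2) ≤ u ^ 2 / 2 := by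
    rw [div_le_iff₀ (by linarith)]
    nlinarith [sq_nonneg u]
  have h3 : u ^ (2 + 1) / (1 - u) ≤ 2 * u ^ 3 := by
    rw [div_le_iff₀ (by linarith)]
    have : 0 ≤ u ^ 3 * (1 - 2 * u) := mul_nonneg (by positivity) (by linarith)
    have e : u ^ (2 + 1) = u ^ 3 := rfl
    rw [e]; linarith
  have l1' := l1.trans h1
  have l2' := l2.trans h2
  have l3' := l3.trans h3
  obtain ⟨r, hr⟩ : ∃ r, r = (0 + u ^ (0 + 1) / (0 + 1) + u ^ (1 + 1) / (1 + 1) +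
    (Real.log (M - 1) - Real.log M)) := ⟨_, rfl⟩
  rw [← hr] at l3'
  have l4 : |(M - 1) * r| ≤ 2 * u ^ 2 := by
    rw [abs_mul, abs_of_nonneg (by linarith)]
    calc (M - 1) * |r| ≤ M * (2 * u ^ 3) := by gcongr; linarith
      _ = 2 * u ^ 2 * (M * u) := by ring
      _ = _ := by rw [hMu, mul_one]
  have hlog : Real.log ((M ^ 2 - α ^ 2) / (2 * (M + 1 / 2)) / 2)
      = Real.log (M ^ 2 - α ^ 2) - Real.log (M + 1 / 2) - Real.log 4 := by
    rw [div_div, Real.log_div p1.ne' (by positivity), show 2 * (M + 1 / 2) * 2 = (M + 1 / 2) * 4 by ring,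
      Real.log_mul (by positivity) (by norm_num)]
    ring
  have hC : (2 * α ^ 2 + 3) / M ^ 2 = (2 * α ^ 2 + 3) * u ^ 2 := by
    rw [hu]; field_simp
  rw [hlog, hC]
  have hmr : (M - 1) * r = u * M - u + u / 2 * (u * M) - u ^ 2 / 2 +
      (M - 1) * (Real.log (M - 1) - Real.log M) := by rw [hr]; ring
  rw [mul_comm u M, hMu] at hmr
  rw [abs_le] at l1' l2' l4 ⊢
  push_cast at l1' l2'
  constructor <;> linarith

theorem prod_eq_exp_sum_log {ι : Type*} (s : Finset ι) {a : ι → ℝ} (ha : ∀ i ∈ s, 0 < a i) :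
    ∏ i ∈ s, a i = Real.exp (∑ i ∈ s, Real.log (a i)) := by
  rw [Real.exp_sum]
  exact Finset.prod_congr rfl fun i hi => (Real.exp_log (ha i hi)).symm

/-- A form of Stirling's formula for the product of the scaled recurrence coefficients. -/
theorem exists_prod_lam_bound (α β : ℝ) {c : ℝ} (hc : 0 < c) :
    ∃ C N0 : ℝ, ∀ k n : ℕ, k ≤ n → N0 ≤ bigN β n → c * bigN β n ≤ bigN β k →
      |∏ j ∈ Finset.Ioc k n, lam α β j / 2 / bigN β n
        - Real.exp (-bigN β n - (bigN β k * Real.log (bigN β k / bigN β n) - bigN β k)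
          - (bigN β n - bigN β k) * Real.log 4)|
      ≤ C * |1 / bigN β n| * Real.exp (-bigN β n - (bigN β k * Real.log (bigN β k / bigN β n) - bigN β k)
          - (bigN β n - bigN β k) * Real.log 4) := by
  obtain ⟨A, R, hA, hR⟩ := exists_abs_log_lam_sub_le α β
  refine ⟨2 * (A / c ^ 2), max (max (R / c) (1 / c)) (max 1 (A / c ^ 2)), fun k n hkn hN hk => ?_⟩
  simp only [max_le_iff] at hN
  obtain ⟨⟨hN1, hN2⟩, hN3, hN4⟩ := hN
  rw [div_le_iff₀' hc] at hN1 hN2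
  obtain ⟨N, hNe⟩ : ∃ N, N = bigN β n := ⟨_, rfl⟩
  rw [← hNe] at hN1 hN2 hN3 hN4 hk ⊢
  have hN0 : 0 < N := by linarith
  have hkN : bigN β k ≤ N := by
    have : (k : ℝ) ≤ n := by exact_mod_cast hkn
    rw [hNe, bigN, bigN]; linarith
  have hk1 : 1 ≤ bigN β k := by linarith
  have hj : ∀ j ∈ Finset.Ioc k n, bigN β k ≤ bigN β j := fun j hj => by
    have : (k : ℝ) ≤ j := by exact_mod_cast (Finset.mem_Ioc.1 hj).1.le
    rw [bigN, bigN]; linarith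
  set G : ℝ → ℝ := fun M => M * Real.log M - M with hG
  have hpos : ∀ j ∈ Finset.Ioc k n, 0 < lam α β j / 2 / N := fun j h => by
    have := (hR j (by linarith [hj j h])).1
    positivity
  have hterm : ∀ j ∈ Finset.Ioc k n, |Real.log (lam α β j / 2 / N)
      - (G (bigN β j) - G (bigN β j - 1) - Real.log 4 - Real.log N)| ≤ A / (c * N) ^ 2 := fun j h => by
    obtain ⟨h1, h2⟩ := hR j (by linarith [hj j h])
    rw [Real.log_div (by positivity) hN0.ne']
    have h3 := h2.trans (div_le_div_of_nonneg_left hA (by positivity)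
      (pow_le_pow_left₀ (by positivity) (hk.trans (hj j h)) 2))
    refine le_of_eq_of_le ?_ h3
    congr 1; simp only [hG]; ring
  have htel : ∀ m, k ≤ m → ∑ j ∈ Finset.Ioc k m, (G (bigN β j) - G (bigN β j - 1) - Real.log 4 - Real.log N)
      = G (bigN β m) - G (bigN β k) - (bigN β m - bigN β k) * (Real.log 4 + Real.log N) := by
    intro m hm
    induction m, hm using Nat.le_induction with
    | base => simp
    | succ m hm ih =>
      rw [← Finset.insert_Ioc_right_eq_Ioc_add_one hm, Finset.sum_insert (by simp), ih]
      have : bigN β (m + 1) - 1 = bigN β m := by rw [bigN, bigN]; push_cast; ring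
      rw [this, show bigN β (m + 1) = bigN β m + 1 by linarith]
      ring
  have hcard : ((Finset.Ioc k n).card : ℝ) ≤ N := by
    have hk' : bigN β k = k + β - 1 := rfl
    have hn' : N = n + β - 1 := hNe
    rw [Nat.card_Ioc, Nat.cast_sub hkn]; linarith
  rw [prod_eq_exp_sum_log _ hpos]
  obtain ⟨E, hE⟩ : ∃ E, E = -N - (bigN β k * Real.log (bigN β k / N) - bigN β k)
      - (N - bigN β k) * Real.log 4 := ⟨_, rfl⟩
  rw [← hE]
  have hEG : E = G N - G (bigN β k) - (N - bigN β k) * (Real.log 4 + Real.log N) := by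
    rw [hE, Real.log_div (by linarith) hN0.ne']; simp only [hG]; ring
  obtain ⟨w, hw⟩ : ∃ w, w = ∑ j ∈ Finset.Ioc k n, Real.log (lam α β j / 2 / N) - E := ⟨_, rfl⟩
  have hw1 : |w| ≤ A / c ^ 2 / N := by
    have := htel n hkn
    rw [← hNe] at this
    rw [hw, hEG, ← this, ← Finset.sum_sub_distrib]
    refine (Finset.abs_sum_le_sum_abs _ _).trans ((Finset.sum_le_card_nsmul _ _ _ hterm).trans ?_)
    rw [nsmul_eq_mul]
    calc _ ≤ N * (A / (c * N) ^ 2) := by gcongr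
      _ = _ := by field_simp
  have hw2 : |w| ≤ 1 := hw1.trans ((div_le_one hN0).2 hN4)
  have hs : ∑ j ∈ Finset.Ioc k n, Real.log (lam α β j / 2 / N) = E + w := by rw [hw]; ring
  rw [hs, Real.exp_add, ← mul_sub_one, abs_mul, abs_of_pos (Real.exp_pos E), mul_comm]
  have h3 := Real.abs_exp_sub_one_le hw2
  rw [abs_of_pos (by positivity : 0 < 1 / N)]
  gcongr
  calc _ ≤ 2 * |w| := h3
    _ ≤ 2 * (A / c ^ 2 / N) := by gcongr
    _ = _ := by ring

/-! ### The exponential region up to an intermediate index -/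

/-- The index at which the solutions of the recurrence are matched, a fixed fraction of `n`. -/
noncomputable def matchIndex (κ₀ : ℝ) (n : ℕ) : ℕ := ⌈κ₀ * n⌉₊

/-- The large parameter at the index `matchIndex κ₀ n + i`, relative to the one at `n`. -/
noncomputable def level (β κ₀ : ℝ) (i n : ℕ) : ℝ := bigN β (matchIndex κ₀ n + i) / bigN β n

/-- The monic polynomial in the variable `z = x / √N`, normalized to be monic again. -/
noncomputable def normPhi (α β : ℝ) (n : ℕ) (z : ℂ) (k : ℕ) : ℂ :=
  monicPhi α β k ((√(bigN β n) : ℝ) * z) / ((√(bigN β n) : ℝ) : ℂ) ^ k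

theorem tendsto_bigN (β : ℝ) : Tendsto (bigN β) atTop atTop := by
  unfold bigN
  have : (fun n : ℕ => (n : ℝ) + β - 1) = fun n : ℕ => (n : ℝ) + (β - 1) := by
    funext n; ring
  rw [this]
  exact tendsto_atTop_add_const_right _ _ tendsto_natCast_atTop_atTop

theorem tendsto_one_div_bigN (β : ℝ) : Tendsto (fun n => 1 / bigN β n) atTop (𝓝 0) := by
  simp only [one_div]
  exact (tendsto_bigN β).inv_tendsto_atTop

theorem tendsto_matchIndex {κ₀ : ℝ} (hκ : 0 < κ₀) : Tendsto (matchIndex κ₀) atTop atTop :=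
  tendsto_nat_ceil_atTop.comp (tendsto_natCast_atTop_atTop.const_mul_atTop hκ)

theorem tendsto_level (β : ℝ) {κ₀ : ℝ} (hκ : 0 < κ₀) (i : ℕ) :
    Tendsto (level β κ₀ i) atTop (𝓝 κ₀) := by
  have h1 : Tendsto (fun n : ℕ => (matchIndex κ₀ n : ℝ) / n) atTop (𝓝 κ₀) :=
    (tendsto_nat_ceil_mul_div_atTop hκ.le).comp tendsto_natCast_atTop_atTop
  have h2 : Tendsto (fun n : ℕ => 1 / (n : ℝ)) atTop (𝓝 0) := tendsto_one_div_atTop_nhds_zero_nat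
  have h3 := (h1.add (h2.const_mul (i + β - 1))).div ((h2.const_mul (β - 1)).const_add 1) (by simp)
  simp only [mul_zero, add_zero, div_one] at h3
  refine h3.congr' ?_
  filter_upwards [eventually_gt_atTop 0] with n hn
  have hn' : (n : ℝ) ≠ 0 := by positivity
  simp only [Pi.div_apply, level, bigN]
  rw [← mul_div_mul_right _ _ hn']
  push_cast
  congr 1 <;> field_simp <;> ring

theorem normPhi_eq (α β : ℝ) {n : ℕ} (hN : 0 < bigN β n) {z : ℂ} (hz : z ≠ 0) (k : ℕ) :
    normPhi α β n z k = z ^ k * scaledPhi α β k (1 / (bigN β n * z ^ 2)) := by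
  have h : ((√(bigN β n) : ℝ) : ℂ) ≠ 0 := by
    exact_mod_cast (Real.sqrt_pos.2 hN).ne'
  have h2 : ((√(bigN β n) : ℝ) : ℂ) ^ 2 = bigN β n := by
    rw [← Complex.ofReal_pow, Real.sq_sqrt hN.le]
  rw [normPhi, monicPhi_eq_pow_mul_scaledPhi α β (mul_ne_zero h hz), mul_pow, mul_pow, h2]
  field_simp

theorem normPhi_recurrence (α β : ℝ) {n : ℕ} (hN : 0 < bigN β n) (z : ℂ) (k : ℕ) :
    normPhi α β n z (k + 2) = z * normPhi α β n z (k + 1)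
      - ((lam α β (k + 1) / 2 / bigN β n : ℝ) : ℂ) * normPhi α β n z k := by
  have h : ((√(bigN β n) : ℝ) : ℂ) ≠ 0 := by
    exact_mod_cast (Real.sqrt_pos.2 hN).ne'
  have h2 : (bigN β n : ℂ) = ((√(bigN β n) : ℝ) : ℂ) ^ 2 := by
    rw [← Complex.ofReal_pow, Real.sq_sqrt hN.le]
  rw [normPhi, normPhi, normPhi, monicPhi, Complex.ofReal_div (_ / 2), h2, pow_add _ k 2, pow_add _ k 1]
  generalize ((lam α β (k + 1) / 2 : ℝ) : ℂ) = L
  field_simp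

/-- The asymptotics of the polynomials near the index `matchIndex κ₀ n`. Relative to the large
parameter at that index `z` becomes `z / √κ₀`, which is close to a real number greater than `1`. -/
theorem normPhi_matchIndex (α : ℝ) {β x₀ κ₀ : ℝ} (hβ : 0 < β) (hx : 0 < x₀) (hκ : 0 < κ₀)
    (hκx : κ₀ < x₀ ^ 2) (i : ℕ) :
    RelEquiv (atTop ×ˢ 𝓝 (x₀ : ℂ)) (fun p => 1 / bigN β p.1)
      (fun p => normPhi α β p.1 p.2 (matchIndex κ₀ p.1 + i))
      (fun p => p.2 ^ (matchIndex κ₀ p.1 + i) *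
        (Complex.exp (wkbLog (1 / (bigN β p.1 * p.2 ^ 2)) (bigN β (matchIndex κ₀ p.1 + i))) *
        Complex.exp (((α ^ 2 - 1 / 4) / 4 : ℝ) * (1 / (bigN β p.1 * p.2 ^ 2)) *
          Complex.log (bigN β p.1 * p.2 ^ 2)))) := by
  have hs0 : 0 < √κ₀ := Real.sqrt_pos.2 hκ
  have hx1 : 1 < x₀ / √κ₀ := by
    rw [one_lt_div hs0]; exact Real.sqrt_lt' hx |>.2 hκx
  -- A disc about `x₀ / √κ₀ > 1` that does not meet `[-1, 1]`.
  obtain ⟨r, hr⟩ : ∃ r, r = (x₀ / √κ₀ - 1) / 2 := ⟨_, rfl⟩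
  have hr0 : 0 < r := by rw [hr]; linarith
  have hKsub : Metric.closedBall ((x₀ / √κ₀ : ℝ) : ℂ) r ⊆ (Complex.ofReal '' Set.Icc (-1 : ℝ) 1)ᶜ := by
    rintro z hz ⟨x, hx, rfl⟩
    rw [Metric.mem_closedBall, dist_eq_norm, ← Complex.ofReal_sub, Complex.norm_real,
      Real.norm_eq_abs, abs_le] at hz
    linarith [hx.2, hz.1]
  obtain ⟨k0, H⟩ := scaled_outer_asymptotics β ((α ^ 2 - 1 / 4) / 4) hβ _
    (isCompact_closedBall _ _) hKsub
  obtain ⟨B1, hB1, h1⟩ := exists_norm_scaledPhi_sub_one_le α β k0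
  obtain ⟨B2, hB2, h2⟩ := exists_norm_scaledPhi_sub_one_le α β (k0 + 1)
  obtain ⟨C, n0, H⟩ := H (max B1 B2) (le_max_of_le_left hB1)
  have t1 : Tendsto (fun p : ℕ × ℂ => level β κ₀ i p.1) (atTop ×ˢ 𝓝 (x₀ : ℂ)) (𝓝 κ₀) :=
    (tendsto_level β hκ i).comp tendsto_fst
  have t2 : Tendsto (fun p : ℕ × ℂ => p.2) (atTop ×ˢ 𝓝 (x₀ : ℂ)) (𝓝 (x₀ : ℂ)) := tendsto_snd
  have t3 : Tendsto (fun p : ℕ × ℂ => p.2 / ((√(level β κ₀ i p.1) : ℝ) : ℂ)) (atTop ×ˢ 𝓝 (x₀ : ℂ))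
      (𝓝 ((x₀ / √κ₀ : ℝ) : ℂ)) := by
    have := t2.div (Complex.continuous_ofReal.continuousAt.tendsto.comp
      (Real.continuous_sqrt.continuousAt.tendsto.comp t1)) (by exact_mod_cast hs0.ne')
    rw [Complex.ofReal_div]
    exact this
  have tN : Tendsto (fun p : ℕ × ℂ => bigN β p.1) (atTop ×ˢ 𝓝 (x₀ : ℂ)) atTop :=
    (tendsto_bigN β).comp tendsto_fst
  have tk : Tendsto (fun p : ℕ × ℂ => matchIndex κ₀ p.1 + i) (atTop ×ˢ 𝓝 (x₀ : ℂ)) atTop :=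
    ((tendsto_add_atTop_nat i).comp (tendsto_matchIndex hκ)).comp tendsto_fst
  refine RelEquiv.of_norm_sub_le (K := |C| * (2 / κ₀)) ?_
  filter_upwards [t3.eventually (Metric.closedBall_mem_nhds _ hr0), tN.eventually_ge_atTop 1,
    tk.eventually_ge_atTop n0, t1.eventually (lt_mem_nhds (half_lt_self hκ)),
    t2.norm.eventually (lt_mem_nhds (show x₀ / 2 < ‖(x₀ : ℂ)‖ by
      rw [Complex.norm_real, Real.norm_of_nonneg hx.le]; exact half_lt_self hx)),
    tN.eventually_ge_atTop (4 / x₀ ^ 2)] with p p1 p2 p3 p4 p5 p6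
  obtain ⟨n, z⟩ := p
  simp only at p1 p2 p3 p4 p5 p6 ⊢
  have hN : 0 < bigN β n := by linarith
  have hz0 : 0 < ‖z‖ := by linarith
  have hz : z ≠ 0 := norm_pos_iff.1 hz0
  obtain ⟨hM, H⟩ := H _ p3
  have hl0 : 0 < level β κ₀ i n := by linarith
  have hlev : bigN β (matchIndex κ₀ n + i) = level β κ₀ i n * bigN β n := by
    rw [level]; field_simp
  obtain ⟨y, hy⟩ : ∃ y, y = 1 / ((bigN β n : ℂ) * z ^ 2) := ⟨_, rfl⟩
  have hzz : (bigN β (matchIndex κ₀ n + i) : ℂ) * (z / ((√(level β κ₀ i n) : ℝ) : ℂ)) ^ 2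
      = bigN β n * z ^ 2 := by
    have hsq : ((√(level β κ₀ i n) : ℝ) : ℂ) ^ 2 = level β κ₀ i n := by
      rw [← Complex.ofReal_pow, Real.sq_sqrt hl0.le]
    have hl0' : (level β κ₀ i n : ℂ) ≠ 0 := by exact_mod_cast hl0.ne'
    rw [div_pow, hsq, hlev]; push_cast; field_simp
  have hy1 : ‖y‖ ≤ 1 := by
    rw [hy, norm_div, norm_one, norm_mul, norm_pow, Complex.norm_real, Real.norm_of_nonneg hN.le,
      div_le_one (by positivity)]
    have : (x₀ / 2) ^ 2 ≤ ‖z‖ ^ 2 := by gcongr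
    calc (1 : ℝ) = 4 / x₀ ^ 2 * (x₀ / 2) ^ 2 := by field_simp; norm_num
      _ ≤ _ := by gcongr
  have := H _ p1 y (by rw [hzz, hy]) (fun k => scaledPhi α β k y) (fun k _ _ => by
    simp only [scaledPhi]
    rw [lam_succ_div_two hβ k]
    push_cast; ring)
    ((h1 y hy1).trans (by gcongr; exact le_max_left _ _))
    ((h2 y hy1).trans (by gcongr; exact le_max_right _ _))
  rw [hzz] at this
  rw [normPhi_eq α β hN hz, ← hy]
  set E1 := wkbLog y (bigN β (matchIndex κ₀ n + i))
  have e2 : (((α ^ 2 - 1 / 4) / 4 : ℝ) : ℂ) * y * Complex.log (bigN β n * z ^ 2) =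
    (((α ^ 2 - 1 / 4) / 4 : ℝ) * y * Complex.log (bigN β n * z ^ 2)) := rfl
  set E2 := (((α ^ 2 - 1 / 4) / 4 : ℝ) : ℂ) * y * Complex.log (bigN β n * z ^ 2)
  have e3 : Complex.exp (-E1) * Complex.exp E1 = 1 := by rw [← Complex.exp_add]; simp
  have e4 : Complex.exp (-E2) * Complex.exp E2 = 1 := by rw [← Complex.exp_add]; simp
  have e5 : z ^ (matchIndex κ₀ n + i) * scaledPhi α β (matchIndex κ₀ n + i) y
      - z ^ (matchIndex κ₀ n + i) * (Complex.exp E1 * Complex.exp E2)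
      = (scaledPhi α β (matchIndex κ₀ n + i) y * Complex.exp (-E1) * Complex.exp (-E2) - 1) *
        (z ^ (matchIndex κ₀ n + i) * (Complex.exp E1 * Complex.exp E2)) := by
    linear_combination (-z ^ (matchIndex κ₀ n + i) * scaledPhi α β (matchIndex κ₀ n + i) y) *
      (e3 * (Complex.exp (-E2) * Complex.exp E2) + e4)
  rw [e5, norm_mul]
  refine mul_le_mul_of_nonneg_right (this.trans ?_) (norm_nonneg _)
  rw [hlev, abs_of_pos (one_div_pos.2 hN)]
  calc C / (level β κ₀ i n * bigN β n) ≤ |C| / (κ₀ / 2 * bigN β n) := by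
        gcongr; exact le_abs_self _
    _ = _ := by field_simp

/-- The two saddle points for `κ` are `z` times the two characteristic roots of the recurrence at
the relative level `κ`. -/
theorem sub_smallSaddle_eq (z : ℂ) (κ : ℝ) : z - smallSaddle z κ = z * wkbRatio (κ / z ^ 2) := by
  rw [smallSaddle, wkbRatio]; ring

/-- Over one index step the dominant solution is multiplied by its characteristic root. -/
theorem exists_norm_wkbLog_step_le {c R : ℝ} (hc : 0 < c) :
    ∃ C : ℝ, 0 ≤ C ∧ ∀ (y : ℂ) (M : ℝ), ‖y‖ ≤ 1 → WkbRegular c R y M →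
      ‖wkbLog y (M + 1) - wkbLog y M - Complex.log (wkbRatio (M * y))‖ ≤ C * ‖y‖ := by
  obtain ⟨C, hC, H⟩ := WkbRegular.taylor (R := R) hc
  refine ⟨C + 1 / (4 * c ^ 2) + (1 / (4 * (c * (1 / 2))) + 1 / (4 * c ^ 4)), by positivity,
    fun y M hy h => ?_⟩
  obtain ⟨h1, -⟩ := H y M hy h
  obtain ⟨h2, -⟩ := h.self
  have h3 : c ≤ ‖wkbRoot (M * y)‖ := h2.trans (Complex.re_le_norm _)
  have h4 := half_le_norm_wkbRatio (hc.trans_le h2)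
  have hy0 := norm_nonneg y
  have b1 : ‖y / (4 * wkbRoot (M * y) ^ 2)‖ ≤ 1 / (4 * c ^ 2) * ‖y‖ := by
    rw [norm_div, norm_mul, norm_pow, Complex.norm_ofNat, div_mul_eq_mul_div, one_mul]
    gcongr
  have b2 : ‖wkbLogDeriv2 y M‖ ≤ (1 / (4 * (c * (1 / 2))) + 1 / (4 * c ^ 4)) * ‖y‖ := by
    refine (norm_add_le _ _).trans ?_
    rw [norm_div, norm_div, norm_mul, norm_mul, norm_mul, norm_neg, norm_pow, norm_pow,
      Complex.norm_ofNat, add_mul, div_mul_eq_mul_div, div_mul_eq_mul_div, one_mul]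
    have : ‖y‖ ^ 2 ≤ ‖y‖ := by nlinarith
    gcongr
  have e : wkbLog y (M + 1) - wkbLog y M - Complex.log (wkbRatio (M * y))
      = (wkbLog y (M + 1) - wkbLog y M - wkbLogDeriv1 y M - wkbLogDeriv2 y M / 2)
        + y / (4 * wkbRoot (M * y) ^ 2) + wkbLogDeriv2 y M / 2 := by
    rw [wkbLogDeriv1]; ring
  rw [e]
  have b3 : ‖wkbLogDeriv2 y M / 2‖ ≤ ‖wkbLogDeriv2 y M‖ := by
    rw [norm_div, Complex.norm_ofNat]; linarith [norm_nonneg (wkbLogDeriv2 y M)]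
  have b4 : C * ‖y‖ ^ 2 ≤ C * ‖y‖ := by gcongr; nlinarith
  have := norm_add₃_le (a := wkbLog y (M + 1) - wkbLog y M - wkbLogDeriv1 y M - wkbLogDeriv2 y M / 2)
    (b := y / (4 * wkbRoot (M * y) ^ 2)) (c := wkbLogDeriv2 y M / 2)
  linarith

/-- The main term of the polynomial of index `matchIndex κ₀ n`. -/
noncomputable def matchTerm (α β κ₀ : ℝ) (n : ℕ) (z : ℂ) : ℂ :=
  z ^ matchIndex κ₀ n *
    (Complex.exp (wkbLog (1 / (bigN β n * z ^ 2)) (bigN β (matchIndex κ₀ n))) *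
      Complex.exp (((α ^ 2 - 1 / 4) / 4 : ℝ) * (1 / (bigN β n * z ^ 2)) *
        Complex.log (bigN β n * z ^ 2)))

theorem one_sub_ofReal_div_mem_slitPlane {x₀ κ₀ : ℝ} (hx : 0 < x₀) (hκx : κ₀ < x₀ ^ 2) :
    (1 : ℂ) - κ₀ / (x₀ : ℂ) ^ 2 ∈ Complex.slitPlane := by
  refine Complex.mem_slitPlane_iff.2 (Or.inl ?_)
  have : (1 : ℂ) - κ₀ / (x₀ : ℂ) ^ 2 = ((1 - κ₀ / x₀ ^ 2 : ℝ) : ℂ) := by push_cast; ring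
  rw [this, Complex.ofReal_re, sub_pos, div_lt_one (by positivity)]
  exact hκx

/-- The second of two consecutive polynomials gains the dominant characteristic root. -/
theorem normPhi_matchIndex_succ (α : ℝ) {β x₀ κ₀ : ℝ} (hβ : 0 < β) (hx : 0 < x₀) (hκ : 0 < κ₀)
    (hκx : κ₀ < x₀ ^ 2) :
    RelEquiv (atTop ×ˢ 𝓝 (x₀ : ℂ)) (fun p => 1 / bigN β p.1)
      (fun p => normPhi α β p.1 p.2 (matchIndex κ₀ p.1 + 1))
      (fun p => (p.2 - smallSaddle p.2 (level β κ₀ 0 p.1)) * matchTerm α β κ₀ p.1 p.2) := by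
  have hε : Tendsto (fun p : ℕ × ℂ => 1 / bigN β p.1) (atTop ×ˢ 𝓝 (x₀ : ℂ)) (𝓝 0) :=
    (tendsto_one_div_bigN β).comp tendsto_fst
  have t1 : Tendsto (fun p : ℕ × ℂ => level β κ₀ 0 p.1) (atTop ×ˢ 𝓝 (x₀ : ℂ)) (𝓝 κ₀) :=
    (tendsto_level β hκ 0).comp tendsto_fst
  have t2 : Tendsto (fun p : ℕ × ℂ => p.2) (atTop ×ˢ 𝓝 (x₀ : ℂ)) (𝓝 (x₀ : ℂ)) := tendsto_snd
  have tN : Tendsto (fun p : ℕ × ℂ => bigN β p.1) (atTop ×ˢ 𝓝 (x₀ : ℂ)) atTop :=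
    (tendsto_bigN β).comp tendsto_fst
  have hx0 : (x₀ : ℂ) ^ 2 ≠ 0 := pow_ne_zero 2 (by exact_mod_cast hx.ne')
  have t4 : Tendsto (fun p : ℕ × ℂ => (1 : ℂ) / p.2 ^ 2) (atTop ×ˢ 𝓝 (x₀ : ℂ))
      (𝓝 (1 / (x₀ : ℂ) ^ 2)) := tendsto_const_nhds.div (t2.pow 2) hx0
  have t3 : Tendsto (fun p : ℕ × ℂ => ((1 / bigN β p.1 : ℝ) : ℂ) * ((1 : ℂ) / p.2 ^ 2))
      (atTop ×ˢ 𝓝 (x₀ : ℂ)) (𝓝 0) := by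
    have := ((Complex.continuous_ofReal.tendsto 0).comp hε).mul t4
    simpa using this
  have t5 : Tendsto (fun p : ℕ × ℂ => (level β κ₀ 0 p.1 : ℂ) / p.2 ^ 2)
      (atTop ×ˢ 𝓝 (x₀ : ℂ)) (𝓝 (κ₀ / (x₀ : ℂ) ^ 2)) :=
    ((Complex.continuous_ofReal.tendsto κ₀).comp t1).div (t2.pow 2) hx0
  have hslit := one_sub_ofReal_div_mem_slitPlane hx hκx
  obtain ⟨c, hc⟩ : ∃ c, c = (wkbRoot (κ₀ / (x₀ : ℂ) ^ 2)).re / 2 := ⟨_, rfl⟩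
  have hpos := wkbRoot_re_pos hslit
  have hc0 : 0 < c := by rw [hc]; exact half_pos hpos
  have hcont : ContinuousAt wkbRoot (κ₀ / (x₀ : ℂ) ^ 2) := by
    unfold wkbRoot
    exact ContinuousAt.cpow (by fun_prop) continuousAt_const hslit
  have hreg : ∀ᶠ τ in 𝓝 ((κ₀ : ℂ) / (x₀ : ℂ) ^ 2), c ≤ (wkbRoot τ).re ∧
      ‖wkbRoot τ‖ ≤ ‖wkbRoot (κ₀ / (x₀ : ℂ) ^ 2)‖ + 1 := by
    have a1 := (Complex.continuous_re.continuousAt.tendsto.comp hcont.tendsto).eventually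
      (lt_mem_nhds (show c < _ by rw [hc]; exact half_lt_self hpos))
    have a2 := hcont.norm.tendsto.eventually (gt_mem_nhds (lt_add_one _))
    filter_upwards [a1, a2] with τ h1 h2 using ⟨h1.le, h2.le⟩
  obtain ⟨r, hr, hreg⟩ := Metric.eventually_nhds_iff.1 hreg
  obtain ⟨C, hC, hstep⟩ := exists_norm_wkbLog_step_le (c := c)
    (R := ‖wkbRoot (κ₀ / (x₀ : ℂ) ^ 2)‖ + 1) hc0
  refine ((normPhi_matchIndex α hβ hx hκ hκx 1).congr_right
    (g₂ := fun p => (p.2 * wkbRatio (level β κ₀ 0 p.1 / p.2 ^ 2) * matchTerm α β κ₀ p.1 p.2) *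
      Complex.exp (wkbLog (1 / (bigN β p.1 * p.2 ^ 2)) (bigN β (matchIndex κ₀ p.1) + 1)
        - wkbLog (1 / (bigN β p.1 * p.2 ^ 2)) (bigN β (matchIndex κ₀ p.1))
        - Complex.log (wkbRatio (level β κ₀ 0 p.1 / p.2 ^ 2)))) ?_).trans_mul_exp hε
    (K := C * (‖1 / (x₀ : ℂ) ^ 2‖ + 1)) ?_ (Eventually.of_forall fun p => ?_)
  · filter_upwards [Metric.tendsto_nhds.1 t5 r hr] with p h5
    obtain ⟨n, z⟩ := p
    simp only at h5 ⊢
    have hw := wkbRatio_ne_zero (hc0.trans_le (hreg h5).1)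
    rw [Complex.exp_sub, Complex.exp_sub, Complex.exp_log hw, matchTerm, pow_succ]
    have h1 : bigN β (matchIndex κ₀ n + 1) = bigN β (matchIndex κ₀ n) + 1 := by
      rw [bigN, bigN]; push_cast; ring
    rw [h1]
    have := Complex.exp_ne_zero (wkbLog (1 / (bigN β n * z ^ 2)) (bigN β (matchIndex κ₀ n)))
    field_simp
  · filter_upwards [Metric.tendsto_nhds.1 t5 (r / 2) (half_pos hr),
      Metric.tendsto_nhds.1 t3 (min (r / 2) 1) (lt_min (half_pos hr) one_pos),
      tN.eventually_ge_atTop 1, t4.norm.eventually (gt_mem_nhds (lt_add_one _))] with p h5 h3 hN h4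
    obtain ⟨n, z⟩ := p
    simp only at h5 h3 hN h4 ⊢
    have hN0 : 0 < bigN β n := by linarith
    have hNc : (bigN β n : ℂ) ≠ 0 := by exact_mod_cast hN0.ne'
    obtain ⟨y, hy⟩ : ∃ y, y = 1 / ((bigN β n : ℂ) * z ^ 2) := ⟨_, rfl⟩
    have e1 : ((1 / bigN β n : ℝ) : ℂ) * ((1 : ℂ) / z ^ 2) = y := by
      rw [hy]; push_cast; rw [div_mul_div_comm, one_mul]
    have e2 : (level β κ₀ 0 n : ℂ) / z ^ 2 = (bigN β (matchIndex κ₀ n) : ℂ) * y := by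
      rw [hy, level, add_zero]; push_cast; rw [div_div, mul_one_div]
    rw [e1, dist_zero_right, lt_min_iff] at h3
    rw [e2, dist_eq_norm] at h5
    rw [← hy, e2]
    refine (hstep y _ h3.2.le fun M' hM' => ?_).trans ?_
    · refine hreg ?_
      have : (M' : ℂ) * y - κ₀ / (x₀ : ℂ) ^ 2 = ((bigN β (matchIndex κ₀ n) : ℂ) * y - κ₀ / (x₀ : ℂ) ^ 2)
        + ((M' - bigN β (matchIndex κ₀ n) : ℝ) : ℂ) * y := by push_cast; ring
      rw [dist_eq_norm, this]
      refine (norm_add_le _ _).trans_lt ?_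
      have h6 : |M' - bigN β (matchIndex κ₀ n)| ≤ 1 := by
        rw [abs_le]; constructor <;> linarith [hM'.1, hM'.2]
      rw [norm_mul, Complex.norm_real, Real.norm_eq_abs]
      nlinarith [norm_nonneg y]
    · rw [mul_assoc]
      refine mul_le_mul_of_nonneg_left ?_ hC
      rw [← e1, norm_mul, Complex.norm_real, Real.norm_eq_abs, mul_comm]
      exact mul_le_mul_of_nonneg_right h4.le (abs_nonneg _)
  · rw [sub_smallSaddle_eq]

/-! ### The contour integrals as solutions with known asymptotics -/

/-- The contribution of a nondegenerate saddle point `ζ`, crossed with velocity `V`, to a contour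
integral with exponent `N κ + r`. -/
noncomputable def saddleTerm (N : ℝ) (z ζ V : ℂ) (κ r : ℝ) : ℂ :=
  saddleExp N z ζ κ * ζ ^ (r : ℂ) * V *
    (Real.pi / (N * ((κ / 2 - 2 * ζ ^ 2) * (V / ζ) ^ 2))) ^ (1 / 2 : ℂ)

/-- Raising the exponent by one multiplies the contribution of a saddle point by that point. -/
theorem saddleTerm_add_one {N : ℝ} {z ζ V : ℂ} {κ r : ℝ} (hζ : ζ ≠ 0) :
    saddleTerm N z ζ V κ (r + 1) = ζ * saddleTerm N z ζ V κ r := by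
  rw [saddleTerm, saddleTerm]; push_cast
  rw [Complex.cpow_add _ _ hζ, Complex.cpow_one]; ring

/-- The contribution of a saddle point is at least of the order `N ^ (-1 / 2)` relative to its
exponential, so that the absolute error of Laplace's method is a relative one. -/
theorem exists_saddleTerm_lower_bound {c C ts ρ : ℝ} (hc : 0 < c) (hC : 0 < C) (hts : 0 < ts) {r : ℝ}
    (hr : |r| ≤ 1) : ∃ a : ℝ, 0 < a ∧ ∀ N : ℝ, 0 < N → ∀ z Q v : ℂ, ∀ κ : ℝ,
      SaddleBounds c C ts ρ z Q v κ → a / √N * ‖saddleExp N z (brokenLine Q v ts) κ‖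
        ≤ ‖saddleTerm N z (brokenLine Q v ts) (brokenLineVel Q v ts) κ r‖ := by
  obtain ⟨b, hb⟩ : ∃ b, b = (1 / 2 + 2 * (C * ts) ^ 2) * (C / (c * ts)) ^ 2 := ⟨_, rfl⟩
  have hb0 : 0 < b := by rw [hb]; positivity
  refine ⟨(1 + C * ts + (c * ts)⁻¹)⁻¹ * c * √(Real.pi / b), by positivity, fun N hN z Q v κ h => ?_⟩
  have hre := h.line.re_ge hts.le
  have hle := h.line.norm_le hts.le
  obtain ⟨ζ, hζ⟩ : ∃ ζ, ζ = brokenLine Q v ts := ⟨_, rfl⟩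
  obtain ⟨V, hV⟩ : ∃ V, V = brokenLineVel Q v ts := ⟨_, rfl⟩
  have hVle : ‖V‖ ≤ C := by rw [hV]; exact h.line.norm_vel_le ts
  have hVge : c ≤ ‖V‖ := by
    rw [hV, brokenLineVel]
    split_ifs
    exacts [h.line.re_Q.trans (Complex.re_le_norm _), h.line.re_v.trans (Complex.re_le_norm _)]
  have hq := h.re_ge
  rw [← hζ] at hre hle
  rw [← hζ, ← hV] at hq ⊢
  have hge : c * ts ≤ ‖ζ‖ := hre.trans (Complex.re_le_norm _)
  have hζ0 : 0 < ‖ζ‖ := (mul_pos hc hts).trans_le hge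
  have hκ0 : 0 ≤ κ := hc.le.trans h.κ_ge
  obtain ⟨q, hqe⟩ : ∃ q, q = (κ / 2 - 2 * ζ ^ 2) * (V / ζ) ^ 2 := ⟨_, rfl⟩
  rw [← hqe] at hq
  have hqn : c ≤ ‖q‖ := hq.trans (Complex.re_le_norm _)
  have hqb : ‖q‖ ≤ b := by
    rw [hqe, hb, norm_mul, norm_pow, norm_div]
    refine mul_le_mul ?_ (by gcongr) (by positivity) (by positivity)
    refine (norm_sub_le _ _).trans ?_
    rw [norm_div, norm_mul, norm_pow, Complex.norm_real, Real.norm_of_nonneg hκ0, Complex.norm_ofNat]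
    have := h.κ_le
    gcongr
  have h1 : (1 + C * ts + (c * ts)⁻¹)⁻¹ ≤ ‖ζ ^ (r : ℂ)‖ := by
    have h2 := norm_cpow_le_of_bounds (r := -r) (by positivity) hge hle (by rwa [abs_neg])
    push_cast at h2
    rw [Complex.cpow_neg, norm_inv] at h2
    have h3 : 0 < ‖ζ ^ (r : ℂ)‖ := by
      rw [Complex.cpow_def_of_ne_zero (norm_pos_iff.1 hζ0)]
      exact norm_pos_iff.2 (Complex.exp_ne_zero _)
    exact inv_le_of_inv_le₀ h3 h2
  have h4 : √(Real.pi / b) / √N ≤ ‖((Real.pi : ℂ) / (N * q)) ^ (1 / 2 : ℂ)‖ := by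
    rw [← Real.sqrt_div (by positivity)]
    refine Real.sqrt_le_iff.2 ⟨norm_nonneg _, ?_⟩
    have : ((Real.pi / (N * q) : ℂ) ^ (1 / 2 : ℂ)) ^ 2 = Real.pi / (N * q) := by
      rw [← Complex.cpow_nat_mul]; norm_num
    rw [← norm_pow, this, norm_div, norm_mul, Complex.norm_real, Complex.norm_real,
      Real.norm_of_nonneg hN.le, Real.norm_of_nonneg Real.pi_pos.le, div_div, mul_comm b]
    have hq0 : 0 < ‖q‖ := hc.trans_le hqn
    gcongr
  rw [saddleTerm, norm_mul, norm_mul, norm_mul, ← hqe]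
  calc _ = ‖saddleExp N z ζ κ‖ * (1 + C * ts + (c * ts)⁻¹)⁻¹ * c * (√(Real.pi / b) / √N) := by ring
    _ ≤ _ := by gcongr

/-- Laplace's method for the contour integrals, with a relative error. -/
theorem contourIntegral_laplace_relative {c C ts ρ : ℝ} (hc : 0 < c) (hC : 0 < C) (hts : 0 < ts)
    (hρ : 0 < ρ) (hρts : ρ < ts) (m : ℕ) {r : ℝ} (hr : |r| ≤ 1) :
    ∃ K N0 : ℝ, ∀ N : ℝ, N0 ≤ N → ∀ z Q v : ℂ, ∀ κ : ℝ, SaddleBounds c C ts ρ z Q v κ →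
      ∀ F : ℝ → ℂ, ContinuousOn F (Set.Ioi 0) →
      (∀ t, 0 < t → ‖F t - 1‖ ≤ m / N * (1 + 1 / t) ^ m) →
      ‖contourIntegral N z Q v F (N * κ + r : ℝ)
          - saddleTerm N z (brokenLine Q v ts) (brokenLineVel Q v ts) κ r‖
        ≤ K * |1 / N| * ‖saddleTerm N z (brokenLine Q v ts) (brokenLineVel Q v ts) κ r‖ := by
  obtain ⟨K, N0, hK, H⟩ := contourIntegral_laplace hc hC hts hρ hρts m hr
  obtain ⟨a, ha, ha'⟩ := exists_saddleTerm_lower_bound (ρ := ρ) hc hC hts hr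
  refine ⟨K / a, max N0 1, fun N hN z Q v κ h F hF hFb => ?_⟩
  have hN0 : 0 < N := by linarith [le_max_right N0 1]
  refine (H N ((le_max_left _ _).trans hN) z Q v κ h F hF hFb).trans ?_
  have h1 := mul_le_mul_of_nonneg_left (ha' N hN0 z Q v κ h)
    (by positivity : 0 ≤ K / a * |1 / N|)
  refine le_trans (le_of_eq ?_) h1
  rw [abs_of_pos (one_div_pos.2 hN0)]
  field_simp

/-- Solutions `J p` of the scaled recurrence, for `p = (n, z)` with `z` near `x₀`, which at the
indices `n` and `n + 1`, and near the index `matchIndex κ₀ n`, are given by single saddle points up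
to a relative error `O(1 / N)`. -/
structure IsSaddleSolution (α β x₀ κ₀ ts σ : ℝ) (J : ℕ × ℂ → ℕ → ℂ) : Prop where
  recurrence : ∀ᶠ p in atTop ×ˢ 𝓝 (x₀ : ℂ), ∀ k, matchIndex κ₀ p.1 ≤ k →
    J p (k + 2) = p.2 * J p (k + 1) - ((lam α β (k + 1) / 2 / bigN β p.1 : ℝ) : ℂ) * J p k
  re_pos : ∀ᶠ p in atTop ×ˢ 𝓝 (x₀ : ℂ),
    0 < ((((1 : ℝ) : ℂ) / 2 - 2 * turningSaddle σ p.2 ^ 2) *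
      (contourDir ts σ p.2 (level β κ₀ 0 p.1) / turningSaddle σ p.2) ^ 2).re ∧
    0 < (((level β κ₀ 0 p.1 : ℂ) / 2 - 2 * smallSaddle p.2 (level β κ₀ 0 p.1) ^ 2) *
      (contourCorner ts p.2 (level β κ₀ 0 p.1) / smallSaddle p.2 (level β κ₀ 0 p.1)) ^ 2).re
  asymptotics : ∀ i : ℕ, i ≤ 1 →
    RelEquiv (atTop ×ˢ 𝓝 (x₀ : ℂ)) (fun p => 1 / bigN β p.1) (fun p => J p (p.1 + i))
      (fun p => saddleTerm (bigN β p.1) p.2 (turningSaddle σ p.2)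
        (contourDir ts σ p.2 (level β κ₀ 0 p.1)) 1 (i - 1 / 2)) ∧
    RelEquiv (atTop ×ˢ 𝓝 (x₀ : ℂ)) (fun p => 1 / bigN β p.1) (fun p => J p (matchIndex κ₀ p.1 + i))
      (fun p => saddleTerm (bigN β p.1) p.2 (smallSaddle p.2 (level β κ₀ 0 p.1))
        (contourCorner ts p.2 (level β κ₀ 0 p.1)) (level β κ₀ 0 p.1) (i - 1 / 2))

/-- The contour integrals through `smallSaddle` and `turningSaddle σ`, with an amplitude that tends
to `1` at infinity, are such solutions. -/
theorem exists_isSaddleSolution (α : ℝ) {β x₀ : ℝ} (hβ : 0 < β) (hx : 0 < x₀) (hx1 : x₀ < 1) :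
    ∃ κ₀ ts q₀ : ℝ, 0 < κ₀ ∧ κ₀ < x₀ ^ 2 ∧ 0 < ts ∧ ts < 1 ∧ q₀ < x₀ / 2 ∧
      contourCorner ts x₀ κ₀ = q₀ ∧ ∀ σ : ℝ, σ ^ 2 = 1 →
      ∃ J : ℕ × ℂ → ℕ → ℂ, IsSaddleSolution α β x₀ κ₀ ts σ J := by
  obtain ⟨κ₀, ts, q₀, hκ, hκx, hts, hts1, hq, hq0, H⟩ := exists_contour hx hx1
  refine ⟨κ₀, ts, q₀, hκ, hκx, hts, hts1, hq, hq0, fun σ hσ => ?_⟩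
  obtain ⟨⟨c₁, C₁, ρ₁, hc₁, hC₁, hρ₁, hρ₁', H₁⟩, c₂, C₂, ρ₂, hc₂, hC₂, hρ₂, hρ₂', H₂⟩ := H σ hσ
  obtain ⟨m, hm⟩ := exists_isAmplitude c₁ C₁ ((α ^ 2 - 1 / 4) / 4)
  have t1 : Tendsto (fun p : ℕ × ℂ => level β κ₀ 0 p.1) (atTop ×ˢ 𝓝 (x₀ : ℂ)) (𝓝 κ₀) :=
    (tendsto_level β hκ 0).comp tendsto_fst
  have t2 : Tendsto (fun p : ℕ × ℂ => p.2) (atTop ×ˢ 𝓝 (x₀ : ℂ)) (𝓝 (x₀ : ℂ)) := tendsto_snd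
  have t12 : Tendsto (fun p : ℕ × ℂ => (p.2, level β κ₀ 0 p.1)) (atTop ×ˢ 𝓝 (x₀ : ℂ))
      (𝓝 ((x₀ : ℂ), κ₀)) := by rw [nhds_prod_eq]; exact t2.prodMk t1
  have tN : Tendsto (fun p : ℕ × ℂ => bigN β p.1) (atTop ×ˢ 𝓝 (x₀ : ℂ)) atTop :=
    (tendsto_bigN β).comp tendsto_fst
  have tk : Tendsto (fun p : ℕ × ℂ => matchIndex κ₀ p.1) (atTop ×ˢ 𝓝 (x₀ : ℂ)) atTop :=
    (tendsto_matchIndex hκ).comp tendsto_fst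
  -- the amplitude is chosen where the geometric bounds hold
  have hch : ∀ p : ℕ × ℂ, ∃ F U : ℝ → ℂ, 1 ≤ bigN β p.1 →
      BrokenLineBounds c₁ C₁ p.2 (contourCorner ts p.2 (level β κ₀ 0 p.1))
        (contourDir ts σ p.2 (level β κ₀ 0 p.1)) →
      IsAmplitude ((α ^ 2 - 1 / 4) / 4) (bigN β p.1) p.2 (contourCorner ts p.2 (level β κ₀ 0 p.1))
        (contourDir ts σ p.2 (level β κ₀ 0 p.1)) F U ∧
      (∀ t, 0 < t → ‖F t - 1‖ ≤ m / bigN β p.1 * (1 + 1 / t) ^ m) ∧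
      (∀ t, 0 < t → ‖Complex.exp (-(2 * bigN β p.1 * (brokenLine (contourCorner ts p.2 (level β κ₀ 0 p.1))
        (contourDir ts σ p.2 (level β κ₀ 0 p.1)) t - p.2) ^ 2)) * U t‖ ≤ m * (1 + 1 / t) ^ m) := by
    intro p
    by_cases h1 : 1 ≤ bigN β p.1
    · by_cases h2 : BrokenLineBounds c₁ C₁ p.2 (contourCorner ts p.2 (level β κ₀ 0 p.1))
        (contourDir ts σ p.2 (level β κ₀ 0 p.1))
      · obtain ⟨F, U, h⟩ := hm _ h1 _ _ _ h2
        exact ⟨F, U, fun _ _ => h⟩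
      · exact ⟨0, 0, fun _ h => absurd h h2⟩
    · exact ⟨0, 0, fun h => absurd h h1⟩
  choose F U hFU using hch
  refine ⟨fun p k => contourIntegral (bigN β p.1) p.2 (contourCorner ts p.2 (level β κ₀ 0 p.1))
    (contourDir ts σ p.2 (level β κ₀ 0 p.1)) (F p) (bigN β k - 1 / 2 : ℝ), ?_, ?_, fun i hi => ⟨?_, ?_⟩⟩
  · filter_upwards [t12.eventually H₁, tN.eventually_ge_atTop 1, tk.eventually_ge_atTop (m + 3)]
      with p h1 hN hk k hkk
    obtain ⟨hA, hF, hU⟩ := hFU p hN h1.line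
    have hN0 : 0 < bigN β p.1 := by linarith
    have hmb : ∀ t : ℝ, 0 < t → 1 ≤ (1 + 1 / t) ^ m := fun t ht =>
      one_le_pow₀ (by have : 0 < 1 / t := by positivity
                      linarith)
    have hmk : ((m + 3 : ℕ) : ℝ) ≤ k := by exact_mod_cast hk.trans hkk
    push_cast at hmk
    have hrec := contourIntegral_recurrence h1.line hN0 hA (B := m + 1) (j := m)
      (fun t ht => by
        have h2 := norm_add_le (F p t - 1) 1
        rw [sub_add_cancel, norm_one] at h2
        have h3 : (m : ℝ) / bigN β p.1 * (1 + 1 / t) ^ m ≤ m * (1 + 1 / t) ^ m := by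
          gcongr; exact div_le_self (Nat.cast_nonneg m) hN
        linarith [hF t ht, hmb t ht])
      (fun t ht => by
        have := hmb t ht
        linarith [hU t ht])
      (ν := bigN β (k + 1) - 1 / 2) (by rw [bigN]; push_cast; linarith)
    have e1 : bigN β (k + 1) - 1 / 2 + 1 = bigN β (k + 2) - 1 / 2 := by
      rw [bigN, bigN]; push_cast; ring
    have e2 : bigN β (k + 1) - 1 / 2 - 1 = bigN β k - 1 / 2 := by
      rw [bigN, bigN]; push_cast; ring
    have e3 : ((lam α β (k + 1) / 2 / bigN β p.1 : ℝ) : ℂ) = ((bigN β (k + 1) - 1 / 2 : ℝ) : ℂ)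
        / (4 * bigN β p.1) - ((α ^ 2 - 1 / 4) / 4 : ℝ) /
        (bigN β p.1 * (((bigN β (k + 1) - 1 / 2 : ℝ) : ℂ) + 1)) := by
      have h0 : bigN β (k + 1) + 1 / 2 ≠ 0 := by rw [bigN]; push_cast; linarith
      have h0' : bigN β (k + 1) - 1 / 2 + 1 ≠ 0 := by rw [bigN]; push_cast; linarith
      have : lam α β (k + 1) / 2 / bigN β p.1 = (bigN β (k + 1) - 1 / 2) / (4 * bigN β p.1)
          - ((α ^ 2 - 1 / 4) / 4) / (bigN β p.1 * (bigN β (k + 1) - 1 / 2 + 1)) := by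
        rw [lam_succ_div_two hβ k, show bigN β (k + 1) - 1 / 2 + 1 = bigN β (k + 1) + 1 / 2 by ring]
        field_simp
      rw [this]; push_cast; ring
    rw [e1, e2] at hrec
    rw [e3]
    exact hrec
  · filter_upwards [t12.eventually H₁, t12.eventually H₂] with p h1 h2
    have e1 := h1.re_ge
    have e2 := h2.re_ge
    rw [brokenLine_contour_two, brokenLineVel_contour_two] at e1
    rw [brokenLine_contour_small hts hts1, brokenLineVel_contour_small hts1] at e2
    exact ⟨hc₁.trans_le e1, hc₂.trans_le e2⟩
  · obtain ⟨K, N0, HK⟩ := contourIntegral_laplace_relative hc₁ hC₁ two_pos hρ₁ hρ₁' m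
      (r := i - 1 / 2) (by interval_cases i <;> norm_num [abs_le])
    refine RelEquiv.of_norm_sub_le (K := K) ?_
    filter_upwards [t12.eventually H₁, tN.eventually_ge_atTop 1, tN.eventually_ge_atTop N0]
      with p h1 hN hN0
    obtain ⟨hA, hF, hU⟩ := hFU p hN h1.line
    have := HK _ hN0 _ _ _ _ h1 (F p) hA.contF hF
    rw [brokenLine_contour_two, brokenLineVel_contour_two] at this
    have e : bigN β p.1 * 1 + (i - 1 / 2) = bigN β (p.1 + i) - 1 / 2 := by
      rw [bigN, bigN]; push_cast; ring
    rw [e] at this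
    exact this
  · obtain ⟨K, N0, HK⟩ := contourIntegral_laplace_relative hc₂ hC₂ hts hρ₂ hρ₂' m
      (r := i - 1 / 2) (by interval_cases i <;> norm_num [abs_le])
    refine RelEquiv.of_norm_sub_le (K := K) ?_
    filter_upwards [t12.eventually H₁, t12.eventually H₂, tN.eventually_ge_atTop 1,
      tN.eventually_ge_atTop N0] with p h1 h2 hN hN0
    obtain ⟨hA, hF, hU⟩ := hFU p hN h1.line
    have := HK _ hN0 _ _ _ _ h2 (F p) hA.contF hF
    rw [brokenLine_contour_small hts hts1, brokenLineVel_contour_small hts1] at this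
    have e : bigN β p.1 * level β κ₀ 0 p.1 + (i - 1 / 2) = bigN β (matchIndex κ₀ p.1 + i) - 1 / 2 := by
      have h0 : bigN β p.1 ≠ 0 := by linarith
      rw [level, add_zero, mul_div_cancel₀ _ h0, bigN, bigN]; push_cast; ring
    rw [e] at this
    exact this

/-! ### Closed forms for the saddle point contributions -/

/-- Of the two square roots of `P²`, a product of two numbers in the right half-plane is the
positive one. -/
theorem mul_eq_of_sq {A w : ℂ} {P : ℝ} (hP : 0 < P) (h : (A * w) ^ 2 = (P : ℂ) ^ 2) (hA : 0 < A.re)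
    (hw : 0 < w.re) : A * w = P := by
  rcases sq_eq_sq_iff_eq_or_eq_neg.1 h with h | h
  · exact h
  · exfalso
    have hw0 : w ≠ 0 := by rintro rfl; simp at hw
    have h1 : A = -((P : ℂ) * w⁻¹) := by
      rw [← mul_inv_cancel_right₀ hw0 A, h]; ring
    rw [h1, Complex.neg_re, Complex.re_ofReal_mul, Complex.inv_re] at hA
    have : 0 < P * (w.re / Complex.normSq w) := mul_pos hP (div_pos hw (Complex.normSq_pos.2 hw0))
    linarith

/-- Determination of the square root in `saddleTerm`, given a square root of its argument up to
sign and enough positivity to fix the sign. -/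
theorem saddleTerm_eq_of_sq {N : ℝ} (hN : 0 < N) {z ζ V E : ℂ} {κ r : ℝ} (hE : E ≠ 0)
    (hq : 0 < ((κ / 2 - 2 * ζ ^ 2) * (V / ζ) ^ 2 : ℂ).re) (hA : 0 < (ζ ^ (r : ℂ) * V * E).re)
    (hsq : 2 * (ζ ^ (r : ℂ) * V * E) ^ 2 = (κ / 2 - 2 * ζ ^ 2) * (V / ζ) ^ 2) :
    saddleTerm N z ζ V κ r = saddleExp N z ζ κ * (√(Real.pi / (2 * N)) : ℝ) * E⁻¹ := by
  rw [saddleTerm]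
  obtain ⟨q, hqe⟩ : ∃ q, q = (κ / 2 - 2 * ζ ^ 2) * (V / ζ) ^ 2 := ⟨_, rfl⟩
  obtain ⟨A, hAe⟩ : ∃ A, A = ζ ^ (r : ℂ) * V * E := ⟨_, rfl⟩
  rw [← hqe] at hq hsq ⊢
  rw [← hAe] at hsq hA
  have hq0 : q ≠ 0 := by rintro rfl; simp at hq
  have hπN : 0 < Real.pi / N := div_pos Real.pi_pos hN
  have h1 : (Real.pi / (N * q) : ℂ) ^ (1 / 2 : ℂ) = (√(Real.pi / N) : ℝ) * (1 / q) ^ (1 / 2 : ℂ) := by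
    have e : (Real.pi / (N * q) : ℂ) = ((Real.pi / N : ℝ) : ℂ) * (1 / q) := by
      push_cast; rw [div_mul_div_comm, mul_one]
    have hq1 : 1 / q ≠ 0 := one_div_ne_zero hq0
    have hc : ((Real.pi / N : ℝ) : ℂ) ≠ 0 := by exact_mod_cast hπN.ne'
    rw [e, Complex.cpow_def_of_ne_zero (mul_ne_zero hc hq1), Complex.log_ofReal_mul hπN hq1, add_mul,
      Complex.exp_add, Complex.cpow_def_of_ne_zero hq1]
    congr 1
    rw [Real.sqrt_eq_rpow, Complex.ofReal_cpow hπN.le, Complex.cpow_def_of_ne_zero hc,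
      Complex.ofReal_log hπN.le]
    push_cast; rfl
  have hw : 0 < ((1 / q) ^ (1 / 2 : ℂ)).re := by
    have h2 : 1 - (1 - 1 / q) ∈ Complex.slitPlane := by
      refine Complex.mem_slitPlane_iff.2 (Or.inl ?_)
      rw [sub_sub_cancel, one_div, Complex.inv_re]
      exact div_pos hq (Complex.normSq_pos.2 hq0)
    have := wkbRoot_re_pos h2
    rwa [wkbRoot, sub_sub_cancel] at this
  have h3 : A * (1 / q) ^ (1 / 2 : ℂ) = (√(1 / 2) : ℝ) := by
    refine mul_eq_of_sq (by positivity) ?_ hA hw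
    rw [← Complex.ofReal_pow, Real.sq_sqrt (by norm_num), mul_pow, ← Complex.cpow_nat_mul]
    norm_num
    rw [← div_eq_mul_inv, div_eq_iff hq0, ← hsq]; ring
  have h4 : √(Real.pi / (2 * N)) = √(Real.pi / N) * √(1 / 2) := by
    rw [← Real.sqrt_mul hπN.le]; congr 1; field_simp
  rw [h1, h4, Complex.ofReal_mul, ← h3, hAe]
  field_simp

/-- A square root of a product, with a branch that depends analytically on both factors. -/
theorem exp_half_log_sq {a b : ℂ} (ha : a ≠ 0) (hb : b ≠ 0) :
    Complex.exp ((Complex.log a + Complex.log b) / 2) ^ 2 = a * b := by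
  rw [← Complex.exp_nat_mul]
  conv_rhs => rw [← Complex.exp_log ha, ← Complex.exp_log hb, ← Complex.exp_add]
  congr 1; push_cast; ring

/-- Conditions, valid near a point of `(0, 1)`, under which the relevant branches are principal. -/
structure MatchRegular (ts : ℝ) (z : ℂ) (κ : ℝ) : Prop where
  κ_pos : 0 < κ
  re_z : 0 < z.re
  re_root : 0 < (wkbRoot (κ / z ^ 2)).re
  re_small : 0 < (smallSaddle z κ).re
  re_amp : 0 < (smallSaddle z κ ^ ((-1 / 2 : ℝ) : ℂ) * contourCorner ts z κ *
    Complex.exp ((Complex.log z + Complex.log (wkbRoot (κ / z ^ 2))) / 2)).re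

/-- The contribution of the small saddle point, with `√(z √(1 - κ / z²))` in the denominator. -/
theorem saddleTerm_small {N ts : ℝ} (hN : 0 < N) (hts : 0 < ts) {z : ℂ} {κ : ℝ} (h : MatchRegular ts z κ)
    (hq : 0 < (((κ : ℂ) / 2 - 2 * smallSaddle z κ ^ 2) *
          (contourCorner ts z κ / smallSaddle z κ) ^ 2).re) :
    saddleTerm N z (smallSaddle z κ) (contourCorner ts z κ) κ (-1 / 2)
      = saddleExp N z (smallSaddle z κ) κ * (√(Real.pi / (2 * N)) : ℝ) *
        (Complex.exp ((Complex.log z + Complex.log (wkbRoot (κ / z ^ 2))) / 2))⁻¹ := by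
  refine saddleTerm_eq_of_sq hN (Complex.exp_ne_zero _) hq h.re_amp ?_
  have hz : z ≠ 0 := by intro h0; have := h.re_z; rw [h0] at this; simp at this
  have hr := wkbRoot_ne_zero h.re_root
  have hζ : smallSaddle z κ ≠ 0 := by
    intro h0; have := h.re_small; rw [h0] at this; simp at this
  have htc : (ts : ℂ) ≠ 0 := by exact_mod_cast hts.ne'
  have e1 : Complex.exp ((Complex.log z + Complex.log (wkbRoot (κ / z ^ 2))) / 2) ^ 2
      = z * wkbRoot (κ / z ^ 2) :=
    exp_half_log_sq hz hr
  have e2 : (smallSaddle z κ ^ ((-1 / 2 : ℝ) : ℂ)) ^ 2 = (smallSaddle z κ)⁻¹ := by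
    rw [← Complex.cpow_nat_mul, ← Complex.cpow_neg_one]; congr 1; push_cast; ring
  have e3 := smallSaddle_eq hz κ
  have e4 : z * wkbRoot (κ / z ^ 2) = z - 2 * smallSaddle z κ := by rw [smallSaddle]; ring
  rw [mul_pow, mul_pow, e1, e2, e4, contourCorner, ← e3]
  field_simp
  ring

/-- The product of the two saddle points for `κ` is `κ / 4`, in logarithmic form. -/
theorem log_add_log_add_log_small {ts : ℝ} {z : ℂ} {κ : ℝ} (h : MatchRegular ts z κ) :
    Complex.log z + Complex.log (wkbRatio (κ / z ^ 2)) + Complex.log (smallSaddle z κ)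
      = ((Real.log κ - Real.log 4 : ℝ) : ℂ) := by
  have hz : z ≠ 0 := by intro h0; have := h.re_z; rw [h0] at this; simp at this
  have hU := wkbRatio_ne_zero h.re_root
  have hζ : smallSaddle z κ ≠ 0 := by
    intro h0; have := h.re_small; rw [h0] at this; simp at this
  refine eq_of_exp_eq_of_abs_im_sub_lt ?_ ?_
  · rw [Complex.exp_add, Complex.exp_add, Complex.exp_log hz, Complex.exp_log hU, Complex.exp_log hζ,
      ← sub_smallSaddle_eq, ← Real.log_div h.κ_pos.ne' (by norm_num), ← Complex.ofReal_exp,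
      Real.exp_log (div_pos h.κ_pos (by norm_num))]
    have := smallSaddle_eq hz κ
    push_cast
    rw [← this]; ring
  · have a1 := abs_lt.1 (Complex.abs_arg_lt_pi_div_two_iff.2 (Or.inl h.re_z))
    have a2 := abs_lt.1 (Complex.abs_arg_lt_pi_div_two_iff.2 (Or.inl
      (by linarith [wkbRatio_re h.re_root] : 0 < (wkbRatio (κ / z ^ 2)).re)))
    have a3 := abs_lt.1 (Complex.abs_arg_lt_pi_div_two_iff.2 (Or.inl h.re_small))
    rw [Complex.ofReal_im, sub_zero, Complex.add_im, Complex.add_im, Complex.log_im, Complex.log_im,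
      Complex.log_im, abs_lt]
    constructor <;> linarith [Real.pi_pos]

/-- The exponentials collected between the index `matchIndex κ₀ n` and `n`, namely the product of
the recurrence coefficients, the polynomial and the contour integral: the intermediate level drops
out. -/
theorem match_product_eq (α β κ₀ : ℝ) {ts : ℝ} {n : ℕ} (hN : 0 < bigN β n) {z : ℂ}
    (h : MatchRegular ts z (level β κ₀ 0 n)) :
    Complex.exp ((-bigN β n - (bigN β (matchIndex κ₀ n) *
        Real.log (bigN β (matchIndex κ₀ n) / bigN β n) - bigN β (matchIndex κ₀ n))
      - (bigN β n - bigN β (matchIndex κ₀ n)) * Real.log 4 : ℝ)) * (matchTerm α β κ₀ n z *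
      (saddleExp (bigN β n) z (smallSaddle z (level β κ₀ 0 n)) (level β κ₀ 0 n) *
        Complex.exp ((Complex.log z + Complex.log (wkbRoot (level β κ₀ 0 n / z ^ 2))) / 2)))
      = Complex.exp (bigN β n * (2 * z ^ 2 - 1 - Real.log 4)) * z ^ (3 / 2 - β : ℂ) *
        Complex.exp (((α ^ 2 - 1 / 4) / 4 : ℝ) * (1 / (bigN β n * z ^ 2)) *
        Complex.log (bigN β n * z ^ 2)) := by
  obtain ⟨κ, hκ⟩ : ∃ κ, κ = level β κ₀ 0 n := ⟨_, rfl⟩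
  have hz : z ≠ 0 := by intro h0; have := h.re_z; rw [h0] at this; simp at this
  have hU := wkbRatio_ne_zero h.re_root
  have hlog := log_add_log_add_log_small h
  have hM : bigN β (matchIndex κ₀ n) = κ * bigN β n := by
    rw [hκ, level, add_zero]; field_simp
  have hk : (matchIndex κ₀ n : ℂ) = (κ : ℂ) * bigN β n - β + 1 := by
    have : (matchIndex κ₀ n : ℝ) = κ * bigN β n - β + 1 := by
      rw [← hM, bigN]; ring
    exact_mod_cast congrArg (fun x : ℝ => (x : ℂ)) this
  have hNc : (bigN β n : ℂ) ≠ 0 := by exact_mod_cast hN.ne'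
  have hMy : ((κ * bigN β n : ℝ) : ℂ) * (1 / (bigN β n * z ^ 2)) = κ / z ^ 2 := by
    push_cast; field_simp
  have hzk : z ^ matchIndex κ₀ n = Complex.exp (((κ : ℂ) * bigN β n - β + 1) * Complex.log z) := by
    rw [← Complex.cpow_natCast, Complex.cpow_def_of_ne_zero hz, hk, mul_comm]
  rw [matchTerm, saddleExp, wkbLog, hM, hzk, ← hκ, hMy, Complex.cpow_def_of_ne_zero hz,
    mul_div_cancel_right₀ κ hN.ne']
  rw [← hκ] at hlog hU h
  simp only [← Complex.exp_add]
  congr 1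
  have e1 : smallSaddle z κ - z = -(z * wkbRatio (κ / z ^ 2)) := by
    rw [← sub_smallSaddle_eq]; ring
  have e2 : (κ : ℂ) = 4 * (z ^ 2 * (wkbRatio (κ / z ^ 2) * (1 - wkbRatio (κ / z ^ 2)))) := by
    have := four_mul_wkbRatio (κ / z ^ 2)
    rw [div_eq_iff (pow_ne_zero 2 hz)] at this
    linear_combination this
  have e3 : (κ : ℂ) + κ * (1 / (2 * wkbRatio (κ / z ^ 2)) - 1 / 2)
      + 2 * (smallSaddle z κ - z) ^ 2 = 2 * z ^ 2 := by
    rw [e1]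
    generalize wkbRatio (κ / z ^ 2) = u at *
    rw [e2]; field_simp; ring
  push_cast at hlog ⊢
  linear_combination (κ : ℂ) * bigN β n * hlog + (bigN β n : ℂ) * e3

/-- Conditions, valid near a point of `(0, 1)`, under which the branches at the saddle points
`turningSaddle` are principal. -/
structure TurningRegular (ts σ : ℝ) (z : ℂ) (κ : ℝ) : Prop where
  ne_zero : 1 - z ^ 2 ≠ 0
  re_pos : 0 < (turningSaddle σ z).re
  re_neg : 0 < (turningSaddle (-σ) z).re
  re_amp : 0 < (turningSaddle σ z ^ ((-1 / 2 : ℝ) : ℂ) * contourDir ts σ z κ *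
    Complex.exp (-(σ * Complex.I * Real.pi / 4) + Complex.log (1 - z ^ 2) / 4)).re

theorem sqrt_one_sub_sq_eq_exp {z : ℂ} (hz : 1 - z ^ 2 ≠ 0) :
    (1 - z ^ 2) ^ (1 / 2 : ℂ) = Complex.exp (Complex.log (1 - z ^ 2) / 2) := by
  rw [Complex.cpow_def_of_ne_zero hz]; congr 1; ring

theorem exp_neg_sigma {σ : ℝ} (hσ : σ = 1 ∨ σ = -1) :
    Complex.exp (-(σ * Complex.I * Real.pi / 2)) = -(σ * Complex.I) := by
  have h1 : Complex.exp (Real.pi / 2 * Complex.I) = Complex.I := Complex.exp_pi_div_two_mul_I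
  rcases hσ with rfl | rfl
  · rw [Complex.exp_neg, show ((1 : ℝ) : ℂ) * Complex.I * Real.pi / 2 = Real.pi / 2 * Complex.I by
      push_cast; ring, h1, Complex.inv_I]; push_cast; ring
  · rw [show -(((-1 : ℝ) : ℂ) * Complex.I * Real.pi / 2) = Real.pi / 2 * Complex.I by
      push_cast; ring, h1]; push_cast; ring

/-- The contribution of `turningSaddle σ z`, with the square root of `z - 2 ζ = -σ i √(1 - z²)` made
explicit. -/
theorem saddleTerm_turning {N ts σ : ℝ} (hN : 0 < N) (hσ : σ = 1 ∨ σ = -1) {z : ℂ} {κ : ℝ}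
    (h : TurningRegular ts σ z κ)
    (hq : 0 < ((((1 : ℝ) : ℂ) / 2 - 2 * turningSaddle σ z ^ 2) *
          (contourDir ts σ z κ / turningSaddle σ z) ^ 2).re) :
    saddleTerm N z (turningSaddle σ z) (contourDir ts σ z κ) 1 (-1 / 2)
      = saddleExp N z (turningSaddle σ z) 1 * (√(Real.pi / (2 * N)) : ℝ) *
        (Complex.exp (-(σ * Complex.I * Real.pi / 4) + Complex.log (1 - z ^ 2) / 4))⁻¹ := by
  refine saddleTerm_eq_of_sq hN (Complex.exp_ne_zero _) hq h.re_amp ?_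
  have hζ : turningSaddle σ z ≠ 0 := by
    intro h0; have := h.re_pos; rw [h0] at this; simp at this
  have e1 : Complex.exp (-(σ * Complex.I * Real.pi / 4) + Complex.log (1 - z ^ 2) / 4) ^ 2
      = z - 2 * turningSaddle σ z := by
    rw [← Complex.exp_nat_mul, turningSaddle, sqrt_one_sub_sq_eq_exp h.ne_zero]
    have : ((2 : ℕ) : ℂ) * (-(σ * Complex.I * Real.pi / 4) + Complex.log (1 - z ^ 2) / 4)
      = -(σ * Complex.I * Real.pi / 2) + Complex.log (1 - z ^ 2) / 2 := by push_cast; ring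
    rw [this, Complex.exp_add, exp_neg_sigma hσ]; ring
  have e2 : (turningSaddle σ z ^ ((-1 / 2 : ℝ) : ℂ)) ^ 2 = (turningSaddle σ z)⁻¹ := by
    rw [← Complex.cpow_nat_mul, ← Complex.cpow_neg_one]; congr 1; push_cast; ring
  have hσ2 : σ ^ 2 = 1 := by rcases hσ with rfl | rfl <;> norm_num
  have e3 := turningSaddle_eq hσ2 z
  rw [mul_pow, mul_pow, e1, e2, Complex.ofReal_one, ← e3]
  field_simp
  ring

/-- The phase at the saddle points `turningSaddle` is, up to a common term, `∓ i θ`. -/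
theorem saddleExp_turning (N : ℝ) {σ : ℝ} (hσ : σ = 1 ∨ σ = -1) {z : ℂ}
    (h1 : 0 < (turningSaddle σ z).re) (h2 : 0 < (turningSaddle (-σ) z).re) :
    saddleExp N z (turningSaddle σ z) 1
      = Complex.exp (N * (z ^ 2 - 1 / 2 - Real.log 2 - σ * Complex.I * theta z)) := by
  obtain ⟨s, hs⟩ : ∃ s, s = (1 - z ^ 2) ^ (1 / 2 : ℂ) := ⟨_, rfl⟩
  have hs2 : s ^ 2 = 1 - z ^ 2 := by rw [hs]; exact sqrt_one_sub_sq z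
  have hσ2 : (σ : ℂ) ^ 2 = 1 := by rcases hσ with rfl | rfl <;> norm_num
  have hdef : ∀ τ : ℝ, 2 * turningSaddle τ z = z + τ * Complex.I * s := fun τ => by
    rw [turningSaddle, ← hs]; ring
  have hre : ∀ τ : ℝ, 0 < (turningSaddle τ z).re → 0 < (z + τ * Complex.I * s).re := fun τ h => by
    rw [← hdef, Complex.mul_re]; simpa using h
  have hlog : Complex.log (z + σ * Complex.I * s) = σ * Complex.log (z + Complex.I * s) := by
    rcases hσ with rfl | rfl
    · simp
    · have a := hre _ h1
      have b := hre _ h2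
      simp only [neg_neg, Complex.ofReal_one, Complex.ofReal_neg, one_mul, neg_mul] at a b ⊢
      have a0 : z + -(Complex.I * s) ≠ 0 := by intro h; rw [h] at a; simp at a
      have b0 : z + Complex.I * s ≠ 0 := by intro h; rw [h] at b; simp at b
      refine eq_of_exp_eq_of_abs_im_sub_lt ?_ ?_
      · rw [Complex.exp_neg, Complex.exp_log a0, Complex.exp_log b0]
        refine eq_inv_of_mul_eq_one_left ?_
        linear_combination (-s ^ 2) * Complex.I_sq + hs2
      · have a1 := abs_lt.1 (Complex.abs_arg_lt_pi_div_two_iff.2 (Or.inl a))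
        have a2 := abs_lt.1 (Complex.abs_arg_lt_pi_div_two_iff.2 (Or.inl b))
        rw [Complex.neg_im, Complex.log_im, Complex.log_im, abs_lt]
        constructor <;> linarith [Real.pi_pos]
  have hne : z + σ * Complex.I * s ≠ 0 := by
    intro h; have := hre _ h1; rw [h] at this; simp at this
  have hhalf : turningSaddle σ z = ((1 / 2 : ℝ) : ℂ) * (z + σ * Complex.I * s) := by
    rw [← hdef]; push_cast; ring
  have hlog2 : Complex.log (turningSaddle σ z) = -Real.log 2 + σ * Complex.log (z + Complex.I * s) := by
    rw [hhalf, Complex.log_ofReal_mul (by norm_num) hne, hlog, one_div, Real.log_inv]; push_cast; rfl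
  rw [saddleExp, hlog2, theta, carccos, ← hs, hhalf]
  congr 1
  push_cast
  linear_combination (N : ℂ) * ((1 / 2) * s ^ 2 * Complex.I ^ 2 * hσ2 - (1 / 2) * hs2
    + ((1 / 2) * s ^ 2 + σ * Complex.log (z + Complex.I * s)) * Complex.I_sq)

/-- The positivity that fixes the sign of the square root in `saddleTerm_turning`: the argument of
`ζ` lies strictly between `0` and `σ π / 2`, and the direction `a + σ i b` of the contour in the
same quadrant. -/
theorem re_cpow_mul_pos {σ a b : ℝ} (hσ : σ = 1 ∨ σ = -1) (ha : 0 < a) (hb : 0 < b) {ζ : ℂ}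
    (hre : 0 < ζ.re) (him : 0 < σ * ζ.im) :
    0 < (ζ ^ ((-1 / 2 : ℝ) : ℂ) * (a + σ * Complex.I * b) *
      Complex.exp (-(σ * Complex.I * Real.pi / 4))).re := by
  have hζ : ζ ≠ 0 := by rintro rfl; simp at hre
  obtain ⟨h1, -⟩ := arg_bounds_of_im hσ him
  have h2 := abs_lt.1 (Complex.abs_arg_lt_pi_div_two_iff.2 (Or.inl hre))
  obtain ⟨ψ, hψ⟩ : ∃ ψ, ψ = ζ.arg / 2 + σ * (Real.pi / 4) := ⟨_, rfl⟩
  have hπ := Real.pi_pos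
  have hψ' : 0 < σ * ψ ∧ |ψ| < Real.pi / 2 := by
    rcases hσ with rfl | rfl
    · rw [abs_lt]; refine ⟨by linarith, by linarith, by linarith⟩
    · rw [abs_lt]; refine ⟨by linarith, by linarith, by linarith⟩
  have hcos : 0 < Real.cos ψ := Real.cos_pos_of_mem_Ioo ⟨(abs_lt.1 hψ'.2).1, (abs_lt.1 hψ'.2).2⟩
  have hsin : 0 < σ * Real.sin ψ := by
    have hb := abs_lt.1 hψ'.2
    rcases hσ with rfl | rfl
    · rw [one_mul]; exact Real.sin_pos_of_pos_of_lt_pi (by linarith) (by linarith)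
    · have := Real.sin_pos_of_pos_of_lt_pi (x := -ψ) (by linarith) (by linarith)
      rw [Real.sin_neg] at this; linarith
  have e : ζ ^ ((-1 / 2 : ℝ) : ℂ) * (a + σ * Complex.I * b) *
      Complex.exp (-(σ * Complex.I * Real.pi / 4))
      = ((Real.exp (-(Real.log ‖ζ‖ / 2)) : ℝ) : ℂ) *
        (((a * Real.cos ψ + σ * b * Real.sin ψ : ℝ) : ℂ) +
          ((σ * b * Real.cos ψ - a * Real.sin ψ : ℝ) : ℂ) * Complex.I) := by
    have h3 : ζ ^ ((-1 / 2 : ℝ) : ℂ) * Complex.exp (-(σ * Complex.I * Real.pi / 4))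
        = ((Real.exp (-(Real.log ‖ζ‖ / 2)) : ℝ) : ℂ) * Complex.exp ((-ψ : ℝ) * Complex.I) := by
      rw [Complex.cpow_def_of_ne_zero hζ, Complex.ofReal_exp, ← Complex.exp_add, ← Complex.exp_add,
        hψ, Complex.log]
      congr 1; push_cast; ring
    rw [mul_right_comm, h3, Complex.exp_mul_I, ← Complex.ofReal_cos, ← Complex.ofReal_sin,
      Real.cos_neg, Real.sin_neg]
    push_cast
    linear_combination (Complex.exp (-(Real.log ‖ζ‖ / 2)) * -(σ * b * Complex.sin ψ)) * Complex.I_sq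
  rw [e, Complex.re_ofReal_mul]
  refine mul_pos (Real.exp_pos _) ?_
  simp only [Complex.add_re, Complex.ofReal_re, Complex.mul_re, Complex.I_re, Complex.I_im,
    Complex.ofReal_im]
  nlinarith [mul_pos ha hcos, mul_pos hb hsin]

theorem continuousAt_contourCorner {x₀ κ₀ : ℝ} (hx : 0 < x₀) (hκ : κ₀ < x₀ ^ 2) (ts : ℝ) :
    ContinuousAt (fun p : ℂ × ℝ => contourCorner ts p.1 p.2) ((x₀ : ℂ), κ₀) :=
  (continuousAt_smallSaddle hx hκ).div_const _

theorem ContinuousAt.eventually_re_pos {P : Type*} [TopologicalSpace P] {f : P → ℂ} {p : P}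
    (h : ContinuousAt f p) (hp : 0 < (f p).re) : ∀ᶠ q in 𝓝 p, 0 < (f q).re :=
  (Complex.continuous_re.continuousAt.comp h).tendsto.eventually (lt_mem_nhds hp)

theorem smallSaddle_ofReal_pos {x₀ κ₀ : ℝ} (hx : 0 < x₀) (hκ0 : 0 < κ₀) (hκ : κ₀ < x₀ ^ 2) :
    ∃ r : ℝ, 0 < r ∧ smallSaddle x₀ κ₀ = r := by
  refine ⟨_, ?_, smallSaddle_ofReal hκ.le hx.ne'⟩
  have : √(1 - κ₀ / x₀ ^ 2) < 1 := by
    rw [Real.sqrt_lt' one_pos]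
    have : 0 < κ₀ / x₀ ^ 2 := by positivity
    linarith
  have : 0 < x₀ * (1 - √(1 - κ₀ / x₀ ^ 2)) := mul_pos hx (by linarith)
  linarith

/-- At `x₀` itself all quantities concerned are positive. -/
theorem eventually_matchRegular {x₀ κ₀ ts : ℝ} (hx : 0 < x₀) (hκ0 : 0 < κ₀) (hκ : κ₀ < x₀ ^ 2)
    (hts : 0 < ts) : ∀ᶠ p : ℂ × ℝ in 𝓝 ((x₀ : ℂ), κ₀), MatchRegular ts p.1 p.2 := by
  have hx0 : (x₀ : ℂ) ≠ 0 := by exact_mod_cast hx.ne'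
  have c1 : ContinuousAt (fun p : ℂ × ℝ => p.1) ((x₀ : ℂ), κ₀) := continuous_fst.continuousAt
  have c2 : ContinuousAt (fun p : ℂ × ℝ => wkbRoot (p.2 / p.1 ^ 2)) ((x₀ : ℂ), κ₀) := by
    unfold wkbRoot
    refine ContinuousAt.cpow (continuousAt_const.sub (ContinuousAt.div ?_ ?_ (pow_ne_zero 2 hx0)))
      continuousAt_const (one_sub_ofReal_div_mem_slitPlane hx hκ)
    · exact (Complex.continuous_ofReal.comp continuous_snd).continuousAt
    · exact (continuous_fst.pow 2).continuousAt
  have c3 := continuousAt_smallSaddle hx hκ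
  obtain ⟨r, hr, hrs⟩ := smallSaddle_ofReal_pos hx hκ0 hκ
  obtain ⟨ρ, hρ, hρs⟩ : ∃ ρ : ℝ, 0 < ρ ∧ wkbRoot ((κ₀ : ℂ) / (x₀ : ℂ) ^ 2) = ρ := by
    have h1 : 0 < 1 - κ₀ / x₀ ^ 2 := by
      rw [sub_pos, div_lt_one (by positivity)]; exact hκ
    refine ⟨(1 - κ₀ / x₀ ^ 2) ^ (1 / 2 : ℝ), by positivity, ?_⟩
    rw [wkbRoot, Complex.ofReal_cpow h1.le]; push_cast; rfl
  have hrs' : ((r : ℂ)) ∈ Complex.slitPlane := Complex.ofReal_mem_slitPlane.2 hr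
  have c4 : ContinuousAt (fun p : ℂ × ℝ => smallSaddle p.1 p.2 ^ ((-1 / 2 : ℝ) : ℂ) *
      contourCorner ts p.1 p.2 * Complex.exp ((Complex.log p.1 + Complex.log (wkbRoot (p.2 / p.1 ^ 2))) / 2))
      ((x₀ : ℂ), κ₀) := by
    refine ((c3.cpow continuousAt_const (by simp only; rwa [hrs])).mul
      (continuousAt_contourCorner hx hκ ts)).mul
      (((c1.clog ?_).add (c2.clog ?_)).div_const 2).cexp
    · exact Complex.ofReal_mem_slitPlane.2 hx
    · simp only; rw [hρs]; exact Complex.ofReal_mem_slitPlane.2 hρ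
  filter_upwards [continuous_snd.continuousAt.eventually (lt_mem_nhds hκ0),
    c1.eventually_re_pos (by simpa using hx), c2.eventually_re_pos (by simp only; rw [hρs]; simpa using hρ),
    c3.eventually_re_pos (by simp only; rw [hrs]; simpa using hr), c4.eventually_re_pos (by
      simp only
      rw [hrs, hρs, contourCorner, hrs, ← Complex.ofReal_log hx.le, ← Complex.ofReal_log hρ.le,
        ← Complex.ofReal_cpow hr.le, ← Complex.ofReal_add, ← Complex.ofReal_div,
        ← Complex.ofReal_ofNat, ← Complex.ofReal_div, ← Complex.ofReal_exp, ← Complex.ofReal_mul,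
        ← Complex.ofReal_mul, Complex.ofReal_re]
      positivity)] with p h1 h2 h3 h4 h5
  exact ⟨h1, h2, h3, h4, h5⟩

/-- At `x₀` the saddle points are in the right half-plane and `re_cpow_mul_pos` applies. -/
theorem eventually_turningRegular {x₀ κ₀ ts q₀ σ : ℝ} (hx : 0 < x₀) (hx1 : x₀ < 1) (hκ : κ₀ < x₀ ^ 2)
    (hq : q₀ < x₀ / 2) (hq0 : contourCorner ts x₀ κ₀ = q₀) (hσ : σ = 1 ∨ σ = -1) :
    ∀ᶠ p : ℂ × ℝ in 𝓝 ((x₀ : ℂ), κ₀), TurningRegular ts σ p.1 p.2 := by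
  have hx2 : x₀ ^ 2 < 1 := by nlinarith
  have hs : 0 < √(1 - x₀ ^ 2) / 2 := half_pos (Real.sqrt_pos.2 (by linarith))
  have hre : ∀ τ : ℝ, (turningSaddle τ x₀).re = x₀ / 2 ∧ (turningSaddle τ x₀).im = τ * (√(1 - x₀ ^ 2) / 2) := by
    intro τ
    rw [turningSaddle_ofReal hx2.le]
    constructor <;> simp
  have c1 : ∀ τ : ℝ, ContinuousAt (fun p : ℂ × ℝ => turningSaddle τ p.1) ((x₀ : ℂ), κ₀) := fun τ =>
    ContinuousAt.comp' (f := Prod.fst) (continuousAt_turningSaddle hx hx1 τ) continuous_fst.continuousAt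
  have hsl : (1 - (x₀ : ℂ) ^ 2) = ((1 - x₀ ^ 2 : ℝ) : ℂ) := by push_cast; ring
  have c2 : ContinuousAt (fun p : ℂ × ℝ => 1 - p.1 ^ 2) ((x₀ : ℂ), κ₀) :=
    Continuous.continuousAt (by fun_prop)
  have c3 : ContinuousAt (fun p : ℂ × ℝ => turningSaddle σ p.1 ^ ((-1 / 2 : ℝ) : ℂ) *
      contourDir ts σ p.1 p.2 *
      Complex.exp (-(σ * Complex.I * Real.pi / 4) + Complex.log (1 - p.1 ^ 2) / 4)) ((x₀ : ℂ), κ₀) := by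
    refine (((c1 σ).cpow continuousAt_const ?_).mul ((c1 σ).sub
      (continuousAt_contourCorner hx hκ ts))).mul
      (continuousAt_const.add ((c2.clog ?_).div_const 4)).cexp
    · exact Complex.mem_slitPlane_iff.2 (Or.inl (by simp only; rw [(hre σ).1]; linarith))
    · simp only; rw [hsl]; exact Complex.ofReal_mem_slitPlane.2 (by linarith)
  have hp : ∀ τ : ℝ, 0 < (turningSaddle τ x₀).re := fun τ => by rw [(hre τ).1]; linarith
  filter_upwards [c2.eventually_re_pos (by simp only; rw [hsl, Complex.ofReal_re]; linarith),
    (c1 σ).eventually_re_pos (hp σ), (c1 (-σ)).eventually_re_pos (hp (-σ)), c3.eventually_re_pos (by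
      have hσ' : 0 < σ * (turningSaddle σ x₀).im := by
        rw [(hre σ).2]
        rcases hσ with rfl | rfl <;> linarith
      have := re_cpow_mul_pos hσ (sub_pos.2 hq) hs (hp σ) hσ'
      have e : contourDir ts σ x₀ κ₀ = ((x₀ / 2 - q₀ : ℝ) : ℂ) + σ * Complex.I * ((√(1 - x₀ ^ 2) / 2 : ℝ) : ℂ) := by
        rw [contourDir, hq0, turningSaddle_ofReal hx2.le]; push_cast; ring
      simp only
      rw [e, Complex.exp_add, ← mul_assoc, hsl, ← Complex.ofReal_log (by linarith), ← Complex.ofReal_ofNat 4,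
        ← Complex.ofReal_div, ← Complex.ofReal_exp, Complex.re_mul_ofReal]
      exact mul_pos (by simpa using this) (Real.exp_pos _))] with p h1 h2 h3 h4
  refine ⟨?_, h2, h3, h4⟩
  intro h0; rw [h0] at h1; simp at h1

/-! ### Connection of the polynomials with the contour integrals -/

theorem RelEquiv.eventually_ne_zero {P : Type*} {l : Filter P} {ε : P → ℝ} {f g : P → ℂ}
    (h : RelEquiv l ε f g) (hε : Tendsto ε l (𝓝 0)) (hg : ∀ᶠ p in l, g p ≠ 0) :
    ∀ᶠ p in l, f p ≠ 0 := by
  obtain ⟨e, he, h⟩ := h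
  have h1 := (he.trans_tendsto hε).const_add 1
  rw [add_zero] at h1
  filter_upwards [h, hg, h1.eventually_ne one_ne_zero] with p h1 h2 h3
  rw [h1]; exact mul_ne_zero h2 h3

/-- The exponential factor common to both oscillatory terms. -/
noncomputable def commonFactor (α β : ℝ) (n : ℕ) (z : ℂ) : ℂ :=
  Complex.exp (bigN β n * (z ^ 2 - 1 / 2 - Real.log 2)) *
    Complex.exp (((α ^ 2 - 1 / 4) / 4 : ℝ) * (1 / (bigN β n * z ^ 2)) * Complex.log (bigN β n * z ^ 2))

/-- One of the two exponentials of which the oscillatory term consists. -/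
noncomputable def waveTerm (β σ : ℝ) (n : ℕ) (z : ℂ) : ℂ :=
  z ^ (3 / 2 - β : ℂ) * Complex.exp (-(Complex.log (1 - z ^ 2) / 4)) *
    Complex.exp (-(σ * Complex.I * (bigN β n * theta z + Real.pi / 4)))

theorem turningSaddle_sub (σ : ℝ) (z : ℂ) :
    turningSaddle σ z - turningSaddle (-σ) z = σ * Complex.I * (1 - z ^ 2) ^ (1 / 2 : ℂ) := by
  rw [turningSaddle, turningSaddle]; push_cast; ring

/-- The quotient of Casoratians that gives the `σ`-part of the polynomial of index `n`, evaluated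
with the main terms of all factors, in closed form. -/
theorem connection_eq (α β κ₀ : ℝ) {ts σ : ℝ} (hts : 0 < ts) (hσ : σ = 1 ∨ σ = -1) {n : ℕ}
    (hN : 0 < bigN β n) {z : ℂ} (hm : MatchRegular ts z (level β κ₀ 0 n))
    (hp : TurningRegular ts σ z (level β κ₀ 0 n)) (hn : TurningRegular ts (-σ) z (level β κ₀ 0 n))
    (hq : 0 < (((level β κ₀ 0 n : ℂ) / 2 - 2 * smallSaddle z (level β κ₀ 0 n) ^ 2) *
      (contourCorner ts z (level β κ₀ 0 n) / smallSaddle z (level β κ₀ 0 n)) ^ 2).re)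
    (hqp : 0 < ((((1 : ℝ) : ℂ) / 2 - 2 * turningSaddle σ z ^ 2) *
      (contourDir ts σ z (level β κ₀ 0 n) / turningSaddle σ z) ^ 2).re)
    (hqn : 0 < ((((1 : ℝ) : ℂ) / 2 - 2 * turningSaddle (-σ) z ^ 2) *
      (contourDir ts (-σ) z (level β κ₀ 0 n) / turningSaddle (-σ) z) ^ 2).re) :
    Complex.exp ((-bigN β n - (bigN β (matchIndex κ₀ n) *
        Real.log (bigN β (matchIndex κ₀ n) / bigN β n) - bigN β (matchIndex κ₀ n))
      - (bigN β n - bigN β (matchIndex κ₀ n)) * Real.log 4 : ℝ)) *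
      ((z - smallSaddle z (level β κ₀ 0 n) - smallSaddle z (level β κ₀ 0 n)) * (matchTerm α β κ₀ n z *
        saddleTerm (bigN β n) z (smallSaddle z (level β κ₀ 0 n))
          (contourCorner ts z (level β κ₀ 0 n)) (level β κ₀ 0 n) (-1 / 2))) *
      saddleTerm (bigN β n) z (turningSaddle σ z) (contourDir ts σ z (level β κ₀ 0 n)) 1 (-1 / 2) /
      ((turningSaddle σ z - turningSaddle (-σ) z) *
        (saddleTerm (bigN β n) z (turningSaddle σ z) (contourDir ts σ z (level β κ₀ 0 n)) 1 (-1 / 2) *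
        saddleTerm (bigN β n) z (turningSaddle (-σ) z) (contourDir ts (-σ) z (level β κ₀ 0 n)) 1 (-1 / 2)))
      = commonFactor α β n z * waveTerm β σ n z := by
  have hσn : -σ = 1 ∨ -σ = -1 := by rcases hσ with rfl | rfl <;> norm_num
  have hP := match_product_eq α β κ₀ hN hm
  have hz : z ≠ 0 := by intro h0; have := hm.re_z; rw [h0] at this; simp at this
  have hr := wkbRoot_ne_zero hm.re_root
  have e1 := exp_half_log_sq hz hr
  have e2 : z - smallSaddle z (level β κ₀ 0 n) - smallSaddle z (level β κ₀ 0 n)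
      = z * wkbRoot (level β κ₀ 0 n / z ^ 2) := by rw [smallSaddle]; ring
  have hsp : ((√(Real.pi / (2 * bigN β n)) : ℝ) : ℂ) ≠ 0 := by
    have : 0 < Real.pi / (2 * bigN β n) := div_pos Real.pi_pos (by positivity)
    exact_mod_cast (Real.sqrt_pos.2 this).ne'
  rw [saddleTerm_small hN hts hm hq, saddleTerm_turning hN hσ hp hqp, saddleTerm_turning hN hσn hn hqn,
    turningSaddle_sub, sqrt_one_sub_sq_eq_exp hp.ne_zero, e2, ← e1,
    saddleExp_turning _ hσn hn.re_pos hn.re_neg]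
  have hx0 : saddleExp (bigN β n) z (turningSaddle σ z) 1 ≠ 0 := Complex.exp_ne_zero _
  obtain ⟨X, hX⟩ : ∃ X, X = saddleExp (bigN β n) z (turningSaddle σ z) 1 := ⟨_, rfl⟩
  obtain ⟨Y, hY⟩ : ∃ Y, Y = saddleExp (bigN β n) z (smallSaddle z (level β κ₀ 0 n)) (level β κ₀ 0 n) :=
    ⟨_, rfl⟩
  obtain ⟨e, he⟩ : ∃ e, e = Complex.exp ((Complex.log z + Complex.log (wkbRoot (level β κ₀ 0 n / z ^ 2))) / 2) :=
    ⟨_, rfl⟩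
  obtain ⟨q, hqe⟩ : ∃ q : ℂ, q = (√(Real.pi / (2 * bigN β n)) : ℝ) := ⟨_, rfl⟩
  obtain ⟨P, hPe⟩ : ∃ P, P = Complex.exp ((-bigN β n - (bigN β (matchIndex κ₀ n) *
        Real.log (bigN β (matchIndex κ₀ n) / bigN β n) - bigN β (matchIndex κ₀ n))
      - (bigN β n - bigN β (matchIndex κ₀ n)) * Real.log 4 : ℝ)) := ⟨_, rfl⟩
  have he0 : e ≠ 0 := by rw [he]; exact Complex.exp_ne_zero _
  rw [← hX] at hx0
  rw [← hqe] at hsp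
  rw [← hX, ← hY, ← he, ← hqe, ← hPe]
  rw [← hY, ← he, ← hPe] at hP
  have hσI : ((σ : ℂ) * Complex.I)⁻¹ = Complex.exp (-(σ * Complex.I * Real.pi / 2)) := by
    rw [exp_neg_sigma hσ]
    refine inv_eq_of_mul_eq_one_right ?_
    have hσ2 : (σ : ℂ) ^ 2 = 1 := by rcases hσ with rfl | rfl <;> norm_num
    linear_combination (-Complex.I ^ 2) * hσ2 - Complex.I_sq
  have hlog4 : Real.log 4 = 2 * Real.log 2 := by
    rw [show (4 : ℝ) = 2 ^ 2 by norm_num, Real.log_pow]; push_cast; ring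
  rw [hlog4] at hP
  generalize hU : Complex.exp (-(σ * Complex.I * Real.pi / 4) + Complex.log (1 - z ^ 2) / 4) = u1
  generalize hVV : Complex.exp (-(((-σ : ℝ) : ℂ) * Complex.I * Real.pi / 4) + Complex.log (1 - z ^ 2) / 4) = u2
  have hu1 : u1 ≠ 0 := by rw [← hU]; exact Complex.exp_ne_zero _
  have hu2 : u2 ≠ 0 := by rw [← hVV]; exact Complex.exp_ne_zero _
  generalize hT : Complex.exp (bigN β n * (z ^ 2 - 1 / 2 - Real.log 2 - ((-σ : ℝ) : ℂ) * Complex.I * theta z)) = T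
  have hT0 : T ≠ 0 := by rw [← hT]; exact Complex.exp_ne_zero _
  have hσI0 : (σ : ℂ) * Complex.I ≠ 0 := by
    rcases hσ with rfl | rfl <;> simp
  have hmain : P * (e ^ 2 * (matchTerm α β κ₀ n z * (Y * q * e⁻¹))) * (X * q * u1⁻¹) /
      ((σ : ℂ) * Complex.I * Complex.exp (Complex.log (1 - z ^ 2) / 2) * (X * q * u1⁻¹ * (T * q * u2⁻¹)))
      = (P * (matchTerm α β κ₀ n z * (Y * e))) * (((σ : ℂ) * Complex.I)⁻¹ * u2 * T⁻¹ *
        (Complex.exp (Complex.log (1 - z ^ 2) / 2))⁻¹) := by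
    have := Complex.exp_ne_zero (Complex.log (1 - z ^ 2) / 2)
    generalize (σ : ℂ) * Complex.I = w at *
    field_simp
  have hexp : Complex.exp (bigN β n * (2 * z ^ 2 - 1 - (2 * Real.log 2 : ℝ))) *
      (((σ : ℂ) * Complex.I)⁻¹ * u2 * T⁻¹ * (Complex.exp (Complex.log (1 - z ^ 2) / 2))⁻¹)
      = Complex.exp (bigN β n * (z ^ 2 - 1 / 2 - Real.log 2)) *
        (Complex.exp (-(Complex.log (1 - z ^ 2) / 4)) *
        Complex.exp (-(σ * Complex.I * (bigN β n * theta z + Real.pi / 4)))) := by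
    rw [hσI, ← hVV, ← hT]
    simp only [← Complex.exp_neg, ← Complex.exp_add]
    congr 1; push_cast; ring
  rw [hmain, hP, commonFactor, waveTerm]
  linear_combination z ^ (3 / 2 - β : ℂ) * Complex.exp (((α ^ 2 - 1 / 4) / 4 : ℝ) *
    (1 / (bigN β n * z ^ 2)) * Complex.log (bigN β n * z ^ 2)) * hexp

/-- At a small level the two characteristic roots are distinct: the polynomials and the contour
integral grow at different rates, and their Casoratian does not suffer from cancellation. -/
theorem smallSaddle_ne_sub {x₀ κ₀ : ℝ} (hx : 0 < x₀) (hκ : κ₀ < x₀ ^ 2) :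
    (x₀ : ℂ) - smallSaddle x₀ κ₀ ≠ smallSaddle x₀ κ₀ := by
  have h : (x₀ : ℂ) - smallSaddle x₀ κ₀ - smallSaddle x₀ κ₀ = x₀ * wkbRoot (κ₀ / (x₀ : ℂ) ^ 2) := by
    rw [smallSaddle]; ring
  rw [← sub_ne_zero, h]
  exact mul_ne_zero (by exact_mod_cast hx.ne')
    (wkbRoot_ne_zero (wkbRoot_re_pos (one_sub_ofReal_div_mem_slitPlane hx hκ)))

/-- For the solutions `J`, `J'` through the two conjugate saddle points, the Casoratian at `n` does
not vanish. The Casoratian of the polynomials and `J'`, divided by it, is the coefficient of `J` in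
the polynomials; multiplied by the value of `J` at `n`, it has the asymptotic form of one of the two
oscillatory terms. -/
theorem connection_relEquiv {α β x₀ κ₀ ts q₀ σ : ℝ} (hβ : 0 < β) (hx : 0 < x₀) (hx1 : x₀ < 1)
    (hκ : 0 < κ₀) (hκx : κ₀ < x₀ ^ 2) (hts : 0 < ts) (hq : q₀ < x₀ / 2)
    (hq0 : contourCorner ts x₀ κ₀ = q₀) (hσ : σ = 1 ∨ σ = -1) {J J' : ℕ × ℂ → ℕ → ℂ}
    (hJ : IsSaddleSolution α β x₀ κ₀ ts σ J) (hJ' : IsSaddleSolution α β x₀ κ₀ ts (-σ) J') :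
    (∀ᶠ p in atTop ×ˢ 𝓝 (x₀ : ℂ), J p (p.1 + 1) * J' p p.1 - J p p.1 * J' p (p.1 + 1) ≠ 0) ∧
    RelEquiv (atTop ×ˢ 𝓝 (x₀ : ℂ)) (fun p => 1 / bigN β p.1)
      (fun p => (normPhi α β p.1 p.2 (p.1 + 1) * J' p p.1 - normPhi α β p.1 p.2 p.1 * J' p (p.1 + 1)) *
        J p p.1 / (J p (p.1 + 1) * J' p p.1 - J p p.1 * J' p (p.1 + 1)))
      (fun p => commonFactor α β p.1 p.2 * waveTerm β σ p.1 p.2) := by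
  have hσn : -σ = 1 ∨ -σ = -1 := by rcases hσ with rfl | rfl <;> norm_num
  have hε : Tendsto (fun p : ℕ × ℂ => 1 / bigN β p.1) (atTop ×ˢ 𝓝 (x₀ : ℂ)) (𝓝 0) :=
    (tendsto_one_div_bigN β).comp tendsto_fst
  have t1 : Tendsto (fun p : ℕ × ℂ => level β κ₀ 0 p.1) (atTop ×ˢ 𝓝 (x₀ : ℂ)) (𝓝 κ₀) :=
    (tendsto_level β hκ 0).comp tendsto_fst
  have t2 : Tendsto (fun p : ℕ × ℂ => p.2) (atTop ×ˢ 𝓝 (x₀ : ℂ)) (𝓝 (x₀ : ℂ)) := tendsto_snd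
  have t12 : Tendsto (fun p : ℕ × ℂ => (p.2, level β κ₀ 0 p.1)) (atTop ×ˢ 𝓝 (x₀ : ℂ))
      (𝓝 ((x₀ : ℂ), κ₀)) := by rw [nhds_prod_eq]; exact t2.prodMk t1
  have tN : Tendsto (fun p : ℕ × ℂ => bigN β p.1) (atTop ×ˢ 𝓝 (x₀ : ℂ)) atTop :=
    (tendsto_bigN β).comp tendsto_fst
  have tS : Tendsto (fun p : ℕ × ℂ => smallSaddle p.2 (level β κ₀ 0 p.1)) (atTop ×ˢ 𝓝 (x₀ : ℂ))
      (𝓝 (smallSaddle x₀ κ₀)) := by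
    have := Tendsto.comp (continuousAt_smallSaddle hx hκx) t12
    exact this
  have tT : ∀ τ, Tendsto (fun p : ℕ × ℂ => turningSaddle τ p.2) (atTop ×ˢ 𝓝 (x₀ : ℂ))
      (𝓝 (turningSaddle τ x₀)) := fun τ => by
    have := Tendsto.comp (continuousAt_turningSaddle hx hx1 τ) t2
    exact this
  have hMR := t12.eventually (eventually_matchRegular hx hκ hκx hts)
  have hTR := t12.eventually (eventually_turningRegular hx hx1 hκx hq hq0 hσ)
  have hTRn := t12.eventually (eventually_turningRegular hx hx1 hκx hq hq0 hσn)
  have hkn : ∀ᶠ p : ℕ × ℂ in atTop ×ˢ 𝓝 (x₀ : ℂ), matchIndex κ₀ p.1 ≤ p.1 := by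
    have hκ1 : κ₀ ≤ 1 := by nlinarith
    refine Eventually.of_forall fun p => Nat.ceil_le.2 ?_
    nlinarith [Nat.cast_nonneg (α := ℝ) p.1]
  -- the asymptotic forms of the contour integrals
  have h01 : ((0 : ℕ) : ℝ) - 1 / 2 = -1 / 2 := by norm_num
  have h11 : ((1 : ℕ) : ℝ) - 1 / 2 = -1 / 2 + 1 := by norm_num
  obtain ⟨S, hS⟩ : ∃ S : ℝ → ℕ × ℂ → ℂ, S = fun τ p => saddleTerm (bigN β p.1) p.2
    (turningSaddle τ p.2) (contourDir ts τ p.2 (level β κ₀ 0 p.1)) 1 (-1 / 2) := ⟨_, rfl⟩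
  obtain ⟨s, hs⟩ : ∃ s : ℕ × ℂ → ℂ, s = fun p => saddleTerm (bigN β p.1) p.2
    (smallSaddle p.2 (level β κ₀ 0 p.1)) (contourCorner ts p.2 (level β κ₀ 0 p.1))
    (level β κ₀ 0 p.1) (-1 / 2) := ⟨_, rfl⟩
  have hre : ∀ {w : ℂ}, 0 < w.re → w ≠ 0 := fun {w} hw h0 => by rw [h0] at hw; simp at hw
  have a0 := (hJ.asymptotics 0 zero_le_one).1
  have a1 := (hJ.asymptotics 1 le_rfl).1.congr_right (g₂ := fun p => turningSaddle σ p.2 * S σ p) (by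
    filter_upwards [hTR] with p hp
    rw [hS, h11, saddleTerm_add_one (hre hp.re_pos)])
  have b0 := (hJ'.asymptotics 0 zero_le_one).1
  have b1 := (hJ'.asymptotics 1 le_rfl).1.congr_right (g₂ := fun p => turningSaddle (-σ) p.2 * S (-σ) p) (by
    filter_upwards [hTRn] with p hp
    rw [hS, h11, saddleTerm_add_one (hre hp.re_pos)])
  have c0 := (hJ'.asymptotics 0 zero_le_one).2
  have c1 := (hJ'.asymptotics 1 le_rfl).2.congr_right
    (g₂ := fun p => smallSaddle p.2 (level β κ₀ 0 p.1) * s p) (by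
    filter_upwards [hMR] with p hp
    rw [hs, h11, saddleTerm_add_one (hre hp.re_small)])
  rw [h01] at a0 b0 c0
  simp only [add_zero] at a0 b0 c0
  -- the Casoratian of the polynomials and one contour integral, carried from the match index to `n`
  have hW := RelEquiv.sub_mul
    (((normPhi_matchIndex_succ α hβ hx hκ hκx).mul hε c0).congr_right
      (g₂ := fun p => (p.2 - smallSaddle p.2 (level β κ₀ 0 p.1)) * (matchTerm α β κ₀ p.1 p.2 * s p))
      (Eventually.of_forall fun p => by rw [hs]; ring))
    (((normPhi_matchIndex α hβ hx hκ hκx 0).mul hε c1).congr_right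
      (g₂ := fun p => smallSaddle p.2 (level β κ₀ 0 p.1) * (matchTerm α β κ₀ p.1 p.2 * s p))
      (Eventually.of_forall fun p => by rw [matchTerm]; simp only [add_zero]; ring))
    (t2.sub tS) tS (smallSaddle_ne_sub hx hκx)
  have hD := RelEquiv.sub_mul
    ((a1.mul hε b0).congr_right (g₂ := fun p => turningSaddle σ p.2 * (S σ p * S (-σ) p))
      (Eventually.of_forall fun p => by rw [hS]; ring))
    ((a0.mul hε b1).congr_right (g₂ := fun p => turningSaddle (-σ) p.2 * (S σ p * S (-σ) p))
      (Eventually.of_forall fun p => by rw [hS]; ring))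
    (tT σ) (tT (-σ)) (by
      rw [← sub_ne_zero, turningSaddle_sub]
      have h1 : (1 - (x₀ : ℂ) ^ 2) ^ (1 / 2 : ℂ) ≠ 0 := by
        rw [sqrt_one_sub_sq_ofReal (by nlinarith)]
        have : 0 < √(1 - x₀ ^ 2) := Real.sqrt_pos.2 (by nlinarith)
        exact_mod_cast this.ne'
      refine mul_ne_zero (mul_ne_zero ?_ Complex.I_ne_zero) h1
      rcases hσ with rfl | rfl <;> norm_num)
  obtain ⟨C, N0, hprod⟩ := exists_prod_lam_bound α β (half_pos hκ)
  have hprod' : RelEquiv (atTop ×ˢ 𝓝 (x₀ : ℂ)) (fun p => 1 / bigN β p.1)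
      (fun p => ∏ j ∈ Finset.Ioc (matchIndex κ₀ p.1) p.1, ((lam α β j / 2 / bigN β p.1 : ℝ) : ℂ))
      (fun p => Complex.exp ((-bigN β p.1 - (bigN β (matchIndex κ₀ p.1) *
        Real.log (bigN β (matchIndex κ₀ p.1) / bigN β p.1) - bigN β (matchIndex κ₀ p.1))
      - (bigN β p.1 - bigN β (matchIndex κ₀ p.1)) * Real.log 4 : ℝ))) := by
    refine RelEquiv.of_norm_sub_le (K := C) ?_
    filter_upwards [hkn, tN.eventually_ge_atTop N0, tN.eventually_gt_atTop 0,
      t1.eventually (lt_mem_nhds (half_lt_self hκ))] with p h1 h2 h3 h4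
    have h5 := hprod _ _ h1 h2 (by
      rw [level, add_zero, lt_div_iff₀ h3] at h4; exact h4.le)
    rw [← Complex.ofReal_exp, ← Complex.ofReal_prod, ← Complex.ofReal_sub, Complex.norm_real,
      Complex.norm_real, Real.norm_eq_abs, Real.norm_eq_abs, abs_of_pos (Real.exp_pos _)]
    exact h5
  have hne := hD.eventually_ne_zero hε
  refine ⟨hne ?_, ?_⟩
  · filter_upwards [hJ.re_pos, hJ'.re_pos, hTR, hTRn, tN.eventually_gt_atTop 0] with p h1 h2 h3 h4 h5
    have hsp : ((√(Real.pi / (2 * bigN β p.1)) : ℝ) : ℂ) ≠ 0 := by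
      have : 0 < Real.pi / (2 * bigN β p.1) := div_pos Real.pi_pos (by positivity)
      exact_mod_cast (Real.sqrt_pos.2 this).ne'
    rw [hS]
    simp only
    rw [saddleTerm_turning h5 hσ h3 h1.1, saddleTerm_turning h5 hσn h4 h2.1, turningSaddle_sub,
      sqrt_one_sub_sq_eq_exp h3.ne_zero]
    have hσ0 : (σ : ℂ) ≠ 0 := by rcases hσ with rfl | rfl <;> norm_num
    refine mul_ne_zero (mul_ne_zero (mul_ne_zero hσ0 Complex.I_ne_zero) (Complex.exp_ne_zero _))
      (mul_ne_zero ?_ ?_) <;>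
    exact mul_ne_zero (mul_ne_zero (Complex.exp_ne_zero _) hsp) (inv_ne_zero (Complex.exp_ne_zero _))
  · have hfin := ((hprod'.mul hε hW).mul hε a0).div hε hD
    refine (hfin.congr_left ?_).congr_right ?_
    · filter_upwards [hkn, hJ'.recurrence, tN.eventually_gt_atTop 0] with p h1 h2 h3
      rw [casoratian_eq_prod (z := p.2)
        (b := fun j => ((lam α β j / 2 / bigN β p.1 : ℝ) : ℂ)) h1 (fun k _ => normPhi_recurrence α β h3 p.2 k) h2]
      simp only [add_zero]
    · filter_upwards [hJ.re_pos, hJ'.re_pos, hTR, hTRn, hMR, tN.eventually_gt_atTop 0]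
        with p h1 h2 h3 h4 h5 h6
      rw [hS, hs]
      exact connection_eq α β κ₀ hts hσ h6 h5 h3 h4 h1.2 h1.1 h2.1

/-! ### The oscillatory region -/

/-- The constants in `prefactor` only account for the normalization of the polynomials. -/
theorem phi_div_prefactor_eq {α β : ℝ} (hα : 0 ≤ α) (hαβ : α < β) {n : ℕ} (hN : 0 < bigN β n) (z : ℂ) :
    phi α β n ((√(bigN β n) : ℝ) * z) / prefactor α β n z
      = normPhi α β n z n / commonFactor α β n z := by
  have hg : (gam α β n : ℂ) ≠ 0 := by exact_mod_cast (gam_pos hα hαβ n).ne'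
  have hs : ((√(bigN β n) : ℝ) : ℂ) ^ n ≠ 0 :=
    pow_ne_zero n (by exact_mod_cast (Real.sqrt_pos.2 hN).ne')
  rw [phi_eq_gam_mul_monicPhi hα hαβ, prefactor_eq_exp hN, normPhi, commonFactor, ← Complex.exp_add,
    mul_assoc, mul_div_mul_left _ _ hg, div_div]
  congr 3
  push_cast; ring

theorem innerTerm_eq (β : ℝ) (n : ℕ) {z : ℂ} (hz : 1 - z ^ 2 ≠ 0) :
    innerTerm β n z = waveTerm β 1 n z + waveTerm β (-1) n z := by
  have e1 : z ^ (3 / 2 - β : ℂ) = (z ^ ((β : ℂ) - 3 / 2))⁻¹ := by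
    rw [← Complex.cpow_neg]; congr 1; ring
  have e2 : Complex.exp (-(Complex.log (1 - z ^ 2) / 4)) = ((1 - z ^ 2) ^ (1 / 4 : ℂ))⁻¹ := by
    rw [Complex.exp_neg, Complex.cpow_def_of_ne_zero hz]; congr 2; ring
  rw [innerTerm, waveTerm, waveTerm, e1, e2, Complex.cos, div_eq_mul_inv, mul_inv]
  push_cast
  have e3 : -(1 * Complex.I * (bigN β n * theta z + Real.pi / 4))
      = -(bigN β n * theta z + Real.pi / 4) * Complex.I := by ring
  have e4 : -(-1 * Complex.I * (bigN β n * theta z + Real.pi / 4))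
      = (bigN β n * theta z + Real.pi / 4) * Complex.I := by ring
  rw [e3, e4]; ring

/-- Up to the algebraic factors, neither of the two exponentials in the cosine exceeds `exp (N |Im
θ|)`. -/
theorem norm_waveTerm_le {β σ : ℝ} (hσ : σ = 1 ∨ σ = -1) {n : ℕ} (hN : 0 < bigN β n) (z : ℂ) :
    ‖waveTerm β σ n z‖ ≤ ‖z ^ (3 / 2 - β : ℂ) * Complex.exp (-(Complex.log (1 - z ^ 2) / 4))‖ *
      Real.exp (bigN β n * |(theta z).im|) := by
  rw [waveTerm, norm_mul _ (Complex.exp (-(σ * _ * _))), Complex.norm_exp]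
  refine mul_le_mul_of_nonneg_left (Real.exp_le_exp.2 ?_) (norm_nonneg _)
  have e : (-(σ * Complex.I * (bigN β n * theta z + Real.pi / 4))).re = σ * (bigN β n * (theta z).im) := by
    have : (Real.pi / 4 : ℂ) = ((Real.pi / 4 : ℝ) : ℂ) := by push_cast; rfl
    rw [this]
    simp
  rw [e]
  have h1 := mul_le_mul_of_nonneg_left (le_abs_self (theta z).im) hN.le
  have h2 := mul_le_mul_of_nonneg_left (neg_abs_le (theta z).im) hN.le
  rcases hσ with rfl | rfl <;> linarith

/-- The oscillatory asymptotics near a point of `(0, 1)`: the polynomial is written as a combination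
of the two contour integrals, and each of the two parts has a relative error `O(1 / N)`. -/
theorem oscillatory_local {α β x₀ : ℝ} (hα : 0 ≤ α) (hαβ : α < β) (hx : 0 < x₀) (hx1 : x₀ < 1) :
    ∃ C : ℝ, ∀ᶠ p : ℕ × ℂ in atTop ×ˢ 𝓝 (x₀ : ℂ),
      ‖phi α β p.1 ((√(bigN β p.1) : ℝ) * p.2) / prefactor α β p.1 p.2 - innerTerm β p.1 p.2‖
        ≤ C / bigN β p.1 * Real.exp (bigN β p.1 * |(theta p.2).im|) := by
  have hβ : 0 < β := hα.trans_lt hαβ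
  obtain ⟨κ₀, ts, q₀, hκ, hκx, hts, -, hq, hq0, hex⟩ := exists_isSaddleSolution α hβ hx hx1
  obtain ⟨J, hJ⟩ := hex 1 (by norm_num)
  obtain ⟨J', hJ'⟩ := hex (-1) (by norm_num)
  obtain ⟨hD, e₁, he₁, h₁⟩ := connection_relEquiv hβ hx hx1 hκ hκx hts hq hq0 (Or.inl rfl) hJ hJ'
  obtain ⟨-, e₂, he₂, h₂⟩ := connection_relEquiv hβ hx hx1 hκ hκx hts hq hq0 (Or.inr rfl) hJ'
    (by rwa [neg_neg])
  obtain ⟨c₁, hc₁⟩ := he₁.bound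
  obtain ⟨c₂, hc₂⟩ := he₂.bound
  have t2 : Tendsto (fun p : ℕ × ℂ => p.2) (atTop ×ˢ 𝓝 (x₀ : ℂ)) (𝓝 (x₀ : ℂ)) := tendsto_snd
  have tN : Tendsto (fun p : ℕ × ℂ => bigN β p.1) (atTop ×ˢ 𝓝 (x₀ : ℂ)) atTop :=
    (tendsto_bigN β).comp tendsto_fst
  have hsl : (1 : ℂ) - (x₀ : ℂ) ^ 2 ∈ Complex.slitPlane := by
    have : (1 : ℂ) - (x₀ : ℂ) ^ 2 = ((1 - x₀ ^ 2 : ℝ) : ℂ) := by push_cast; ring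
    rw [this]; exact Complex.ofReal_mem_slitPlane.2 (by nlinarith)
  have hc : ContinuousAt (fun z : ℂ => 1 - z ^ 2) (x₀ : ℂ) := Continuous.continuousAt (by fun_prop)
  obtain ⟨B, hB⟩ : ∃ B : ℂ → ℂ, B = fun z => z ^ (3 / 2 - β : ℂ) *
    Complex.exp (-(Complex.log (1 - z ^ 2) / 4)) := ⟨_, rfl⟩
  have hBc : ContinuousAt B x₀ := by
    rw [hB]
    exact (continuousAt_id.cpow continuousAt_const (Complex.ofReal_mem_slitPlane.2 hx)).mul
      ((hc.clog hsl).div_const 4).neg.cexp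
  refine ⟨(|c₁| + |c₂|) * (‖B x₀‖ + 1), ?_⟩
  filter_upwards [hD, h₁, h₂, hc₁, hc₂, tN.eventually_gt_atTop 0,
    t2.eventually (hc.eventually_ne (Complex.slitPlane_ne_zero hsl)),
    t2.eventually (hBc.norm.eventually (gt_mem_nhds (lt_add_one _)))] with p p1 p2 p3 p4 p5 p6 p7 p8
  obtain ⟨n, z⟩ := p
  simp only at p1 p2 p3 p4 p5 p6 p7 p8 ⊢
  have hF : commonFactor α β n z ≠ 0 := mul_ne_zero (Complex.exp_ne_zero _) (Complex.exp_ne_zero _)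
  -- Cramer's rule for the expansion of the polynomials in `J` and `J'`.
  have hsum : normPhi α β n z n = commonFactor α β n z * waveTerm β 1 n z * (1 + e₁ (n, z))
      + commonFactor α β n z * waveTerm β (-1) n z * (1 + e₂ (n, z)) := by
    rw [← p2, ← p3]
    have hD' : J' (n, z) (n + 1) * J (n, z) n - J' (n, z) n * J (n, z) (n + 1)
      = -(J (n, z) (n + 1) * J' (n, z) n - J (n, z) n * J' (n, z) (n + 1)) := by ring
    rw [hD', div_neg, ← sub_eq_add_neg, ← sub_div, eq_div_iff p1]
    ring
  have hdiff : phi α β n ((√(bigN β n) : ℝ) * z) / prefactor α β n z - innerTerm β n z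
      = waveTerm β 1 n z * e₁ (n, z) + waveTerm β (-1) n z * e₂ (n, z) := by
    rw [phi_div_prefactor_eq hα hαβ p6, hsum, innerTerm_eq β n p7]
    field_simp
    ring
  have w₁ := norm_waveTerm_le (β := β) (σ := 1) (Or.inl rfl) p6 z
  have w₂ := norm_waveTerm_le (β := β) (σ := -1) (Or.inr rfl) p6 z
  have hBz : ‖z ^ (3 / 2 - β : ℂ) * Complex.exp (-(Complex.log (1 - z ^ 2) / 4))‖ ≤ ‖B x₀‖ + 1 := by
    have := p8.le
    rw [hB] at this ⊢
    exact this
  have q₁ : ‖e₁ (n, z)‖ ≤ |c₁| * (1 / bigN β n) := by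
    rw [Real.norm_of_nonneg (one_div_pos.2 p6).le] at p4
    exact p4.trans (by gcongr; exact le_abs_self _)
  have q₂ : ‖e₂ (n, z)‖ ≤ |c₂| * (1 / bigN β n) := by
    rw [Real.norm_of_nonneg (one_div_pos.2 p6).le] at p5
    exact p5.trans (by gcongr; exact le_abs_self _)
  rw [hdiff]
  calc _ ≤ ‖waveTerm β 1 n z‖ * ‖e₁ (n, z)‖ + ‖waveTerm β (-1) n z‖ * ‖e₂ (n, z)‖ := by
        rw [← norm_mul, ← norm_mul]; exact norm_add_le _ _
    _ ≤ ((‖B x₀‖ + 1) * Real.exp (bigN β n * |(theta z).im|)) * (|c₁| * (1 / bigN β n))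
        + ((‖B x₀‖ + 1) * Real.exp (bigN β n * |(theta z).im|)) * (|c₂| * (1 / bigN β n)) := by
        gcongr
        exacts [w₁.trans (by gcongr), w₂.trans (by gcongr)]
    _ = _ := by ring

theorem theta_ofReal_im {x : ℝ} (hx : x ^ 2 ≤ 1) : (theta x).im = 0 := by
  have hs := sqrt_one_sub_sq_ofReal hx
  have hn : ‖(x : ℂ) + Complex.I * (√(1 - x ^ 2) : ℝ)‖ = 1 := by
    have : ‖(x : ℂ) + Complex.I * (√(1 - x ^ 2) : ℝ)‖ ^ 2 = 1 := by
      rw [← Complex.normSq_eq_norm_sq, mul_comm, Complex.normSq_add_mul_I, Real.sq_sqrt (by linarith)]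
      ring
    exact (pow_eq_one_iff_of_nonneg (norm_nonneg _) two_ne_zero).1 this
  rw [theta, carccos, hs, Complex.sub_im, ← Complex.ofReal_mul, Complex.ofReal_im, neg_mul,
    Complex.neg_im, Complex.I_mul_im, Complex.log_re, hn, Real.log_one]
  ring

/-- The phase is real on the interval and Lipschitz near it. -/
theorem exists_abs_im_theta_le {x₀ : ℝ} (hx : 0 < x₀) (hx1 : x₀ < 1) :
    ∃ L : ℝ, ∀ᶠ z in 𝓝 (x₀ : ℂ), |(theta z).im| ≤ L * |z.im| := by
  have hx2 : x₀ ^ 2 < 1 := by nlinarith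
  have hs : AnalyticAt ℂ (fun z : ℂ => (1 - z ^ 2) ^ (1 / 2 : ℂ)) x₀ := by
    refine AnalyticAt.cpow (by fun_prop) analyticAt_const ?_
    have : (1 : ℂ) - (x₀ : ℂ) ^ 2 = ((1 - x₀ ^ 2 : ℝ) : ℂ) := by push_cast; ring
    rw [this]; exact Complex.ofReal_mem_slitPlane.2 (by linarith)
  have hθ : AnalyticAt ℂ theta x₀ := by
    unfold theta carccos
    refine (analyticAt_id.mul hs).sub (analyticAt_const.mul
      ((analyticAt_id.add (analyticAt_const.mul hs)).clog ?_))
    refine Complex.mem_slitPlane_iff.2 (Or.inl ?_)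
    simp only [Pi.add_apply, Pi.mul_apply, id]
    rw [sqrt_one_sub_sq_ofReal hx2.le]
    simpa using hx
  obtain ⟨K, t, ht, hK⟩ := (hθ.contDiffAt (n := 1)).exists_lipschitzOnWith
  obtain ⟨r, hr, hrt⟩ := Metric.mem_nhds_iff.1 ht
  refine ⟨K, ?_⟩
  filter_upwards [Metric.ball_mem_nhds (x₀ : ℂ) (lt_min hr (lt_min hx (sub_pos.2 hx1)))] with z hz
  rw [Metric.mem_ball, dist_eq_norm, lt_min_iff, lt_min_iff] at hz
  have h1 : |z.re - x₀| ≤ ‖z - x₀‖ := by simpa using Complex.abs_re_le_norm (z - x₀)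
  have h2 : ((z.re : ℝ) : ℂ) ∈ t := hrt (by
    rw [Metric.mem_ball, dist_eq_norm, ← Complex.ofReal_sub, Complex.norm_real, Real.norm_eq_abs]
    linarith)
  have h3 : z ∈ t := hrt (by rw [Metric.mem_ball, dist_eq_norm]; exact hz.1)
  have h4 := hK.dist_le_mul z h3 _ h2
  have h5 := abs_le.1 h1
  have h6 : (theta (z.re : ℂ)).im = 0 := theta_ofReal_im (by nlinarith)
  have h7 : z - (z.re : ℂ) = z.im * Complex.I := by
    apply Complex.ext <;> simp
  rw [dist_eq_norm, dist_eq_norm, h7, norm_mul, Complex.norm_I, mul_one, Complex.norm_real,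
    Real.norm_eq_abs] at h4
  have h8 := Complex.abs_im_le_norm (theta z - theta (z.re : ℂ))
  rw [Complex.sub_im, h6, sub_zero] at h8
  exact h8.trans h4

/-- The oscillatory asymptotics, uniformly near a compact subinterval of `(0, 1)`. -/
theorem oscillatory_uniform {α β : ℝ} (hα : 0 ≤ α) (hαβ : α < β) {δ : ℝ} (hδ : 0 < δ) :
    ∃ η C L : ℝ, 0 < η ∧ (∀ᶠ n : ℕ in atTop, ∀ z ∈ intervalNhd δ η,
        ‖phi α β n ((√(bigN β n) : ℝ) * z) / prefactor α β n z - innerTerm β n z‖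
          ≤ C / bigN β n * Real.exp (bigN β n * |(theta z).im|)) ∧
      ∀ z ∈ intervalNhd δ η, |(theta z).im| ≤ L * |z.im| := by
  have hK : IsCompact (Complex.ofReal '' Set.Icc δ (1 - δ)) :=
    isCompact_Icc.image Complex.continuous_ofReal
  obtain ⟨V, hV, hKV, C, L, hC, hL⟩ : ∃ V : Set ℂ, IsOpen V ∧ Complex.ofReal '' Set.Icc δ (1 - δ) ⊆ V ∧
      ∃ C L : ℝ, (∀ᶠ n : ℕ in atTop, ∀ z ∈ V,
        ‖phi α β n ((√(bigN β n) : ℝ) * z) / prefactor α β n z - innerTerm β n z‖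
          ≤ C / bigN β n * Real.exp (bigN β n * |(theta z).im|)) ∧
      ∀ z ∈ V, |(theta z).im| ≤ L * |z.im| := by
    refine hK.induction_on (p := fun S => ∃ V : Set ℂ, IsOpen V ∧ S ⊆ V ∧
      ∃ C L : ℝ, (∀ᶠ n : ℕ in atTop, ∀ z ∈ V,
        ‖phi α β n ((√(bigN β n) : ℝ) * z) / prefactor α β n z - innerTerm β n z‖
          ≤ C / bigN β n * Real.exp (bigN β n * |(theta z).im|)) ∧
      ∀ z ∈ V, |(theta z).im| ≤ L * |z.im|) ?_ ?_ ?_ ?_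
    · exact ⟨∅, isOpen_empty, subset_rfl, 0, 0, Eventually.of_forall fun n z hz => absurd hz (by simp),
        fun z hz => absurd hz (by simp)⟩
    · rintro S T hST ⟨V, hV, hTV, h⟩
      exact ⟨V, hV, hST.trans hTV, h⟩
    · rintro S T ⟨V, hV, hSV, C, L, hC, hL⟩ ⟨V', hV', hTV', C', L', hC', hL'⟩
      refine ⟨V ∪ V', hV.union hV', Set.union_subset_union hSV hTV', max C C', max L L', ?_, ?_⟩
      · filter_upwards [hC, hC', (tendsto_bigN β).eventually_gt_atTop 0] with n h1 h2 hN z hz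
        rcases hz with hz | hz
        · exact (h1 z hz).trans (by gcongr; exact le_max_left _ _)
        · exact (h2 z hz).trans (by gcongr; exact le_max_right _ _)
      · rintro z (hz | hz)
        · exact (hL z hz).trans (by gcongr; exact le_max_left _ _)
        · exact (hL' z hz).trans (by gcongr; exact le_max_right _ _)
    · rintro _ ⟨x, hx, rfl⟩
      have hx0 : 0 < x := hδ.trans_le hx.1
      have hx1 : x < 1 := by linarith [hx.2]
      obtain ⟨C, hC⟩ := oscillatory_local hα hαβ hx0 hx1
      obtain ⟨L, hL⟩ := exists_abs_im_theta_le hx0 hx1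
      obtain ⟨pa, hpa, pb, hpb, hab⟩ := eventually_prod_iff.1 hC
      obtain ⟨V, hVs, hV, hxV⟩ := mem_nhds_iff.1 (hpb.and hL)
      refine ⟨V, mem_nhdsWithin_of_mem_nhds (hV.mem_nhds hxV), V, hV, subset_rfl, C, L, ?_,
        fun z hz => (hVs hz).2⟩
      filter_upwards [hpa] with n hn z hz using hab hn (hVs hz).1
  obtain ⟨η, hη, hηV⟩ := hK.exists_cthickening_subset_open hV hKV
  have hsub : intervalNhd δ η ⊆ V := by
    rintro z ⟨x, hx, hz⟩
    exact hηV (Metric.mem_cthickening_of_dist_le z (x : ℂ) η _ ⟨x, hx, rfl⟩ (by rwa [dist_eq_norm]))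
  refine ⟨η, C, L, hη, ?_, fun z hz => hL z (hsub hz)⟩
  filter_upwards [hC] with n hn z hz using hn z (hsub hz)

theorem mainTheorem3 (α β : ℝ) (hα : 0 ≤ α) (hαβ : α < β) :
    -- exponential region
    (∀ K : Set ℂ, IsCompact K → K ⊆ (Complex.ofReal '' Set.Icc (-1 : ℝ) 1)ᶜ →
      ∃ C : ℝ, ∀ᶠ n : ℕ in Filter.atTop, ∀ z ∈ K, ∃ ε : ℂ, ‖ε‖ ≤ C / bigN β n ∧
        phi α β n ((√(bigN β n) : ℝ) * z) = outerTerm α β n z * (1 + ε)) ∧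
    -- oscillatory region: a fixed complex neighbourhood of the interval
    (∀ δ : ℝ, 0 < δ → δ < 1 / 2 → ∃ η : ℝ, 0 < η ∧
      ∃ C : ℝ, ∀ᶠ n : ℕ in Filter.atTop, ∀ z ∈ intervalNhd δ η,
        ‖phi α β n ((√(bigN β n) : ℝ) * z) / prefactor α β n z - innerTerm β n z‖
          ≤ C / bigN β n * Real.exp (bigN β n * |(theta z).im|)) ∧
    -- oscillatory region: an additive error on the interval and within `O(1 / N)` of it
    (∀ δ : ℝ, 0 < δ → δ < 1 / 2 → ∀ A : ℝ, 0 ≤ A →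
      ∃ C : ℝ, ∀ᶠ n : ℕ in Filter.atTop, ∀ z ∈ intervalNhd δ (A / bigN β n),
        ‖phi α β n ((√(bigN β n) : ℝ) * z) / prefactor α β n z - innerTerm β n z‖
          ≤ C / bigN β n) := by
  refine ⟨fun K hK hKsub => phi_outer_asymptotics hα hαβ hK hKsub, fun δ hδ _ => ?_,
    fun δ hδ _ A hA => ?_⟩
  · obtain ⟨η, C, -, hη, hC, -⟩ := oscillatory_uniform hα hαβ hδ
    exact ⟨η, hη, C, hC⟩
  · obtain ⟨η, C, L, hη, hC, hL⟩ := oscillatory_uniform hα hαβ hδ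
    refine ⟨|C| * Real.exp (|L| * A), ?_⟩
    filter_upwards [hC, (tendsto_bigN β).eventually_gt_atTop 0,
      (tendsto_bigN β).eventually_ge_atTop (A / η)] with n hn hN hNA z hz
    obtain ⟨x, hx, hxz⟩ := hz
    have hAη : A / bigN β n ≤ η := by
      rw [div_le_iff₀ hη] at hNA
      rw [div_le_iff₀ hN]; linarith
    have hzη : z ∈ intervalNhd δ η := ⟨x, hx, hxz.trans hAη⟩
    have him : |z.im| ≤ A / bigN β n := by
      have := Complex.abs_im_le_norm (z - x)
      rw [Complex.sub_im, Complex.ofReal_im, sub_zero] at this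
      exact this.trans hxz
    have hexp : bigN β n * |(theta z).im| ≤ |L| * A := by
      calc bigN β n * |(theta z).im| ≤ bigN β n * (|L| * (A / bigN β n)) := by
            gcongr
            exact (hL z hzη).trans (by gcongr; exact le_abs_self _)
        _ = _ := by field_simp
    calc _ ≤ C / bigN β n * Real.exp (bigN β n * |(theta z).im|) := hn z hzη
      _ ≤ |C| / bigN β n * Real.exp (|L| * A) := by gcongr; exact le_abs_self _
      _ = _ := by ring
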